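/- Let $0<q<1$ and $[z]=(q^z-q^{-z})/(q-q^{-1})$. **Algebra.** $\mathcal A(S^4_q)$ is the unital complex $*$-algebra generated by $x_0=x_0^*$, $x_1,x_1^*,x_2,x_2^*$ with relations $x_ix_j=q^2x_jx_i$ for $0\le i<j\le 2$, $x_i^*x_j=q^2x_jx_i^*$ for $i\ne j$, $[x_1^*,x_1]=(1-q^4)x_0^2$, $[x_2^*,x_2]=x_1^*x_1-q^4x_1x_1^*$, $x_0^2+x_1x_1^*+x_2x_2^*=1$ (together with their adjoints). **Symmetry.** $U_q(so(5))$ is generated by $K_i^{\pm1},E_i,F_i$ ($i=1,2$) with $K_1K_2=K_2K_1$, $K_iE_jK_i^{-1}=q^{c_{ij}}E_j$, $K_iF_jK_i^{-1}=q^{-c_{ij}}F_j$ (where $c_{11}=1$, $c_{22}=2$, $c_{12}=c_{21}=-1$), $[E_i,F_j]=\delta_{ij}\frac{K_i^2-K_i^{-2}}{q^i-q^{-i}}$ and the $q$-Serre relations $E_1E_2^2-(q^2+q^{-2})E_2E_1E_2+E_2^2E_1=0$, $E_1^3E_2-(q^2+1+q^{-2})(E_1^2E_2E_1-E_1E_2E_1^2)-E_2E_1^3=0$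 and the same for $F_1,F_2$. Its coproduct is given by $\Delta K_i=K_i\otimes K_i$, $\Delta E_i=E_i\otimes K_i+K_i^{-1}\otimes E_i$, $\Delta F_i=F_i\otimes K_i+K_i^{-1}\otimes F_i$, and its counit $\epsilon$ by $\epsilon(K_i)=1$, $\epsilon(E_i)=\epsilon(F_i)=0$. It acts on $\mathcal A(S^4_q)$ with $h\triangleright(ab)=(h_{(1)}\triangleright a)(h_{(2)}\triangleright b)$, $h\triangleright 1=\epsilon(h)1$, by $K_1\triangleright x_1=qx_1$, $K_2\triangleright x_1=q^{-1}x_1$, $K_2\triangleright x_2=qx_2$ (and inversely on $x_1^*,x_2^*$; the other generators are fixed by $K_i$), $E_1\triangleright x_0=q^{-1/2}x_1$, $E_1\triangleright x_1^*=-q^{3/2}[2]x_0$, $E_2\triangleright x_1=x_2$, $E_2\triangleright x_2^*=-q^2x_1^*$, $F_1\triangleright x_1=q^{1/2}[2]x_0$, $F_1\triangleright x_0=-q^{-3/2}x_1^*$, $F_2\triangleright x_2=x_1$, $F_2\triangleright x_1^*=-q^{-2}x_2^*$, all other values of $E_i,F_i$ on generators being zero. Let $\kappa(a)=K_1^8K_2^6\triangleright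 a$ be the modular automorphism. **Twisted homology.** $C^\kappa_n\subset\mathcal A(S^4_q)^{\otimes(n+1)}$ is the subspace fixed by $\kappa^{\otimes(n+1)}$, $$b_\kappa(a_0\otimes\dots\otimes a_{n+1})=\sum_{j=0}^{n}(-1)^ja_0\otimes\dots\otimes a_ja_{j+1}\otimes\dots\otimes a_{n+1}+(-1)^{n+1}\kappa(a_{n+1})a_0\otimes a_1\otimes\dots\otimes a_n,$$ and $HH^\kappa_\bullet$ is the homology of $(C^\kappa_\bullet,b_\kappa)$. **The element $\omega_4$.** Let $\eta=\mathrm{diag}(q^4,q^{-2},q^2,q^{-4})$, $\gamma_0=\mathrm{diag}(1,-q^2,-q^2,q^4)$, $\gamma_1=-qE_{13}+q^3E_{24}$, $\gamma_{-1}=-q^{-1}E_{31}+qE_{42}$, $\gamma_2=q^3(E_{12}+E_{34})$, $\gamma_{-2}=q^{-3}(E_{21}+E_{43})$ ($E_{ab}$ the $4\times4$ matrix units), $e=\frac12(1+\gamma_0x_0+\gamma_1x_1+\gamma_2x_2+\gamma_{-1}x_1^*+\gamma_{-2}x_2^*)$ and $$\omega_4=\mathrm{Tr}_{\mathbb C^4}\big(\eta(e-\tfrac12)^{\dot\otimes5}\big)=\sum_{k_0,\dots,k_5=1}^4\eta_{k_0k_1}(e-\tfrac12)_{k_1k_2}\otimes\dots\otimes(e-\tfrac12)_{k_5k_0}\in\mathcal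 A(S^4_q)^{\otimes5}.$$ **Fredholm module.** Let $\mathcal H_\pm$ have orthonormal basis $|l,m_1,m_2;j\rangle_\pm$ with $l\in\mathbb N+\frac12$, $j=\frac12,\frac32,\dots,l$, $j-|m_1|\in\mathbb N$, $l+\frac12-j-|m_2|\in\mathbb N$ (kets with other labels are $0$). The chiral representations of $\mathcal A(S^4_q)$ on $\mathcal H_\pm$ are the $*$-representations by bounded operators with \begin{align*} x_0|l,m_1,m_2;j\rangle_\pm={}&A^+_{j,m_1}\big(C^+_{l,j,m_2}|l{+}1,m_1,m_2;j{+}1\rangle_\pm\mp C^0_{l,j,m_2}|l,m_1,m_2;j{+}1\rangle_\pm+C^-_{l,j,m_2}|l{-}1,m_1,m_2;j{+}1\rangle_\pm\big)\\ &+A^0_{j,m_1}\big(H^+_{l,j,m_2}|l{+}1,m_1,m_2;j\rangle_\pm\pm H^0_{l,j,m_2}|l,m_1,m_2;j\rangle_\pm+H^+_{l-1,j,m_2}|l{-}1,m_1,m_2;j\rangle_\pm\big)\\ &+A^+_{j-1,m_1}\big(C^-_{l+1,j-1,m_2}|l{+}1,m_1,m_2;j{-}1\rangle_\pm\mp C^0_{l,j-1,m_2}|l,m_1,m_2;j{-}1\rangle_\pm+C^+_{l-1,j-1,m_2}|l{-}1,m_1,m_2;j{-}1\rangle_\pm\big),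 \end{align*} $x_1|l,m_1,m_2;j\rangle_\pm$ given by the same expression with $m_1$ replaced by $m_1+1$ in the kets on the right and $A^+_{j,m_1},A^0_{j,m_1},A^+_{j-1,m_1}$ replaced by $B^+_{j,m_1},B^0_{j,m_1},B^-_{j,m_1}$, and $$x_2|l,m_1,m_2;j\rangle_\pm=D^+_{l,j,m_2}|l{+}1,m_1,m_2{+}1;j\rangle_\pm\pm D^0_{l,j,m_2}|l,m_1,m_2{+}1;j\rangle_\pm+D^-_{l,j,m_2}|l{-}1,m_1,m_2{+}1;j\rangle_\pm .$$ Here $A^+_{j,m_1}=q^{m_1-1}\frac{\sqrt{[j+m_1+1][j-m_1+1]}}{[2j+2]}$, $A^0_{j,m_1}=q^{-2}\frac{q^{j+m_1+1}[2][j-m_1]-[2j]}{[2j][2j+2]}$, $B^+_{j,m_1}=q^{-j+m_1-1/2}\frac{\sqrt{[j+m_1+1][j+m_1+2]}}{[2j+2]}$, $B^0_{j,m_1}=(1+q^2)q^{m_1-1/2}\frac{\sqrt{[j-m_1][j+m_1+1]}}{[2j][2j+2]}$, $B^-_{j,m_1}=-q^{j+m_1+1/2}\frac{\sqrt{[j-m_1][j-m_1-1]}}{[2j]}$,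 and, with $\epsilon=\epsilon_{l,j,m_2}=\pm\frac12$ the sign for which $l+\epsilon-j-m_2$ is an even integer (computed from the coefficient's own subscripts), $C^+_{l,j,m_2}=-q^{m_2-1-\epsilon}\frac{\sqrt{[l+j+m_2+3+\epsilon][l+j-m_2+3-\epsilon]}}{[2l+4]}$, $C^0_{l,j,m_2}=[4\epsilon]q^{2\epsilon l+m_2-1+3\epsilon}\frac{\sqrt{[l+\frac12+j-2\epsilon m_2+2][l+\frac12-j-2\epsilon m_2]}}{[2l+2][2l+4]}$, $C^-_{l,j,m_2}=-q^{m_2-1+\epsilon}\frac{\sqrt{[l-j+m_2-\epsilon][l-j-m_2+\epsilon]}}{[2l+2]}$, $H^+_{l,j,m_2}=q^{m_2-1+\epsilon(2j+1)}\frac{\sqrt{[l+2\epsilon j-m_2+2+\epsilon][l-2\epsilon j+m_2+2-\epsilon]}}{[2l+4]}$, $H^0_{l,j,m_2}=\frac{[l-\epsilon(2j+1)-m_2+1][l-\epsilon(2j+1)+m_2+2]-q^{-2}[l+\epsilon(2j+1)-m_2+2][l+\epsilon(2j+1)+m_2+1]}{[2l+2][2l+4]}$, $D^+_{l,j,m_2}=q^{-l+m_2-3/2}\frac{\sqrt{[l+j+m_2+3+\epsilon][l-j+m_2+2-\epsilon]}}{[2l+4]}$,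 $D^0_{l,j,m_2}=[2]q^{m_2+1/2}\frac{\sqrt{[l-2\epsilon j-m_2+1-\epsilon][l-2\epsilon j+m_2+2-\epsilon]}}{[2l+2][2l+4]}$, $D^-_{l,j,m_2}=-q^{l+m_2+3/2}\frac{\sqrt{[l-j-m_2+\epsilon][l+j-m_2+1-\epsilon]}}{[2l+2]}$. On $\mathcal H=\mathcal H_+\oplus\mathcal H_-$, let $F$ exchange $|l,m_1,m_2;j\rangle_+$ and $|l,m_1,m_2;j\rangle_-$, let $\gamma=\pm1$ on $\mathcal H_\pm$, and let $K_1^8K_2^6$ act as the diagonal operator $|l,m_1,m_2;j\rangle_\pm\mapsto q^{2m_1+6m_2}|l,m_1,m_2;j\rangle_\pm$. **Claim.** 1. $\mathrm{Tr}_{\mathbb C^4}(\eta\gamma_i\gamma_j\gamma_k)=0$ for all $i,j,k\in\{0,\pm1,\pm2\}$. 2. $\omega_4$ is $U_q(so(5))$-invariant, i.e. $h\triangleright\omega_4=\epsilon(h)\omega_4$ for all $h$ (action on $\mathcal A(S^4_q)^{\otimes5}$ through the iterated coproduct), and it is a twisted Hochschild $4$-cycle: $\omega_4\in C^\kappa_4$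 and $b_\kappa(\omega_4)=0$. 3. The two chiral representations exist, for all $a_0,\dots,a_4\in\mathcal A(S^4_q)$ the operator $K_1^{-8}K_2^{-6}\gamma F[F,a_0]\cdots[F,a_4]$ is of trace class on $\mathcal H$, and $$\mathrm{ch}^{F,\kappa}_4(a_0\otimes\dots\otimes a_4)=\mathrm{Tr}_{\mathcal H}\big(K_1^{-8}K_2^{-6}\gamma F[F,a_0]\cdots[F,a_4]\big)$$ defines a linear form on $\mathcal A(S^4_q)^{\otimes5}$ with $\mathrm{ch}^{F,\kappa}_4\circ\kappa^{\otimes5}=\mathrm{ch}^{F,\kappa}_4$ and $\mathrm{ch}^{F,\kappa}_4\circ b_\kappa=0$. 4. $\mathrm{ch}^{F,\kappa}_4(\omega_4)=2$, and the class $[\omega_4]\in HH^\kappa_4$ is non-zero. -/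

import Mathlib

open scoped TensorProduct
namespace QSphere

/-- The deformation parameter `0 < q < 1`. -/
abbrev Param : Type := Set.Ioo (0 : ℝ) 1
/-- The parameter `q` as a complex number. -/
noncomputable def qc (q : Param) : ℂ := ((q : ℝ) : ℂ)
/-- The square root `q^{1/2}`. -/
noncomputable def rootq (q : Param) : ℂ := ((Real.sqrt (q : ℝ) : ℝ) : ℂ)

theorem rootq_sq (q : Param) : qc q = rootq q ^ 2 := by
  have h : Real.sqrt (q : ℝ) ^ 2 = (q : ℝ) := Real.sq_sqrt q.2.1.le
  simp only [qc, rootq]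
  rw [← Complex.ofReal_pow, h]

theorem rootq_ne (q : Param) : rootq q ≠ 0 := by
  simpa [rootq] using (Real.sqrt_pos.2 q.2.1).ne'

theorem qc_ne (q : Param) : qc q ≠ 0 := by
  simpa [qc] using q.2.1.ne'

theorem qc_pow_ne (q : Param) (n : ℕ) (hn : n ≠ 0) : qc q ^ n - (qc q ^ n)⁻¹ ≠ 0 := by
  have h1 : ((q : ℝ)) ^ n < 1 := pow_lt_one₀ q.2.1.le q.2.2 hn
  have h0 : 0 < ((q : ℝ)) ^ n := pow_pos q.2.1 n
  have h2 : 1 < (((q : ℝ)) ^ n)⁻¹ := (one_lt_inv₀ h0).2 h1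
  have : (q : ℝ) ^ n - ((q : ℝ) ^ n)⁻¹ ≠ 0 := by linarith [h1, h2] |> ne_of_lt
  simp only [qc]
  exact_mod_cast this

set_option linter.unusedSimpArgs false
set_option linter.unusedSectionVars false

/-- The generators `x₀, x₁, x₂, x₁*, x₂*`. -/
inductive SGen
  | x₀ | x₁ | x₂ | x₁s | x₂s

/-- The defining relations of `A(S⁴_q)`, imposed on elements `x g` of an algebra `T`; `x₁s` and `x₂s`
are `x₁*` and `x₂*`. The list is closed under the `*`-operation. -/
inductive SRel (q : Param) {T : Type*} [Ring T] [Algebra ℂ T] (x : SGen → T) : T → T → Prop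
  | r01 : SRel q x (x .x₀ * x .x₁) (qc q ^ 2 • (x .x₁ * x .x₀))
  | r02 : SRel q x (x .x₀ * x .x₂) (qc q ^ 2 • (x .x₂ * x .x₀))
  | r12 : SRel q x (x .x₁ * x .x₂) (qc q ^ 2 • (x .x₂ * x .x₁))
  | r1s0 : SRel q x (x .x₁s * x .x₀) (qc q ^ 2 • (x .x₀ * x .x₁s))
  | r2s0 : SRel q x (x .x₂s * x .x₀) (qc q ^ 2 • (x .x₀ * x .x₂s))
  | r2s1s : SRel q x (x .x₂s * x .x₁s) (qc q ^ 2 • (x .x₁s * x .x₂s))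
  | r1s2 : SRel q x (x .x₁s * x .x₂) (qc q ^ 2 • (x .x₂ * x .x₁s))
  | r2s1 : SRel q x (x .x₂s * x .x₁) (qc q ^ 2 • (x .x₁ * x .x₂s))
  | r11 : SRel q x (x .x₁s * x .x₁ - x .x₁ * x .x₁s) ((1 - qc q ^ 4) • x .x₀ ^ 2)
  | r22 : SRel q x (x .x₂s * x .x₂ - x .x₂ * x .x₂s) (x .x₁s * x .x₁ - qc q ^ 4 • (x .x₁ * x .x₁s))
  | rad : SRel q x (x .x₀ ^ 2 + x .x₁ * x .x₁s + x .x₂ * x .x₂s) 1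

/-- The elements `x i` of `T` satisfy the defining relations. -/
def SRelations (q : Param) {T : Type*} [Ring T] [Algebra ℂ T] (x : SGen → T) : Prop :=
  ∀ a b, SRel q x a b → a = b

/-- The coordinate algebra `A(S⁴_q)` of the quantum 4-sphere, by generators and relations. -/
def SphereAlg (q : Param) : Type := RingQuot (SRel q (FreeAlgebra.ι ℂ))
noncomputable instance (q : Param) : Ring (SphereAlg q) := inferInstanceAs (Ring (RingQuot (SRel q (FreeAlgebra.ι ℂ))))
noncomputable instance (q : Param) : Algebra ℂ (SphereAlg q) :=
  inferInstanceAs (Algebra ℂ (RingQuot (SRel q (FreeAlgebra.ι ℂ))))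

/-- The quotient map from the free algebra. -/
noncomputable def mkS (q : Param) : FreeAlgebra ℂ SGen →ₐ[ℂ] SphereAlg q := RingQuot.mkAlgHom ℂ (SRel q (FreeAlgebra.ι ℂ))

/-- The generators of `A(S⁴_q)`. -/
noncomputable def sgen (q : Param) (i : SGen) : SphereAlg q := mkS q (FreeAlgebra.ι ℂ i)

theorem SRel.map (q : Param) {T T' : Type*} [Ring T] [Algebra ℂ T] [Ring T'] [Algebra ℂ T']
    (x : SGen → T) (f : T →ₐ[ℂ] T') {a b : T} (h : SRel q x a b) :
    SRel q (fun i => f (x i)) (f a) (f b) := by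
  cases h <;> simp only [map_mul, map_pow, map_sub, map_smul, map_add, map_one] <;> constructor

theorem sgen_rel (q : Param) : SRelations q (sgen q) := by
  intro a b h
  have key : ∀ a b, SRel q (FreeAlgebra.ι ℂ) a b → mkS q a = mkS q b :=
    fun a b h => RingQuot.mkAlgHom_rel ℂ h
  cases h <;> simp only [sgen, ← map_mul, ← map_pow, ← map_sub, ← map_smul, ← map_add,
    ← map_one (mkS q)] <;> apply key <;> constructor

/-- The universal property of `A(S⁴_q)`. -/
noncomputable def SphereAlg.lift (q : Param) {T : Type*} [Ring T] [Algebra ℂ T] (x : SGen → T)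
    (h : SRelations q x) : SphereAlg q →ₐ[ℂ] T :=
  RingQuot.liftAlgHom ℂ ⟨FreeAlgebra.lift ℂ x, by
    intro a b hab
    have := hab.map q _ (FreeAlgebra.lift ℂ x)
    simp only [FreeAlgebra.lift_ι_apply] at this
    exact h _ _ this⟩

theorem SphereAlg.lift_gen (q : Param) {T : Type*} [Ring T] [Algebra ℂ T] (x : SGen → T)
    (h : SRelations q x) (i : SGen) : SphereAlg.lift q x h (sgen q i) = x i := by
  simp only [SphereAlg.lift, sgen, mkS]
  erw [RingQuot.liftAlgHom_mkAlgHom_apply]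
  simp

theorem SphereAlg.adjoin (q : Param) : Algebra.adjoin ℂ (Set.range (sgen q)) = ⊤ := by
  have h : Set.range (sgen q) = mkS q '' Set.range (FreeAlgebra.ι ℂ) := by
    rw [← Set.range_comp]; rfl
  rw [h, ← AlgHom.map_adjoin, FreeAlgebra.adjoin_range_ι, Algebra.map_top, AlgHom.range_eq_top]
  exact RingQuot.mkAlgHom_surjective ℂ (SRel q (FreeAlgebra.ι ℂ))

/-- The weights of a scaling automorphism. -/
noncomputable def wt (a b : ℂ) : SGen → ℂ
  | .x₀ => 1 | .x₁ => a | .x₂ => b | .x₁s => a⁻¹ | .x₂s => b⁻¹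

theorem scale_rel (q : Param) {a b : ℂ} (ha : a ≠ 0) (hb : b ≠ 0) :
    SRelations q (fun i => wt a b i • sgen q i) := by
  have h := sgen_rel q
  intro u v huv
  cases huv <;> simp only [wt, smul_mul_assoc, mul_smul_comm, smul_smul, smul_pow, one_smul,
    mul_inv_cancel₀ ha, mul_inv_cancel₀ hb, inv_mul_cancel₀ ha, inv_mul_cancel₀ hb,
    h _ _ .r01, h _ _ .r02, h _ _ .r12, h _ _ .r1s0, h _ _ .r2s0, h _ _ .r2s1s, h _ _ .r1s2, h _ _ .r2s1, h _ _ .r11, h _ _ .r22, h _ _ .rad]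
  all_goals (match_scalars; ring)

/-- The scaling endomorphism `x₁ ↦ a x₁, x₂ ↦ b x₂`. -/
noncomputable def scale (q : Param) (a b : ℂ) (ha : a ≠ 0) (hb : b ≠ 0) : SphereAlg q →ₐ[ℂ] SphereAlg q :=
  SphereAlg.lift q _ (scale_rel q ha hb)

theorem normal (q : Param) :
   sgen q .x₁ * sgen q .x₀ = (qc q ^ 2)⁻¹ • (sgen q .x₀ * sgen q .x₁) ∧
   sgen q .x₂ * sgen q .x₀ = (qc q ^ 2)⁻¹ • (sgen q .x₀ * sgen q .x₂) ∧
   sgen q .x₂ * sgen q .x₁ = (qc q ^ 2)⁻¹ • (sgen q .x₁ * sgen q .x₂) ∧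
   sgen q .x₂ * sgen q .x₁s = (qc q ^ 2)⁻¹ • (sgen q .x₁s * sgen q .x₂) ∧
   sgen q .x₁s * sgen q .x₁ = sgen q .x₁ * sgen q .x₁s + (1 - qc q ^ 4) • (sgen q .x₀ * sgen q .x₀) ∧
   sgen q .x₂ * sgen q .x₂s = 1 - sgen q .x₀ * sgen q .x₀ - sgen q .x₁ * sgen q .x₁s ∧
   sgen q .x₂s * sgen q .x₂ = 1 - qc q ^ 4 • (sgen q .x₀ * sgen q .x₀) - qc q ^ 4 • (sgen q .x₁ * sgen q .x₁s) := by
  have h := sgen_rel q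
  have hq : qc q ^ 2 ≠ 0 := pow_ne_zero _ (qc_ne q)
  have e1 := h _ _ .r11
  have e2 := h _ _ .r22
  have e3 := h _ _ .rad
  rw [pow_two] at e1 e3
  have e4 := sub_eq_iff_eq_add.1 e1
  have e5 : sgen q .x₂ * sgen q .x₂s = 1 - sgen q .x₀ * sgen q .x₀ - sgen q .x₁ * sgen q .x₁s := by
    rw [← e3]; abel
  refine ⟨by rw [h _ _ .r01, inv_smul_smul₀ hq], by rw [h _ _ .r02, inv_smul_smul₀ hq], by rw [h _ _ .r12, inv_smul_smul₀ hq],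
    by rw [h _ _ .r1s2, inv_smul_smul₀ hq], by rw [e4, add_comm], e5, ?_⟩
  rw [sub_eq_iff_eq_add.1 e2, e5, e4]
  match_scalars <;> ring

/-- The elements `E_i ▷ x_g` (with `i = 0, 1` for `E₁, E₂`); here `[2] = q + q⁻¹`. -/
noncomputable def dE (q : Param) : Fin 2 → SGen → SphereAlg q
  | 0, .x₀ => (rootq q)⁻¹ • sgen q .x₁
  | 0, .x₁s => -(rootq q ^ 3 * (qc q + (qc q)⁻¹)) • sgen q .x₀
  | 1, .x₁ => sgen q .x₂
  | 1, .x₂s => -(qc q ^ 2) • sgen q .x₁s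
  | _, _ => 0

/-- The elements `F_i ▷ x_g` (with `i = 0, 1` for `F₁, F₂`). -/
noncomputable def dF (q : Param) : Fin 2 → SGen → SphereAlg q
  | 0, .x₁ => (rootq q * (qc q + (qc q)⁻¹)) • sgen q .x₀
  | 0, .x₀ => -((rootq q ^ 3)⁻¹) • sgen q .x₁s
  | 1, .x₂ => sgen q .x₁
  | 1, .x₁s => -(qc q ^ 2)⁻¹ • sgen q .x₂s
  | _, _ => 0

/-- The upper triangular matrix with rows `(p, d)` and `(0, k)`. -/
def ut {T : Type*} [Ring T] (p d k : T) : Matrix (Fin 2) (Fin 2) T := !![p, d; 0, k]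

section ut
variable {T : Type*} [Ring T] [Algebra ℂ T]
theorem ut_mul (p d k p' d' k' : T) :
    ut p d k * ut p' d' k' = ut (p * p') (p * d' + d * k') (k * k') := by
  simp [ut, Matrix.mul_fin_two]
theorem ut_smul (c : ℂ) (p d k : T) : c • ut p d k = ut (c • p) (c • d) (c • k) := by
  simp [ut]
theorem ut_add (p d k p' d' k' : T) :
    ut p d k + ut p' d' k' = ut (p + p') (d + d') (k + k') := by
  simp [ut]
theorem ut_sub (p d k p' d' k' : T) :
    ut p d k - ut p' d' k' = ut (p - p') (d - d') (k - k') := by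
  simp [ut]
theorem ut_one : (1 : Matrix (Fin 2) (Fin 2) T) = ut 1 0 1 := by
  simp [ut, Matrix.one_fin_two]
theorem ut_congr {p d k p' d' k' : T} (h₁ : p = p') (h₂ : d = d') (h₃ : k = k') :
    ut p d k = ut p' d' k' := by rw [h₁, h₂, h₃]

theorem ut_rel (q : Param) (p d k : SGen → T) (hp : SRelations q p) (hk : SRelations q k)
    (r01 : p .x₀ * d .x₁ + d .x₀ * k .x₁ = qc q ^ 2 • (p .x₁ * d .x₀ + d .x₁ * k .x₀))
    (r02 : p .x₀ * d .x₂ + d .x₀ * k .x₂ = qc q ^ 2 • (p .x₂ * d .x₀ + d .x₂ * k .x₀))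
    (r12 : p .x₁ * d .x₂ + d .x₁ * k .x₂ = qc q ^ 2 • (p .x₂ * d .x₁ + d .x₂ * k .x₁))
    (r1s0 : p .x₁s * d .x₀ + d .x₁s * k .x₀ = qc q ^ 2 • (p .x₀ * d .x₁s + d .x₀ * k .x₁s))
    (r2s0 : p .x₂s * d .x₀ + d .x₂s * k .x₀ = qc q ^ 2 • (p .x₀ * d .x₂s + d .x₀ * k .x₂s))
    (r2s1s : p .x₂s * d .x₁s + d .x₂s * k .x₁s
      = qc q ^ 2 • (p .x₁s * d .x₂s + d .x₁s * k .x₂s))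
    (r1s2 : p .x₁s * d .x₂ + d .x₁s * k .x₂ = qc q ^ 2 • (p .x₂ * d .x₁s + d .x₂ * k .x₁s))
    (r2s1 : p .x₂s * d .x₁ + d .x₂s * k .x₁ = qc q ^ 2 • (p .x₁ * d .x₂s + d .x₁ * k .x₂s))
    (r11 : p .x₁s * d .x₁ + d .x₁s * k .x₁ - (p .x₁ * d .x₁s + d .x₁ * k .x₁s)
      = (1 - qc q ^ 4) • (p .x₀ * d .x₀ + d .x₀ * k .x₀))
    (r22 : p .x₂s * d .x₂ + d .x₂s * k .x₂ - (p .x₂ * d .x₂s + d .x₂ * k .x₂s)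
      = p .x₁s * d .x₁ + d .x₁s * k .x₁ - qc q ^ 4 • (p .x₁ * d .x₁s + d .x₁ * k .x₁s))
    (rad : p .x₀ * d .x₀ + d .x₀ * k .x₀ + (p .x₁ * d .x₁s + d .x₁ * k .x₁s)
      + (p .x₂ * d .x₂s + d .x₂ * k .x₂s) = 0) :
    SRelations q (fun g => ut (p g) (d g) (k g)) := by
  intro u v huv
  cases huv <;> simp only [pow_two, ut_mul, ut_smul, ut_sub, ut_add, ut_one] <;>
    apply ut_congr <;> try simp only [← pow_two]
  exacts [hp _ _ .r01, r01, hk _ _ .r01, hp _ _ .r02, r02, hk _ _ .r02, hp _ _ .r12, r12, hk _ _ .r12, hp _ _ .r1s0, r1s0, hk _ _ .r1s0,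
    hp _ _ .r2s0, r2s0, hk _ _ .r2s0, hp _ _ .r2s1s, r2s1s, hk _ _ .r2s1s, hp _ _ .r1s2, r1s2, hk _ _ .r1s2,
    hp _ _ .r2s1, r2s1, hk _ _ .r2s1, hp _ _ .r11, r11, hk _ _ .r11, hp _ _ .r22, r22, hk _ _ .r22, hp _ _ .rad, rad, hk _ _ .rad]
end ut

/-- `K_i ▷ x_g = kw q i g • x_g`. -/
noncomputable def kw (q : Param) (i : Fin 2) : SGen → ℂ :=
  match i with
  | 0 => wt (qc q) 1
  | 1 => wt (qc q)⁻¹ (qc q)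

/-- `K_i⁻¹ ▷ x_g = kw' q i g • x_g`. -/
noncomputable def kw' (q : Param) (i : Fin 2) : SGen → ℂ :=
  match i with
  | 0 => wt (qc q)⁻¹ 1
  | 1 => wt (qc q) (qc q)⁻¹

theorem kw_rel (q : Param) (i : Fin 2) : SRelations q (fun g => kw q i g • sgen q g) :=
  match i with
  | 0 => scale_rel q (qc_ne q) one_ne_zero
  | 1 => scale_rel q (inv_ne_zero (qc_ne q)) (qc_ne q)

theorem kw'_rel (q : Param) (i : Fin 2) : SRelations q (fun g => kw' q i g • sgen q g) :=
  match i with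
  | 0 => scale_rel q (inv_ne_zero (qc_ne q)) one_ne_zero
  | 1 => scale_rel q (qc_ne q) (inv_ne_zero (qc_ne q))

theorem E_rel (q : Param) (i : Fin 2) :
    SRelations q (fun g => ut (kw' q i g • sgen q g) (dE q i g) (kw q i g • sgen q g)) := by
  have h := sgen_rel q
  obtain ⟨n1, n2, n3, n4, n5, n6, n7⟩ := normal q
  have hs := rootq_ne q
  apply ut_rel q _ _ _ (kw'_rel q i) (kw_rel q i)
  all_goals
    match i with
    | 0 => 
      simp only [dE, kw, kw', wt, smul_mul_assoc, mul_smul_comm, smul_smul, zero_mul, mul_zero, add_zero, zero_add, smul_zero,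
        sub_zero, zero_sub, n1, n2, n3, n4, n5, n6, n7, h _ _ .r1s0, h _ _ .r2s0, h _ _ .r2s1s, h _ _ .r2s1, rootq_sq]
      try (match_scalars <;> field_simp <;> ring)
    | 1 => 
      simp only [dE, kw, kw', wt, smul_mul_assoc, mul_smul_comm, smul_smul, zero_mul, mul_zero, add_zero, zero_add, smul_zero,
        sub_zero, zero_sub, n1, n2, n3, n4, n5, n6, n7, h _ _ .r1s0, h _ _ .r2s0, h _ _ .r2s1s, h _ _ .r2s1, rootq_sq]
      try (match_scalars <;> field_simp <;> ring)

theorem F_rel (q : Param) (i : Fin 2) :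
    SRelations q (fun g => ut (kw' q i g • sgen q g) (dF q i g) (kw q i g • sgen q g)) := by
  have h := sgen_rel q
  obtain ⟨n1, n2, n3, n4, n5, n6, n7⟩ := normal q
  have hs := rootq_ne q
  apply ut_rel q _ _ _ (kw'_rel q i) (kw_rel q i)
  all_goals
    match i with
    | 0 => 
      simp only [dF, kw, kw', wt, smul_mul_assoc, mul_smul_comm, smul_smul, zero_mul, mul_zero, add_zero, zero_add, smul_zero,
        sub_zero, zero_sub, n1, n2, n3, n4, n5, n6, n7, h _ _ .r1s0, h _ _ .r2s0, h _ _ .r2s1s, h _ _ .r2s1, rootq_sq]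
      try (match_scalars <;> field_simp <;> ring)
    | 1 => 
      simp only [dF, kw, kw', wt, smul_mul_assoc, mul_smul_comm, smul_smul, zero_mul, mul_zero, add_zero, zero_add, smul_zero,
        sub_zero, zero_sub, n1, n2, n3, n4, n5, n6, n7, h _ _ .r1s0, h _ _ .r2s0, h _ _ .r2s1s, h _ _ .r2s1, rootq_sq]
      try (match_scalars <;> field_simp <;> ring)


section Serre
variable {T : Type*} [Ring T] [Algebra ℂ T]

/-- The first `q`-Serre expression. -/
noncomputable def serre₁ (p : ℂ) (x₁ x₂ : T) : T :=
  x₁ * x₂ ^ 2 - (p ^ 2 + (p ^ 2)⁻¹) • (x₂ * x₁ * x₂) + x₂ ^ 2 * x₁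

/-- The second `q`-Serre expression. -/
noncomputable def serre₂ (p : ℂ) (x₁ x₂ : T) : T :=
  x₁ ^ 3 * x₂ - (p ^ 2 + 1 + (p ^ 2)⁻¹) • (x₁ ^ 2 * x₂ * x₁ - x₁ * x₂ * x₁ ^ 2) - x₂ * x₁ ^ 3

theorem swap_assoc {a b c : T} {r : ℂ} (h : b * a = r • (a * b)) :
    b * (a * c) = r • (a * (b * c)) := by
  rw [← mul_assoc, h, smul_mul_assoc, mul_assoc]

theorem serre₁_add (p : ℂ) (hp : p ≠ 0) (a₁ a₂ b₁ b₂ : T)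
    (h₂₂ : b₂ * a₂ = (p ^ 4)⁻¹ • (a₂ * b₂))
    (h₁₂ : b₁ * a₂ = p ^ 2 • (a₂ * b₁)) (h₂₁ : b₂ * a₁ = p ^ 2 • (a₁ * b₂)) :
    serre₁ p (a₁ + b₁) (a₂ + b₂) = serre₁ p a₁ a₂ + serre₁ p b₁ b₂ := by
  simp only [serre₁, pow_succ, pow_zero, one_mul, mul_add, add_mul, mul_assoc] at *
  simp only [h₂₂, h₁₂, h₂₁, swap_assoc h₂₂, swap_assoc h₁₂, swap_assoc h₂₁, mul_smul_comm, smul_mul_assoc, smul_smul]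
  match_scalars <;> field_simp <;> ring

theorem serre₂_add (p : ℂ) (hp : p ≠ 0) (a₁ a₂ b₁ b₂ : T)
    (h₁₁ : b₁ * a₁ = (p ^ 2)⁻¹ • (a₁ * b₁))
    (h₁₂ : b₁ * a₂ = p ^ 2 • (a₂ * b₁)) (h₂₁ : b₂ * a₁ = p ^ 2 • (a₁ * b₂)) :
    serre₂ p (a₁ + b₁) (a₂ + b₂) = serre₂ p a₁ a₂ + serre₂ p b₁ b₂ := by
  simp only [serre₂, pow_succ, pow_zero, one_mul, mul_add, add_mul, mul_assoc] at *
  simp only [h₁₁, h₁₂, h₂₁, swap_assoc h₁₁, swap_assoc h₁₂, swap_assoc h₂₁, mul_smul_comm, smul_mul_assoc, smul_smul]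
  match_scalars <;> field_simp <;> ring
theorem serre₁_inv (p : ℂ) (x₁ x₂ : T) : serre₁ p⁻¹ x₁ x₂ = serre₁ p x₁ x₂ := by
  simp [serre₁, add_comm]
theorem serre₂_inv (p : ℂ) (x₁ x₂ : T) : serre₂ p⁻¹ x₁ x₂ = serre₂ p x₁ x₂ := by
  have : p⁻¹ ^ 2 + 1 + (p⁻¹ ^ 2)⁻¹ = p ^ 2 + 1 + (p ^ 2)⁻¹ := by simp; ring
  rw [serre₂, this, serre₂]
end Serre

/-- The generators `K_i, K_i⁻¹, E_i, F_i` of `U_q(so(5))`; the indices `0, 1` stand for `1, 2`. -/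
inductive UGen
  | K (i : Fin 2) | K' (i : Fin 2) | E (i : Fin 2) | F (i : Fin 2)

/-- The exponents in `K_i E_j K_i⁻¹ = q ^ (cw i j) E_j`: `1, 2` on the diagonal and `-1` off it. -/
def cw (i j : Fin 2) : ℤ := if i = j then (i : ℤ) + 1 else -1

/-- The defining relations of `U_q(so(5))`, imposed on elements `x g` of an algebra `T`. -/
inductive URel (q : Param) {T : Type*} [Ring T] [Algebra ℂ T] (x : UGen → T) : T → T → Prop
  | K_comm : URel q x (x (.K 0) * x (.K 1)) (x (.K 1) * x (.K 0))
  | K_inv (i : Fin 2) : URel q x (x (.K i) * x (.K' i)) 1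
  | inv_K (i : Fin 2) : URel q x (x (.K' i) * x (.K i)) 1
  | EF (i : Fin 2) : URel q x (x (.E i) * x (.F i) - x (.F i) * x (.E i))
      ((qc q ^ ((i : ℕ) + 1) - (qc q ^ ((i : ℕ) + 1))⁻¹)⁻¹ • (x (.K i) ^ 2 - x (.K' i) ^ 2))
  | EF_ne (i j : Fin 2) (h : i ≠ j) : URel q x (x (.E i) * x (.F j) - x (.F j) * x (.E i)) 0
  | KE (i j : Fin 2) : URel q x (x (.K i) * x (.E j) * x (.K' i)) (qc q ^ cw i j • x (.E j))
  | KF (i j : Fin 2) : URel q x (x (.K' i) * x (.F j) * x (.K i)) (qc q ^ cw i j • x (.F j))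
  | serreE₁ : URel q x (serre₁ (qc q) (x (.E 0)) (x (.E 1))) 0
  | serreE₂ : URel q x (serre₂ (qc q) (x (.E 0)) (x (.E 1))) 0
  | serreF₁ : URel q x (serre₁ (qc q) (x (.F 0)) (x (.F 1))) 0
  | serreF₂ : URel q x (serre₂ (qc q) (x (.F 0)) (x (.F 1))) 0

/-- The elements `x g` of `T` satisfy the defining relations of `U_q(so(5))`. -/
def URelations (q : Param) {T : Type*} [Ring T] [Algebra ℂ T] (x : UGen → T) : Prop :=
  ∀ a b, URel q x a b → a = b

theorem URel.map (q : Param) {T T' : Type*} [Ring T] [Algebra ℂ T] [Ring T'] [Algebra ℂ T']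
    (x : UGen → T) (f : T →ₐ[ℂ] T') {a b : T} (h : URel q x a b) :
    URel q (fun i => f (x i)) (f a) (f b) := by
  cases h <;> simp only [map_mul, map_pow, map_sub, map_smul, map_add, map_one, map_zero, serre₁, serre₂]
  case EF => exact .EF _
  case EF_ne h => exact .EF_ne _ _ h
  all_goals constructor

/-- The algebra `U_q(so(5))`. -/
def UqSo5 (q : Param) : Type := RingQuot (URel q (FreeAlgebra.ι ℂ))
noncomputable instance (q : Param) : Ring (UqSo5 q) :=
  inferInstanceAs (Ring (RingQuot (URel q (FreeAlgebra.ι ℂ))))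
noncomputable instance (q : Param) : Algebra ℂ (UqSo5 q) :=
  inferInstanceAs (Algebra ℂ (RingQuot (URel q (FreeAlgebra.ι ℂ))))

/-- The quotient map from the free algebra. -/
noncomputable def mkU (q : Param) : FreeAlgebra ℂ UGen →ₐ[ℂ] UqSo5 q :=
  RingQuot.mkAlgHom ℂ (URel q (FreeAlgebra.ι ℂ))

/-- The generators of `U_q(so(5))`. -/
noncomputable def ugen (q : Param) (i : UGen) : UqSo5 q := mkU q (FreeAlgebra.ι ℂ i)

theorem ugen_rel (q : Param) : URelations q (ugen q) := by
  intro a b h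
  have key : ∀ a b, URel q (FreeAlgebra.ι ℂ) a b → mkU q a = mkU q b :=
    fun a b h => RingQuot.mkAlgHom_rel ℂ h
  cases h <;> simp only [ugen, serre₁, serre₂, ← map_mul, ← map_pow, ← map_sub, ← map_smul, ← map_add,
    ← map_one (mkU q), ← map_zero (mkU q)] <;> apply key
  case EF => exact .EF _
  case EF_ne h => exact .EF_ne _ _ h
  all_goals constructor

/-- The universal property of `U_q(so(5))`. -/
noncomputable def UqSo5.lift (q : Param) {T : Type*} [Ring T] [Algebra ℂ T] (x : UGen → T)
    (h : URelations q x) : UqSo5 q →ₐ[ℂ] T :=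
  RingQuot.liftAlgHom ℂ ⟨FreeAlgebra.lift ℂ x, by
    intro a b hab
    have := hab.map q _ (FreeAlgebra.lift ℂ x)
    simp only [FreeAlgebra.lift_ι_apply] at this
    exact h _ _ this⟩

theorem UqSo5.lift_gen (q : Param) {T : Type*} [Ring T] [Algebra ℂ T] (x : UGen → T)
    (h : URelations q x) (i : UGen) : UqSo5.lift q x h (ugen q i) = x i := by
  simp only [UqSo5.lift, ugen, mkU]
  erw [RingQuot.liftAlgHom_mkAlgHom_apply]
  simp

theorem UqSo5.adjoin (q : Param) : Algebra.adjoin ℂ (Set.range (ugen q)) = ⊤ := by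
  have h : Set.range (ugen q) = mkU q '' Set.range (FreeAlgebra.ι ℂ) := by
    rw [← Set.range_comp]; rfl
  rw [h, ← AlgHom.map_adjoin, FreeAlgebra.adjoin_range_ι, Algebra.map_top, AlgHom.range_eq_top]
  exact RingQuot.mkAlgHom_surjective ℂ (URel q (FreeAlgebra.ι ℂ))

theorem UqSo5.hom_ext (q : Param) {T : Type*} [Ring T] [Algebra ℂ T] {f g : UqSo5 q →ₐ[ℂ] T}
    (h : ∀ i, f (ugen q i) = g (ugen q i)) : f = g := by
  have : Set.EqOn f g (Set.range (ugen q)) := by rintro _ ⟨i, rfl⟩; exact h i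
  exact AlgHom.ext_of_adjoin_eq_top (UqSo5.adjoin q) this

/-- The relations which involve `K`. -/
structure CartanRelations (q : Param) {T : Type*} [Ring T] [Algebra ℂ T] (x : UGen → T) : Prop where
  KK : ∀ i j, x (.K i) * x (.K j) = x (.K j) * x (.K i)
  K_inv : ∀ i, x (.K i) * x (.K' i) = 1
  inv_K : ∀ i, x (.K' i) * x (.K i) = 1
  KE : ∀ i j, x (.K i) * x (.E j) = qc q ^ cw i j • (x (.E j) * x (.K i))
  FK : ∀ i j, x (.F j) * x (.K i) = qc q ^ cw i j • (x (.K i) * x (.F j))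

section
variable {q : Param} {T : Type*} [Ring T] [Algebra ℂ T] {x : UGen → T}

theorem URelations.cartan (h : URelations q x) : CartanRelations q x where
  KK i j := by
    have := h _ _ .K_comm
    fin_cases i <;> fin_cases j <;> simp [this]
  K_inv i := h _ _ (.K_inv i)
  inv_K i := h _ _ (.inv_K i)
  KE i j := by
    rw [← smul_mul_assoc, ← h _ _ (.KE i j), mul_assoc, h _ _ (.inv_K i), mul_one]
  FK i j := by
    rw [← mul_smul_comm, ← h _ _ (.KF i j), mul_assoc, ← mul_assoc, h _ _ (.K_inv i), one_mul]

theorem CartanRelations.K'E (h : CartanRelations q x) (i j : Fin 2) :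
    x (.K' i) * x (.E j) = (qc q ^ cw i j)⁻¹ • (x (.E j) * x (.K' i)) := by
  have hq : qc q ^ cw i j ≠ 0 := zpow_ne_zero _ (qc_ne q)
  have h1 : x (.K' i) * (x (.K i) * x (.E j)) * x (.K' i) =
     qc q ^ cw i j • (x (.K' i) * x (.E j)) := by
    rw [h.KE, mul_smul_comm, smul_mul_assoc, mul_assoc, mul_assoc, h.K_inv, mul_one]
  rw [← mul_assoc, h.inv_K, one_mul] at h1
  rw [h1, inv_smul_smul₀ hq]

theorem CartanRelations.FK' (h : CartanRelations q x) (i j : Fin 2) :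
    x (.F j) * x (.K' i) = (qc q ^ cw i j)⁻¹ • (x (.K' i) * x (.F j)) := by
  have hq : qc q ^ cw i j ≠ 0 := zpow_ne_zero _ (qc_ne q)
  have h1 : x (.K' i) * (x (.F j) * x (.K i)) * x (.K' i) =
     qc q ^ cw i j • (x (.F j) * x (.K' i)) := by
    rw [h.FK, mul_smul_comm, smul_mul_assoc, ← mul_assoc, h.inv_K, one_mul]
  rw [mul_assoc, mul_assoc, h.K_inv, mul_one] at h1
  rw [h1, inv_smul_smul₀ hq]

theorem CartanRelations.K'K' (h : CartanRelations q x) (i j : Fin 2) :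
    x (.K' i) * x (.K' j) = x (.K' j) * x (.K' i) := by
  have e1 : (x (.K' i) * x (.K' j)) * (x (.K j) * x (.K i)) = 1 := by
    rw [mul_assoc, ← mul_assoc (x (.K' j)), h.inv_K, one_mul, h.inv_K]
  have e2 : (x (.K j) * x (.K i)) * (x (.K' j) * x (.K' i)) = 1 := by
    rw [h.KK j i, mul_assoc, ← mul_assoc (x (.K j)), h.K_inv, one_mul, h.K_inv]
  exact left_inv_eq_right_inv e1 e2

/-- The coproduct on generators: `K_i ⊗ K_i`, `K_i⁻¹ ⊗ K_i⁻¹`, `E_i ⊗ K_i + K_i⁻¹ ⊗ E_i` and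
`F_i ⊗ K_i + K_i⁻¹ ⊗ F_i`. -/
def cop {R : Type*} [Ring R] [Algebra ℂ R] (x : UGen → R) {R' : Type*} [Ring R'] [Algebra ℂ R']
    (y : UGen → R') : UGen → R ⊗[ℂ] R'
  | .K i => x (.K i) ⊗ₜ y (.K i)
  | .K' i => x (.K' i) ⊗ₜ y (.K' i)
  | .E i => x (.E i) ⊗ₜ y (.K i) + x (.K' i) ⊗ₜ y (.E i)
  | .F i => x (.F i) ⊗ₜ y (.K i) + x (.K' i) ⊗ₜ y (.F i)

theorem cw_symm (i j : Fin 2) : cw i j = cw j i := by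
  fin_cases i <;> fin_cases j <;> rfl

section cop
variable {R : Type*} [Ring R] [Algebra ℂ R] {x : UGen → R} {R' : Type*} [Ring R'] [Algebra ℂ R']
    {y : UGen → R'}

theorem cop_cartan (hx : CartanRelations q x) (hy : CartanRelations q y) : CartanRelations q (cop x y) where
  KK i j := by simp only [cop, Algebra.TensorProduct.tmul_mul_tmul, hx.KK i j, hy.KK i j]
  K_inv i := by simp only [cop, Algebra.TensorProduct.tmul_mul_tmul, hx.K_inv, hy.K_inv, Algebra.TensorProduct.one_def]
  inv_K i := by simp only [cop, Algebra.TensorProduct.tmul_mul_tmul, hx.inv_K, hy.inv_K, Algebra.TensorProduct.one_def]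
  KE i j := by
    have e : x (.K i) * x (.K' j) = x (.K' j) * x (.K i) := by
      have := hx.KK i j
      calc _ = x (.K' j) * (x (.K j) * x (.K i)) * x (.K' j) := by
              rw [← mul_assoc, hx.inv_K, one_mul]
        _ = _ := by rw [← hx.KK i j, mul_assoc, mul_assoc, hx.K_inv, mul_one]
    simp only [cop, Algebra.TensorProduct.tmul_mul_tmul, mul_add, add_mul, hx.KE, hy.KE, e, hy.KK i j, smul_add,
      TensorProduct.smul_tmul', TensorProduct.tmul_smul]
  FK i j := by
    have e : x (.K i) * x (.K' j) = x (.K' j) * x (.K i) := by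
      have := hx.KK i j
      calc _ = x (.K' j) * (x (.K j) * x (.K i)) * x (.K' j) := by
              rw [← mul_assoc, hx.inv_K, one_mul]
        _ = _ := by rw [← hx.KK i j, mul_assoc, mul_assoc, hx.K_inv, mul_one]
    simp only [cop, Algebra.TensorProduct.tmul_mul_tmul, mul_add, add_mul, hx.FK, hy.FK, e, hy.KK i j, smul_add,
      TensorProduct.smul_tmul', TensorProduct.tmul_smul]

theorem cop_EF (hx : CartanRelations q x) (hy : CartanRelations q y) (i j : Fin 2) : cop x y (.E i) * cop x y (.F j) - cop x y (.F j) * cop x y (.E i) =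
    (x (.E i) * x (.F j) - x (.F j) * x (.E i)) ⊗ₜ (y (.K i) * y (.K j)) +
    (x (.K' i) * x (.K' j)) ⊗ₜ (y (.E i) * y (.F j) - y (.F j) * y (.E i)) := by
  have hq : qc q ^ cw i j ≠ 0 := zpow_ne_zero _ (qc_ne q)
  simp only [cop, Algebra.TensorProduct.tmul_mul_tmul, mul_add, add_mul, hx.K'E, hx.FK', hy.KE, hy.FK,
    TensorProduct.sub_tmul, TensorProduct.tmul_sub, TensorProduct.smul_tmul', TensorProduct.tmul_smul, smul_smul,
    cw_symm j i, inv_mul_cancel₀ hq, mul_inv_cancel₀ hq, one_smul, hy.KK j i, hx.K'K' j i]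
  abel

theorem cop_crossE (hx : CartanRelations q x) (hy : CartanRelations q y) (i j : Fin 2) :
    (x (.K' i) ⊗ₜ[ℂ] y (.E i)) * (x (.E j) ⊗ₜ[ℂ] y (.K j)) =
      ((qc q ^ cw i j)⁻¹ ^ 2) • ((x (.E j) ⊗ₜ[ℂ] y (.K j)) * (x (.K' i) ⊗ₜ[ℂ] y (.E i))) := by
  have hq : qc q ^ cw i j ≠ 0 := zpow_ne_zero _ (qc_ne q)
  simp only [Algebra.TensorProduct.tmul_mul_tmul, hx.K'E, hy.KE, ← TensorProduct.smul_tmul',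
    TensorProduct.tmul_smul, smul_smul, cw_symm j i]
  congr 1
  field_simp

theorem cop_crossF (hx : CartanRelations q x) (hy : CartanRelations q y) (i j : Fin 2) :
    (x (.K' i) ⊗ₜ[ℂ] y (.F i)) * (x (.F j) ⊗ₜ[ℂ] y (.K j)) =
      ((qc q ^ cw i j) ^ 2) • ((x (.F j) ⊗ₜ[ℂ] y (.K j)) * (x (.K' i) ⊗ₜ[ℂ] y (.F i))) := by
  have hq : qc q ^ cw i j ≠ 0 := zpow_ne_zero _ (qc_ne q)
  simp only [Algebra.TensorProduct.tmul_mul_tmul, hx.FK', hy.FK, ← TensorProduct.smul_tmul',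
    TensorProduct.tmul_smul, smul_smul, cw_symm j i]
  congr 1
  field_simp

theorem serre₁_tmul (hy : CartanRelations q y) (a₁ a₂ : R) :
    serre₁ (qc q) (a₁ ⊗ₜ[ℂ] y (.K 0)) (a₂ ⊗ₜ[ℂ] y (.K 1)) =
      serre₁ (qc q) a₁ a₂ ⊗ₜ (y (.K 0) * y (.K 1) ^ 2) := by
  have k1 := hy.KK 1 0
  have k1' : ∀ c, y (.K 1) * (y (.K 0) * c) = y (.K 0) * (y (.K 1) * c) := fun c => by
    rw [← mul_assoc, k1, mul_assoc]
  simp only [serre₁, pow_two, Algebra.TensorProduct.tmul_mul_tmul, mul_assoc, k1, k1',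
    TensorProduct.add_tmul, TensorProduct.sub_tmul, TensorProduct.smul_tmul', TensorProduct.tmul_smul]

theorem serre₂_tmul (hy : CartanRelations q y) (a₁ a₂ : R) :
    serre₂ (qc q) (a₁ ⊗ₜ[ℂ] y (.K 0)) (a₂ ⊗ₜ[ℂ] y (.K 1)) =
      serre₂ (qc q) a₁ a₂ ⊗ₜ (y (.K 0) ^ 3 * y (.K 1)) := by
  have k1 := hy.KK 1 0
  have k1' : ∀ c, y (.K 1) * (y (.K 0) * c) = y (.K 0) * (y (.K 1) * c) := fun c => by
    rw [← mul_assoc, k1, mul_assoc]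
  simp only [serre₂, pow_succ, pow_zero, one_mul, Algebra.TensorProduct.tmul_mul_tmul, mul_assoc,
    k1, k1', TensorProduct.sub_tmul, ← TensorProduct.smul_tmul', TensorProduct.tmul_smul]

theorem tmul_serre₁ (hx : CartanRelations q x) (b₁ b₂ : R') :
    serre₁ (qc q) (x (.K' 0) ⊗ₜ[ℂ] b₁) (x (.K' 1) ⊗ₜ[ℂ] b₂) =
      (x (.K' 0) * x (.K' 1) ^ 2) ⊗ₜ serre₁ (qc q) b₁ b₂ := by
  have k1 := hx.K'K' 1 0
  have k1' : ∀ c, x (.K' 1) * (x (.K' 0) * c) = x (.K' 0) * (x (.K' 1) * c) := fun c => by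
    rw [← mul_assoc, k1, mul_assoc]
  simp only [serre₁, pow_two, Algebra.TensorProduct.tmul_mul_tmul, mul_assoc, k1, k1',
    TensorProduct.tmul_add, TensorProduct.tmul_sub, TensorProduct.smul_tmul', TensorProduct.tmul_smul]

theorem tmul_serre₂ (hx : CartanRelations q x) (b₁ b₂ : R') :
    serre₂ (qc q) (x (.K' 0) ⊗ₜ[ℂ] b₁) (x (.K' 1) ⊗ₜ[ℂ] b₂) =
      (x (.K' 0) ^ 3 * x (.K' 1)) ⊗ₜ serre₂ (qc q) b₁ b₂ := by
  have k1 := hx.K'K' 1 0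
  have k1' : ∀ c, x (.K' 1) * (x (.K' 0) * c) = x (.K' 0) * (x (.K' 1) * c) := fun c => by
    rw [← mul_assoc, k1, mul_assoc]
  simp only [serre₂, pow_succ, pow_zero, one_mul, Algebra.TensorProduct.tmul_mul_tmul, mul_assoc,
    k1, k1', TensorProduct.tmul_sub, TensorProduct.smul_tmul', TensorProduct.tmul_smul]

theorem cop_serreE₁ (hx : CartanRelations q x) (hy : CartanRelations q y) : serre₁ (qc q) (cop x y (.E 0)) (cop x y (.E 1)) =
    serre₁ (qc q) (x (.E 0)) (x (.E 1)) ⊗ₜ (y (.K 0) * y (.K 1) ^ 2) +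
    (x (.K' 0) * x (.K' 1) ^ 2) ⊗ₜ serre₁ (qc q) (y (.E 0)) (y (.E 1)) := by
  simp only [cop]
  rw [serre₁_add _ (qc_ne q), serre₁_tmul hy, tmul_serre₁ hx] <;>
    rw [cop_crossE hx hy] <;> congr 1 <;> simp [cw, ← pow_mul]

theorem cop_serreE₂ (hx : CartanRelations q x) (hy : CartanRelations q y) : serre₂ (qc q) (cop x y (.E 0)) (cop x y (.E 1)) =
    serre₂ (qc q) (x (.E 0)) (x (.E 1)) ⊗ₜ (y (.K 0) ^ 3 * y (.K 1)) +
    (x (.K' 0) ^ 3 * x (.K' 1)) ⊗ₜ serre₂ (qc q) (y (.E 0)) (y (.E 1)) := by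
  simp only [cop]
  rw [serre₂_add _ (qc_ne q), serre₂_tmul hy, tmul_serre₂ hx] <;>
    rw [cop_crossE hx hy] <;> congr 1 <;> simp [cw, ← pow_mul]

theorem cop_serreF₁ (hx : CartanRelations q x) (hy : CartanRelations q y) : serre₁ (qc q) (cop x y (.F 0)) (cop x y (.F 1)) =
    serre₁ (qc q) (x (.F 0)) (x (.F 1)) ⊗ₜ (y (.K 0) * y (.K 1) ^ 2) +
    (x (.K' 0) * x (.K' 1) ^ 2) ⊗ₜ serre₁ (qc q) (y (.F 0)) (y (.F 1)) := by
  simp only [cop]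
  rw [← serre₁_inv, serre₁_add _ (inv_ne_zero (qc_ne q)), serre₁_inv, serre₁_inv,
    serre₁_tmul hy, tmul_serre₁ hx] <;>
    rw [cop_crossF hx hy] <;> congr 1 <;> simp [cw, ← pow_mul]

theorem cop_serreF₂ (hx : CartanRelations q x) (hy : CartanRelations q y) : serre₂ (qc q) (cop x y (.F 0)) (cop x y (.F 1)) =
    serre₂ (qc q) (x (.F 0)) (x (.F 1)) ⊗ₜ (y (.K 0) ^ 3 * y (.K 1)) +
    (x (.K' 0) ^ 3 * x (.K' 1)) ⊗ₜ serre₂ (qc q) (y (.F 0)) (y (.F 1)) := by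
  simp only [cop]
  rw [← serre₂_inv, serre₂_add _ (inv_ne_zero (qc_ne q)), serre₂_inv, serre₂_inv,
    serre₂_tmul hy, tmul_serre₂ hx] <;>
    rw [cop_crossF hx hy] <;> congr 1 <;> simp [cw, ← pow_mul]
end cop

theorem cop_rel {R : Type*} [Ring R] [Algebra ℂ R] {x : UGen → R} {R' : Type*} [Ring R']
    [Algebra ℂ R'] {y : UGen → R'} (hx : URelations q x) (hy : URelations q y) :
    URelations q (cop x y) := by
  have cx := hx.cartan
  have cy := hy.cartan
  have c := cop_cartan cx cy
  intro a b h
  cases h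
  case K_comm => exact c.KK 0 1
  case K_inv i => exact c.K_inv i
  case inv_K i => exact c.inv_K i
  case EF i =>
    rw [cop_EF cx cy, hx _ _ (.EF i), hy _ _ (.EF i)]
    simp only [cop, pow_two, Algebra.TensorProduct.tmul_mul_tmul, ← TensorProduct.smul_tmul',
      TensorProduct.tmul_smul, ← smul_add, TensorProduct.sub_tmul, TensorProduct.tmul_sub]
    congr 1
    abel
  case EF_ne i j h =>
    rw [cop_EF cx cy, hx _ _ (.EF_ne i j h), hy _ _ (.EF_ne i j h)]
    simp
  case KE i j => rw [c.KE, smul_mul_assoc, mul_assoc, c.K_inv, mul_one]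
  case KF i j => rw [mul_assoc, c.FK, mul_smul_comm, ← mul_assoc, c.inv_K, one_mul]
  case serreE₁ =>
    rw [cop_serreE₁ cx cy, hx _ _ .serreE₁, hy _ _ .serreE₁]; simp
  case serreE₂ =>
    rw [cop_serreE₂ cx cy, hx _ _ .serreE₂, hy _ _ .serreE₂]; simp
  case serreF₁ =>
    rw [cop_serreF₁ cx cy, hx _ _ .serreF₁, hy _ _ .serreF₁]; simp
  case serreF₂ =>
    rw [cop_serreF₂ cx cy, hx _ _ .serreF₂, hy _ _ .serreF₂]; simp
end

/-- The counit on generators. -/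
def coun : UGen → ℂ
  | .K _ => 1 | .K' _ => 1 | .E _ => 0 | .F _ => 0

theorem coun_rel (q : Param) : URelations q coun := by
  intro a b h
  cases h <;> simp [coun, serre₁, serre₂]

/-- The coproduct. -/
noncomputable def comulU (q : Param) : UqSo5 q →ₐ[ℂ] UqSo5 q ⊗[ℂ] UqSo5 q :=
  UqSo5.lift q _ (cop_rel (ugen_rel q) (ugen_rel q))

/-- The counit. -/
noncomputable def counitU (q : Param) : UqSo5 q →ₐ[ℂ] ℂ := UqSo5.lift q coun (coun_rel q)

noncomputable instance (q : Param) : Bialgebra ℂ (UqSo5 q) :=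
  Bialgebra.ofAlgHom (comulU q) (counitU q)
    (UqSo5.hom_ext q fun i => by
      cases i <;> simp [comulU, UqSo5.lift_gen, cop, TensorProduct.add_tmul, TensorProduct.tmul_add, add_assoc])
    (UqSo5.hom_ext q fun i => by
      cases i <;> simp [comulU, counitU, UqSo5.lift_gen, cop, coun])
    (UqSo5.hom_ext q fun i => by
      cases i <;> simp [comulU, counitU, UqSo5.lift_gen, cop, coun])


/-- The automorphism `K_i ▷`. -/
noncomputable def opK (q : Param) (i : Fin 2) : SphereAlg q →ₐ[ℂ] SphereAlg q := SphereAlg.lift q _ (kw_rel q i)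
/-- The automorphism `K_i⁻¹ ▷`. -/
noncomputable def opK' (q : Param) (i : Fin 2) : SphereAlg q →ₐ[ℂ] SphereAlg q := SphereAlg.lift q _ (kw'_rel q i)
/-- The homomorphism `a ↦ (K_i⁻¹ ▷ a, E_i ▷ a; 0, K_i ▷ a)`. -/
noncomputable def matE (q : Param) (i : Fin 2) : SphereAlg q →ₐ[ℂ] Matrix (Fin 2) (Fin 2) (SphereAlg q) :=
  SphereAlg.lift q _ (E_rel q i)
/-- The homomorphism `a ↦ (K_i⁻¹ ▷ a, F_i ▷ a; 0, K_i ▷ a)`. -/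
noncomputable def matF (q : Param) (i : Fin 2) : SphereAlg q →ₐ[ℂ] Matrix (Fin 2) (Fin 2) (SphereAlg q) :=
  SphereAlg.lift q _ (F_rel q i)

theorem SphereAlg.induction (q : Param) {P : SphereAlg q → Prop} (hg : ∀ i, P (sgen q i))
    (hc : ∀ c, P (algebraMap ℂ _ c)) (ha : ∀ a b, P a → P b → P (a + b))
    (hm : ∀ a b, P a → P b → P (a * b)) (a : SphereAlg q) : P a := by
  have h : a ∈ Algebra.adjoin ℂ (Set.range (sgen q)) := by rw [SphereAlg.adjoin]; trivial
  induction h using Algebra.adjoin_induction with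
  | mem x hx => obtain ⟨i, rfl⟩ := hx; exact hg i
  | algebraMap r => exact hc r
  | add x y _ _ hx hy => exact ha x y hx hy
  | mul x y _ _ hx hy => exact hm x y hx hy

theorem SphereAlg.hom_ext (q : Param) {T : Type*} [Ring T] [Algebra ℂ T] {f g : SphereAlg q →ₐ[ℂ] T}
    (h : ∀ i, f (sgen q i) = g (sgen q i)) : f = g := by
  have : Set.EqOn f g (Set.range (sgen q)) := by rintro _ ⟨i, rfl⟩; exact h i
  exact AlgHom.ext_of_adjoin_eq_top (SphereAlg.adjoin q) this

/-- The operators on `A(S⁴_q)` by which the generators of `U_q(so(5))` act: `K_i` and `K_i⁻¹` by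
automorphisms and `E_i`, `F_i` by twisted derivations,
`E_i ▷ (a b) = (E_i ▷ a) (K_i ▷ b) + (K_i⁻¹ ▷ a) (E_i ▷ b)`. -/
noncomputable def genAct (q : Param) : UGen → Module.End ℂ (SphereAlg q)
  | .K i => (opK q i).toLinearMap
  | .K' i => (opK' q i).toLinearMap
  | .E i => Matrix.entryLinearMap ℂ (SphereAlg q) 0 1 ∘ₗ (matE q i).toLinearMap
  | .F i => Matrix.entryLinearMap ℂ (SphereAlg q) 0 1 ∘ₗ (matF q i).toLinearMap

theorem matE_eq (q : Param) (i : Fin 2) (a : SphereAlg q) :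
    matE q i a = ut (opK' q i a) (genAct q (.E i) a) (opK q i a) := by
  induction a using SphereAlg.induction with
  | hg g => simp [matE, genAct, opK, opK', SphereAlg.lift_gen, ut, Matrix.entryLinearMap_apply]
  | hc c =>
    have : (algebraMap ℂ (Matrix (Fin 2) (Fin 2) (SphereAlg q)) c) = ut (algebraMap ℂ (SphereAlg q) c) 0 (algebraMap ℂ (SphereAlg q) c) := by
      rw [Algebra.algebraMap_eq_smul_one, ut_one, ut_smul, smul_zero, Algebra.algebraMap_eq_smul_one]
    simp [genAct, this]
    simp [ut]
  | ha a b ha hb => 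
    rw [map_add, ha, hb, ut_add, map_add, map_add, map_add]
  | hm a b ha hb =>
    have : genAct q (.E i) (a * b) = opK' q i a * genAct q (.E i) b + genAct q (.E i) a * opK q i b := by
      have : genAct q (.E i) (a * b) = (matE q i a * matE q i b) 0 1 := by
        simp [genAct, Matrix.entryLinearMap_apply]
      rw [this, ha, hb, ut_mul]
      simp [ut]
    rw [map_mul, ha, hb, ut_mul, map_mul (opK' q i), map_mul (opK q i), this]

theorem matF_eq (q : Param) (i : Fin 2) (a : SphereAlg q) :
    matF q i a = ut (opK' q i a) (genAct q (.F i) a) (opK q i a) := by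
  induction a using SphereAlg.induction with
  | hg g => simp [matF, genAct, opK, opK', SphereAlg.lift_gen, ut, Matrix.entryLinearMap_apply]
  | hc c =>
    have : (algebraMap ℂ (Matrix (Fin 2) (Fin 2) (SphereAlg q)) c) = ut (algebraMap ℂ (SphereAlg q) c) 0 (algebraMap ℂ (SphereAlg q) c) := by
      rw [Algebra.algebraMap_eq_smul_one, ut_one, ut_smul, smul_zero, Algebra.algebraMap_eq_smul_one]
    simp [genAct, this]
    simp [ut]
  | ha a b ha hb => 
    rw [map_add, ha, hb, ut_add, map_add, map_add, map_add]
  | hm a b ha hb =>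
    have : genAct q (.F i) (a * b) = opK' q i a * genAct q (.F i) b + genAct q (.F i) a * opK q i b := by
      have : genAct q (.F i) (a * b) = (matF q i a * matF q i b) 0 1 := by
        simp [genAct, Matrix.entryLinearMap_apply]
      rw [this, ha, hb, ut_mul]
      simp [ut]
    rw [map_mul, ha, hb, ut_mul, map_mul (opK' q i), map_mul (opK q i), this]

theorem actE_mul (q : Param) (i : Fin 2) (a b : SphereAlg q) : genAct q (.E i) (a * b) =
    genAct q (.E i) a * genAct q (.K i) b + genAct q (.K' i) a * genAct q (.E i) b := by
  have : genAct q (.E i) (a * b) = (matE q i a * matE q i b) 0 1 := by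
    simp [genAct, Matrix.entryLinearMap_apply]
  rw [this, matE_eq, matE_eq, ut_mul, add_comm]
  simp [ut, genAct]

theorem actF_mul (q : Param) (i : Fin 2) (a b : SphereAlg q) : genAct q (.F i) (a * b) =
    genAct q (.F i) a * genAct q (.K i) b + genAct q (.K' i) a * genAct q (.F i) b := by
  have : genAct q (.F i) (a * b) = (matF q i a * matF q i b) 0 1 := by
    simp [genAct, Matrix.entryLinearMap_apply]
  rw [this, matF_eq, matF_eq, ut_mul, add_comm]
  simp [ut, genAct]

theorem actK_gen (q : Param) (i : Fin 2) (g : SGen) :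
    genAct q (.K i) (sgen q g) = kw q i g • sgen q g := by simp [genAct, opK, SphereAlg.lift_gen]
theorem actK'_gen (q : Param) (i : Fin 2) (g : SGen) :
    genAct q (.K' i) (sgen q g) = kw' q i g • sgen q g := by simp [genAct, opK', SphereAlg.lift_gen]
theorem actE_gen (q : Param) (i : Fin 2) (g : SGen) :
    genAct q (.E i) (sgen q g) = dE q i g := by
  simp [genAct, matE, SphereAlg.lift_gen, ut, Matrix.entryLinearMap_apply]
theorem actF_gen (q : Param) (i : Fin 2) (g : SGen) :
    genAct q (.F i) (sgen q g) = dF q i g := by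
  simp [genAct, matF, SphereAlg.lift_gen, ut, Matrix.entryLinearMap_apply]
theorem actK_mul (q : Param) (i : Fin 2) (a b : SphereAlg q) : genAct q (.K i) (a * b) =
    genAct q (.K i) a * genAct q (.K i) b := by simp [genAct]
theorem actK'_mul (q : Param) (i : Fin 2) (a b : SphereAlg q) : genAct q (.K' i) (a * b) =
    genAct q (.K' i) a * genAct q (.K' i) b := by simp [genAct]
theorem act_one (q : Param) (g : UGen) : genAct q g 1 = coun g • 1 := by
  cases g <;> simp [genAct, coun]

/-- The multiplication intertwines `Y` and `X`. -/
def Intertwines (q : Param) (X : Module.End ℂ (SphereAlg q)) (Y : Module.End ℂ (SphereAlg q) ⊗[ℂ] Module.End ℂ (SphereAlg q)) : Prop :=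
  X ∘ₗ LinearMap.mul' ℂ (SphereAlg q) =
    LinearMap.mul' ℂ (SphereAlg q) ∘ₗ (Module.endTensorEndAlgHom (R := ℂ) (S := ℂ) (A := ℂ) Y)

section
variable {q : Param} {X X' : Module.End ℂ (SphereAlg q)} {Y Y' : Module.End ℂ (SphereAlg q) ⊗[ℂ] Module.End ℂ (SphereAlg q)}

theorem intertwines_gen (g : UGen) : Intertwines q (genAct q g) (cop (genAct q) (genAct q) g) := by
  unfold Intertwines
  ext a b
  cases g <;> simp only [cop, map_add, Module.endTensorEndAlgHom_apply, TensorProduct.AlgebraTensorModule.curry_apply,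
    LinearMap.comp_apply, TensorProduct.curry_apply, LinearMap.restrictScalars_self, LinearMap.mul'_apply, LinearMap.add_apply,
    TensorProduct.AlgebraTensorModule.map_tmul, actE_mul, actF_mul, actK_mul, actK'_mul]

theorem Intertwines.mul (h : Intertwines q X Y) (h' : Intertwines q X' Y') :
    Intertwines q (X * X') (Y * Y') := by
  unfold Intertwines at *
  rw [map_mul, Module.End.mul_eq_comp, Module.End.mul_eq_comp, LinearMap.comp_assoc, h', ← LinearMap.comp_assoc, h,
    LinearMap.comp_assoc]

theorem Intertwines.add (h : Intertwines q X Y) (h' : Intertwines q X' Y') :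
    Intertwines q (X + X') (Y + Y') := by
  unfold Intertwines at *
  rw [map_add, LinearMap.add_comp, LinearMap.comp_add, h, h']

theorem Intertwines.sub (h : Intertwines q X Y) (h' : Intertwines q X' Y') :
    Intertwines q (X - X') (Y - Y') := by
  unfold Intertwines at *
  rw [map_sub, LinearMap.sub_comp, LinearMap.comp_sub, h, h']

theorem Intertwines.smul (c : ℂ) (h : Intertwines q X Y) :
    Intertwines q (c • X) (c • Y) := by
  unfold Intertwines at *
  rw [map_smul, LinearMap.smul_comp, LinearMap.comp_smul, h]

theorem Intertwines.pow (h : Intertwines q X Y) (n : ℕ) :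
    Intertwines q (X ^ n) (Y ^ n) := by
  induction n with
  | zero => rw [pow_zero, pow_zero]; unfold Intertwines; ext a b; simp [Algebra.TensorProduct.one_def, Module.endTensorEndAlgHom_apply]
  | succ n ih => rw [pow_succ, pow_succ]; exact ih.mul h

theorem Intertwines.serre₁ (p : ℂ) (h : Intertwines q X Y) (h' : Intertwines q X' Y') :
    Intertwines q (serre₁ p X X') (serre₁ p Y Y') :=
  ((h.mul (h'.pow 2)).sub (((h'.mul h).mul h').smul _)).add ((h'.pow 2).mul h)

theorem Intertwines.serre₂ (p : ℂ) (h : Intertwines q X Y) (h' : Intertwines q X' Y') :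
    Intertwines q (serre₂ p X X') (serre₂ p Y Y') :=
  (((h.pow 3).mul h').sub (((((h.pow 2).mul h').mul h).sub ((h.mul h').mul (h.pow 2))).smul _)).sub (h'.mul (h.pow 3))

theorem Intertwines.eq_zero {P Q : Module.End ℂ (SphereAlg q)} (h : Intertwines q X (X ⊗ₜ P + Q ⊗ₜ X))
    (h1 : X 1 = 0) (hg : ∀ g, X (sgen q g) = 0) : X = 0 := by
  ext a
  induction a using SphereAlg.induction with
  | hg g => simpa using hg g
  | hc c => simp [Algebra.algebraMap_eq_smul_one, h1]
  | ha a b ha hb => simpa [ha] using hb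
  | hm a b ha hb =>
    have := LinearMap.congr_fun h (a ⊗ₜ b)
    simp only [LinearMap.zero_apply] at ha hb
    rw [LinearMap.zero_apply]
    simpa only [map_add, Module.endTensorEndAlgHom_apply, LinearMap.comp_apply, LinearMap.mul'_apply,
      LinearMap.add_apply, TensorProduct.AlgebraTensorModule.map_tmul, ha, hb, zero_mul, mul_zero, add_zero] using this

theorem kw_mul (q : Param) (i : Fin 2) (g : SGen) : kw q i g * kw' q i g = 1 := by
  have := qc_ne q
  fin_cases i <;> cases g <;> simp [kw, kw', wt, this]

theorem act_KK (q : Param) (i j : Fin 2) :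
    genAct q (.K i) * genAct q (.K j) = genAct q (.K j) * genAct q (.K i) := by
  have : (opK q i).comp (opK q j) = (opK q j).comp (opK q i) :=
    SphereAlg.hom_ext q fun g => by simp [opK, SphereAlg.lift_gen, smul_smul, mul_comm]
  exact congrArg AlgHom.toLinearMap this

theorem act_KK' (q : Param) (i j : Fin 2) :
    genAct q (.K i) * genAct q (.K' j) = genAct q (.K' j) * genAct q (.K i) := by
  have : (opK q i).comp (opK' q j) = (opK' q j).comp (opK q i) :=
    SphereAlg.hom_ext q fun g => by simp [opK, opK', SphereAlg.lift_gen, smul_smul, mul_comm]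
  exact congrArg AlgHom.toLinearMap this

theorem act_KE (q : Param) (i j : Fin 2) : genAct q (.K i) * genAct q (.E j) =
    qc q ^ cw i j • (genAct q (.E j) * genAct q (.K i)) := by
  rw [← sub_eq_zero]
  have h := ((intertwines_gen (q := q) (.K i)).mul (intertwines_gen (.E j))).sub
    (((intertwines_gen (q := q) (.E j)).mul (intertwines_gen (.K i))).smul (qc q ^ cw i j))
  have e : cop (genAct q) (genAct q) (.K i) * cop (genAct q) (genAct q) (.E j) -
      qc q ^ cw i j • (cop (genAct q) (genAct q) (.E j) * cop (genAct q) (genAct q) (.K i)) =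
      (genAct q (.K i) * genAct q (.E j) - qc q ^ cw i j • (genAct q (.E j) * genAct q (.K i))) ⊗ₜ
        (genAct q (.K i) * genAct q (.K j)) + (genAct q (.K i) * genAct q (.K' j)) ⊗ₜ
      (genAct q (.K i) * genAct q (.E j) - qc q ^ cw i j • (genAct q (.E j) * genAct q (.K i))) := by
    simp only [cop, Algebra.TensorProduct.tmul_mul_tmul, mul_add, add_mul, act_KK q j i,
      ← act_KK' q i j, smul_add, TensorProduct.sub_tmul, TensorProduct.tmul_sub,
      ← TensorProduct.smul_tmul', TensorProduct.tmul_smul]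
    abel
  rw [e] at h
  have hq := qc_ne q
  refine h.eq_zero ?_ fun g => ?_
  · simp [act_one, coun]
  · fin_cases i <;> fin_cases j <;> cases g <;>
      simp [actE_gen, actK_gen, dE, kw, wt, cw, map_smul, smul_smul] <;>
      (try match_scalars) <;> (try field_simp) <;> (try ring)

theorem act_FK (q : Param) (i j : Fin 2) : genAct q (.F j) * genAct q (.K i) =
    qc q ^ cw i j • (genAct q (.K i) * genAct q (.F j)) := by
  rw [← sub_eq_zero]
  have h := ((intertwines_gen (q := q) (.F j)).mul (intertwines_gen (.K i))).sub
    (((intertwines_gen (q := q) (.K i)).mul (intertwines_gen (.F j))).smul (qc q ^ cw i j))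
  have e : cop (genAct q) (genAct q) (.F j) * cop (genAct q) (genAct q) (.K i) -
      qc q ^ cw i j • (cop (genAct q) (genAct q) (.K i) * cop (genAct q) (genAct q) (.F j)) =
      (genAct q (.F j) * genAct q (.K i) - qc q ^ cw i j • (genAct q (.K i) * genAct q (.F j))) ⊗ₜ
        (genAct q (.K i) * genAct q (.K j)) + (genAct q (.K i) * genAct q (.K' j)) ⊗ₜ
      (genAct q (.F j) * genAct q (.K i) - qc q ^ cw i j • (genAct q (.K i) * genAct q (.F j))) := by
    simp only [cop, Algebra.TensorProduct.tmul_mul_tmul, mul_add, add_mul, act_KK q j i,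
      ← act_KK' q i j, smul_add, TensorProduct.sub_tmul, TensorProduct.tmul_sub,
      ← TensorProduct.smul_tmul', TensorProduct.tmul_smul]
    abel
  rw [e] at h
  have hq := qc_ne q
  refine h.eq_zero ?_ fun g => ?_
  · simp [act_one, coun]
  · fin_cases i <;> fin_cases j <;> cases g <;>
      simp [actF_gen, actK_gen, dF, kw, wt, cw, map_smul, smul_smul] <;>
      (try match_scalars) <;> (try field_simp) <;> (try ring)

theorem act_cartan (q : Param) : CartanRelations q (genAct q) where
  KK := act_KK q
  K_inv i := by
    have : (opK q i).comp (opK' q i) = AlgHom.id ℂ _ :=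
      SphereAlg.hom_ext q fun g => by simp [opK, opK', SphereAlg.lift_gen, smul_smul, mul_comm, kw_mul]
    exact congrArg AlgHom.toLinearMap this
  inv_K i := by
    have : (opK' q i).comp (opK q i) = AlgHom.id ℂ _ :=
      SphereAlg.hom_ext q fun g => by simp [opK, opK', SphereAlg.lift_gen, smul_smul, kw_mul]
    exact congrArg AlgHom.toLinearMap this
  KE := act_KE q
  FK := act_FK q

theorem act_rel (q : Param) : URelations q (genAct q) := by
  have c := act_cartan q
  have hq := qc_ne q
  have hr := rootq_ne q
  have p1 : qc q ^ 1 - (qc q ^ 1)⁻¹ ≠ 0 := qc_pow_ne q 1 one_ne_zero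
  have p2 : qc q ^ 2 - (qc q ^ 2)⁻¹ ≠ 0 := qc_pow_ne q 2 two_ne_zero
  have g := intertwines_gen (q := q)
  intro a b h
  cases h
  case K_comm => exact c.KK 0 1
  case K_inv i => exact c.K_inv i
  case inv_K i => exact c.inv_K i
  case KE i j => rw [c.KE, smul_mul_assoc, mul_assoc, c.K_inv, mul_one]
  case KF i j => rw [mul_assoc, c.FK, mul_smul_comm, ← mul_assoc, c.inv_K, one_mul]
  case EF i =>
    rw [← sub_eq_zero]
    have h := (((g (.E i)).mul (g (.F i))).sub ((g (.F i)).mul (g (.E i)))).sub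
      ((((g (.K i)).pow 2).sub ((g (.K' i)).pow 2)).smul
        (qc q ^ ((i : ℕ) + 1) - (qc q ^ ((i : ℕ) + 1))⁻¹)⁻¹)
    rw [cop_EF c c] at h
    refine Intertwines.eq_zero (P := genAct q (.K i) ^ 2) (Q := genAct q (.K' i) ^ 2) ?_ ?_ fun g => ?_
    · convert h using 1
      simp only [cop, pow_two, Algebra.TensorProduct.tmul_mul_tmul, ← TensorProduct.smul_tmul', smul_sub,
        TensorProduct.tmul_smul, ← smul_add, TensorProduct.sub_tmul, TensorProduct.tmul_sub]
      abel
    · simp [act_one, coun, pow_two]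
    · generalize hcd : (qc q ^ ((i : ℕ) + 1) - (qc q ^ ((i : ℕ) + 1))⁻¹)⁻¹ = d
      have hd : d * (qc q ^ ((i : ℕ) + 1) - (qc q ^ ((i : ℕ) + 1))⁻¹) = 1 := by
        rw [← hcd]
        apply inv_mul_cancel₀
        exact qc_pow_ne q _ (Nat.succ_ne_zero _)
      clear hcd h
      fin_cases i <;> cases g <;>
        simp [pow_two, actE_gen, actF_gen, actK_gen, actK'_gen, dF, dE, kw, kw', wt, map_smul, smul_smul] at hd ⊢
      all_goals match_scalars
      all_goals (
        field_simp at hd ⊢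
        first
          | done
          | ring1
          | linear_combination -hd
          | linear_combination hd
          | linear_combination (-(qc q ^ 2 + 1)) * hd
          | linear_combination (qc q ^ 2 + 1) * hd)
  case EF_ne i j hij =>
    have h := ((g (.E i)).mul (g (.F j))).sub ((g (.F j)).mul (g (.E i)))
    rw [cop_EF c c] at h
    refine h.eq_zero ?_ fun g => ?_
    · simp [act_one, coun]
    · fin_cases i <;> fin_cases j <;> first | exact absurd rfl hij | skip
      all_goals cases g <;> simp [actE_gen, actF_gen, dF, dE, map_smul, smul_smul, rootq_sq]
  case serreE₁ =>
    have h := (g (.E 0)).serre₁ (qc q) (g (.E 1))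
    rw [cop_serreE₁ c c] at h
    refine h.eq_zero ?_ fun g => ?_
    · simp [act_one, coun, serre₁, pow_two]
    · cases g <;> simp [serre₁, pow_two, actE_gen, actF_gen, dF, dE, map_smul, smul_smul, rootq_sq]
  case serreE₂ =>
    have h := (g (.E 0)).serre₂ (qc q) (g (.E 1))
    rw [cop_serreE₂ c c] at h
    refine h.eq_zero ?_ fun g => ?_
    · simp [act_one, coun, serre₂, pow_succ]
    · cases g <;> simp [serre₂, pow_succ, actE_gen, actF_gen, dF, dE, map_smul, smul_smul, rootq_sq]
  case serreF₁ =>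
    have h := (g (.F 0)).serre₁ (qc q) (g (.F 1))
    rw [cop_serreF₁ c c] at h
    refine h.eq_zero ?_ fun g => ?_
    · simp [act_one, coun, serre₁, pow_two]
    · cases g <;> simp [serre₁, pow_two, actE_gen, actF_gen, dF, dE, map_smul, smul_smul, rootq_sq]
  case serreF₂ =>
    have h := (g (.F 0)).serre₂ (qc q) (g (.F 1))
    rw [cop_serreF₂ c c] at h
    refine h.eq_zero ?_ fun g => ?_
    · simp [act_one, coun, serre₂, pow_succ]
    · cases g <;> simp [serre₂, pow_succ, actE_gen, actF_gen, dF, dE, map_smul, smul_smul, rootq_sq]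
end

/-- The action `▷` of `U_q(so(5))` on `A(S⁴_q)`. -/
noncomputable def act (q : Param) : UqSo5 q →ₐ[ℂ] Module.End ℂ (SphereAlg q) :=
  UqSo5.lift q _ (act_rel q)

theorem act_gen (q : Param) (g : UGen) : act q (ugen q g) = genAct q g :=
  UqSo5.lift_gen q _ _ g

theorem opK_opK' (q : Param) (i : Fin 2) : genAct q (.K i) * genAct q (.K' i) = 1 := (act_cartan q).K_inv i
theorem opK'_opK (q : Param) (i : Fin 2) : genAct q (.K' i) * genAct q (.K i) = 1 := (act_cartan q).inv_K i

/-- The element `K₁⁸ K₂⁶` of `U_q(so(5))`. -/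
noncomputable def modularElt (q : Param) : UqSo5 q := ugen q (.K 0) ^ 8 * ugen q (.K 1) ^ 6

theorem act_modularElt (q : Param) :
    act q (modularElt q) = ((opK q 0) ^ 8 * (opK q 1) ^ 6).toLinearMap := by
  rw [modularElt, map_mul, map_pow, map_pow, act_gen, act_gen]
  have h : ∀ (f : SphereAlg q →ₐ[ℂ] SphereAlg q) (n : ℕ), f.toLinearMap ^ n = (f ^ n).toLinearMap := by
    intro f n
    induction n with
    | zero => rfl
    | succ n ih => rw [pow_succ, pow_succ, ih]; rfl
  simp only [genAct, h]
  rfl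

theorem act_modularElt_mul (q : Param) (a b : SphereAlg q) :
    act q (modularElt q) (a * b) = act q (modularElt q) a * act q (modularElt q) b := by
  rw [act_modularElt]
  exact map_mul ((opK q 0) ^ 8 * (opK q 1) ^ 6) a b

theorem act_modularElt_one (q : Param) : act q (modularElt q) 1 = 1 := by
  rw [act_modularElt]
  exact map_one ((opK q 0) ^ 8 * (opK q 1) ^ 6)

/-- The inverse `K₂⁻⁶ K₁⁻⁸` of `K₁⁸ K₂⁶`. -/
noncomputable def modularEltInv (q : Param) : UqSo5 q := ugen q (.K' 1) ^ 6 * ugen q (.K' 0) ^ 8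

theorem modularElt_mul_inv (q : Param) : modularElt q * modularEltInv q = 1 := by
  have h := (ugen_rel q).cartan
  have p : ∀ (i : Fin 2) (n : ℕ), ugen q (.K i) ^ n * ugen q (.K' i) ^ n = 1 := by
    intro i n
    have : Commute (ugen q (.K i)) (ugen q (.K' i)) := (h.K_inv i).trans (h.inv_K i).symm
    rw [← this.mul_pow, h.K_inv, one_pow]
  rw [modularElt, modularEltInv, mul_assoc, ← mul_assoc _ (ugen q (.K' 1) ^ 6), p, one_mul, p]

theorem modularElt_inv_mul (q : Param) : modularEltInv q * modularElt q = 1 := by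
  have h := (ugen_rel q).cartan
  have p : ∀ (i : Fin 2) (n : ℕ), ugen q (.K' i) ^ n * ugen q (.K i) ^ n = 1 := by
    intro i n
    have : Commute (ugen q (.K' i)) (ugen q (.K i)) := (h.inv_K i).trans (h.K_inv i).symm
    rw [← this.mul_pow, h.inv_K, one_pow]
  rw [modularElt, modularEltInv, mul_assoc, ← mul_assoc _ (ugen q (.K 0) ^ 8), p, one_mul, p]

/-- The modular automorphism `κ : a ↦ K₁⁸ K₂⁶ ▷ a` of `A(S⁴_q)`. -/
noncomputable def kappa (q : Param) : SphereAlg q ≃ₐ[ℂ] SphereAlg q :=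
  AlgEquiv.ofLinearEquiv
    (LinearEquiv.ofLinearMap (act q (modularElt q)) (act q (modularEltInv q))
      (by rw [← Module.End.mul_eq_comp, ← map_mul, modularElt_mul_inv, map_one]; rfl)
      (by rw [← Module.End.mul_eq_comp, ← map_mul, modularElt_inv_mul, map_one]; rfl))
    (act_modularElt_one q) (act_modularElt_mul q)

/-- The identification `A^{⊗n} ⊗ A ≃ A^{⊗(n+1)}`. -/
noncomputable def tensorSnoc (A : Type*) [AddCommGroup A] [Module ℂ A] (n : ℕ) :
    (⨂[ℂ]^n A) ⊗[ℂ] A ≃ₗ[ℂ] ⨂[ℂ]^(n + 1) A :=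
  (TensorProduct.congr (LinearEquiv.refl ℂ _)
    (PiTensorProduct.subsingletonEquiv (R := ℂ) (s := fun _ : Fin 1 => A) (0 : Fin 1)).symm).trans
    TensorPower.mulEquiv

/-- The action of `U_q(so(5))` on `A(S⁴_q)^{⊗n}` through the iterated coproduct. -/
noncomputable def tensorAct (q : Param) : (n : ℕ) → UqSo5 q →ₐ[ℂ] Module.End ℂ (⨂[ℂ]^n (SphereAlg q))
  | 0 => (Algebra.ofId ℂ _).comp (Bialgebra.counitAlgHom ℂ (UqSo5 q))
  | n + 1 => ((tensorSnoc (SphereAlg q) n).conjAlgEquiv ℂ).toAlgHom.comp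
      (Module.endTensorEndAlgHom.comp
        ((Algebra.TensorProduct.map (tensorAct q n) (act q)).comp
          (Bialgebra.comulAlgHom ℂ (UqSo5 q))))

section Hochschild
variable {A : Type*} [Ring A] [Algebra ℂ A]

/-- A map of tuples which is linear in each entry. -/
def IsMulti {m n : ℕ} (f : (Fin m → A) → Fin n → A) : Prop :=
  ∀ (a : Fin m → A) (i : Fin m), ∃ (s : Fin n) (L : A →ₗ[ℂ] A),
    ∀ x, f (Function.update a i x) = Function.update (f a) s (L x)

/-- The linear map `a₁ ⊗ ⋯ ⊗ a_m ↦ b₁ ⊗ ⋯ ⊗ b_n` for `(b₁, …, b_n) = f (a₁, …, a_m)`. -/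
noncomputable def tensorMap {m n : ℕ} (f : (Fin m → A) → Fin n → A) (hf : IsMulti f) :
    (⨂[ℂ]^m A) →ₗ[ℂ] ⨂[ℂ]^n A :=
  PiTensorProduct.lift
    { toFun := fun a => PiTensorProduct.tprod ℂ (f a)
      map_update_add' := by
        intro _ a i x y
        obtain ⟨s, L, h⟩ := hf a i
        have h' : ∀ x, f (Function.update a i x) = Function.update (f a) s (L x) := by
          intro x
          rw [← h x]
          congr!
        rw [h', h', h', map_add, MultilinearMap.map_update_add]
      map_update_smul' := by
        intro _ a i c x
        obtain ⟨s, L, h⟩ := hf a i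
        have h' : ∀ x, f (Function.update a i x) = Function.update (f a) s (L x) := by
          intro x
          rw [← h x]
          congr!
        rw [h', h', map_smul, MultilinearMap.map_update_smul] }

theorem tensorMap_tprod {m n : ℕ} (f : (Fin m → A) → Fin n → A) (hf : IsMulti f) (a : Fin m → A) :
    tensorMap f hf (PiTensorProduct.tprod ℂ a) = PiTensorProduct.tprod ℂ (f a) := by
  simp [tensorMap]

/-- `(a₀, …, a_{n+1}) ↦ (a₀, …, a_j a_{j+1}, …, a_{n+1})`. -/
def innerTuple (n : ℕ) (j : Fin (n + 1)) (a : Fin (n + 2) → A) : Fin (n + 1) → A :=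
  Fin.contractNth j.castSucc (· * ·) a

/-- `(a₀, …, a_{n+1}) ↦ (σ(a_{n+1}) a₀, a₁, …, a_n)`. -/
def lastTuple (σ : A ≃ₐ[ℂ] A) (n : ℕ) (a : Fin (n + 2) → A) : Fin (n + 1) → A :=
  Function.update (Fin.init a) 0 (σ (a (Fin.last (n + 1))) * a 0)

theorem innerTuple_multi (n : ℕ) (j : Fin (n + 1)) : IsMulti (innerTuple (A := A) n j) := by
  intro a i
  rcases lt_trichotomy i j.castSucc with h | h | h
  · refine ⟨⟨i, by grind⟩, LinearMap.id, fun x => ?_⟩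
    funext k
    simp only [innerTuple, Fin.contractNth, Function.update_apply, LinearMap.id_apply, Fin.ext_iff]
    grind
  · refine ⟨j, LinearMap.mulRight ℂ (a j.succ), fun x => ?_⟩
    subst h
    funext k
    simp only [innerTuple, Fin.contractNth, Function.update_apply, LinearMap.mulRight_apply, Fin.ext_iff]
    grind
  · by_cases h' : i = j.succ
    · refine ⟨j, LinearMap.mulLeft ℂ (a j.castSucc), fun x => ?_⟩
      subst h'
      funext k
      simp only [innerTuple, Fin.contractNth, Function.update_apply, LinearMap.mulLeft_apply, Fin.ext_iff]
      grind
    · refine ⟨⟨i - 1, by grind⟩, LinearMap.id, fun x => ?_⟩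
      rw [Fin.ext_iff] at h'
      funext k
      simp only [innerTuple, Fin.contractNth, Function.update_apply, LinearMap.id_apply, Fin.ext_iff]
      grind

theorem lastTuple_multi (σ : A ≃ₐ[ℂ] A) (n : ℕ) : IsMulti (lastTuple σ n) := by
  intro a i
  by_cases hl : i = Fin.last (n + 1)
  · refine ⟨0, LinearMap.mulRight ℂ (a 0) ∘ₗ σ.toLinearMap, fun x => ?_⟩
    subst hl
    funext k
    simp only [lastTuple, Fin.init, Function.update_apply, LinearMap.comp_apply,
      LinearMap.mulRight_apply, AlgEquiv.toLinearMap_apply, Fin.ext_iff]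
    grind
  · by_cases hi : i = 0
    · refine ⟨0, LinearMap.mulLeft ℂ (σ (a (Fin.last (n + 1)))), fun x => ?_⟩
      subst hi
      funext k
      simp only [lastTuple, Fin.init, Function.update_apply, LinearMap.mulLeft_apply, Fin.ext_iff]
      grind
    · refine ⟨⟨i, by grind⟩, LinearMap.id, fun x => ?_⟩
      rw [Fin.ext_iff] at hl hi
      funext k
      simp only [lastTuple, Fin.init, Function.update_apply, LinearMap.id_apply, Fin.ext_iff]
      grind

/-- The twisted Hochschild boundary `b_σ : A^{⊗(n+2)} → A^{⊗(n+1)}`. -/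
noncomputable def twistedBoundary (σ : A ≃ₐ[ℂ] A) (n : ℕ) : (⨂[ℂ]^(n + 2) A) →ₗ[ℂ] ⨂[ℂ]^(n + 1) A :=
  ∑ j : Fin (n + 1), (-1 : ℂ) ^ (j : ℕ) • tensorMap (innerTuple n j) (innerTuple_multi n j) +
    (-1 : ℂ) ^ (n + 1) • tensorMap (lastTuple σ n) (lastTuple_multi σ n)

/-- `σ^{⊗(n+1)}`. -/
noncomputable def twistMap (σ : A ≃ₐ[ℂ] A) (n : ℕ) : (⨂[ℂ]^(n + 1) A) →ₗ[ℂ] ⨂[ℂ]^(n + 1) A :=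
  PiTensorProduct.map fun _ => σ.toLinearMap

/-- The twisted `n`-chains: the tensors in `A^{⊗(n+1)}` invariant under `σ^{⊗(n+1)}`. -/
noncomputable def twistedChains (σ : A ≃ₐ[ℂ] A) (n : ℕ) : Submodule ℂ (⨂[ℂ]^(n + 1) A) :=
  LinearMap.eqLocus (twistMap σ n) LinearMap.id

/-- The twisted Hochschild `n`-cycles. -/
noncomputable def twistedCycles (σ : A ≃ₐ[ℂ] A) : (n : ℕ) → Submodule ℂ (⨂[ℂ]^(n + 1) A)
  | 0 => twistedChains σ 0
  | n + 1 => twistedChains σ (n + 1) ⊓ LinearMap.ker (twistedBoundary σ n)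

/-- The boundaries of the twisted `(n + 1)`-chains. -/
noncomputable def twistedBoundaries (σ : A ≃ₐ[ℂ] A) (n : ℕ) : Submodule ℂ (⨂[ℂ]^(n + 1) A) :=
  (twistedChains σ (n + 1)).map (twistedBoundary σ n)

/-- The twisted Hochschild homology `HH_n^σ(A)`. -/
abbrev TwistedHH (σ : A ≃ₐ[ℂ] A) (n : ℕ) : Type _ :=
  twistedCycles σ n ⧸ (twistedBoundaries σ n).comap (twistedCycles σ n).subtype

/-- The class of a twisted cycle. -/
noncomputable def TwistedHH.mk (σ : A ≃ₐ[ℂ] A) (n : ℕ) : twistedCycles σ n →ₗ[ℂ] TwistedHH σ n :=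
  ((twistedBoundaries σ n).comap (twistedCycles σ n).subtype).mkQ

end Hochschild

/-- The deformed Dirac matrices; `γ₋₁` and `γ₋₂` are indexed by `x₁s` and `x₂s`. -/
noncomputable def gammaMat (q : Param) : SGen → Matrix (Fin 4) (Fin 4) ℂ
  | .x₀ => !![1, 0, 0, 0; 0, -(qc q) ^ 2, 0, 0; 0, 0, -(qc q) ^ 2, 0; 0, 0, 0, (qc q) ^ 4]
  | .x₁ => !![0, 0, -qc q, 0; 0, 0, 0, (qc q) ^ 3; 0, 0, 0, 0; 0, 0, 0, 0]
  | .x₁s => !![0, 0, 0, 0; 0, 0, 0, 0; -(qc q)⁻¹, 0, 0, 0; 0, qc q, 0, 0]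
  | .x₂ => !![0, (qc q) ^ 3, 0, 0; 0, 0, 0, 0; 0, 0, 0, (qc q) ^ 3; 0, 0, 0, 0]
  | .x₂s => !![0, 0, 0, 0; ((qc q) ^ 3)⁻¹, 0, 0, 0; 0, 0, 0, 0; 0, 0, ((qc q) ^ 3)⁻¹, 0]

/-- The matrix `η = diag(q⁴, q⁻², q², q⁻⁴)`. -/
noncomputable def eta (q : Param) : Matrix (Fin 4) (Fin 4) ℂ :=
  Matrix.diagonal ![(qc q) ^ 4, ((qc q) ^ 2)⁻¹, (qc q) ^ 2, ((qc q) ^ 4)⁻¹]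

/-- The matrix `γ_g x_g` with entries in `A(S⁴_q)`. -/
noncomputable def gammaTerm (q : Param) (g : SGen) : Matrix (Fin 4) (Fin 4) (SphereAlg q) :=
  (gammaMat q g).map fun c => c • sgen q g

/-- The idempotent `e = ½ (1 + γ₀ x₀ + γ₁ x₁ + γ₂ x₂ + γ₋₁ x₁* + γ₋₂ x₂*)`. -/
noncomputable def idem (q : Param) : Matrix (Fin 4) (Fin 4) (SphereAlg q) :=
  (1 / 2 : ℂ) • (1 + gammaTerm q .x₀ + gammaTerm q .x₁ + gammaTerm q .x₂ + gammaTerm q .x₁s +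
    gammaTerm q .x₂s)

/-- The matrix `e - ½`. -/
noncomputable def idemHalf (q : Param) : Matrix (Fin 4) (Fin 4) (SphereAlg q) :=
  idem q - (1 / 2 : ℂ) • 1

/-- The tensor `ω₄ = ∑ η_{k₀k₁} (e - ½)_{k₁k₂} ⊗ ⋯ ⊗ (e - ½)_{k₅k₀}`. -/
noncomputable def omega₄ (q : Param) : ⨂[ℂ]^5 (SphereAlg q) :=
  ∑ k : Fin 6 → Fin 4, eta q (k 0) (k 1) •
    PiTensorProduct.tprod ℂ ![idemHalf q (k 1) (k 2), idemHalf q (k 2) (k 3),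
      idemHalf q (k 3) (k 4), idemHalf q (k 4) (k 5), idemHalf q (k 5) (k 0)]

/-- The `q`-number `[z] = (q^z - q^{-z}) / (q - q⁻¹)`. -/
noncomputable def qNum (q : Param) (z : ℝ) : ℝ :=
  ((q : ℝ) ^ z - (q : ℝ) ^ (-z)) / ((q : ℝ) - (q : ℝ)⁻¹)

/-- The labels of the basis `|l, m₁, m₂; j⟩`: `l ∈ ℕ + ½`, `j ∈ {½, 3/2, …, l}`,
`j - |m₁| ∈ ℕ` and `l + ½ - j - |m₂| ∈ ℕ`. -/
def Admissible (l m₁ m₂ j : ℝ) : Prop :=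
  (∃ n : ℕ, l = n + 1 / 2) ∧ (∃ n : ℕ, j = n + 1 / 2) ∧ j ≤ l ∧
    (∃ n : ℕ, j - |m₁| = n) ∧ ∃ n : ℕ, l + 1 / 2 - j - |m₂| = n

/-- Admissible labels. -/
structure SpinorIndex where
  l : ℝ
  m₁ : ℝ
  m₂ : ℝ
  j : ℝ
  adm : Admissible l m₁ m₂ j

noncomputable instance : DecidableEq SpinorIndex := Classical.decEq _

/-- The Hilbert space with orthonormal basis `|l, m₁, m₂; j⟩`. -/
abbrev SpinorSpace : Type := lp (fun _ : SpinorIndex => ℂ) 2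

section
open scoped Classical

/-- The vector `|l, m₁, m₂; j⟩`, which is zero if the labels are not admissible. -/
noncomputable def ket (l m₁ m₂ j : ℝ) : SpinorSpace :=
  if h : Admissible l m₁ m₂ j then lp.single 2 (⟨l, m₁, m₂, j, h⟩ : SpinorIndex) (1 : ℂ) else 0

/-- `ε = ±½` with `l + ε - j - m₂` even. -/
noncomputable def eps (l j m₂ : ℝ) : ℝ :=
  if ∃ n : ℤ, l + 1 / 2 - j - m₂ = 2 * n then 1 / 2 else -1 / 2

end

section Coefficients
variable (q : Param)

/-- The coefficient `A⁺_{j,m₁}`. -/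
noncomputable def coefA (j m₁ : ℝ) : ℝ :=
  (q : ℝ) ^ (m₁ - 1) * √(qNum q (j + m₁ + 1) * qNum q (j - m₁ + 1)) / qNum q (2 * j + 2)

/-- The coefficient `A⁰_{j,m₁}`. -/
noncomputable def coefA₀ (j m₁ : ℝ) : ℝ :=
  (q : ℝ) ^ (-2 : ℝ) * ((q : ℝ) ^ (j + m₁ + 1) * qNum q 2 * qNum q (j - m₁) - qNum q (2 * j)) /
    (qNum q (2 * j) * qNum q (2 * j + 2))

/-- The coefficient `B⁺_{j,m₁}`. -/
noncomputable def coefB (j m₁ : ℝ) : ℝ :=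
  (q : ℝ) ^ (-j + m₁ - 1 / 2) * √(qNum q (j + m₁ + 1) * qNum q (j + m₁ + 2)) / qNum q (2 * j + 2)

/-- The coefficient `B⁰_{j,m₁}`. -/
noncomputable def coefB₀ (j m₁ : ℝ) : ℝ :=
  (1 + (q : ℝ) ^ 2) * (q : ℝ) ^ (m₁ - 1 / 2) * √(qNum q (j - m₁) * qNum q (j + m₁ + 1)) /
    (qNum q (2 * j) * qNum q (2 * j + 2))

/-- The coefficient `B⁻_{j,m₁}`. -/
noncomputable def coefBm (j m₁ : ℝ) : ℝ :=
  -(q : ℝ) ^ (j + m₁ + 1 / 2) * √(qNum q (j - m₁) * qNum q (j - m₁ - 1)) / qNum q (2 * j)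

/-- The coefficient `C⁺_{l,j,m₂}`. -/
noncomputable def coefC (l j m₂ : ℝ) : ℝ :=
  -(q : ℝ) ^ (m₂ - 1 - eps l j m₂) *
    √(qNum q (l + j + m₂ + 3 + eps l j m₂) * qNum q (l + j - m₂ + 3 - eps l j m₂)) /
      qNum q (2 * l + 4)

/-- The coefficient `C⁰_{l,j,m₂}`. -/
noncomputable def coefC₀ (l j m₂ : ℝ) : ℝ :=
  qNum q (4 * eps l j m₂) * (q : ℝ) ^ (2 * eps l j m₂ * l + m₂ - 1 + 3 * eps l j m₂) *
    √(qNum q (l + 1 / 2 + j - 2 * eps l j m₂ * m₂ + 2) *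
      qNum q (l + 1 / 2 - j - 2 * eps l j m₂ * m₂)) /
        (qNum q (2 * l + 2) * qNum q (2 * l + 4))

/-- The coefficient `C⁻_{l,j,m₂}`. -/
noncomputable def coefCm (l j m₂ : ℝ) : ℝ :=
  -(q : ℝ) ^ (m₂ - 1 + eps l j m₂) *
    √(qNum q (l - j + m₂ - eps l j m₂) * qNum q (l - j - m₂ + eps l j m₂)) / qNum q (2 * l + 2)

/-- The coefficient `H⁺_{l,j,m₂}`. -/
noncomputable def coefH (l j m₂ : ℝ) : ℝ :=
  (q : ℝ) ^ (m₂ - 1 + eps l j m₂ * (2 * j + 1)) *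
    √(qNum q (l + 2 * eps l j m₂ * j - m₂ + 2 + eps l j m₂) *
      qNum q (l - 2 * eps l j m₂ * j + m₂ + 2 - eps l j m₂)) / qNum q (2 * l + 4)

/-- The coefficient `H⁰_{l,j,m₂}`. -/
noncomputable def coefH₀ (l j m₂ : ℝ) : ℝ :=
  (qNum q (l - eps l j m₂ * (2 * j + 1) - m₂ + 1) * qNum q (l - eps l j m₂ * (2 * j + 1) + m₂ + 2) -
    (q : ℝ) ^ (-2 : ℝ) * qNum q (l + eps l j m₂ * (2 * j + 1) - m₂ + 2) *
      qNum q (l + eps l j m₂ * (2 * j + 1) + m₂ + 1)) /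
        (qNum q (2 * l + 2) * qNum q (2 * l + 4))

/-- The coefficient `D⁺_{l,j,m₂}`. -/
noncomputable def coefD (l j m₂ : ℝ) : ℝ :=
  (q : ℝ) ^ (-l + m₂ - 3 / 2) *
    √(qNum q (l + j + m₂ + 3 + eps l j m₂) * qNum q (l - j + m₂ + 2 - eps l j m₂)) /
      qNum q (2 * l + 4)

/-- The coefficient `D⁰_{l,j,m₂}`. -/
noncomputable def coefD₀ (l j m₂ : ℝ) : ℝ :=
  qNum q 2 * (q : ℝ) ^ (m₂ + 1 / 2) *
    √(qNum q (l - 2 * eps l j m₂ * j - m₂ + 1 - eps l j m₂) *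
      qNum q (l - 2 * eps l j m₂ * j + m₂ + 2 - eps l j m₂)) /
        (qNum q (2 * l + 2) * qNum q (2 * l + 4))

/-- The coefficient `D⁻_{l,j,m₂}`. -/
noncomputable def coefDm (l j m₂ : ℝ) : ℝ :=
  -(q : ℝ) ^ (l + m₂ + 3 / 2) *
    √(qNum q (l - j - m₂ + eps l j m₂) * qNum q (l + j - m₂ + 1 - eps l j m₂)) / qNum q (2 * l + 2)

end Coefficients

/-- `π` is the chiral `*`-representation of `A(S⁴_q)` with sign `s = ±1`, given on the basis
`|l, m₁, m₂; j⟩`. -/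
structure IsChiralRep (q : Param) (s : ℝ) (π : SphereAlg q →ₐ[ℂ] (SpinorSpace →L[ℂ] SpinorSpace)) :
    Prop where
  x₀_ket : ∀ l m₁ m₂ j : ℝ, Admissible l m₁ m₂ j → π (sgen q .x₀) (ket l m₁ m₂ j) =
    (coefA q j m₁ * coefC q l j m₂) • ket (l + 1) m₁ m₂ (j + 1)
    - (s * coefA q j m₁ * coefC₀ q l j m₂) • ket l m₁ m₂ (j + 1)
    + (coefA q j m₁ * coefCm q l j m₂) • ket (l - 1) m₁ m₂ (j + 1)
    + (coefA₀ q j m₁ * coefH q l j m₂) • ket (l + 1) m₁ m₂ j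
    + (s * coefA₀ q j m₁ * coefH₀ q l j m₂) • ket l m₁ m₂ j
    + (coefA₀ q j m₁ * coefH q (l - 1) j m₂) • ket (l - 1) m₁ m₂ j
    + (coefA q (j - 1) m₁ * coefCm q (l + 1) (j - 1) m₂) • ket (l + 1) m₁ m₂ (j - 1)
    - (s * coefA q (j - 1) m₁ * coefC₀ q l (j - 1) m₂) • ket l m₁ m₂ (j - 1)
    + (coefA q (j - 1) m₁ * coefC q (l - 1) (j - 1) m₂) • ket (l - 1) m₁ m₂ (j - 1)
  x₁_ket : ∀ l m₁ m₂ j : ℝ, Admissible l m₁ m₂ j → π (sgen q .x₁) (ket l m₁ m₂ j) =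
    (coefB q j m₁ * coefC q l j m₂) • ket (l + 1) (m₁ + 1) m₂ (j + 1)
    - (s * coefB q j m₁ * coefC₀ q l j m₂) • ket l (m₁ + 1) m₂ (j + 1)
    + (coefB q j m₁ * coefCm q l j m₂) • ket (l - 1) (m₁ + 1) m₂ (j + 1)
    + (coefB₀ q j m₁ * coefH q l j m₂) • ket (l + 1) (m₁ + 1) m₂ j
    + (s * coefB₀ q j m₁ * coefH₀ q l j m₂) • ket l (m₁ + 1) m₂ j
    + (coefB₀ q j m₁ * coefH q (l - 1) j m₂) • ket (l - 1) (m₁ + 1) m₂ j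
    + (coefBm q j m₁ * coefCm q (l + 1) (j - 1) m₂) • ket (l + 1) (m₁ + 1) m₂ (j - 1)
    - (s * coefBm q j m₁ * coefC₀ q l (j - 1) m₂) • ket l (m₁ + 1) m₂ (j - 1)
    + (coefBm q j m₁ * coefC q (l - 1) (j - 1) m₂) • ket (l - 1) (m₁ + 1) m₂ (j - 1)
  x₂_ket : ∀ l m₁ m₂ j : ℝ, Admissible l m₁ m₂ j → π (sgen q .x₂) (ket l m₁ m₂ j) =
    coefD q l j m₂ • ket (l + 1) m₁ (m₂ + 1) j
    + (s * coefD₀ q l j m₂) • ket l m₁ (m₂ + 1) j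
    + coefDm q l j m₂ • ket (l - 1) m₁ (m₂ + 1) j
  adj_x₀ : ContinuousLinearMap.adjoint (π (sgen q .x₀)) = π (sgen q .x₀)
  adj_x₁ : ContinuousLinearMap.adjoint (π (sgen q .x₁)) = π (sgen q .x₁s)
  adj_x₂ : ContinuousLinearMap.adjoint (π (sgen q .x₂)) = π (sgen q .x₂s)

/-- The Hilbert space `H = H₊ ⊕ H₋`. -/
abbrev Spinors : Type := WithLp 2 (SpinorSpace × SpinorSpace)

/-- The operator on `H₊ ⊕ H₋` which corresponds to an operator on the product. -/
noncomputable def onSpinors (T : SpinorSpace × SpinorSpace →L[ℂ] SpinorSpace × SpinorSpace) :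
    Spinors →L[ℂ] Spinors :=
  (WithLp.prodContinuousLinearEquiv 2 ℂ SpinorSpace SpinorSpace).symm.toContinuousLinearMap ∘L T ∘L
    (WithLp.prodContinuousLinearEquiv 2 ℂ SpinorSpace SpinorSpace).toContinuousLinearMap

/-- The direct sum of two operators. -/
noncomputable def dsum (S T : SpinorSpace →L[ℂ] SpinorSpace) : Spinors →L[ℂ] Spinors :=
  onSpinors (S.prodMap T)

/-- The operator `F`, which exchanges `|l, m₁, m₂; j⟩₊` and `|l, m₁, m₂; j⟩₋`. -/
noncomputable def opF : Spinors →L[ℂ] Spinors :=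
  onSpinors ((ContinuousLinearMap.snd ℂ _ _).prod (ContinuousLinearMap.fst ℂ _ _))

/-- The grading `γ = ±1` on `H_±`. -/
noncomputable def opGamma : Spinors →L[ℂ] Spinors := dsum 1 (-1)

/-- The bounded operator `γ F [F, a₀] ⋯ [F, a_n]`. -/
noncomputable def chernOp {q : Param} (πp πm : SphereAlg q →ₐ[ℂ] (SpinorSpace →L[ℂ] SpinorSpace))
    {n : ℕ} (a : Fin n → SphereAlg q) : Spinors →L[ℂ] Spinors :=
  opGamma * opF *
    (List.ofFn fun i => opF * dsum (πp (a i)) (πm (a i)) - dsum (πp (a i)) (πm (a i)) * opF).prod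

/-- The eigenvalue `q^{-2m₁-6m₂}` of the (unbounded) operator `K₁⁻⁸ K₂⁻⁶` on `|l, m₁, m₂; j⟩_±`. -/
noncomputable def modularWeight (q : Param) (v : SpinorIndex) : ℂ :=
  (((q : ℝ) ^ (-(2 * v.m₁ + 6 * v.m₂)) : ℝ) : ℂ)

/-- `T = K₁⁻⁸ K₂⁻⁶ B`, where `K₁⁻⁸ K₂⁻⁶` is the self-adjoint diagonal operator on its maximal
domain. -/
def IsModularMul (q : Param) (B T : Spinors →L[ℂ] Spinors) : Prop :=
  ∀ (u : Spinors) (v : SpinorIndex),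
    (T u).fst v = modularWeight q v * (B u).fst v ∧ (T u).snd v = modularWeight q v * (B u).snd v

/-- Trace class operators of a Hilbert space, in the form of nuclear operators. -/
def IsTraceClass {E : Type*} [NormedAddCommGroup E] [InnerProductSpace ℂ E] (T : E →L[ℂ] E) : Prop :=
  ∃ x y : ℕ → E, Summable (fun n => ‖x n‖ * ‖y n‖) ∧
    ∀ u, HasSum (fun n => inner ℂ (x n) u • y n) (T u)

/-- The operator `T` is of trace class with trace `t`. -/
def HasTrace {E : Type} [NormedAddCommGroup E] [InnerProductSpace ℂ E] (T : E →L[ℂ] E) (t : ℂ) :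
    Prop :=
  IsTraceClass T ∧
    ∀ (ι : Type) (b : HilbertBasis ι ℂ E), HasSum (fun i => inner ℂ (b i) (T (b i))) t

/-- The linear form `φ` on `A(S⁴_q)^{⊗(n+1)}` is the twisted Chern character
`ch_n(a₀ ⊗ ⋯ ⊗ a_n) = Tr(K₁⁻⁸ K₂⁻⁶ γ F [F, a₀] ⋯ [F, a_n])`, with operators of trace class. -/
def IsTwistedChern {q : Param} (πp πm : SphereAlg q →ₐ[ℂ] (SpinorSpace →L[ℂ] SpinorSpace))
    (n : ℕ) (φ : (⨂[ℂ]^(n + 1) (SphereAlg q)) →ₗ[ℂ] ℂ) : Prop :=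
  ∀ a : Fin (n + 1) → SphereAlg q, ∃ T : Spinors →L[ℂ] Spinors,
    IsModularMul q (chernOp πp πm a) T ∧ HasTrace T (φ (PiTensorProduct.tprod ℂ a))

end QSphere

open scoped TensorProduct
namespace QSphere
set_option linter.unusedSimpArgs false
set_option linter.unusedSectionVars false
set_option linter.unusedVariables false
set_option linter.unusedTactic false
set_option linter.unreachableTactic false

/-! Cycle. The matrix f = e - 1/2 is half of a deformed Dirac matrix of square 1 (`diracMat_sq`).
Each K_i acts on f by conjugation with a diagonal matrix k, and E_i, F_i act by f ↦ k [f, X] k with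
a constant matrix X commuting with η k². This form survives tensor powers (`dotPow_skew`), so the
η-trace ω₄ is invariant (`invariant_skew`). In b_κ(ω₄) each of the five terms contains a product f f
= 1/4; what is left is an η-trace of three factors f with a unit inserted, which vanishes because
Tr(η γ_i γ_j γ_k) = 0 (`trilinear_eq_zero`).

Representations. After a rescaling of the basis the matrix coefficients are rational functions of p
= q^{1/2} and of integral powers of q, and the generators act on functions on a lattice of labels
(`lat`). There x₀, x₁, x₁* are combinations of three reduced operators, which change j by 1, 0, -1,
with coefficients in j and m₁ only, while x₂ and x₂* are single reduced operators. A few identities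
between products of reduced operators (`comp_pm`, `comp_mp`, `comp_de` and the commutation rules)
give the relations. Square roots of products of q-numbers (`gW`, `gV`) lead back to the orthonormal
basis, where the coefficients are symmetric (`hc_rev`); this yields the adjoints and the remaining
relations. The sphere relation bounds all coefficients by 1.

Trace class. The two chiral representations π₊ and π₋ differ only in the sign of the part which
preserves l. A Casimir-type sum of squares of its coefficients depends on l alone and is O(q^{4l})
(`casimir_sum`, `hc_preserving_le`), so d = π₊ - π₋ takes values of order q^{2l}. The modular weight
is at most of order q^{-6l}, hence products of at least four differences have a weighted trace τ,
and ch(a₀ ⊗ ⋯ ⊗ a₄) = 2 τ(da₀ ⋯ da₄) (`chernOp_eq`). As K₁⁸K₂⁶ implements κ, τ is κ-twisted cyclic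
(`tau_rep`). With d(ab) = da π₊(b) + π₋(a) db the boundary telescopes to zero
(`chernForm_boundary`).

Value. Let D and S be the difference and the sum of π₊(f) and π₋(f). Both matrices have square 1/4,
so S D = -D S and S² = 1 - D². By cyclicity the η-weighted trace of Dⁿ equals that of Dⁿ⁺² for odd n
≥ 5 (`tauMat_step`), so the value at n = 5 is the limit for n → ∞. Now D preserves l and splits into
blocks of size at most four with explicit eigenvalues (`blk_eq`, `dual_eq`). All have modulus less
than 1, except one eigenvalue 1 at l = 1/2 (`eig_lt`, `exceptional`). The powers therefore converge
to a rank one projection; on its range η cancels the modular weight, and the limit is 1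
(`tauMat_five`). Hence ch(ω₄) = 2. Since ch vanishes on boundaries, the class of ω₄ is non-zero. -/

/-! ### The deformed Dirac matrices. -/

/-- The matrix `∑_g γ_g y_g` over an algebra. -/
noncomputable def diracMat (q : Param) {T : Type*} [Ring T] [Algebra ℂ T] (y : SGen → T) : Matrix (Fin 4) (Fin 4) T :=
  Matrix.of fun i j => gammaMat q .x₀ i j • y .x₀ + gammaMat q .x₁ i j • y .x₁ + gammaMat q .x₂ i j • y .x₂ +
    gammaMat q .x₁s i j • y .x₁s + gammaMat q .x₂s i j • y .x₂s

theorem idemHalf_eq (q : Param) : idemHalf q = (1 / 2 : ℂ) • diracMat q (sgen q) := by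
  ext i j
  simp only [idemHalf, idem, gammaTerm, diracMat, Matrix.sub_apply, Matrix.smul_apply, Matrix.add_apply, Matrix.map_apply, Matrix.of_apply]
  module

-- All 125 traces are one trilinear identity: Γ y is the combination of the five matrices with
-- unknown coefficients y, the trace of η Γ(y) Γ(z) Γ(w) vanishes identically, and each γ_g is Γ at
-- an indicator function.
set_option maxHeartbeats 1000000 in
theorem gammaMat_trace (q : Param) (i j k : SGen) :
    (eta q * gammaMat q i * gammaMat q j * gammaMat q k).trace = 0 := by
  have hq := qc_ne q
  let Γ : (SGen → ℂ) → Matrix (Fin 4) (Fin 4) ℂ := fun y =>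
    !![y .x₀, qc q ^ 3 * y .x₂, -(qc q * y .x₁), 0;
      (qc q ^ 3)⁻¹ * y .x₂s, -(qc q ^ 2 * y .x₀), 0, qc q ^ 3 * y .x₁;
      -((qc q)⁻¹ * y .x₁s), 0, -(qc q ^ 2 * y .x₀), qc q ^ 3 * y .x₂;
      0, qc q * y .x₁s, (qc q ^ 3)⁻¹ * y .x₂s, qc q ^ 4 * y .x₀]
  have hΓ : ∀ y z w, (eta q * Γ y * Γ z * Γ w).trace = 0 := fun y z w => by
    simp [Γ, eta, Matrix.trace, Matrix.mul_apply, Fin.sum_univ_four, Matrix.diagonal_apply]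
    field_simp
    ring
  have e : ∀ g, ∃ y, gammaMat q g = Γ y := fun g => by
    classical
    refine ⟨fun g' => if g' = g then 1 else 0, ?_⟩
    ext a b
    cases g <;> fin_cases a <;> fin_cases b <;> simp [gammaMat, Γ]
  obtain ⟨y, hy⟩ := e i
  obtain ⟨z, hz⟩ := e j
  obtain ⟨w, hw⟩ := e k
  rw [hy, hz, hw]
  exact hΓ y z w

-- Entry by entry this is the list of relations: the off-diagonal entries are the q-commutation
-- rules, the diagonal ones the relations for x₁*x₁, x₂*x₂ and the radius. It is the reason why e is
-- idempotent.
set_option maxHeartbeats 1000000 in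
theorem diracMat_sq (q : Param) {T : Type*} [Ring T] [Algebra ℂ T] {y : SGen → T} (h : SRelations q y) :
    diracMat q y * diracMat q y = 1 := by
  have hq := qc_ne q
  have e1 := sub_eq_iff_eq_add.1 (h _ _ .r11)
  have e2 := sub_eq_iff_eq_add.1 (h _ _ .r22)
  have e3 := h _ _ .rad
  rw [pow_two] at e1 e3
  have e5 : y .x₂ * y .x₂s = 1 - y .x₀ * y .x₀ - y .x₁ * y .x₁s := by
    rw [← e3]; abel
  ext i j
  fin_cases i <;> fin_cases j <;>
    simp [diracMat, gammaMat, Matrix.mul_apply, Fin.sum_univ_four, e1, e2, e5, smul_smul, h _ _ .r01, h _ _ .r02, h _ _ .r12, h _ _ .r1s0, h _ _ .r2s0, h _ _ .r2s1s, h _ _ .r1s2, h _ _ .r2s1] <;>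
    match_scalars <;> field_simp <;> ring

/-! ### Tensor powers of a matrix and the invariance of ω₄. -/

theorem tensorSnoc_tprod {A : Type*} [Ring A] [Algebra ℂ A] (n : ℕ) (a : Fin n → A) (x : A) :
    tensorSnoc A n (PiTensorProduct.tprod ℂ a ⊗ₜ x) = PiTensorProduct.tprod ℂ (Fin.snoc (α := fun _ => A) a x) := by
  have h : (PiTensorProduct.subsingletonEquiv (R := ℂ) (s := fun _ : Fin 1 => A) (0 : Fin 1)).symm x =
      PiTensorProduct.tprod ℂ (fun _ : Fin 1 => x) := by
    rw [LinearEquiv.symm_apply_eq]; simp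
  simp only [tensorSnoc, LinearEquiv.trans_apply, TensorProduct.congr_tmul, LinearEquiv.refl_apply, h]
  have := TensorPower.tprod_mul_tprod ℂ a (fun _ : Fin 1 => x)
  rw [TensorPower.gMul_def, Fin.append_right_eq_snoc] at this
  exact this

theorem comul_ugen (q : Param) (g : UGen) :
    Bialgebra.comulAlgHom ℂ (UqSo5 q) (ugen q g) = cop (ugen q) (ugen q) g :=
  UqSo5.lift_gen q _ (cop_rel (ugen_rel q) (ugen_rel q)) g

theorem counit_ugen (q : Param) (g : UGen) : Coalgebra.counit (R := ℂ) (ugen q g) = coun g :=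
  UqSo5.lift_gen q _ (coun_rel q) g

/-- The action is built by splitting off the last factor, so inductions on the number of factors
need only the coproduct of one generator. -/
theorem tensorAct_cop (q : Param) (n : ℕ) (g : UGen) (t : ⨂[ℂ]^n (SphereAlg q)) (x : SphereAlg q) :
    tensorAct q (n + 1) (ugen q g) (tensorSnoc _ n (t ⊗ₜ x)) =
      tensorSnoc _ n (Module.endTensorEndAlgHom (R := ℂ) (S := ℂ) (A := ℂ)
        (cop (fun g => tensorAct q n (ugen q g)) (genAct q) g) (t ⊗ₜ x)) := by
  simp only [tensorAct, AlgHom.comp_apply, comul_ugen]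
  have e : Algebra.TensorProduct.map (tensorAct q n) (act q) (cop (ugen q) (ugen q) g) =
      cop (fun g => tensorAct q n (ugen q g)) (genAct q) g := by
    cases g <;> simp [cop, act_gen]
  rw [e]
  change (LinearEquiv.conj (tensorSnoc (SphereAlg q) n)) _ _ = _
  rw [LinearEquiv.conj_apply_apply, LinearEquiv.symm_apply_apply]

/-- The `n`-fold product of a matrix with itself, with tensor products of the entries. -/
noncomputable def dotPow {A : Type*} [Ring A] [Algebra ℂ A] (f : Matrix (Fin 4) (Fin 4) A) :
    (n : ℕ) → Fin 4 → Fin 4 → ⨂[ℂ]^n A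
  | 0, i, j => if i = j then PiTensorProduct.tprod ℂ Fin.elim0 else 0
  | n + 1, i, j => ∑ k, tensorSnoc A n (dotPow f n i k ⊗ₜ f k j)

section
variable {q : Param} {f : Matrix (Fin 4) (Fin 4) (SphereAlg q)}

theorem tensorAct_zero (g : UGen) (t : ⨂[ℂ]^0 (SphereAlg q)) : tensorAct q 0 (ugen q g) t = coun g • t := by
  simp only [tensorAct, AlgHom.comp_apply]
  have : Bialgebra.counitAlgHom ℂ (UqSo5 q) (ugen q g) = coun g := counit_ugen q g
  rw [this]
  rfl

/-- In matrix form g acts by f ↦ k⁻¹ f k with k diagonal. Between neighbouring factors k k⁻¹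
cancels, so the whole power is conjugated. The hypothesis `hg` ranges over all pairs of algebras
because the left leg acts on tensor powers of every length. -/
theorem dotPow_group {g : UGen} (hc : coun g = 1)
    (hg : ∀ {R : Type} [Ring R] [Algebra ℂ R] (x : UGen → R) {R' : Type} [Ring R'] [Algebra ℂ R'] (y : UGen → R'),
      cop x y g = x g ⊗ₜ y g) {k : Fin 4 → ℂ} (hk : ∀ i, k i ≠ 0)
    (h : ∀ i j, genAct q g (f i j) = ((k i)⁻¹ * k j) • f i j) (n : ℕ) (i j : Fin 4) :
    tensorAct q n (ugen q g) (dotPow f n i j) = ((k i)⁻¹ * k j) • dotPow f n i j := by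
  induction n generalizing i j with
  | zero =>
    rw [tensorAct_zero, hc]
    by_cases hij : i = j
    · subst hij; simp [hk]
    · simp [dotPow, hij]
  | succ n ih =>
    simp only [dotPow, map_sum, tensorAct_cop, hg, Finset.smul_sum]
    refine Finset.sum_congr rfl fun m _ => ?_
    change tensorSnoc _ n (tensorAct q n (ugen q g) (dotPow f n i m) ⊗ₜ genAct q g (f m j)) = _
    rw [ih, h, TensorProduct.smul_tmul_smul, map_smul]
    congr 1
    field_simp [hk m]

/-- In matrix form g ▷ f = k [f, X] k, while c and c' act by k⁻¹ f k and k f k⁻¹. The coproduct g ⊗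
c + c' ⊗ g then gives k ([fⁿ, X] f + fⁿ [f, X]) k = k [fⁿ⁺¹, X] k, so the commutator form reproduces
itself. -/
theorem dotPow_skew {g c c' : UGen} (hc : coun g = 0)
    (hg : ∀ {R : Type} [Ring R] [Algebra ℂ R] (x : UGen → R) {R' : Type} [Ring R'] [Algebra ℂ R'] (y : UGen → R'),
      cop x y g = x g ⊗ₜ y c + x c' ⊗ₜ y g) {k : Fin 4 → ℂ} (hk : ∀ i, k i ≠ 0) {X : Fin 4 → Fin 4 → ℂ}
    (h : ∀ i j, genAct q c (f i j) = ((k i)⁻¹ * k j) • f i j)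
    (h' : ∀ n i j, tensorAct q n (ugen q c') (dotPow f n i j) = (k i * (k j)⁻¹) • dotPow f n i j)
    (hE : ∀ i j, genAct q g (f i j) = (k i * k j) • (∑ m, X m j • f i m - ∑ m, X i m • f m j))
    (n : ℕ) (i j : Fin 4) :
    tensorAct q n (ugen q g) (dotPow f n i j) =
      (k i * k j) • (∑ m, X m j • dotPow f n i m - ∑ m, X i m • dotPow f n m j) := by
  induction n generalizing i j with
  | zero =>
    rw [tensorAct_zero, hc]
    simp [dotPow, Finset.sum_ite_eq, smul_ite]
  | succ n ih =>
    have key : ∀ m, tensorAct q (n + 1) (ugen q g) (tensorSnoc _ n (dotPow f n i m ⊗ₜ f m j)) =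
        (k i * k j) • (∑ r, X r j • tensorSnoc _ n (dotPow f n i m ⊗ₜ f m r)
          - ∑ r, X i r • tensorSnoc _ n (dotPow f n r m ⊗ₜ f m j)) +
        (k i * k j) • (∑ r, X r m • tensorSnoc _ n (dotPow f n i r ⊗ₜ f m j)
          - ∑ r, X m r • tensorSnoc _ n (dotPow f n i m ⊗ₜ f r j)) := by
      intro m
      rw [tensorAct_cop, hg]
      change tensorSnoc _ n (tensorAct q n (ugen q g) (dotPow f n i m) ⊗ₜ genAct q c (f m j) +
        tensorAct q n (ugen q c') (dotPow f n i m) ⊗ₜ genAct q g (f m j)) = _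
      rw [ih, h, h', hE, TensorProduct.smul_tmul_smul, TensorProduct.smul_tmul_smul]
      simp only [TensorProduct.sub_tmul, TensorProduct.tmul_sub, TensorProduct.sum_tmul, TensorProduct.tmul_sum,
        map_add, map_sub, map_smul, map_sum, TensorProduct.tmul_smul, ← TensorProduct.smul_tmul']
      have e1 : k i * k m * ((k m)⁻¹ * k j) = k i * k j := by field_simp [hk m]
      have e2 : k i * (k m)⁻¹ * (k m * k j) = k i * k j := by field_simp [hk m]
      rw [e1, e2]
      simp only [smul_add, smul_sub]; abel
    simp only [dotPow, map_sum, key, Finset.sum_add_distrib, ← Finset.smul_sum, Finset.sum_sub_distrib]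
    -- After the exchange of summation the two sums with X between the last two factors cancel.
    rw [Finset.sum_comm (f := fun m r => X r m • tensorSnoc _ n (dotPow f n i r ⊗ₜ f m j)),
      Finset.sum_comm (f := fun m r => X r j • tensorSnoc _ n (dotPow f n i m ⊗ₜ f m r)),
      Finset.sum_comm (f := fun m r => X i r • tensorSnoc _ n (dotPow f n r m ⊗ₜ f m j))]
    simp only [Finset.smul_sum, smul_sub]
    abel

end

/-- The diagonal entries of the matrix `η`. -/
noncomputable def etaDiag (q : Param) : Fin 4 → ℂ := ![qc q ^ 4, (qc q ^ 2)⁻¹, qc q ^ 2, (qc q ^ 4)⁻¹]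

theorem sum_fin_six {M : Type*} [AddCommMonoid M] (g : (Fin 6 → Fin 4) → M) :
    ∑ k, g k = ∑ a, ∑ b, ∑ c, ∑ d, ∑ e, ∑ f, g ![a, b, c, d, e, f] := by
  have h : ∀ (n : ℕ) (g : (Fin (n + 1) → Fin 4) → M), ∑ k, g k = ∑ a, ∑ k, g (Matrix.vecCons a k) := by
    intro n g
    rw [← (Fin.consEquiv fun _ => Fin 4).sum_comp, Fintype.sum_prod_type]
    rfl
  simp only [h, Finset.univ_unique, Finset.sum_singleton]
  rfl

theorem eta_apply (q : Param) (a b : Fin 4) : eta q a b = if a = b then etaDiag q a else 0 :=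
  Matrix.diagonal_apply _ _ _

theorem sum_rev_three {M : Type*} [AddCommMonoid M] (g : Fin 4 → Fin 4 → Fin 4 → M) :
    ∑ b, ∑ c, ∑ d, g b c d = ∑ d, ∑ c, ∑ b, g b c d := by
  rw [Finset.sum_comm]
  simp only [Finset.sum_comm (f := fun b d => g b _ d)]
  rw [Finset.sum_comm]

theorem sum_rev_four {M : Type*} [AddCommMonoid M] (g : Fin 4 → Fin 4 → Fin 4 → Fin 4 → M) :
    ∑ b, ∑ c, ∑ d, ∑ e, g b c d e = ∑ e, ∑ d, ∑ c, ∑ b, g b c d e := by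
  rw [Finset.sum_congr rfl fun b _ => sum_rev_three (g b), Finset.sum_comm]
  refine Finset.sum_congr rfl fun e _ => ?_
  rw [Finset.sum_comm]
  refine Finset.sum_congr rfl fun d _ => ?_
  rw [Finset.sum_comm]

theorem omega_eq (q : Param) : omega₄ q = ∑ a, etaDiag q a • ∑ b, ∑ c, ∑ d, ∑ e,
    PiTensorProduct.tprod ℂ ![idemHalf q a b, idemHalf q b c, idemHalf q c d, idemHalf q d e, idemHalf q e a] := by
  rw [omega₄, sum_fin_six]
  refine Finset.sum_congr rfl fun a _ => ?_
  rw [Finset.sum_eq_single a]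
  · simp only [Finset.smul_sum, Matrix.cons_val, eta_apply, if_true]
  · intro b _ hb
    refine Finset.sum_eq_zero fun c _ => Finset.sum_eq_zero fun d _ => Finset.sum_eq_zero fun e _ => Finset.sum_eq_zero fun f _ => ?_
    simp only [Matrix.cons_val, eta_apply, if_neg hb.symm, zero_smul]
  · simp

theorem dotPow_one {A : Type*} [Ring A] [Algebra ℂ A] (f : Matrix (Fin 4) (Fin 4) A) (i j : Fin 4) :
    dotPow f 1 i j = PiTensorProduct.tprod ℂ ![f i j] := by
  simp only [dotPow]
  rw [Finset.sum_eq_single i]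
  · rw [if_pos rfl, tensorSnoc_tprod]
    congr 1
    ext x
    fin_cases x
    rfl
  · intro b _ hb
    rw [if_neg hb.symm, TensorProduct.zero_tmul, map_zero]
  · simp

theorem snoc_cons {A : Type*} {n : ℕ} (x : A) (v : Fin n → A) (y : A) :
    Fin.snoc (α := fun _ => A) (Matrix.vecCons x v) y = Matrix.vecCons x (Fin.snoc (α := fun _ => A) v y) :=
  (Fin.cons_snoc_eq_snoc_cons _ _ _).symm

theorem snoc_empty {A : Type*} (v : Fin 0 → A) (y : A) : Fin.snoc (α := fun _ => A) v y = ![y] := by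
  ext x
  fin_cases x
  rfl

theorem dotPow_five {A : Type*} [Ring A] [Algebra ℂ A] (f : Matrix (Fin 4) (Fin 4) A) (i j : Fin 4) :
    dotPow f 5 i j = ∑ b, ∑ c, ∑ d, ∑ e, PiTensorProduct.tprod ℂ ![f i b, f b c, f c d, f d e, f e j] := by
  have h : ∀ n i j, dotPow f (n + 1) i j = ∑ k, tensorSnoc A n (dotPow f n i k ⊗ₜ f k j) := fun _ _ _ => rfl
  -- `dotPow` unfolds from its last factor, so the sums appear in the opposite order.
  rw [sum_rev_four, h 4]
  simp only [h 3, h 2, h 1, dotPow_one, map_sum, TensorProduct.sum_tmul, tensorSnoc_tprod, snoc_cons, snoc_empty]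

theorem omega_eq_dotPow (q : Param) : omega₄ q = ∑ a, etaDiag q a • dotPow (idemHalf q) 5 a a := by
  simp only [omega_eq, dotPow_five]

theorem invariant_group {q : Param} {g : UGen} (hc : coun g = 1)
    (hg : ∀ {R : Type} [Ring R] [Algebra ℂ R] (x : UGen → R) {R' : Type} [Ring R'] [Algebra ℂ R'] (y : UGen → R'),
      cop x y g = x g ⊗ₜ y g) {k : Fin 4 → ℂ} (hk : ∀ i, k i ≠ 0)
    (h : ∀ i j, genAct q g (idemHalf q i j) = ((k i)⁻¹ * k j) • idemHalf q i j) :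
    tensorAct q 5 (ugen q g) (omega₄ q) = omega₄ q := by
  simp only [omega_eq_dotPow, map_sum, map_smul, dotPow_group hc hg hk h, inv_mul_cancel₀ (hk _), one_smul]

/-- The η-trace of k [f⁵, X] k is the trace of f⁵ against [X, η k²], and `hX` says that X commutes
with the diagonal matrix η k². -/
theorem invariant_skew {q : Param} {g c c' : UGen} (hc : coun g = 0) 
    (hg : ∀ {R : Type} [Ring R] [Algebra ℂ R] (x : UGen → R) {R' : Type} [Ring R'] [Algebra ℂ R'] (y : UGen → R'),
      cop x y g = x g ⊗ₜ y c + x c' ⊗ₜ y g) (hc' : coun c' = 1)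
    (hg' : ∀ {R : Type} [Ring R] [Algebra ℂ R] (x : UGen → R) {R' : Type} [Ring R'] [Algebra ℂ R'] (y : UGen → R'),
      cop x y c' = x c' ⊗ₜ y c') {k : Fin 4 → ℂ} (hk : ∀ i, k i ≠ 0) {X : Fin 4 → Fin 4 → ℂ}
    (h : ∀ i j, genAct q c (idemHalf q i j) = ((k i)⁻¹ * k j) • idemHalf q i j)
    (h' : ∀ i j, genAct q c' (idemHalf q i j) = (k i * (k j)⁻¹) • idemHalf q i j)
    (hE : ∀ i j, genAct q g (idemHalf q i j) = (k i * k j) • (∑ m, X m j • idemHalf q i m - ∑ m, X i m • idemHalf q m j))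
    (hX : ∀ i j, etaDiag q i * k i * k i * X j i = etaDiag q j * k j * k j * X j i) :
    tensorAct q 5 (ugen q g) (omega₄ q) = 0 := by
  have h'' : ∀ n i j, tensorAct q n (ugen q c') (dotPow (idemHalf q) n i j) = (k i * (k j)⁻¹) • dotPow (idemHalf q) n i j := by
    intro n i j
    have := dotPow_group (q := q) (f := idemHalf q) hc' hg' (k := fun i => (k i)⁻¹) (fun i => inv_ne_zero (hk i)) (by simpa using h') n i j
    simpa using this
  simp only [omega_eq_dotPow, map_sum, map_smul, dotPow_skew hc hg hk h h'' hE, smul_sub, Finset.smul_sum, Finset.sum_sub_distrib, smul_smul]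
  rw [Finset.sum_comm (f := fun i m => (etaDiag q i * (k i * k i * X i m)) • dotPow (idemHalf q) 5 m i), sub_eq_zero]
  refine Finset.sum_congr rfl fun i _ => Finset.sum_congr rfl fun m _ => ?_
  congr 1
  linear_combination hX i m

/-- The weights of the matrix `e` under `K_i`. -/
noncomputable def kdiag (q : Param) : Fin 2 → Fin 4 → ℂ
  | 0 => ![1, 1, qc q, qc q]
  | 1 => ![1, qc q, (qc q)⁻¹, 1]

/-- The matrices which implement the action of `E_i` on the matrix `e`. -/
noncomputable def xE (q : Param) : Fin 2 → Matrix (Fin 4) (Fin 4) ℂ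
  | 0 => !![0, 0, 0, 0; 0, 0, 0, 0; -(rootq q ^ 3)⁻¹, 0, 0, 0; 0, -(rootq q ^ 3)⁻¹, 0, 0]
  | 1 => !![0, 0, 0, 0; 0, 0, -(qc q)⁻¹, 0; 0, 0, 0, 0; 0, 0, 0, 0]

/-- The matrices which implement the action of `F_i` on the matrix `e`. -/
noncomputable def xF (q : Param) : Fin 2 → Matrix (Fin 4) (Fin 4) ℂ
  | 0 => !![0, 0, -(rootq q)⁻¹, 0; 0, 0, 0, -(rootq q)⁻¹; 0, 0, 0, 0; 0, 0, 0, 0]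
  | 1 => !![0, 0, 0, 0; 0, 0, 0, 0; 0, -qc q, 0, 0; 0, 0, 0, 0]

theorem kdiag_ne (q : Param) (l : Fin 2) (i : Fin 4) : kdiag q l i ≠ 0 := by
  have hq := qc_ne q
  fin_cases l <;> fin_cases i <;> simp [kdiag, hq]

theorem idemHalf_explicit (q : Param) : idemHalf q = (1 / 2 : ℂ) •
    !![sgen q .x₀, qc q ^ 3 • sgen q .x₂, -(qc q • sgen q .x₁), 0;
      (qc q ^ 3)⁻¹ • sgen q .x₂s, -(qc q ^ 2 • sgen q .x₀), 0, qc q ^ 3 • sgen q .x₁;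
      -((qc q)⁻¹ • sgen q .x₁s), 0, -(qc q ^ 2 • sgen q .x₀), qc q ^ 3 • sgen q .x₂;
      0, qc q • sgen q .x₁s, (qc q ^ 3)⁻¹ • sgen q .x₂s, qc q ^ 4 • sgen q .x₀] := by
  rw [idemHalf_eq]
  congr 1
  ext i j
  fin_cases i <;> fin_cases j <;> simp [diracMat, gammaMat]

theorem idemHalf_K (q : Param) (l : Fin 2) (i j : Fin 4) :
    genAct q (.K l) (idemHalf q i j) = ((kdiag q l i)⁻¹ * kdiag q l j) • idemHalf q i j := by
  have hq := qc_ne q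
  rw [idemHalf_explicit]
  fin_cases l <;> fin_cases i <;> fin_cases j <;>
    simp [kdiag, actK_gen, kw, wt, smul_smul] <;> match_scalars <;> field_simp

theorem idemHalf_K' (q : Param) (l : Fin 2) (i j : Fin 4) :
    genAct q (.K' l) (idemHalf q i j) = (kdiag q l i * (kdiag q l j)⁻¹) • idemHalf q i j := by
  have hq := qc_ne q
  rw [idemHalf_explicit]
  fin_cases l <;> fin_cases i <;> fin_cases j <;>
    simp [kdiag, actK'_gen, kw', wt, smul_smul] <;> match_scalars <;> field_simp

set_option maxHeartbeats 1000000 in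
theorem idemHalf_E (q : Param) (l : Fin 2) (i j : Fin 4) :
    genAct q (.E l) (idemHalf q i j) = (kdiag q l i * kdiag q l j) •
      (∑ m, xE q l m j • idemHalf q i m - ∑ m, xE q l i m • idemHalf q m j) := by
  have hq := qc_ne q
  have hp := rootq_ne q
  rw [idemHalf_explicit]
  fin_cases l <;> fin_cases i <;> fin_cases j <;>
    simp [kdiag, xE, actE_gen, dE, smul_smul, Fin.sum_univ_four] <;> match_scalars <;>
    simp only [rootq_sq] <;> field_simp <;> ring

set_option maxHeartbeats 1000000 in
theorem idemHalf_F (q : Param) (l : Fin 2) (i j : Fin 4) :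
    genAct q (.F l) (idemHalf q i j) = (kdiag q l i * kdiag q l j) •
      (∑ m, xF q l m j • idemHalf q i m - ∑ m, xF q l i m • idemHalf q m j) := by
  have hq := qc_ne q
  have hp := rootq_ne q
  rw [idemHalf_explicit]
  fin_cases l <;> fin_cases i <;> fin_cases j <;>
    simp [kdiag, xF, actF_gen, dF, smul_smul, Fin.sum_univ_four] <;> match_scalars <;>
    simp only [rootq_sq] <;> field_simp <;> ring

theorem omega_invariant_gen (q : Param) (g : UGen) :
    tensorAct q 5 (ugen q g) (omega₄ q) = coun g • omega₄ q := by
  have hq := qc_ne q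
  cases g with
  | K l =>
    rw [invariant_group rfl (fun _ _ _ _ _ => rfl) (kdiag_ne q l) (idemHalf_K q l)]
    simp [coun]
  | K' l =>
    rw [invariant_group (k := fun i => (kdiag q l i)⁻¹) rfl (fun _ _ _ _ _ => rfl) (fun i => inv_ne_zero (kdiag_ne q l i))
      (by simpa using idemHalf_K' q l)]
    simp [coun]
  | E l =>
    rw [invariant_skew (c := .K l) (c' := .K' l) rfl (fun _ _ _ _ _ => rfl) rfl (fun _ _ _ _ _ => rfl) (kdiag_ne q l)
      (idemHalf_K q l) (idemHalf_K' q l) (idemHalf_E q l)]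
    · simp [coun]
    · intro i j
      fin_cases l <;> fin_cases i <;> fin_cases j <;> simp [kdiag, etaDiag, xE] <;> field_simp <;> simp
  | F l =>
    rw [invariant_skew (c := .K l) (c' := .K' l) rfl (fun _ _ _ _ _ => rfl) rfl (fun _ _ _ _ _ => rfl) (kdiag_ne q l)
      (idemHalf_K q l) (idemHalf_K' q l) (idemHalf_F q l)]
    · simp [coun]
    · intro i j
      fin_cases l <;> fin_cases i <;> fin_cases j <;> simp [kdiag, etaDiag, xF] <;> field_simp <;> simp

theorem omega_invariant (q : Param) (h : UqSo5 q) :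
    tensorAct q 5 h (omega₄ q) = Coalgebra.counit (R := ℂ) h • omega₄ q := by
  have hh : h ∈ Algebra.adjoin ℂ (Set.range (ugen q)) := by rw [UqSo5.adjoin]; trivial
  have hc : ∀ x, Coalgebra.counit (R := ℂ) x = Bialgebra.counitAlgHom ℂ (UqSo5 q) x := fun _ => rfl
  simp only [hc]
  induction hh using Algebra.adjoin_induction with
  | mem x hx =>
    obtain ⟨i, rfl⟩ := hx
    rw [omega_invariant_gen, ← counit_ugen q i]
    rfl
  | algebraMap r => rw [AlgHom.commutes, AlgHom.commutes, Module.algebraMap_end_apply, Algebra.algebraMap_self_apply]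
  | add x y _ _ hx hy => rw [map_add, LinearMap.add_apply, hx, hy, map_add, add_smul]
  | mul x y _ _ hx hy => rw [map_mul, Module.End.mul_apply, hy, map_smul, hx, map_mul, smul_smul, mul_comm]

/-! ### The element ω₄ is a twisted cycle. -/

/-- The weights of the matrix `e` under the modular automorphism. -/
noncomputable def kapDiag (q : Param) (i : Fin 4) : ℂ := kdiag q 0 i ^ 8 * kdiag q 1 i ^ 6

theorem kappa_apply (q : Param) (a : SphereAlg q) : kappa q a = ((opK q 0) ^ 8 * (opK q 1) ^ 6) a := by
  change act q (modularElt q) a = _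
  rw [act_modularElt]
  rfl

theorem kappa_gen (q : Param) (g : SGen) : kappa q (sgen q g) = (kw q 0 g ^ 8 * kw q 1 g ^ 6) • sgen q g := by
  have h : ∀ l n, (opK q l ^ n) (sgen q g) = kw q l g ^ n • sgen q g := by
    intro l n
    induction n with
    | zero => simp
    | succ n ih =>
      rw [pow_succ', AlgHom.mul_apply, ih, map_smul, opK, SphereAlg.lift_gen, smul_smul, pow_succ]
  rw [kappa_apply, AlgHom.mul_apply, h, map_smul, h, smul_smul, mul_comm]

theorem kappa_idemHalf (q : Param) (i j : Fin 4) :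
    kappa q (idemHalf q i j) = ((kapDiag q i)⁻¹ * kapDiag q j) • idemHalf q i j := by
  have h : ∀ l n, (opK q l ^ n) (idemHalf q i j) = ((kdiag q l i)⁻¹ * kdiag q l j) ^ n • idemHalf q i j := by
    intro l n
    induction n with
    | zero => simp
    | succ n ih =>
      have := idemHalf_K q l i j
      simp only [genAct, AlgHom.toLinearMap_apply] at this
      rw [pow_succ', AlgHom.mul_apply, ih, map_smul, this, smul_smul, pow_succ]
  rw [kappa_apply, AlgHom.mul_apply, h, map_smul, h, smul_smul, kapDiag, kapDiag]
  congr 1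
  rw [mul_pow, mul_pow, mul_inv, inv_pow, inv_pow]
  ring

theorem kapDiag_ne (q : Param) (i : Fin 4) : kapDiag q i ≠ 0 :=
  mul_ne_zero (pow_ne_zero _ (kdiag_ne q 0 i)) (pow_ne_zero _ (kdiag_ne q 1 i))

section
variable {q : Param}

theorem idemHalf_mul (q : Param) (i j : Fin 4) :
    ∑ k, idemHalf q i k * idemHalf q k j = if i = j then (1 / 4 : ℂ) • 1 else 0 := by
  have h : idemHalf q * idemHalf q = (1 / 4 : ℂ) • 1 := by
    rw [idemHalf_eq, smul_mul_assoc, mul_smul_comm, diracMat_sq q (sgen_rel q), smul_smul]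
    norm_num
  rw [← Matrix.mul_apply, h, Matrix.smul_apply, Matrix.one_apply, smul_ite, smul_zero]

theorem contract {M : Type*} [AddCommMonoid M] [Module ℂ M] (L : SphereAlg q → M) (hL : IsLinearMap ℂ L)
    (i j : Fin 4) : ∑ k, L (idemHalf q i k * idemHalf q k j) = if i = j then (1 / 4 : ℂ) • L 1 else 0 := by
  have := congrArg (hL.mk' L) (idemHalf_mul q i j)
  simpa [map_sum, apply_ite L, hL.map_smul, hL.map_zero] using this

/-- Expanding every entry of e - 1/2 in the five generators, the coefficient of L(x_g, x_h, x_i) is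
1/8 times Tr(η γ_g γ_h γ_i), which is zero. -/
theorem trilinear_eq_zero {M : Type*} [AddCommGroup M] [Module ℂ M] (L : SphereAlg q → SphereAlg q → SphereAlg q → M)
    (h₁ : ∀ v w, IsLinearMap ℂ fun u => L u v w) (h₂ : ∀ u w, IsLinearMap ℂ fun v => L u v w)
    (h₃ : ∀ u v, IsLinearMap ℂ fun w => L u v w) :
    ∑ a, etaDiag q a • ∑ b, ∑ c, L (idemHalf q a b) (idemHalf q b c) (idemHalf q c a) = 0 := by
  let G : Fin 5 → SGen := ![.x₀, .x₁, .x₂, .x₁s, .x₂s]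
  have hf : ∀ i j, idemHalf q i j = ∑ g, (1 / 2 * gammaMat q (G g) i j) • sgen q (G g) := by
    intro i j
    rw [idemHalf_eq, Fin.sum_univ_five]
    simp only [diracMat, Matrix.smul_apply, Matrix.of_apply, G, Matrix.cons_val]
    module
  have e₁ : ∀ (c : Fin 5 → ℂ) v w, L (∑ g, c g • sgen q (G g)) v w = ∑ g, c g • L (sgen q (G g)) v w := by
    intro c v w
    refine (map_sum ((h₁ v w).mk' _) (fun g => c g • sgen q (G g)) Finset.univ).trans (Finset.sum_congr rfl fun g _ => ?_)
    exact map_smul (IsLinearMap.mk' _ _) _ _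
  have e₂ : ∀ (c : Fin 5 → ℂ) v w, L v (∑ g, c g • sgen q (G g)) w = ∑ g, c g • L v (sgen q (G g)) w := by
    intro c v w
    refine (map_sum ((h₂ v w).mk' _) (fun g => c g • sgen q (G g)) Finset.univ).trans (Finset.sum_congr rfl fun g _ => ?_)
    exact map_smul (IsLinearMap.mk' _ _) _ _
  have e₃ : ∀ (c : Fin 5 → ℂ) v w, L v w (∑ g, c g • sgen q (G g)) = ∑ g, c g • L v w (sgen q (G g)) := by
    intro c v w
    refine (map_sum ((h₃ v w).mk' _) (fun g => c g • sgen q (G g)) Finset.univ).trans (Finset.sum_congr rfl fun g _ => ?_)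
    exact map_smul (IsLinearMap.mk' _ _) _ _
  have tr : ∀ g h i, ∑ a, etaDiag q a * ∑ b, ∑ c, gammaMat q g a b * gammaMat q h b c * gammaMat q i c a = 0 := by
    intro g h i
    rw [← gammaMat_trace q g h i, Matrix.mul_assoc, Matrix.mul_assoc, Matrix.trace]
    refine Finset.sum_congr rfl fun a _ => ?_
    rw [Matrix.diag_apply, eta, Matrix.diagonal_mul]
    simp only [Matrix.mul_apply, Finset.mul_sum, mul_assoc]
    rfl
  simp only [hf, e₁, e₂, e₃, Finset.smul_sum, smul_smul]
  have : ∀ F : Fin 4 → Fin 4 → Fin 4 → Fin 5 → Fin 5 → Fin 5 → M,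
      ∑ a, ∑ b, ∑ c, ∑ g, ∑ h, ∑ i, F a b c g h i = ∑ g, ∑ h, ∑ i, ∑ a, ∑ b, ∑ c, F a b c g h i := by
    intro F
    have := Finset.sum_comm (s := Finset.univ) (t := Finset.univ)
      (f := fun (x : Fin 4 × Fin 4 × Fin 4) (y : Fin 5 × Fin 5 × Fin 5) => F x.1 x.2.1 x.2.2 y.1 y.2.1 y.2.2)
    simpa only [Fintype.sum_prod_type] using this
  rw [this]
  refine Finset.sum_eq_zero fun g _ => Finset.sum_eq_zero fun h _ => Finset.sum_eq_zero fun i _ => ?_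
  simp only [← Finset.sum_smul]
  convert zero_smul ℂ _ using 2
  rw [← mul_zero (1 / 8 : ℂ), ← tr (G g) (G h) (G i)]
  simp only [Finset.mul_sum]
  refine Finset.sum_congr rfl fun a _ => Finset.sum_congr rfl fun b _ => Finset.sum_congr rfl fun c _ => ?_
  ring

theorem isLinear_tprod {A : Type*} [Ring A] [Algebra ℂ A] {n : ℕ} (v : Fin n → A) (s : Fin n) (f : A → Fin n → A)
    (hf : ∀ x, f x = Function.update v s x) : IsLinearMap ℂ fun x => PiTensorProduct.tprod ℂ (f x) := by
  rw [funext fun x => congrArg (PiTensorProduct.tprod ℂ) (hf x)]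
  exact ((PiTensorProduct.tprod ℂ).toLinearMap v s).isLinear

theorem twistedBoundary_tprod {A : Type*} [Ring A] [Algebra ℂ A] (σ : A ≃ₐ[ℂ] A) (a b c d e : A) :
    twistedBoundary σ 3 (PiTensorProduct.tprod ℂ ![a, b, c, d, e]) =
      PiTensorProduct.tprod ℂ ![a * b, c, d, e] - PiTensorProduct.tprod ℂ ![a, b * c, d, e] +
      PiTensorProduct.tprod ℂ ![a, b, c * d, e] - PiTensorProduct.tprod ℂ ![a, b, c, d * e] +
      PiTensorProduct.tprod ℂ ![σ e * a, b, c, d] := by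
  have h0 : innerTuple 3 0 ![a, b, c, d, e] = ![a * b, c, d, e] := by funext x; fin_cases x <;> rfl
  have h1 : innerTuple 3 1 ![a, b, c, d, e] = ![a, b * c, d, e] := by funext x; fin_cases x <;> rfl
  have h2 : innerTuple 3 2 ![a, b, c, d, e] = ![a, b, c * d, e] := by funext x; fin_cases x <;> rfl
  have h3 : innerTuple 3 3 ![a, b, c, d, e] = ![a, b, c, d * e] := by funext x; fin_cases x <;> rfl
  have h4 : lastTuple σ 3 ![a, b, c, d, e] = ![σ e * a, b, c, d] := by funext x; fin_cases x <;> rfl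
  have hs : ∀ f : Fin (3 + 1) → ((⨂[ℂ]^(3 + 2) A) →ₗ[ℂ] ⨂[ℂ]^(3 + 1) A), ∑ j, f j = f 0 + f 1 + f 2 + f 3 :=
    fun f => Fin.sum_univ_four f
  have e3 : ((3 : Fin (3 + 1)) : ℕ) = 3 := rfl
  have e2 : ((2 : Fin (3 + 1)) : ℕ) = 2 := rfl
  have e1 : ((1 : Fin (3 + 1)) : ℕ) = 1 := rfl
  have e0 : ((0 : Fin (3 + 1)) : ℕ) = 0 := rfl
  rw [twistedBoundary, hs]
  simp only [e0, e1, e2, e3, LinearMap.add_apply, LinearMap.smul_apply, tensorMap_tprod, h0, h1, h2, h3, h4]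
  norm_num
  module

/-- Up to a scalar, η is inverse to the diagonal matrix which implements κ on e. This is what makes
the η-trace compatible with the twisted boundary. -/
theorem etaDiag_kapDiag (q : Param) (i : Fin 4) : etaDiag q i * kapDiag q i = qc q ^ 4 := by
  have hq := qc_ne q
  fin_cases i <;> simp [etaDiag, kapDiag, kdiag] <;> field_simp

/-- Each of the five terms vanishes separately. The sum over the index between two multiplied
entries contracts them to 1/4 by `contract`, which leaves a trilinear η-trace with a unit in one
slot. -/
theorem twistedBoundary_omega (q : Param) : twistedBoundary (kappa q) 3 (omega₄ q) = 0 := by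
  have tup : ∀ (v : Fin 4 → SphereAlg q) (s : Fin 4) (f : SphereAlg q → Fin 4 → SphereAlg q),
      (∀ x y, f x y = Function.update v s x y) → IsLinearMap ℂ fun x => PiTensorProduct.tprod ℂ (f x) :=
    fun v s f h => isLinear_tprod v s f fun x => funext fun y => h x y
  have l0 : ∀ u v w : SphereAlg q, IsLinearMap ℂ fun x => PiTensorProduct.tprod ℂ ![x, u, v, w] := fun u v w =>
    tup ![0, u, v, w] 0 _ fun x y => by fin_cases y <;> rfl
  have l1 : ∀ u v w : SphereAlg q, IsLinearMap ℂ fun x => PiTensorProduct.tprod ℂ ![u, x, v, w] := fun u v w =>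
    tup ![u, 0, v, w] 1 _ fun x y => by fin_cases y <;> rfl
  have l2 : ∀ u v w : SphereAlg q, IsLinearMap ℂ fun x => PiTensorProduct.tprod ℂ ![u, v, x, w] := fun u v w =>
    tup ![u, v, 0, w] 2 _ fun x y => by fin_cases y <;> rfl
  have l3 : ∀ u v w : SphereAlg q, IsLinearMap ℂ fun x => PiTensorProduct.tprod ℂ ![u, v, w, x] := fun u v w =>
    tup ![u, v, w, 0] 3 _ fun x y => by fin_cases y <;> rfl
  have t0 := trilinear_eq_zero (fun u v w => PiTensorProduct.tprod ℂ ![(1 : SphereAlg q), u, v, w])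
    (fun v w => l1 1 v w) (fun u w => l2 1 u w) (fun u v => l3 1 u v)
  have t1 := trilinear_eq_zero (fun u v w => PiTensorProduct.tprod ℂ ![u, (1 : SphereAlg q), v, w])
    (fun v w => l0 1 v w) (fun u w => l2 u 1 w) (fun u v => l3 u 1 v)
  have t2 := trilinear_eq_zero (fun u v w => PiTensorProduct.tprod ℂ ![u, v, (1 : SphereAlg q), w])
    (fun v w => l0 v 1 w) (fun u w => l1 u 1 w) (fun u v => l3 u v 1)
  have t3 := trilinear_eq_zero (fun u v w => PiTensorProduct.tprod ℂ ![u, v, w, (1 : SphereAlg q)])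
    (fun v w => l0 v w 1) (fun u w => l1 u w 1) (fun u v => l2 u v 1)
  have kap : ∀ e a b, kappa q (idemHalf q e a) * idemHalf q a b =
      ((kapDiag q e)⁻¹ * kapDiag q a) • (idemHalf q e a * idemHalf q a b) := by
    intro e a b
    rw [kappa_idemHalf, smul_mul_assoc]
  simp only [omega_eq, map_sum, map_smul, twistedBoundary_tprod, kap, (l0 _ _ _).map_smul, Finset.sum_add_distrib, Finset.sum_sub_distrib,
    smul_add, smul_sub]
  have s0 : ∑ a, etaDiag q a • ∑ b, ∑ c, ∑ d, ∑ e, PiTensorProduct.tprod ℂ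
      ![idemHalf q a b * idemHalf q b c, idemHalf q c d, idemHalf q d e, idemHalf q e a] = 0 := by
    have : ∀ a, ∑ b, ∑ c, ∑ d, ∑ e, PiTensorProduct.tprod ℂ
        ![idemHalf q a b * idemHalf q b c, idemHalf q c d, idemHalf q d e, idemHalf q e a] =
        (1 / 4 : ℂ) • ∑ d, ∑ e, PiTensorProduct.tprod ℂ ![1, idemHalf q a d, idemHalf q d e, idemHalf q e a] := by
      intro a
      rw [Finset.sum_comm, Finset.sum_eq_single a]
      · rw [Finset.sum_comm, Finset.smul_sum]
        refine Finset.sum_congr rfl fun d _ => ?_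
        rw [Finset.sum_comm, Finset.smul_sum]
        refine Finset.sum_congr rfl fun e _ => ?_
        rw [contract _ (l0 _ _ _), if_pos rfl]
      · intro c _ hc
        rw [Finset.sum_comm]
        refine Finset.sum_eq_zero fun d _ => ?_
        rw [Finset.sum_comm]
        refine Finset.sum_eq_zero fun e _ => ?_
        rw [contract _ (l0 _ _ _), if_neg hc.symm]
      · simp
    simp only [this, smul_comm _ (1 / 4 : ℂ), ← Finset.smul_sum, t0, smul_zero]
  have s1 : ∑ a, etaDiag q a • ∑ b, ∑ c, ∑ d, ∑ e, PiTensorProduct.tprod ℂ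
      ![idemHalf q a b, idemHalf q b c * idemHalf q c d, idemHalf q d e, idemHalf q e a] = 0 := by
    have : ∀ a b, ∑ c, ∑ d, ∑ e, PiTensorProduct.tprod ℂ
        ![idemHalf q a b, idemHalf q b c * idemHalf q c d, idemHalf q d e, idemHalf q e a] =
        (1 / 4 : ℂ) • ∑ e, PiTensorProduct.tprod ℂ ![idemHalf q a b, 1, idemHalf q b e, idemHalf q e a] := by
      intro a b
      rw [Finset.sum_comm, Finset.sum_eq_single b]
      · rw [Finset.sum_comm, Finset.smul_sum]
        refine Finset.sum_congr rfl fun e _ => ?_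
        rw [contract _ (l1 _ _ _), if_pos rfl]
      · intro c _ hc
        rw [Finset.sum_comm]
        refine Finset.sum_eq_zero fun e _ => ?_
        rw [contract _ (l1 _ _ _), if_neg hc.symm]
      · simp
    simp only [this, smul_comm _ (1 / 4 : ℂ), ← Finset.smul_sum, t1, smul_zero]
  have s2 : ∑ a, etaDiag q a • ∑ b, ∑ c, ∑ d, ∑ e, PiTensorProduct.tprod ℂ
      ![idemHalf q a b, idemHalf q b c, idemHalf q c d * idemHalf q d e, idemHalf q e a] = 0 := by
    have : ∀ a b c, ∑ d, ∑ e, PiTensorProduct.tprod ℂ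
        ![idemHalf q a b, idemHalf q b c, idemHalf q c d * idemHalf q d e, idemHalf q e a] =
        (1 / 4 : ℂ) • PiTensorProduct.tprod ℂ ![idemHalf q a b, idemHalf q b c, 1, idemHalf q c a] := by
      intro a b c
      rw [Finset.sum_comm, Finset.sum_eq_single c]
      · rw [contract _ (l2 _ _ _), if_pos rfl]
      · intro d _ hd
        rw [contract _ (l2 _ _ _), if_neg hd.symm]
      · simp
    simp only [this, smul_comm _ (1 / 4 : ℂ), ← Finset.smul_sum, t2, smul_zero]
  have s3 : ∑ a, etaDiag q a • ∑ b, ∑ c, ∑ d, ∑ e, PiTensorProduct.tprod ℂ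
      ![idemHalf q a b, idemHalf q b c, idemHalf q c d, idemHalf q d e * idemHalf q e a] = 0 := by
    simp only [contract _ (l3 _ _ _), Finset.sum_ite_eq', Finset.mem_univ, if_true, smul_comm _ (1 / 4 : ℂ), ← Finset.smul_sum, t3, smul_zero]
  have s4 : ∑ a, etaDiag q a • ∑ b, ∑ c, ∑ d, ∑ e, ((kapDiag q e)⁻¹ * kapDiag q a) • PiTensorProduct.tprod ℂ
      ![idemHalf q e a * idemHalf q a b, idemHalf q b c, idemHalf q c d, idemHalf q d e] = 0 := by
    -- In the last term κ moves the weight η from the index a to the index e, so that a becomes a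
    -- free contraction index.
    have hw : ∀ a e, etaDiag q a * ((kapDiag q e)⁻¹ * kapDiag q a) = etaDiag q e := by
      intro a e
      have h1 := etaDiag_kapDiag q a
      have h2 := etaDiag_kapDiag q e
      have := kapDiag_ne q e
      field_simp
      rw [mul_comm, mul_comm] at h1
      linear_combination h1 - h2
    simp only [Finset.smul_sum, smul_smul, hw]
    rw [Finset.sum_comm]
    have : ∀ b, ∑ a, ∑ c, ∑ d, ∑ e, etaDiag q e • PiTensorProduct.tprod ℂ
        ![idemHalf q e a * idemHalf q a b, idemHalf q b c, idemHalf q c d, idemHalf q d e] =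
        (1 / 4 : ℂ) • etaDiag q b • ∑ c, ∑ d, PiTensorProduct.tprod ℂ ![1, idemHalf q b c, idemHalf q c d, idemHalf q d b] := by
      intro b
      rw [Finset.sum_comm, Finset.smul_sum, Finset.smul_sum]
      refine Finset.sum_congr rfl fun c _ => ?_
      rw [Finset.sum_comm, Finset.smul_sum, Finset.smul_sum]
      refine Finset.sum_congr rfl fun d _ => ?_
      rw [Finset.sum_comm]
      simp only [← Finset.smul_sum, contract _ (l0 _ _ _), smul_ite, smul_zero, Finset.sum_ite_eq', Finset.mem_univ, if_true]
      rw [smul_comm]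
    simp only [this, ← Finset.smul_sum, t0, smul_zero]
  rw [s0, s1, s2, s3, s4]
  simp

theorem twistMap_omega (q : Param) : twistMap (kappa q) 4 (omega₄ q) = omega₄ q := by
  have h : ∀ a b c d e, twistMap (kappa q) 4 (PiTensorProduct.tprod ℂ ![idemHalf q a b, idemHalf q b c, idemHalf q c d, idemHalf q d e, idemHalf q e a]) =
      PiTensorProduct.tprod ℂ ![idemHalf q a b, idemHalf q b c, idemHalf q c d, idemHalf q d e, idemHalf q e a] := by
    intro a b c d e
    rw [twistMap, PiTensorProduct.map_tprod]
    have : (fun i => (kappa q).toLinearMap (![idemHalf q a b, idemHalf q b c, idemHalf q c d, idemHalf q d e, idemHalf q e a] i)) =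
      fun i => (![(kapDiag q a)⁻¹ * kapDiag q b, (kapDiag q b)⁻¹ * kapDiag q c, (kapDiag q c)⁻¹ * kapDiag q d,
        (kapDiag q d)⁻¹ * kapDiag q e, (kapDiag q e)⁻¹ * kapDiag q a] : Fin 5 → ℂ) i •
        (![idemHalf q a b, idemHalf q b c, idemHalf q c d, idemHalf q d e, idemHalf q e a] : Fin 5 → SphereAlg q) i := by
      funext i
      fin_cases i <;> exact kappa_idemHalf q _ _
    rw [this, MultilinearMap.map_smul_univ, Fin.prod_univ_five]
    -- The weights of the five entries cancel around the cycle of indices.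
    convert one_smul ℂ _
    simp only [Matrix.cons_val]
    have := kapDiag_ne q
    field_simp [this a, this b, this c, this d, this e]
  rw [omega_eq]
  simp only [map_sum, map_smul, h]

theorem omega_mem_twistedCycles (q : Param) : omega₄ q ∈ twistedCycles (kappa q) 4 :=
  ⟨twistMap_omega q, twistedBoundary_omega q⟩

end

/-! ### Reduced operators with rational coefficients. -/

section Coefficients
variable {F : Type*} [Field F]

/-- `q^{-z} - q^z`, as a function of `x = q^z`. -/
def br (x : F) : F := x⁻¹ - x

/-- `{2l+2}` and `{2l+4}` for `l = n + 1/2`, `X = q^n`. -/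
def n3 (p X : F) : F := br (p ^ 6 * X ^ 2)
def n5 (p X : F) : F := br (p ^ 10 * X ^ 2)
/-- The factor `[2] / ([2l+2] [2l+4])`. -/
def nn (p X : F) : F := (p ^ 2 + (p ^ 2)⁻¹) * br (p ^ 2) / (n3 p X * n5 p X)

/-! The reduced coefficients: the letters `p`, `z`, `m` stand for the change of `j` by `1`, `0`,
`-1`, the letters `d`, `e` for the change of `m₂` by `1`, `-1`; the second letter `U`, `Z`, `D`
stands for the change of `l` by `1`, `0`, `-1`. The arguments are the parity of `l + 1/2 - j - m₂`
and `p = q^{1/2}`, `X = q^{l - 1/2}`, `K = q^{j - 1/2}`, `B = q^{m₂ - 1/2}`. -/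

def pU : Bool → F → F → F → F → F
  | true, p, X, _, B => -(B / p ^ 2) / n5 p X
  | false, p, X, _, B => -B / n5 p X
def pZ : Bool → F → F → F → F → F
  | true, p, X, K, B => -(p ^ 3 * X * B * br (X / (K * B)) * nn p X)
  | false, p, X, K, B => B / (p ^ 5 * X) * br (p ^ 2 * X * B / K) * nn p X
def pD : Bool → F → F → F → F → F
  | true, p, X, K, B => -(B * br (X * B / K) * br (X / (K * B))) / n3 p X
  | false, p, X, K, B => -(B / p ^ 2 * br (p ^ 2 * X * B / K) * br (X / (p ^ 2 * K * B))) / n3 p X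
def zU : Bool → F → F → F → F → F
  | true, p, X, K, B => p * B * K / n5 p X
  | false, p, X, K, B => B / (p ^ 3 * K) / n5 p X
def zZ : Bool → F → F → F → F → F
  | true, p, X, K, B => (br (X / (K * B)) * br (p ^ 4 * X * B / K) -
      br (p ^ 6 * X * K / B) * br (p ^ 6 * X * K * B) / p ^ 4) / (n3 p X * n5 p X)
  | false, p, X, K, B => (br (p ^ 4 * X * K / B) * br (p ^ 8 * X * K * B) -
      br (p ^ 2 * X / (K * B)) * br (p ^ 2 * X * B / K) / p ^ 4) / (n3 p X * n5 p X)
def zD : Bool → F → F → F → F → F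
  | true, p, X, K, B => B / (p ^ 3 * K) * br (X / (K * B)) * br (p ^ 6 * X * K * B) / n3 p X
  | false, p, X, K, B => p * B * K * br (p ^ 4 * X * K / B) * br (p ^ 2 * X * B / K) / n3 p X
def mU : Bool → F → F → F → F → F
  | true, p, X, _, B => -B / n5 p X
  | false, p, X, _, B => -(B / p ^ 2) / n5 p X
def mZ : Bool → F → F → F → F → F
  | true, p, X, K, B => B / (p ^ 5 * X) * br (p ^ 6 * X * K * B) * nn p X
  | false, p, X, K, B => -(p ^ 3 * X * B * br (p ^ 4 * X * K / B) * nn p X)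
def mD : Bool → F → F → F → F → F
  | true, p, X, K, B => -(B / p ^ 2 * br (p ^ 6 * X * K * B) * br (p ^ 2 * X * K / B)) / n3 p X
  | false, p, X, K, B => -(B * br (p ^ 4 * X * K * B) * br (p ^ 4 * X * K / B)) / n3 p X
def dU : Bool → F → F → F → F → F
  | _, p, X, _, B => B / (p ^ 3 * X) / n5 p X
def dZ : Bool → F → F → F → F → F
  | true, p, X, K, B => p ^ 2 * B * br (X / (K * B)) * nn p X
  | false, p, X, K, B => p ^ 2 * B * br (p ^ 4 * X * K / B) * nn p X
def dD : Bool → F → F → F → F → F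
  | true, p, X, K, B => -(p ^ 5 * X * B * br (X / (K * B)) * br (p ^ 2 * X * K / B)) / n3 p X
  | false, p, X, K, B => -(p ^ 5 * X * B * br (X / (p ^ 2 * K * B)) * br (p ^ 4 * X * K / B)) / n3 p X
def eU : Bool → F → F → F → F → F
  | _, p, X, _, B => -(p ^ 5 * X * B) / n5 p X
def eZ : Bool → F → F → F → F → F
  | true, p, X, K, B => B * br (p ^ 6 * X * K * B) * nn p X
  | false, p, X, K, B => B * br (p ^ 2 * X * B / K) * nn p X
def eD : Bool → F → F → F → F → F
  | true, p, X, K, B => B / (p ^ 3 * X) * br (p ^ 6 * X * K * B) * br (X * B / K) / n3 p X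
  | false, p, X, K, B => B / (p ^ 3 * X) * br (p ^ 4 * X * K * B) * br (p ^ 2 * X * B / K) / n3 p X

/-- The reduced operators. -/
inductive Dir
  | p | z | m | d | e

/-- The coefficients of the reduced operators which raise `l`. -/
def cU : Dir → Bool → F → F → F → F → F
  | .p => pU | .z => zU | .m => mU | .d => dU | .e => eU
/-- The coefficients of the reduced operators which preserve `l`. -/
def cZ : Dir → Bool → F → F → F → F → F
  | .p => pZ | .z => zZ | .m => mZ | .d => dZ | .e => eZ
/-- The coefficients of the reduced operators which lower `l`. -/
def cD : Dir → Bool → F → F → F → F → F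
  | .p => pD | .z => zD | .m => mD | .d => dD | .e => eD

/-- The shift of the argument `K`. -/
def kS : Dir → F → F → F
  | .p, p, K => p ^ 2 * K
  | .m, p, K => K / p ^ 2
  | _, _, K => K
/-- The shift of the argument `B`. -/
def bS : Dir → F → F → F
  | .d, p, B => p ^ 2 * B
  | .e, p, B => B / p ^ 2
  | _, _, B => B
/-- Whether the part of the operator which preserves `l` changes the parity. -/
def fl : Dir → Bool
  | .z => false
  | _ => true

/-- The coefficients of the product of two reduced operators. -/
def comp (f g : Dir) : Fin 5 → Bool → F → F → F → F → F
  | 0, e, p, X, K, B => cU f e p X K B * cU g (e ^^ !fl f) p (p ^ 2 * X) (kS f p K) (bS f p B)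
  | 1, e, p, X, K, B => cU f e p X K B * cZ g (e ^^ !fl f) p (p ^ 2 * X) (kS f p K) (bS f p B) +
      cZ f e p X K B * cU g (e ^^ fl f) p X (kS f p K) (bS f p B)
  | 2, e, p, X, K, B => cU f e p X K B * cD g (e ^^ !fl f) p (p ^ 2 * X) (kS f p K) (bS f p B) +
      cZ f e p X K B * cZ g (e ^^ fl f) p X (kS f p K) (bS f p B) +
      cD f e p X K B * cU g (e ^^ !fl f) p (X / p ^ 2) (kS f p K) (bS f p B)
  | 3, e, p, X, K, B => cZ f e p X K B * cD g (e ^^ fl f) p X (kS f p K) (bS f p B) +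
      cD f e p X K B * cZ g (e ^^ !fl f) p (X / p ^ 2) (kS f p K) (bS f p B)
  | 4, e, p, X, K, B => cD f e p X K B * cD g (e ^^ !fl f) p (X / p ^ 2) (kS f p K) (bS f p B)

/-- The coefficients of the identity. -/
def compOne : Fin 5 → F
  | 2 => 1
  | _ => 0

/-- The parameters for which the denominators do not vanish. -/
structure Generic (p X K B : F) : Prop where
  hp : p ≠ 0
  hX : X ≠ 0
  hK : K ≠ 0
  hB : B ≠ 0
  h1 : 1 - p ^ 4 * X ^ 4 ≠ 0
  h3 : 1 - p ^ 12 * X ^ 4 ≠ 0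
  h5 : 1 - p ^ 20 * X ^ 4 ≠ 0
  h7 : 1 - p ^ 28 * X ^ 4 ≠ 0
  h9 : 1 - p ^ 36 * X ^ 4 ≠ 0

variable {p X K B : F}

-- In this and the next identities the index i is the component which changes l by 2 - i. For each
-- component and parity the claim is a polynomial identity once the denominators allowed by
-- `Generic` are cleared. The factor p⁴ is q².
set_option maxHeartbeats 1000000 in
theorem comp_dp (h : Generic p X K B) (i : Fin 5) (e : Bool) :
    comp .d .p i e p X K B = p ^ 4 * comp .p .d i e p X K B := by
  obtain ⟨hp, hX, hK, hB, h1, h3, h5, h7, h9⟩ := h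
  fin_cases i <;> cases e <;> simp only [Fin.zero_eta, Fin.mk_one, Fin.reduceFinMk, comp, compOne, cU, cZ, cD, kS, bS, fl, Bool.xor_true, Bool.xor_false, Bool.false_xor, Bool.true_xor, Bool.not_true, Bool.not_false,
    pU, pZ, pD, zU, zZ, zD, mU, mZ, mD, dU, dZ, dD, eU, eZ, eD, nn, n3, n5, br]
  all_goals field_simp
  all_goals ring

set_option maxHeartbeats 1000000 in
theorem comp_dz (h : Generic p X K B) (i : Fin 5) (e : Bool) :
    comp .d .z i e p X K B = p ^ 4 * comp .z .d i e p X K B := by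
  obtain ⟨hp, hX, hK, hB, h1, h3, h5, h7, h9⟩ := h
  fin_cases i <;> cases e <;> simp only [Fin.zero_eta, Fin.mk_one, Fin.reduceFinMk, comp, compOne, cU, cZ, cD, kS, bS, fl, Bool.xor_true, Bool.xor_false, Bool.false_xor, Bool.true_xor, Bool.not_true, Bool.not_false,
    pU, pZ, pD, zU, zZ, zD, mU, mZ, mD, dU, dZ, dD, eU, eZ, eD, nn, n3, n5, br]
  all_goals field_simp
  all_goals ring

set_option maxHeartbeats 1000000 in
theorem comp_dm (h : Generic p X K B) (i : Fin 5) (e : Bool) :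
    comp .d .m i e p X K B = p ^ 4 * comp .m .d i e p X K B := by
  obtain ⟨hp, hX, hK, hB, h1, h3, h5, h7, h9⟩ := h
  fin_cases i <;> cases e <;> simp only [Fin.zero_eta, Fin.mk_one, Fin.reduceFinMk, comp, compOne, cU, cZ, cD, kS, bS, fl, Bool.xor_true, Bool.xor_false, Bool.false_xor, Bool.true_xor, Bool.not_true, Bool.not_false,
    pU, pZ, pD, zU, zZ, zD, mU, mZ, mD, dU, dZ, dD, eU, eZ, eD, nn, n3, n5, br]
  all_goals field_simp
  all_goals ring

set_option maxHeartbeats 1000000 in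
theorem comp_pz (h : Generic p X K B) (i : Fin 5) (e : Bool) :
    comp .p .z i e p X K B = comp .z .p i e p X K B := by
  obtain ⟨hp, hX, hK, hB, h1, h3, h5, h7, h9⟩ := h
  fin_cases i <;> cases e <;> simp only [Fin.zero_eta, Fin.mk_one, Fin.reduceFinMk, comp, compOne, cU, cZ, cD, kS, bS, fl, Bool.xor_true, Bool.xor_false, Bool.false_xor, Bool.true_xor, Bool.not_true, Bool.not_false,
    pU, pZ, pD, zU, zZ, zD, mU, mZ, mD, dU, dZ, dD, eU, eZ, eD, nn, n3, n5, br]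
  all_goals field_simp
  all_goals ring

set_option maxHeartbeats 1000000 in
theorem comp_mz (h : Generic p X K B) (i : Fin 5) (e : Bool) :
    comp .m .z i e p X K B = comp .z .m i e p X K B := by
  obtain ⟨hp, hX, hK, hB, h1, h3, h5, h7, h9⟩ := h
  fin_cases i <;> cases e <;> simp only [Fin.zero_eta, Fin.mk_one, Fin.reduceFinMk, comp, compOne, cU, cZ, cD, kS, bS, fl, Bool.xor_true, Bool.xor_false, Bool.false_xor, Bool.true_xor, Bool.not_true, Bool.not_false,
    pU, pZ, pD, zU, zZ, zD, mU, mZ, mD, dU, dZ, dD, eU, eZ, eD, nn, n3, n5, br]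
  all_goals field_simp
  all_goals ring

-- With `comp_mp` this expresses 1 - x₂x₂* in two ways through products of the operators which
-- change j. All relations in x₀, x₁, x₁* are obtained as combinations of the two, with coefficients
-- depending on j and m₁.
set_option maxHeartbeats 1000000 in
theorem comp_pm (h : Generic p X K B) (i : Fin 5) (e : Bool) :
    br (p ^ 2) ^ 2 * comp .z .z i e p X K B + br (p ^ 4 * K ^ 2) * br (p ^ 8 * K ^ 2) * comp .p .m i e p X K B =
      br (p ^ 6 * K ^ 2) ^ 2 * (compOne i - comp .e .d i e p X K B) := by
  obtain ⟨hp, hX, hK, hB, h1, h3, h5, h7, h9⟩ := h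
  fin_cases i <;> cases e <;> simp only [Fin.zero_eta, Fin.mk_one, Fin.reduceFinMk, comp, compOne, cU, cZ, cD, kS, bS, fl, Bool.xor_true, Bool.xor_false, Bool.false_xor, Bool.true_xor, Bool.not_true, Bool.not_false,
    pU, pZ, pD, zU, zZ, zD, mU, mZ, mD, dU, dZ, dD, eU, eZ, eD, nn, n3, n5, br]
  all_goals field_simp
  all_goals ring

set_option maxHeartbeats 1000000 in
theorem comp_mp (h : Generic p X K B) (i : Fin 5) (e : Bool) :
    br (p ^ 2) ^ 2 * comp .z .z i e p X K B + br (p ^ 4 * K ^ 2) * br (K ^ 2) * comp .m .p i e p X K B =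
      br (p ^ 2 * K ^ 2) ^ 2 * (compOne i - comp .e .d i e p X K B) := by
  obtain ⟨hp, hX, hK, hB, h1, h3, h5, h7, h9⟩ := h
  fin_cases i <;> cases e <;> simp only [Fin.zero_eta, Fin.mk_one, Fin.reduceFinMk, comp, compOne, cU, cZ, cD, kS, bS, fl, Bool.xor_true, Bool.xor_false, Bool.false_xor, Bool.true_xor, Bool.not_true, Bool.not_false,
    pU, pZ, pD, zU, zZ, zD, mU, mZ, mD, dU, dZ, dD, eU, eZ, eD, nn, n3, n5, br]
  all_goals field_simp
  all_goals ring

-- The counterpart of 1 - x₂*x₂ = q⁴ (1 - x₂x₂*), a consequence of the sphere relations in which x₀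
-- and x₁ do not occur.
set_option maxHeartbeats 1000000 in
theorem comp_de (h : Generic p X K B) (i : Fin 5) (e : Bool) :
    compOne i - comp .d .e i e p X K B = p ^ 8 * (compOne i - comp .e .d i e p X K B) := by
  obtain ⟨hp, hX, hK, hB, h1, h3, h5, h7, h9⟩ := h
  fin_cases i <;> cases e <;> simp only [Fin.zero_eta, Fin.mk_one, Fin.reduceFinMk, comp, compOne, cU, cZ, cD, kS, bS, fl, Bool.xor_true, Bool.xor_false, Bool.false_xor, Bool.true_xor, Bool.not_true, Bool.not_false,
    pU, pZ, pD, zU, zZ, zD, mU, mZ, mD, dU, dZ, dD, eU, eZ, eD, nn, n3, n5, br]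
  all_goals field_simp
  all_goals ring

end Coefficients

/-! ### The coefficients which depend on j and m₁. -/

section SpinCoefficients
variable {F : Type*} [Field F]

/-- The reduced coefficients `A` of `x₀`, with `K = q^{j - 1/2}` and `A = q^{m₁ - 1/2}`. -/
def kA : Dir → F → F → F → F
  | .p, p, K, A => A / p / br (p ^ 6 * K ^ 2)
  | .z, p, K, A => (p ^ 4)⁻¹ * (p ^ 4 * K * A * (p ^ 2 + (p ^ 2)⁻¹) * br (K / A) - br (p ^ 2 * K ^ 2)) * br (p ^ 2) /
      (br (p ^ 2 * K ^ 2) * br (p ^ 6 * K ^ 2))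
  | .m, p, K, A => A / p * (br (p ^ 2 * K * A) * br (K / A)) / br (p ^ 2 * K ^ 2)
  | _, _, _, _ => 0
/-- The reduced coefficients of `x₁*`. -/
def kB : Dir → F → F → F → F
  | .p, p, K, A => A / (p * K) / br (p ^ 6 * K ^ 2)
  | .z, p, K, A => (1 + p ^ 4) * A * br (p ^ 2) * br (K / A) / (br (p ^ 2 * K ^ 2) * br (p ^ 6 * K ^ 2))
  | .m, p, K, A => -(p ^ 3 * K * A) * (br (K / A) * br (K / (p ^ 2 * A))) / br (p ^ 2 * K ^ 2)
  | _, _, _, _ => 0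
/-- The reduced coefficients of `x₁`. -/
def kC : Dir → F → F → F → F
  | .p, p, K, A => -(p ^ 3 * K * A) / br (p ^ 6 * K ^ 2)
  | .z, p, K, A => (1 + p ^ 4) * (A / p ^ 2) * br (p ^ 2) * br (p ^ 2 * K * A) / (br (p ^ 2 * K ^ 2) * br (p ^ 6 * K ^ 2))
  | .m, p, K, A => A / (p * K) * (br (K * A) * br (p ^ 2 * K * A)) / br (p ^ 2 * K ^ 2)
  | _, _, _, _ => 0

/-- The quadratic scalars `Z` are such that `∑ Z_{στ} C_σ C_τ = c (1 - E D)`. -/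
structure Quadratic (p K : F) (Z : Dir → Dir → F) (c : F) : Prop where
  pp : Z .p .p = 0
  mm : Z .m .m = 0
  pz : Z .p .z + Z .z .p = 0
  mz : Z .m .z + Z .z .m = 0
  mix : ∃ α β : F, Z .p .m = α * (br (p ^ 4 * K ^ 2) * br (p ^ 8 * K ^ 2)) ∧
    Z .m .p = β * (br (p ^ 4 * K ^ 2) * br (K ^ 2)) ∧ Z .z .z = (α + β) * br (p ^ 2) ^ 2 ∧
    α * br (p ^ 6 * K ^ 2) ^ 2 + β * br (p ^ 2 * K ^ 2) ^ 2 = c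

variable {p K A : F}

/-- The zz-coefficient and c form a linear system for α and β, whose determinant factors into two
brackets by `key`. The hypotheses `hpm` and `hmp` are the remaining two conditions, cleared of this
determinant. -/
theorem quadratic_of (hp : p ≠ 0) (hK : K ≠ 0) (h1 : 1 - p ^ 4 ≠ 0) (h2 : 1 - p ^ 8 ≠ 0) (h3 : 1 - p ^ 16 * K ^ 8 ≠ 0)
    (Z : Dir → Dir → F) (c : F) (pp : Z .p .p = 0) (mm : Z .m .m = 0)
    (pz : Z .p .z + Z .z .p = 0) (mz : Z .m .z + Z .z .m = 0)
    (hpm : Z .p .m * br (p ^ 8 * K ^ 4) * br (p ^ 4) * br (p ^ 2) ^ 2 =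
      (c * br (p ^ 2) ^ 2 - br (p ^ 2 * K ^ 2) ^ 2 * Z .z .z) * (br (p ^ 4 * K ^ 2) * br (p ^ 8 * K ^ 2)))
    (hmp : Z .m .p * br (p ^ 8 * K ^ 4) * br (p ^ 4) * br (p ^ 2) ^ 2 =
      (br (p ^ 6 * K ^ 2) ^ 2 * Z .z .z - c * br (p ^ 2) ^ 2) * (br (p ^ 4 * K ^ 2) * br (K ^ 2))) :
    Quadratic p K Z c := by
  have n1 : br (p ^ 2) ≠ 0 := by
    simp only [br]; field_simp; simpa [hp] using h1
  have n2 : br (p ^ 4) ≠ 0 := by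
    simp only [br]; field_simp; simpa [hp] using h2
  have n3 : br (p ^ 8 * K ^ 4) ≠ 0 := by
    simp only [br]; field_simp; simpa [hp, hK] using h3
  refine ⟨pp, mm, pz, mz, (c * br (p ^ 2) ^ 2 - br (p ^ 2 * K ^ 2) ^ 2 * Z .z .z) / (br (p ^ 8 * K ^ 4) * br (p ^ 4) * br (p ^ 2) ^ 2),
    (br (p ^ 6 * K ^ 2) ^ 2 * Z .z .z - c * br (p ^ 2) ^ 2) / (br (p ^ 8 * K ^ 4) * br (p ^ 4) * br (p ^ 2) ^ 2), ?_, ?_, ?_, ?_⟩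
  · field_simp; linear_combination hpm
  · field_simp; linear_combination hmp
  all_goals
    have key : br (p ^ 6 * K ^ 2) ^ 2 - br (p ^ 2 * K ^ 2) ^ 2 = br (p ^ 8 * K ^ 4) * br (p ^ 4) := by
      simp only [br]; field_simp; ring
    field_simp
  · linear_combination (-(Z .z .z)) * key
  · linear_combination (c * br (p ^ 2) ^ 2) * key

/-- The parameters for which the denominators do not vanish. -/
structure SpinGeneric (p K A : F) : Prop where
  hp : p ≠ 0
  hK : K ≠ 0
  hA : A ≠ 0
  h4 : 1 - p ^ 4 ≠ 0
  h8 : 1 - p ^ 8 ≠ 0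
  k1 : 1 - p ^ 4 * K ^ 4 ≠ 0
  k2 : 1 - p ^ 16 * K ^ 8 ≠ 0
  k3 : 1 - p ^ 12 * K ^ 4 ≠ 0
  km : p ^ 4 - K ^ 4 ≠ 0
  k5 : 1 - p ^ 20 * K ^ 4 ≠ 0

-- Here and in the next three lemmas Z is the coefficient of the product of the σ- and τ-parts in
-- one of the relations. The second factor is evaluated after the shift by the first: K by `kS`, and
-- A by a factor q or q⁻¹ when the first factor is x₁* or x₁. The scalar c counts the multiples of 1
-- - x₂x₂*.
set_option maxHeartbeats 1000000 in
theorem quadratic_r1s0 (h : SpinGeneric p K A) : Quadratic p K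
    (fun σ τ => kB σ p K A * kA τ p (kS σ p K) (p ^ 2 * A) - p ^ 4 * (kA σ p K A * kB τ p (kS σ p K) A)) (0) := by
  obtain ⟨hp, hK, hA, h4, h8, k1, k2, k3, km, k5⟩ := h
  apply quadratic_of hp hK h4 h8 k2 <;> simp only [kA, kB, kC, kS, br] <;> field_simp <;> ring


set_option maxHeartbeats 1000000 in
theorem quadratic_r11 (h : SpinGeneric p K A) : Quadratic p K
    (fun σ τ => kB σ p K A * kC τ p (kS σ p K) (p ^ 2 * A) - kC σ p K A * kB τ p (kS σ p K) (A / p ^ 2) -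
      (1 - p ^ 8) * (kA σ p K A * kA τ p (kS σ p K) A)) (0) := by
  obtain ⟨hp, hK, hA, h4, h8, k1, k2, k3, km, k5⟩ := h
  apply quadratic_of hp hK h4 h8 k2 <;> simp only [kA, kB, kC, kS, br] <;> field_simp <;> ring


set_option maxHeartbeats 1000000 in
theorem quadratic_rad (h : SpinGeneric p K A) : Quadratic p K
    (fun σ τ => kA σ p K A * kA τ p (kS σ p K) A + kC σ p K A * kB τ p (kS σ p K) (A / p ^ 2)) (1) := by
  obtain ⟨hp, hK, hA, h4, h8, k1, k2, k3, km, k5⟩ := h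
  apply quadratic_of hp hK h4 h8 k2 <;> simp only [kA, kB, kC, kS, br] <;> field_simp <;> ring


-- Here c = 1 - q⁴, because `rop_de` turns x₂*x₂ - x₂x₂* into (1 - q⁴)(1 - x₂x₂*).
set_option maxHeartbeats 1000000 in
theorem quadratic_r22 (h : SpinGeneric p K A) : Quadratic p K
    (fun σ τ => kB σ p K A * kC τ p (kS σ p K) (p ^ 2 * A) - p ^ 8 * (kC σ p K A * kB τ p (kS σ p K) (A / p ^ 2))) (1 - p ^ 8) := by
  obtain ⟨hp, hK, hA, h4, h8, k1, k2, k3, km, k5⟩ := h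
  apply quadratic_of hp hK h4 h8 k2 <;> simp only [kA, kB, kC, kS, br] <;> field_simp <;> ring


end SpinCoefficients

/-! ### The lattice of labels and the relations on lattice functions. -/

/-- The real number `q^{1/2}`. -/
noncomputable def rp (q : Param) : ℝ := Real.sqrt (q : ℝ)
/-- The real number `q^n`. -/
noncomputable def qz (q : Param) (n : ℤ) : ℝ := (q : ℝ) ^ n

section
variable (q : Param)

theorem rp_sq : rp q ^ 2 = (q : ℝ) := Real.sq_sqrt q.2.1.le
theorem rp_pos : 0 < rp q := Real.sqrt_pos.2 q.2.1
theorem rp_lt_one : rp q < 1 := by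
  rw [rp, Real.sqrt_lt' one_pos]; simpa using q.2.2
theorem qz_pos (n : ℤ) : 0 < qz q n := zpow_pos q.2.1 n
theorem qz_eq (n : ℤ) : qz q n = rp q ^ (2 * n) := by
  rw [qz, ← rp_sq, zpow_mul, zpow_ofNat]
theorem qz_add (m n : ℤ) : qz q (m + n) = qz q m * qz q n := zpow_add₀ q.2.1.ne' m n
theorem qz_succ (n : ℤ) : qz q (n + 1) = rp q ^ 2 * qz q n := by
  rw [qz_add, mul_comm, rp_sq]; simp [qz]
theorem qz_pred (n : ℤ) : qz q (n - 1) = qz q n / rp q ^ 2 := by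
  rw [eq_div_iff (pow_ne_zero _ (rp_pos q).ne'), mul_comm, ← qz_succ, sub_add_cancel]
theorem qz_zero : qz q 0 = 1 := by simp [qz]

theorem rp_zpow_ne {m : ℤ} (hm : m ≠ 0) : rp q ^ m ≠ 1 := by
  intro h
  rcases lt_or_gt_of_ne hm with h' | h'
  · exact absurd h (one_lt_zpow_of_neg₀ (rp_pos q) (rp_lt_one q) h').ne'
  · exact absurd h (zpow_lt_one₀ (rp_pos q) (rp_lt_one q) h').ne

/-- The product is the power of p with exponent i + 2jn, and 0 < p < 1. Every non-degeneracy
condition becomes a statement on integers. -/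
theorem one_sub_ne {i j : ℕ} {n : ℤ} (h : (i : ℤ) + 2 * j * n ≠ 0) : 1 - rp q ^ i * qz q n ^ j ≠ 0 := by
  have e : rp q ^ i * qz q n ^ j = rp q ^ ((i : ℤ) + 2 * j * n) := by
    rw [zpow_add₀ (rp_pos q).ne', zpow_natCast, qz_eq, ← zpow_natCast (rp q ^ (2 * n)), ← zpow_mul]
    ring_nf
  rw [e]
  exact sub_ne_zero.2 (rp_zpow_ne q h).symm

theorem generic (n b k : ℤ) : Generic (rp q) (qz q n) (qz q k) (qz q b) where
  hp := (rp_pos q).ne'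
  hX := (qz_pos q n).ne'
  hK := (qz_pos q k).ne'
  hB := (qz_pos q b).ne'
  h1 := one_sub_ne q (by norm_num; omega)
  h3 := one_sub_ne q (by norm_num; omega)
  h5 := one_sub_ne q (by norm_num; omega)
  h7 := one_sub_ne q (by norm_num; omega)
  h9 := one_sub_ne q (by norm_num; omega)

theorem spinGeneric {k : ℤ} (hk : 0 ≤ k) (a : ℤ) : SpinGeneric (rp q) (qz q k) (qz q a) where
  hp := (rp_pos q).ne'
  hK := (qz_pos q k).ne'
  hA := (qz_pos q a).ne'
  h4 := by simpa using one_sub_ne q (i := 4) (j := 0) (n := 0) (by norm_num)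
  h8 := by simpa using one_sub_ne q (i := 8) (j := 0) (n := 0) (by norm_num)
  k1 := one_sub_ne q (by norm_num; omega)
  k2 := one_sub_ne q (by norm_num; omega)
  k3 := one_sub_ne q (by norm_num; omega)
  km := by
    -- The shift from k to k - 1 brings the difference into the form of `one_sub_ne`.
    have e : rp q ^ 4 - qz q k ^ 4 = rp q ^ 4 * (1 - rp q ^ 4 * qz q (k - 1) ^ 4) := by
      rw [qz_pred]
      have := (rp_pos q).ne'
      field_simp
    rw [e]
    exact mul_ne_zero (pow_ne_zero _ (rp_pos q).ne') (one_sub_ne q (by norm_num; omega))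
  k5 := one_sub_ne q (by norm_num; omega)

end

/-- The parity of `l + 1/2 - j - m₂`. -/
def par (n b k : ℤ) : Bool := decide (Even (n - k - b))

/-- The change of `m₂`. -/
def db : Dir → ℤ
  | .d => 1 | .e => -1 | _ => 0
/-- The change of `j`. -/
def dk : Dir → ℤ
  | .p => 1 | .m => -1 | _ => 0

theorem par_flip {n b k n' b' k' : ℤ} (h : (n' - k' - b' - (n - k - b)) % 2 = 1) : par n' b' k' = !par n b k := by
  simp only [par, ← decide_not, Int.even_iff, decide_eq_decide]
  omega
theorem par_same {n b k n' b' k' : ℤ} (h : (n' - k' - b' - (n - k - b)) % 2 = 0) : par n' b' k' = par n b k := by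
  simp only [par, ← decide_not, Int.even_iff, decide_eq_decide]
  omega

theorem par_succ (f : Dir) (n b k : ℤ) : par (n + 1) (b + db f) (k + dk f) = (par n b k ^^ !fl f) := by
  cases f <;> simp only [db, dk, fl, Bool.not_true, Bool.not_false, Bool.xor_true, Bool.xor_false] <;>
    first | (apply par_flip; omega) | (apply par_same; omega)
theorem par_pred (f : Dir) (n b k : ℤ) : par (n - 1) (b + db f) (k + dk f) = (par n b k ^^ !fl f) := by
  cases f <;> simp only [db, dk, fl, Bool.not_true, Bool.not_false, Bool.xor_true, Bool.xor_false] <;>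
    first | (apply par_flip; omega) | (apply par_same; omega)
theorem par_stay (f : Dir) (n b k : ℤ) : par n (b + db f) (k + dk f) = (par n b k ^^ fl f) := by
  cases f <;> simp only [db, dk, fl, Bool.not_true, Bool.not_false, Bool.xor_true, Bool.xor_false] <;>
    first | (apply par_flip; omega) | (apply par_same; omega)

section
variable (q : Param)

theorem kS_qz (f : Dir) (k : ℤ) : kS f (rp q) (qz q k) = qz q (k + dk f) := by
  cases f <;> simp [kS, dk, qz_succ, ← sub_eq_add_neg, qz_pred]
theorem bS_qz (f : Dir) (b : ℤ) : bS f (rp q) (qz q b) = qz q (b + db f) := by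
  cases f <;> simp [bS, db, qz_succ, ← sub_eq_add_neg, qz_pred]

/-- The coefficients `cU` at a point of the lattice. -/
noncomputable def lU (f : Dir) (n b k : ℤ) : ℝ := cU f (par n b k) (rp q) (qz q n) (qz q k) (qz q b)
/-- The coefficients `cZ` at a point of the lattice. -/
noncomputable def lZ (f : Dir) (n b k : ℤ) : ℝ := cZ f (par n b k) (rp q) (qz q n) (qz q k) (qz q b)
/-- The coefficients `cD` at a point of the lattice. -/
noncomputable def lD (f : Dir) (n b k : ℤ) : ℝ := cD f (par n b k) (rp q) (qz q n) (qz q k) (qz q b)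
/-- The coefficients `comp` at a point of the lattice. -/
noncomputable def lcomp (f g : Dir) (i : Fin 5) (n b k : ℤ) : ℝ :=
  comp f g i (par n b k) (rp q) (qz q n) (qz q k) (qz q b)

/-- The reduced operators on functions on the lattice, with the sign `s`. -/
noncomputable def rop (f : Dir) (s : ℂ) (w : ℤ → ℤ → ℤ → ℂ) (n b k : ℤ) : ℂ :=
  (lU q f n b k : ℂ) * w (n + 1) (b + db f) (k + dk f) + s * (lZ q f n b k : ℂ) * w n (b + db f) (k + dk f) +
    (lD q f n b k : ℂ) * w (n - 1) (b + db f) (k + dk f)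

/-- The sign s multiplies the parts which preserve l. As s² = 1, it survives only in the components
which change l by ±1, so the identities for `comp` serve both chiralities. -/
theorem rop_rop (f g : Dir) {s : ℂ} (hs : s ^ 2 = 1) (w : ℤ → ℤ → ℤ → ℂ) (n b k : ℤ) :
    rop q f s (rop q g s w) n b k =
      (lcomp q f g 0 n b k : ℂ) * w (n + 1 + 1) (b + db f + db g) (k + dk f + dk g) +
      s * (lcomp q f g 1 n b k : ℂ) * w (n + 1) (b + db f + db g) (k + dk f + dk g) +
      (lcomp q f g 2 n b k : ℂ) * w n (b + db f + db g) (k + dk f + dk g) +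
      s * (lcomp q f g 3 n b k : ℂ) * w (n - 1) (b + db f + db g) (k + dk f + dk g) +
      (lcomp q f g 4 n b k : ℂ) * w (n - 1 - 1) (b + db f + db g) (k + dk f + dk g) := by
  have e1 : n + 1 - 1 = n := by ring
  have e2 : n - 1 + 1 = n := by ring
  simp only [rop, lU, lZ, lD, lcomp, comp, par_succ, par_pred, ← kS_qz, ← bS_qz, qz_succ, qz_pred, e1, e2]
  simp only [kS_qz, bS_qz, par_stay]
  push_cast
  linear_combination (((cZ f (par n b k) (rp q) (qz q n) (qz q k) (qz q b) : ℝ) : ℂ) *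
    ((cZ g (par n b k ^^ fl f) (rp q) (qz q n) (qz q (k + dk f)) (qz q (b + db f)) : ℝ) : ℂ) * 
      w n (b + db f + db g) (k + dk f + dk g)) * hs

variable {s : ℂ} (hs : s ^ 2 = 1) (w : ℤ → ℤ → ℤ → ℂ) (n b k : ℤ)
include hs

theorem rop_d {f : Dir} (hf : f = .p ∨ f = .z ∨ f = .m) :
    rop q .d s (rop q f s w) n b k = (rp q : ℂ) ^ 4 * rop q f s (rop q .d s w) n b k := by
  have key : ∀ i, (lcomp q .d f i n b k : ℂ) = (rp q : ℂ) ^ 4 * (lcomp q f .d i n b k : ℂ) := by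
    intro i
    rcases hf with rfl | rfl | rfl
    · exact_mod_cast comp_dp (generic q n b k) i _
    · exact_mod_cast comp_dz (generic q n b k) i _
    · exact_mod_cast comp_dm (generic q n b k) i _
  rw [rop_rop q _ _ hs, rop_rop q _ _ hs, key, key, key, key, key, add_right_comm b, add_right_comm k]
  ring

theorem rop_z {f : Dir} (hf : f = .p ∨ f = .m) :
    rop q f s (rop q .z s w) n b k = rop q .z s (rop q f s w) n b k := by
  have key : ∀ i, (lcomp q f .z i n b k : ℂ) = (lcomp q .z f i n b k : ℂ) := by
    intro i
    rcases hf with rfl | rfl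
    · exact_mod_cast comp_pz (generic q n b k) i _
    · exact_mod_cast comp_mz (generic q n b k) i _
  rw [rop_rop q _ _ hs, rop_rop q _ _ hs, key, key, key, key, key, add_right_comm b, add_right_comm k]

/-- Since z commutes with p and m, the mixed terms with z cancel. The rest is α times the identity
`comp_pm` plus β times `comp_mp`. -/
theorem rop_quadratic {Z : Dir → Dir → ℝ} {c : ℝ} (h : Quadratic (rp q) (qz q k) Z c) :
    ((Z .p .p : ℂ) * rop q .p s (rop q .p s w) n b k + Z .p .z * rop q .p s (rop q .z s w) n b k +
      Z .p .m * rop q .p s (rop q .m s w) n b k + Z .z .p * rop q .z s (rop q .p s w) n b k +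
      Z .z .z * rop q .z s (rop q .z s w) n b k + Z .z .m * rop q .z s (rop q .m s w) n b k +
      Z .m .p * rop q .m s (rop q .p s w) n b k + Z .m .z * rop q .m s (rop q .z s w) n b k +
      Z .m .m * rop q .m s (rop q .m s w) n b k) = c * (w n b k - rop q .e s (rop q .d s w) n b k) := by
  obtain ⟨pp, mm, pz, mz, α, β, hpm, hmp, hzz, hc⟩ := h
  have pz' : (Z .p .z : ℂ) = -Z .z .p := by rw [eq_neg_iff_add_eq_zero]; exact_mod_cast pz
  have mz' : (Z .m .z : ℂ) = -Z .z .m := by rw [eq_neg_iff_add_eq_zero]; exact_mod_cast mz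
  have e1 : ∀ x y : ℤ, x + y + -y = x := by intros; ring
  have e2 : ∀ x y : ℤ, x + -y + y = x := by intros; ring
  have r1 : ∀ i, ((br (rp q ^ 2) : ℝ) : ℂ) ^ 2 * lcomp q .z .z i n b k +
      (br (rp q ^ 4 * qz q k ^ 2) : ℝ) * (br (rp q ^ 8 * qz q k ^ 2) : ℝ) * lcomp q .p .m i n b k =
      ((br (rp q ^ 6 * qz q k ^ 2) : ℝ) : ℂ) ^ 2 * ((compOne i : ℝ) - lcomp q .e .d i n b k) := by
    intro i; exact_mod_cast comp_pm (generic q n b k) i _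
  have r2 : ∀ i, ((br (rp q ^ 2) : ℝ) : ℂ) ^ 2 * lcomp q .z .z i n b k +
      (br (rp q ^ 4 * qz q k ^ 2) : ℝ) * (br (qz q k ^ 2) : ℝ) * lcomp q .m .p i n b k =
      ((br (rp q ^ 2 * qz q k ^ 2) : ℝ) : ℂ) ^ 2 * ((compOne i : ℝ) - lcomp q .e .d i n b k) := by
    intro i; exact_mod_cast comp_mp (generic q n b k) i _
  have R1 : ((br (rp q ^ 2) : ℝ) : ℂ) ^ 2 * rop q .z s (rop q .z s w) n b k +
      (br (rp q ^ 4 * qz q k ^ 2) : ℝ) * (br (rp q ^ 8 * qz q k ^ 2) : ℝ) * rop q .p s (rop q .m s w) n b k =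
      ((br (rp q ^ 6 * qz q k ^ 2) : ℝ) : ℂ) ^ 2 * (w n b k - rop q .e s (rop q .d s w) n b k) := by
    have h0 := r1 0; have h1 := r1 1; have h2 := r1 2; have h3 := r1 3; have h4 := r1 4
    simp only [compOne, Complex.ofReal_zero, Complex.ofReal_one] at h0 h1 h2 h3 h4
    simp only [rop_rop q _ _ hs, db, dk, add_zero, e1, e2]
    linear_combination w (n + 1 + 1) b k * h0 + s * w (n + 1) b k * h1 + w n b k * h2 + s * w (n - 1) b k * h3 + w (n - 1 - 1) b k * h4
  have R2 : ((br (rp q ^ 2) : ℝ) : ℂ) ^ 2 * rop q .z s (rop q .z s w) n b k +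
      (br (rp q ^ 4 * qz q k ^ 2) : ℝ) * (br (qz q k ^ 2) : ℝ) * rop q .m s (rop q .p s w) n b k =
      ((br (rp q ^ 2 * qz q k ^ 2) : ℝ) : ℂ) ^ 2 * (w n b k - rop q .e s (rop q .d s w) n b k) := by
    have h0 := r2 0; have h1 := r2 1; have h2 := r2 2; have h3 := r2 3; have h4 := r2 4
    simp only [compOne, Complex.ofReal_zero, Complex.ofReal_one] at h0 h1 h2 h3 h4
    simp only [rop_rop q _ _ hs, db, dk, add_zero, e1, e2]
    linear_combination w (n + 1 + 1) b k * h0 + s * w (n + 1) b k * h1 + w n b k * h2 + s * w (n - 1) b k * h3 + w (n - 1 - 1) b k * h4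
  rw [pp, mm, pz', mz', hpm, hmp, hzz, rop_z q hs w n b k (Or.inl rfl), rop_z q hs w n b k (Or.inr rfl), ← hc]
  push_cast at R1 R2 ⊢
  linear_combination (α : ℂ) * R1 + (β : ℂ) * R2

theorem rop_de :
    w n b k - rop q .d s (rop q .e s w) n b k = (rp q : ℂ) ^ 8 * (w n b k - rop q .e s (rop q .d s w) n b k) := by
  have e1 : ∀ x y : ℤ, x + y + -y = x := by intros; ring
  have e2 : ∀ x y : ℤ, x + -y + y = x := by intros; ring
  have r : ∀ i, ((compOne i : ℝ) : ℂ) - lcomp q .d .e i n b k = (rp q : ℂ) ^ 8 * ((compOne i : ℝ) - lcomp q .e .d i n b k) := by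
    intro i; exact_mod_cast comp_de (generic q n b k) i _
  have h0 := r 0; have h1 := r 1; have h2 := r 2; have h3 := r 3; have h4 := r 4
  simp only [compOne, Complex.ofReal_zero, Complex.ofReal_one] at h0 h1 h2 h3 h4
  simp only [rop_rop q _ _ hs, db, dk, add_zero, e1, e2]
  linear_combination w (n + 1 + 1) b k * h0 + s * w (n + 1) b k * h1 + w n b k * h2 + s * w (n - 1) b k * h3 + w (n - 1 - 1) b k * h4

end

section
variable (q : Param)

/-- A combination of the reduced operators with coefficients which depend on `j` and `m₁`. -/
noncomputable def spin (f : Dir → ℝ → ℝ → ℝ → ℝ) (s : ℂ) (a : ℤ) (w : ℤ → ℤ → ℤ → ℂ) (n b k : ℤ) : ℂ :=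
  (f .p (rp q) (qz q k) (qz q a) : ℂ) * rop q .p s w n b k + (f .z (rp q) (qz q k) (qz q a) : ℂ) * rop q .z s w n b k +
    (f .m (rp q) (qz q k) (qz q a) : ℂ) * rop q .m s w n b k

/-- The action of the generators on functions on the lattice of the labels `(m₁, l, m₂, j)`. -/
noncomputable def lat (s : ℂ) : SGen → (ℤ → ℤ → ℤ → ℤ → ℂ) → ℤ → ℤ → ℤ → ℤ → ℂ
  | .x₀, u, a => spin q kA s a (u a)
  | .x₁s, u, a => spin q kB s a (u (a + 1))
  | .x₁, u, a => spin q kC s a (u (a - 1))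
  | .x₂s, u, a => rop q .d s (u a)
  | .x₂, u, a => rop q .e s (u a)

theorem rop_spin (f : Dir) (g : Dir → ℝ → ℝ → ℝ → ℝ) (s : ℂ) (a : ℤ) (w : ℤ → ℤ → ℤ → ℂ) (n b k : ℤ) :
    rop q f s (spin q g s a w) n b k =
      (g .p (rp q) (kS f (rp q) (qz q k)) (qz q a) : ℂ) * rop q f s (rop q .p s w) n b k +
      (g .z (rp q) (kS f (rp q) (qz q k)) (qz q a) : ℂ) * rop q f s (rop q .z s w) n b k +
      (g .m (rp q) (kS f (rp q) (qz q k)) (qz q a) : ℂ) * rop q f s (rop q .m s w) n b k := by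
  have h : ∀ w, rop q f s w n b k = (lU q f n b k : ℂ) * w (n + 1) (b + db f) (k + dk f) +
    s * (lZ q f n b k : ℂ) * w n (b + db f) (k + dk f) + (lD q f n b k : ℂ) * w (n - 1) (b + db f) (k + dk f) := fun _ => rfl
  rw [h (spin q g s a w), h (rop q .p s w), h (rop q .z s w), h (rop q .m s w), kS_qz]
  simp only [spin]
  ring

theorem spin_spin (f g : Dir → ℝ → ℝ → ℝ → ℝ) (s : ℂ) (a a' : ℤ) (w : ℤ → ℤ → ℤ → ℂ) (n b k : ℤ) :
    spin q f s a (spin q g s a' w) n b k =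
      ((f .p (rp q) (qz q k) (qz q a) * g .p (rp q) (kS .p (rp q) (qz q k)) (qz q a') : ℝ) : ℂ) * rop q .p s (rop q .p s w) n b k +
      ((f .p (rp q) (qz q k) (qz q a) * g .z (rp q) (kS .p (rp q) (qz q k)) (qz q a') : ℝ) : ℂ) * rop q .p s (rop q .z s w) n b k +
      ((f .p (rp q) (qz q k) (qz q a) * g .m (rp q) (kS .p (rp q) (qz q k)) (qz q a') : ℝ) : ℂ) * rop q .p s (rop q .m s w) n b k +
      ((f .z (rp q) (qz q k) (qz q a) * g .p (rp q) (kS .z (rp q) (qz q k)) (qz q a') : ℝ) : ℂ) * rop q .z s (rop q .p s w) n b k +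
      ((f .z (rp q) (qz q k) (qz q a) * g .z (rp q) (kS .z (rp q) (qz q k)) (qz q a') : ℝ) : ℂ) * rop q .z s (rop q .z s w) n b k +
      ((f .z (rp q) (qz q k) (qz q a) * g .m (rp q) (kS .z (rp q) (qz q k)) (qz q a') : ℝ) : ℂ) * rop q .z s (rop q .m s w) n b k +
      ((f .m (rp q) (qz q k) (qz q a) * g .p (rp q) (kS .m (rp q) (qz q k)) (qz q a') : ℝ) : ℂ) * rop q .m s (rop q .p s w) n b k +
      ((f .m (rp q) (qz q k) (qz q a) * g .z (rp q) (kS .m (rp q) (qz q k)) (qz q a') : ℝ) : ℂ) * rop q .m s (rop q .z s w) n b k +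
      ((f .m (rp q) (qz q k) (qz q a) * g .m (rp q) (kS .m (rp q) (qz q k)) (qz q a') : ℝ) : ℂ) * rop q .m s (rop q .m s w) n b k := by
  rw [spin, rop_spin, rop_spin, rop_spin]
  push_cast
  ring

variable {s : ℂ} (hs : s ^ 2 = 1) (u : ℤ → ℤ → ℤ → ℤ → ℂ) (a n b k : ℤ)
include hs

/-- The direction d changes neither j nor m₁, so it passes through the spin coefficients and only
the rule for the reduced operators matters. -/
theorem rop_d_spin (g : Dir → ℝ → ℝ → ℝ → ℝ) (a : ℤ) (w : ℤ → ℤ → ℤ → ℂ) :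
    rop q .d s (spin q g s a w) n b k = (rp q : ℂ) ^ 4 * spin q g s a (rop q .d s w) n b k := by
  rw [rop_spin, rop_d q hs _ _ _ _ (Or.inl rfl), rop_d q hs _ _ _ _ (Or.inr (Or.inl rfl)), rop_d q hs _ _ _ _ (Or.inr (Or.inr rfl)),
    spin]
  simp only [kS]
  ring

/-- Only four of the eight q-commutation rules are proved on the lattice: the three here and
`lat_r1s0`. The other four are their adjoints. -/
theorem lat_r2s0 : lat q s .x₂s (lat q s .x₀ u) a n b k = (rp q : ℂ) ^ 4 * lat q s .x₀ (lat q s .x₂s u) a n b k :=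
  rop_d_spin q hs n b k _ _ _
theorem lat_r2s1s : lat q s .x₂s (lat q s .x₁s u) a n b k = (rp q : ℂ) ^ 4 * lat q s .x₁s (lat q s .x₂s u) a n b k :=
  rop_d_spin q hs n b k _ _ _
theorem lat_r2s1 : lat q s .x₂s (lat q s .x₁ u) a n b k = (rp q : ℂ) ^ 4 * lat q s .x₁ (lat q s .x₂s u) a n b k :=
  rop_d_spin q hs n b k _ _ _

variable (hk : 0 ≤ k)
include hk

/-- The relations which rest on `Quadratic` need k ≥ 0: at k = -1 the determinant in `quadratic_of`
degenerates. -/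
theorem lat_r1s0 : lat q s .x₁s (lat q s .x₀ u) a n b k = (rp q : ℂ) ^ 4 * lat q s .x₀ (lat q s .x₁s u) a n b k := by
  have h := rop_quadratic q hs (u (a + 1)) n b k (quadratic_r1s0 (spinGeneric q hk a))
  rw [← qz_succ] at h
  change spin q kB s a (spin q kA s (a + 1) (u (a + 1))) n b k = _ * spin q kA s a (spin q kB s a (u (a + 1))) n b k
  rw [spin_spin, spin_spin]
  push_cast at h ⊢
  linear_combination h

theorem lat_r11 : lat q s .x₁s (lat q s .x₁ u) a n b k - lat q s .x₁ (lat q s .x₁s u) a n b k =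
    (1 - (rp q : ℂ) ^ 8) * lat q s .x₀ (lat q s .x₀ u) a n b k := by
  have h := rop_quadratic q hs (u a) n b k (quadratic_r11 (spinGeneric q hk a))
  rw [← qz_succ, ← qz_pred] at h
  change spin q kB s a (spin q kC s (a + 1) (u (a + 1 - 1))) n b k - spin q kC s a (spin q kB s (a - 1) (u (a - 1 + 1))) n b k =
    _ * spin q kA s a (spin q kA s a (u a)) n b k
  rw [add_sub_cancel_right, sub_add_cancel, spin_spin, spin_spin, spin_spin]
  push_cast at h ⊢
  linear_combination h

theorem lat_rad : lat q s .x₀ (lat q s .x₀ u) a n b k + lat q s .x₁ (lat q s .x₁s u) a n b k +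
    lat q s .x₂ (lat q s .x₂s u) a n b k = u a n b k := by
  have h := rop_quadratic q hs (u a) n b k (quadratic_rad (spinGeneric q hk a))
  rw [← qz_pred] at h
  change spin q kA s a (spin q kA s a (u a)) n b k + spin q kC s a (spin q kB s (a - 1) (u (a - 1 + 1))) n b k +
    rop q .e s (rop q .d s (u a)) n b k = _
  rw [sub_add_cancel, spin_spin, spin_spin]
  push_cast at h ⊢
  linear_combination h

theorem lat_r22 : lat q s .x₂s (lat q s .x₂ u) a n b k - lat q s .x₂ (lat q s .x₂s u) a n b k =
    lat q s .x₁s (lat q s .x₁ u) a n b k - (rp q : ℂ) ^ 8 * lat q s .x₁ (lat q s .x₁s u) a n b k := by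
  have h := rop_quadratic q hs (u a) n b k (quadratic_r22 (spinGeneric q hk a))
  have h' := rop_de q hs (u a) n b k
  rw [← qz_succ, ← qz_pred] at h
  change rop q .d s (rop q .e s (u a)) n b k - rop q .e s (rop q .d s (u a)) n b k =
    spin q kB s a (spin q kC s (a + 1) (u (a + 1 - 1))) n b k - _ * spin q kC s a (spin q kB s (a - 1) (u (a - 1 + 1))) n b k
  rw [add_sub_cancel_right, sub_add_cancel, spin_spin, spin_spin]
  push_cast at h ⊢
  linear_combination -h - h'

end

/-! ### The weights which symmetrise the coefficients. -/

section
variable (q : Param)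

/-- The number `q^{-z} - q^z`. -/
noncomputable def bz (z : ℤ) : ℝ := br (qz q z)

theorem qz_lt_one {z : ℤ} (hz : 0 < z) : qz q z < 1 := zpow_lt_one₀ q.2.1 q.2.2 hz
theorem bz_zero : bz q 0 = 0 := by simp [bz, br, qz]
theorem bz_pos {z : ℤ} (hz : 0 < z) : 0 < bz q z := by
  have h0 := qz_pos q z
  have h1 := qz_lt_one q hz
  have h2 : 1 < (qz q z)⁻¹ := (one_lt_inv₀ h0).2 h1
  rw [bz, br]; linarith
theorem bz_nonneg {z : ℤ} (hz : 0 ≤ z) : 0 ≤ bz q z := by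
  rcases hz.eq_or_lt with rfl | h
  · rw [bz_zero]
  · exact (bz_pos q h).le
theorem bz_neg (z : ℤ) : bz q (-z) = -bz q z := by
  have : qz q (-z) = (qz q z)⁻¹ := by simp [qz]
  rw [bz, bz, br, br, this, inv_inv]; ring
theorem qz_sub (m n : ℤ) : qz q (m - n) = qz q m / qz q n := zpow_sub₀ q.2.1.ne' m n
theorem rp_pow (m : ℕ) : rp q ^ (2 * m) = qz q m := by rw [pow_mul, rp_sq, qz, zpow_natCast]
theorem qz_pow (m : ℕ) (n : ℤ) : qz q n ^ m = qz q (m * n) := by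
  rw [qz, qz, ← zpow_natCast, ← zpow_mul, mul_comm]

/-- The product of the numbers `bz i` for even `i`, `0 < i ≤ x`. -/
noncomputable def fe (x : ℤ) : ℝ := ∏ i ∈ Finset.range (x / 2).toNat, bz q (2 * i + 2)
/-- The product of the numbers `bz i` for odd `i`, `0 < i ≤ x + 1`. -/
noncomputable def fo (x : ℤ) : ℝ := ∏ i ∈ Finset.range (x / 2 + 1).toNat, bz q (2 * i + 1)
/-- The product of the numbers `bz i` for `0 < i ≤ x`. -/
noncomputable def ff (x : ℤ) : ℝ := ∏ i ∈ Finset.range x.toNat, bz q (i + 1)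

theorem fe_pos (x : ℤ) : 0 < fe q x := Finset.prod_pos fun i _ => bz_pos q (by positivity)
theorem fo_pos (x : ℤ) : 0 < fo q x := Finset.prod_pos fun i _ => bz_pos q (by positivity)
theorem ff_pos (x : ℤ) : 0 < ff q x := Finset.prod_pos fun i _ => bz_pos q (by positivity)

theorem fe_even {x y : ℤ} (hy : y = x + 1) (h : x % 2 = 0) : fe q y = fe q x := by
  have : y / 2 = x / 2 := by omega
  rw [fe, fe, this]
theorem fe_odd {x y : ℤ} (hy : y = x + 1) (h : x % 2 = 1) (h0 : 0 ≤ x) : fe q y = bz q y * fe q x := by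
  have e : (y / 2).toNat = (x / 2).toNat + 1 := by omega
  have e' : 2 * ((x / 2).toNat : ℤ) + 2 = y := by omega
  rw [fe, fe, e, Finset.prod_range_succ, mul_comm, e']
theorem fo_even {x y : ℤ} (hy : y = x + 1) (h : x % 2 = 0) : fo q y = fo q x := by
  have : y / 2 = x / 2 := by omega
  rw [fo, fo, this]
theorem fo_odd {x y : ℤ} (hy : y = x + 1) (h : x % 2 = 1) (h0 : 0 ≤ x + 1) : fo q y = bz q (y + 1) * fo q x := by
  have e : (y / 2 + 1).toNat = (x / 2 + 1).toNat + 1 := by omega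
  rw [fo, fo, e, Finset.prod_range_succ, mul_comm]
  congr 2
  omega
theorem ff_succ {x y : ℤ} (hy : y = x + 1) (h0 : 0 ≤ x) : ff q y = bz q y * ff q x := by
  have e : y.toNat = x.toNat + 1 := by omega
  have e' : (x.toNat : ℤ) + 1 = y := by omega
  rw [ff, ff, e, Finset.prod_range_succ, mul_comm, e']
theorem fe_two_even {x y : ℤ} (hy : y = x + 2) (h : x % 2 = 0) (h0 : 0 ≤ x + 1) : fe q y = bz q y * fe q x := by
  rw [fe_odd q (x := x + 1) (by omega) (by omega) (by omega), fe_even q (x := x) rfl h]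
theorem fe_two_odd {x y : ℤ} (hy : y = x + 2) (h : x % 2 = 1) (h0 : 0 ≤ x) : fe q y = bz q (y - 1) * fe q x := by
  rw [fe_even q (x := y - 1) (by omega) (by omega), fe_odd q (x := x) (by omega) h h0]
theorem fo_two_even {x y : ℤ} (hy : y = x + 2) (h : x % 2 = 0) (h0 : 0 ≤ x + 1) : fo q y = bz q (y + 1) * fo q x := by
  rw [fo_odd q (x := x + 1) (by omega) (by omega) (by omega), fo_even q (x := x) rfl h]
theorem fo_two_odd {x y : ℤ} (hy : y = x + 2) (h : x % 2 = 1) (h0 : 0 ≤ x + 1) : fo q y = bz q y * fo q x := by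
  rw [fo_even q (x := y - 1) (by omega) (by omega), fo_odd q (x := x) (by omega) h h0, sub_add_cancel]

/-- The weight of the rational basis with respect to `l`, `m₂`, `j`. -/
noncomputable def gW (n b k : ℤ) : ℝ := fe q (n - k - b) * fe q (n - k + b + 1) * fo q (n + k + b + 2) * fo q (n + k - b + 1)
/-- The weight of the rational basis with respect to `m₁`, `j`. -/
noncomputable def gV (a k : ℤ) : ℝ := ff q (k + a + 1) * ff q (k - a)

theorem gW_pos (n b k : ℤ) : 0 < gW q n b k :=
  mul_pos (mul_pos (mul_pos (fe_pos q _) (fe_pos q _)) (fo_pos q _)) (fo_pos q _)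
theorem gV_pos (a k : ℤ) : 0 < gV q a k := mul_pos (ff_pos q _) (ff_pos q _)

/-- The factors of the coefficients of the reduced operators which depend on the basis. -/
noncomputable def low (f : Dir) (δ : Fin 3) (n b k : ℤ) : ℝ :=
  match f, δ with
  | .p, 1 => if par n b k then bz q (n - k - b) else bz q (n - k + b + 1)
  | .p, 2 => if par n b k then bz q (n - k + b) * bz q (n - k - b) else bz q (n - k + b + 1) * bz q (n - k - b - 1)
  | .z, 2 => if par n b k then bz q (n - k - b) * bz q (n + k + b + 3) else bz q (n + k - b + 2) * bz q (n - k + b + 1)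
  | .m, 1 => if par n b k then bz q (n + k + b + 3) else bz q (n + k - b + 2)
  | .m, 2 => if par n b k then bz q (n + k + b + 3) * bz q (n + k - b + 1) else bz q (n + k + b + 2) * bz q (n + k - b + 2)
  | .d, 1 => if par n b k then bz q (n - k - b) else bz q (n + k - b + 2)
  | .d, 2 => if par n b k then bz q (n - k - b) * bz q (n + k - b + 1) else bz q (n - k - b - 1) * bz q (n + k - b + 2)
  | .e, 1 => if par n b k then bz q (n + k + b + 3) else bz q (n - k + b + 1)
  | .e, 2 => if par n b k then bz q (n + k + b + 3) * bz q (n - k + b) else bz q (n + k + b + 2) * bz q (n - k + b + 1)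
  | _, _ => 1

/-- The factors of the coefficients of the reduced operators which do not depend on the basis. -/
noncomputable def rr (f : Dir) (δ : Fin 3) (n b k : ℤ) : ℝ :=
  match f, δ with
  | .p, 0 => -(if par n b k then qz q b / rp q ^ 2 else qz q b) / bz q (2 * n + 5)
  | .p, 1 => (if par n b k then -(rp q ^ 3 * qz q n * qz q b) else qz q b / (rp q ^ 5 * qz q n)) *
      ((rp q ^ 2 + (rp q ^ 2)⁻¹) * bz q 1 / (bz q (2 * n + 3) * bz q (2 * n + 5)))
  | .p, 2 => -(if par n b k then qz q b else qz q b / rp q ^ 2) / bz q (2 * n + 3)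
  | .z, 0 => (if par n b k then rp q * qz q b * qz q k else qz q b / (rp q ^ 3 * qz q k)) / bz q (2 * n + 5)
  | .z, 1 => lZ q .z n b k
  | .z, 2 => (if par n b k then qz q b / (rp q ^ 3 * qz q k) else rp q * qz q b * qz q k) / bz q (2 * n + 3)
  | .m, 0 => -(if par n b k then qz q b else qz q b / rp q ^ 2) / bz q (2 * n + 5)
  | .m, 1 => (if par n b k then qz q b / (rp q ^ 5 * qz q n) else -(rp q ^ 3 * qz q n * qz q b)) *
      ((rp q ^ 2 + (rp q ^ 2)⁻¹) * bz q 1 / (bz q (2 * n + 3) * bz q (2 * n + 5)))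
  | .m, 2 => -(if par n b k then qz q b / rp q ^ 2 else qz q b) / bz q (2 * n + 3)
  | .d, 0 => qz q b / (rp q ^ 3 * qz q n) / bz q (2 * n + 5)
  | .d, 1 => rp q ^ 2 * qz q b * ((rp q ^ 2 + (rp q ^ 2)⁻¹) * bz q 1 / (bz q (2 * n + 3) * bz q (2 * n + 5)))
  | .d, 2 => -(rp q ^ 5 * qz q n * qz q b) / bz q (2 * n + 3)
  | .e, 0 => -(rp q ^ 5 * qz q n * qz q b) / bz q (2 * n + 5)
  | .e, 1 => qz q b * ((rp q ^ 2 + (rp q ^ 2)⁻¹) * bz q 1 / (bz q (2 * n + 3) * bz q (2 * n + 5)))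
  | .e, 2 => qz q b / (rp q ^ 3 * qz q n) / bz q (2 * n + 3)

/-- The coefficients `lU`, `lZ`, `lD`. -/
noncomputable def lc (f : Dir) : Fin 3 → ℤ → ℤ → ℤ → ℝ
  | 0 => lU q f | 1 => lZ q f | 2 => lD q f

/-- The splitting is arranged so that `rr` is the same for a step and for its reverse (`rr_rev`),
while `low` collects the brackets by which the two directions differ. -/
theorem lc_eq (f : Dir) (δ : Fin 3) (n b k : ℤ) : lc q f δ n b k = rr q f δ n b k * low q f δ n b k := by
  have e2 : rp q ^ 2 = qz q 1 := rp_pow q 1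
  have e4 : rp q ^ 4 = qz q 2 := rp_pow q 2
  have e6 : rp q ^ 6 = qz q 3 := rp_pow q 3
  have e10 : rp q ^ 10 = qz q 5 := rp_pow q 5
  have a1 : br (qz q n / (qz q k * qz q b)) = bz q (n - k - b) := by
    rw [bz]; congr 1; rw [qz_sub, qz_sub, div_div]
  have a2 : br (rp q ^ 2 * qz q n * qz q b / qz q k) = bz q (n - k + b + 1) := by
    rw [bz, e2, ← qz_add, ← qz_add, ← qz_sub]; congr 2; ring
  have a3 : br (qz q n * qz q b / qz q k) = bz q (n - k + b) := by
    rw [bz, ← qz_add, ← qz_sub]; congr 2; ring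
  have a4 : br (qz q n / (rp q ^ 2 * qz q k * qz q b)) = bz q (n - k - b - 1) := by
    rw [bz, e2, ← qz_add, ← qz_add, ← qz_sub]; congr 2; ring
  have a5 : br (rp q ^ 6 * qz q n * qz q k * qz q b) = bz q (n + k + b + 3) := by
    rw [bz, e6, ← qz_add, ← qz_add, ← qz_add]; congr 2; ring
  have a6 : br (rp q ^ 4 * qz q n * qz q k / qz q b) = bz q (n + k - b + 2) := by
    rw [bz, e4, ← qz_add, ← qz_add, ← qz_sub]; congr 2; ring
  have a7 : br (rp q ^ 4 * qz q n * qz q k * qz q b) = bz q (n + k + b + 2) := by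
    rw [bz, e4, ← qz_add, ← qz_add, ← qz_add]; congr 2; ring
  have a8 : br (rp q ^ 2 * qz q n * qz q k / qz q b) = bz q (n + k - b + 1) := by
    rw [bz, e2, ← qz_add, ← qz_add, ← qz_sub]; congr 2; ring
  have a9 : br (rp q ^ 6 * qz q n ^ 2) = bz q (2 * n + 3) := by
    rw [bz, e6, qz_pow, ← qz_add]; congr 2; push_cast; ring
  have a10 : br (rp q ^ 10 * qz q n ^ 2) = bz q (2 * n + 5) := by
    rw [bz, e10, qz_pow, ← qz_add]; congr 2; push_cast; ring
  have a11 : br (rp q ^ 2) = bz q 1 := by rw [bz, e2]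
  cases f <;> fin_cases δ <;> rcases h : par n b k <;>
    simp only [Fin.zero_eta, Fin.mk_one, Fin.reduceFinMk, lc, lU, lZ, lD, h, cU, cZ, cD, rr, low, pU, pZ, pD, zU, zD, mU, mZ, mD, dU, dZ, dD, eU, eZ, eD, nn, n3, n5,
      a1, a2, a3, a4, a5, a6, a7, a8, a9, a10, a11, if_true, if_false, Bool.false_eq_true] <;> ring

/-- The reverse of a reduced operator. -/
def rev : Dir → Dir
  | .p => .m | .z => .z | .m => .p | .d => .e | .e => .d

/-- The changes of `l` and `j`. -/
def tv : Fin 3 → ℤ := ![1, 0, -1]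

theorem rev_rev (f : Dir) : rev (rev f) = f := by cases f <;> rfl
theorem tv_rev (δ : Fin 3) : tv δ.rev = -tv δ := by fin_cases δ <;> rfl
theorem db_rev (f : Dir) : db (rev f) = -db f := by cases f <;> rfl
theorem dk_rev (f : Dir) : dk (rev f) = -dk f := by cases f <;> rfl

theorem par_mod_true {n b k : ℤ} (h : par n b k = true) : (n - k - b) % 2 = 0 := by
  simpa [par, Int.even_iff] using h
theorem par_mod_false {n b k : ℤ} (h : par n b k = false) : (n - k - b) % 2 = 1 := by
  simpa [par, Int.even_iff] using h

theorem par_tv (f : Dir) (δ : Fin 3) (n b k : ℤ) : par (n + tv δ) (b + db f) (k + dk f) =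
    (par n b k ^^ (if δ = 1 then fl f else !fl f)) := by
  fin_cases δ
  · exact par_succ f n b k
  · simpa [tv] using par_stay f n b k
  · simpa [tv, ← sub_eq_add_neg] using par_pred f n b k

/-- The denominators 2n + 5 and 2n + 3 exchange their roles under n ↦ n ± 1, and the parity selects
the matching power of p. -/
theorem rr_rev (f : Dir) (δ : Fin 3) (n b k : ℤ) :
    rr q (rev f) δ.rev (n + tv δ) (b + db f) (k + dk f) = rr q f δ n b k := by
  have hp := (rp_pos q).ne'
  have hX := (qz_pos q n).ne'
  have hK := (qz_pos q k).ne'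
  have hB := (qz_pos q b).ne'
  have r0 : Fin.rev (0 : Fin 3) = 2 := rfl
  have r1 : Fin.rev (1 : Fin 3) = 1 := rfl
  have r2 : Fin.rev (2 : Fin 3) = 0 := rfl
  have m1 : 2 * (n + 1) + 3 = 2 * n + 5 := by ring
  have m2 : 2 * (n - 1) + 5 = 2 * n + 3 := by ring
  have v0 : tv 0 = 1 := rfl
  have v1 : tv 1 = 0 := rfl
  have v2 : tv 2 = -1 := rfl
  rcases h : par n b k <;> cases f <;> fin_cases δ <;>
    simp only [rr, lZ, rev, par_tv, h, r0, r1, r2, Fin.zero_eta, Fin.mk_one, Fin.reduceFinMk, fl, Bool.not_true, Bool.not_false, Bool.xor_true, Bool.xor_false, if_true, if_false, Fin.reduceEq,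
      Bool.false_eq_true] <;>
    simp only [v0, v1, v2, db, dk, add_zero, ← sub_eq_add_neg, qz_succ, qz_pred, m1, m2] <;> first | done | (field_simp; done)

/-- In this and the following lemmas a step changes each of the four factors of `gW` by at most one
bracket, and the parity decides by which one. The products run over even or odd integers only,
because arguments relevant at fixed parity move by two. The directions p, z, d suffice, as m and e
are their reverses (`low_rev`). -/
theorem low_p_0 {n b k : ℤ} (hk : 0 ≤ k) (hn : k ≤ n) (h1 : -(n - k) - 1 ≤ b) (h2 : b ≤ n - k)
    (hn' : (k + 1) ≤ (n + 1)) (h1' : -((n + 1) - (k + 1)) - 1 ≤ b) (h2' : b ≤ (n + 1) - (k + 1)) :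
    low q .p 0 n b k * gW q (n + 1) b (k + 1) = low q .m 2 (n + 1) b (k + 1) * gW q n b k := by
  rcases hp : par n b k
  · have hm := par_mod_false hp
    have hp' : par (n + 1) b (k + 1) = false := by
      have := par_same (n := n) (b := b) (k := k) (n' := (n + 1)) (b' := b) (k' := (k + 1)) (by omega)
      rw [this, hp]
    have g0 : fe q ((n + 1) - (k + 1) - b) = fe q (n - k - b) := by congr 1; ring
    have g1 : fe q ((n + 1) - (k + 1) + b + 1) = fe q (n - k + b + 1) := by congr 1; ring
    have g2 := fo_two_odd q (x := n + k + b + 2) (y := (n + 1) + (k + 1) + b + 2) (by ring) (by omega) (by omega)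
    have g3 := fo_two_even q (x := n + k - b + 1) (y := (n + 1) + (k + 1) - b + 1) (by ring) (by omega) (by omega)
    simp only [low, hp, hp', gW, if_true, if_false, Bool.false_eq_true, g0, g1, g2, g3]
    ring_nf
  · have hm := par_mod_true hp
    have hp' : par (n + 1) b (k + 1) = true := by
      have := par_same (n := n) (b := b) (k := k) (n' := (n + 1)) (b' := b) (k' := (k + 1)) (by omega)
      rw [this, hp]
    have g0 : fe q ((n + 1) - (k + 1) - b) = fe q (n - k - b) := by congr 1; ring
    have g1 : fe q ((n + 1) - (k + 1) + b + 1) = fe q (n - k + b + 1) := by congr 1; ring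
    have g2 := fo_two_even q (x := n + k + b + 2) (y := (n + 1) + (k + 1) + b + 2) (by ring) (by omega) (by omega)
    have g3 := fo_two_odd q (x := n + k - b + 1) (y := (n + 1) + (k + 1) - b + 1) (by ring) (by omega) (by omega)
    simp only [low, hp, hp', gW, if_true, if_false, Bool.false_eq_true, g0, g1, g2, g3]
    ring_nf
theorem low_p_1 {n b k : ℤ} (hk : 0 ≤ k) (hn : k ≤ n) (h1 : -(n - k) - 1 ≤ b) (h2 : b ≤ n - k)
    (hn' : (k + 1) ≤ n) (h1' : -(n - (k + 1)) - 1 ≤ b) (h2' : b ≤ n - (k + 1)) :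
    low q .p 1 n b k * gW q n b (k + 1) = low q .m 1 n b (k + 1) * gW q n b k := by
  rcases hp : par n b k
  · have hm := par_mod_false hp
    have hp' : par n b (k + 1) = true := by
      have := par_flip (n := n) (b := b) (k := k) (n' := n) (b' := b) (k' := (k + 1)) (by omega)
      rw [this, hp]; rfl
    have g0 : fe q (n - k - b) = fe q (n - (k + 1) - b) := fe_even q (by ring) (by omega)
    have g1 := fe_odd q (x := n - (k + 1) + b + 1) (y := n - k + b + 1) (by ring) (by omega) (by omega)
    have g2 := fo_odd q (x := n + k + b + 2) (y := n + (k + 1) + b + 2) (by ring) (by omega) (by omega)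
    have g3 : fo q (n + (k + 1) - b + 1) = fo q (n + k - b + 1) := fo_even q (by ring) (by omega)
    simp only [low, hp, hp', gW, if_true, if_false, Bool.false_eq_true, g0, g1, g2, g3]
    ring_nf
  · have hm := par_mod_true hp
    have hp' : par n b (k + 1) = false := by
      have := par_flip (n := n) (b := b) (k := k) (n' := n) (b' := b) (k' := (k + 1)) (by omega)
      rw [this, hp]; rfl
    have g0 := fe_odd q (x := n - (k + 1) - b) (y := n - k - b) (by ring) (by omega) (by omega)
    have g1 : fe q (n - k + b + 1) = fe q (n - (k + 1) + b + 1) := fe_even q (by ring) (by omega)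
    have g2 : fo q (n + (k + 1) + b + 2) = fo q (n + k + b + 2) := fo_even q (by ring) (by omega)
    have g3 := fo_odd q (x := n + k - b + 1) (y := n + (k + 1) - b + 1) (by ring) (by omega) (by omega)
    simp only [low, hp, hp', gW, if_true, if_false, Bool.false_eq_true, g0, g1, g2, g3]
    ring_nf
theorem low_p_2 {n b k : ℤ} (hk : 0 ≤ k) (hn : k ≤ n) (h1 : -(n - k) - 1 ≤ b) (h2 : b ≤ n - k)
    (hn' : (k + 1) ≤ (n - 1)) (h1' : -((n - 1) - (k + 1)) - 1 ≤ b) (h2' : b ≤ (n - 1) - (k + 1)) :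
    low q .p 2 n b k * gW q (n - 1) b (k + 1) = low q .m 0 (n - 1) b (k + 1) * gW q n b k := by
  rcases hp : par n b k
  · have hm := par_mod_false hp
    have hp' : par (n - 1) b (k + 1) = false := by
      have := par_same (n := n) (b := b) (k := k) (n' := (n - 1)) (b' := b) (k' := (k + 1)) (by omega)
      rw [this, hp]
    have g0 := fe_two_odd q (x := (n - 1) - (k + 1) - b) (y := n - k - b) (by ring) (by omega) (by omega)
    have g1 := fe_two_even q (x := (n - 1) - (k + 1) + b + 1) (y := n - k + b + 1) (by ring) (by omega) (by omega)
    have g2 : fo q ((n - 1) + (k + 1) + b + 2) = fo q (n + k + b + 2) := by congr 1; ring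
    have g3 : fo q ((n - 1) + (k + 1) - b + 1) = fo q (n + k - b + 1) := by congr 1; ring
    simp only [low, hp, hp', gW, if_true, if_false, Bool.false_eq_true, g0, g1, g2, g3]
    ring_nf
  · have hm := par_mod_true hp
    have hp' : par (n - 1) b (k + 1) = true := by
      have := par_same (n := n) (b := b) (k := k) (n' := (n - 1)) (b' := b) (k' := (k + 1)) (by omega)
      rw [this, hp]
    have g0 := fe_two_even q (x := (n - 1) - (k + 1) - b) (y := n - k - b) (by ring) (by omega) (by omega)
    have g1 := fe_two_odd q (x := (n - 1) - (k + 1) + b + 1) (y := n - k + b + 1) (by ring) (by omega) (by omega)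
    have g2 : fo q ((n - 1) + (k + 1) + b + 2) = fo q (n + k + b + 2) := by congr 1; ring
    have g3 : fo q ((n - 1) + (k + 1) - b + 1) = fo q (n + k - b + 1) := by congr 1; ring
    simp only [low, hp, hp', gW, if_true, if_false, Bool.false_eq_true, g0, g1, g2, g3]
    ring_nf
theorem low_z_0 {n b k : ℤ} (hk : 0 ≤ k) (hn : k ≤ n) (h1 : -(n - k) - 1 ≤ b) (h2 : b ≤ n - k)
    (hn' : k ≤ (n + 1)) (h1' : -((n + 1) - k) - 1 ≤ b) (h2' : b ≤ (n + 1) - k) :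
    low q .z 0 n b k * gW q (n + 1) b k = low q .z 2 (n + 1) b k * gW q n b k := by
  rcases hp : par n b k
  · have hm := par_mod_false hp
    have hp' : par (n + 1) b k = true := by
      have := par_flip (n := n) (b := b) (k := k) (n' := (n + 1)) (b' := b) (k' := k) (by omega)
      rw [this, hp]; rfl
    have g0 := fe_odd q (x := n - k - b) (y := (n + 1) - k - b) (by ring) (by omega) (by omega)
    have g1 : fe q ((n + 1) - k + b + 1) = fe q (n - k + b + 1) := fe_even q (by ring) (by omega)
    have g2 := fo_odd q (x := n + k + b + 2) (y := (n + 1) + k + b + 2) (by ring) (by omega) (by omega)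
    have g3 : fo q ((n + 1) + k - b + 1) = fo q (n + k - b + 1) := fo_even q (by ring) (by omega)
    simp only [low, hp, hp', gW, if_true, if_false, Bool.false_eq_true, g0, g1, g2, g3]
    ring_nf
  · have hm := par_mod_true hp
    have hp' : par (n + 1) b k = false := by
      have := par_flip (n := n) (b := b) (k := k) (n' := (n + 1)) (b' := b) (k' := k) (by omega)
      rw [this, hp]; rfl
    have g0 : fe q ((n + 1) - k - b) = fe q (n - k - b) := fe_even q (by ring) (by omega)
    have g1 := fe_odd q (x := n - k + b + 1) (y := (n + 1) - k + b + 1) (by ring) (by omega) (by omega)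
    have g2 : fo q ((n + 1) + k + b + 2) = fo q (n + k + b + 2) := fo_even q (by ring) (by omega)
    have g3 := fo_odd q (x := n + k - b + 1) (y := (n + 1) + k - b + 1) (by ring) (by omega) (by omega)
    simp only [low, hp, hp', gW, if_true, if_false, Bool.false_eq_true, g0, g1, g2, g3]
    ring_nf
theorem low_z_2 {n b k : ℤ} (hk : 0 ≤ k) (hn : k ≤ n) (h1 : -(n - k) - 1 ≤ b) (h2 : b ≤ n - k)
    (hn' : k ≤ (n - 1)) (h1' : -((n - 1) - k) - 1 ≤ b) (h2' : b ≤ (n - 1) - k) :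
    low q .z 2 n b k * gW q (n - 1) b k = low q .z 0 (n - 1) b k * gW q n b k := by
  rcases hp : par n b k
  · have hm := par_mod_false hp
    have hp' : par (n - 1) b k = true := by
      have := par_flip (n := n) (b := b) (k := k) (n' := (n - 1)) (b' := b) (k' := k) (by omega)
      rw [this, hp]; rfl
    have g0 : fe q (n - k - b) = fe q ((n - 1) - k - b) := fe_even q (by ring) (by omega)
    have g1 := fe_odd q (x := (n - 1) - k + b + 1) (y := n - k + b + 1) (by ring) (by omega) (by omega)
    have g2 : fo q (n + k + b + 2) = fo q ((n - 1) + k + b + 2) := fo_even q (by ring) (by omega)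
    have g3 := fo_odd q (x := (n - 1) + k - b + 1) (y := n + k - b + 1) (by ring) (by omega) (by omega)
    simp only [low, hp, hp', gW, if_true, if_false, Bool.false_eq_true, g0, g1, g2, g3]
    ring_nf
  · have hm := par_mod_true hp
    have hp' : par (n - 1) b k = false := by
      have := par_flip (n := n) (b := b) (k := k) (n' := (n - 1)) (b' := b) (k' := k) (by omega)
      rw [this, hp]; rfl
    have g0 := fe_odd q (x := (n - 1) - k - b) (y := n - k - b) (by ring) (by omega) (by omega)
    have g1 : fe q (n - k + b + 1) = fe q ((n - 1) - k + b + 1) := fe_even q (by ring) (by omega)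
    have g2 := fo_odd q (x := (n - 1) + k + b + 2) (y := n + k + b + 2) (by ring) (by omega) (by omega)
    have g3 : fo q (n + k - b + 1) = fo q ((n - 1) + k - b + 1) := fo_even q (by ring) (by omega)
    simp only [low, hp, hp', gW, if_true, if_false, Bool.false_eq_true, g0, g1, g2, g3]
    ring_nf
theorem low_d_0 {n b k : ℤ} (hk : 0 ≤ k) (hn : k ≤ n) (h1 : -(n - k) - 1 ≤ b) (h2 : b ≤ n - k)
    (hn' : k ≤ (n + 1)) (h1' : -((n + 1) - k) - 1 ≤ (b + 1)) (h2' : (b + 1) ≤ (n + 1) - k) :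
    low q .d 0 n b k * gW q (n + 1) (b + 1) k = low q .e 2 (n + 1) (b + 1) k * gW q n b k := by
  rcases hp : par n b k
  · have hm := par_mod_false hp
    have hp' : par (n + 1) (b + 1) k = false := by
      have := par_same (n := n) (b := b) (k := k) (n' := (n + 1)) (b' := (b + 1)) (k' := k) (by omega)
      rw [this, hp]
    have g0 : fe q ((n + 1) - k - (b + 1)) = fe q (n - k - b) := by congr 1; ring
    have g1 := fe_two_even q (x := n - k + b + 1) (y := (n + 1) - k + (b + 1) + 1) (by ring) (by omega) (by omega)
    have g2 := fo_two_odd q (x := n + k + b + 2) (y := (n + 1) + k + (b + 1) + 2) (by ring) (by omega) (by omega)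
    have g3 : fo q ((n + 1) + k - (b + 1) + 1) = fo q (n + k - b + 1) := by congr 1; ring
    simp only [low, hp, hp', gW, if_true, if_false, Bool.false_eq_true, g0, g1, g2, g3]
    ring_nf
  · have hm := par_mod_true hp
    have hp' : par (n + 1) (b + 1) k = true := by
      have := par_same (n := n) (b := b) (k := k) (n' := (n + 1)) (b' := (b + 1)) (k' := k) (by omega)
      rw [this, hp]
    have g0 : fe q ((n + 1) - k - (b + 1)) = fe q (n - k - b) := by congr 1; ring
    have g1 := fe_two_odd q (x := n - k + b + 1) (y := (n + 1) - k + (b + 1) + 1) (by ring) (by omega) (by omega)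
    have g2 := fo_two_even q (x := n + k + b + 2) (y := (n + 1) + k + (b + 1) + 2) (by ring) (by omega) (by omega)
    have g3 : fo q ((n + 1) + k - (b + 1) + 1) = fo q (n + k - b + 1) := by congr 1; ring
    simp only [low, hp, hp', gW, if_true, if_false, Bool.false_eq_true, g0, g1, g2, g3]
    ring_nf
theorem low_d_1 {n b k : ℤ} (hk : 0 ≤ k) (hn : k ≤ n) (h1 : -(n - k) - 1 ≤ b) (h2 : b ≤ n - k)
    (hn' : k ≤ n) (h1' : -(n - k) - 1 ≤ (b + 1)) (h2' : (b + 1) ≤ n - k) :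
    low q .d 1 n b k * gW q n (b + 1) k = low q .e 1 n (b + 1) k * gW q n b k := by
  rcases hp : par n b k
  · have hm := par_mod_false hp
    have hp' : par n (b + 1) k = true := by
      have := par_flip (n := n) (b := b) (k := k) (n' := n) (b' := (b + 1)) (k' := k) (by omega)
      rw [this, hp]; rfl
    have g0 : fe q (n - k - b) = fe q (n - k - (b + 1)) := fe_even q (by ring) (by omega)
    have g1 : fe q (n - k + (b + 1) + 1) = fe q (n - k + b + 1) := fe_even q (by ring) (by omega)
    have g2 := fo_odd q (x := n + k + b + 2) (y := n + k + (b + 1) + 2) (by ring) (by omega) (by omega)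
    have g3 := fo_odd q (x := n + k - (b + 1) + 1) (y := n + k - b + 1) (by ring) (by omega) (by omega)
    simp only [low, hp, hp', gW, if_true, if_false, Bool.false_eq_true, g0, g1, g2, g3]
    ring_nf
  · have hm := par_mod_true hp
    have hp' : par n (b + 1) k = false := by
      have := par_flip (n := n) (b := b) (k := k) (n' := n) (b' := (b + 1)) (k' := k) (by omega)
      rw [this, hp]; rfl
    have g0 := fe_odd q (x := n - k - (b + 1)) (y := n - k - b) (by ring) (by omega) (by omega)
    have g1 := fe_odd q (x := n - k + b + 1) (y := n - k + (b + 1) + 1) (by ring) (by omega) (by omega)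
    have g2 : fo q (n + k + (b + 1) + 2) = fo q (n + k + b + 2) := fo_even q (by ring) (by omega)
    have g3 : fo q (n + k - b + 1) = fo q (n + k - (b + 1) + 1) := fo_even q (by ring) (by omega)
    simp only [low, hp, hp', gW, if_true, if_false, Bool.false_eq_true, g0, g1, g2, g3]
    ring_nf
theorem low_d_2 {n b k : ℤ} (hk : 0 ≤ k) (hn : k ≤ n) (h1 : -(n - k) - 1 ≤ b) (h2 : b ≤ n - k)
    (hn' : k ≤ (n - 1)) (h1' : -((n - 1) - k) - 1 ≤ (b + 1)) (h2' : (b + 1) ≤ (n - 1) - k) :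
    low q .d 2 n b k * gW q (n - 1) (b + 1) k = low q .e 0 (n - 1) (b + 1) k * gW q n b k := by
  rcases hp : par n b k
  · have hm := par_mod_false hp
    have hp' : par (n - 1) (b + 1) k = false := by
      have := par_same (n := n) (b := b) (k := k) (n' := (n - 1)) (b' := (b + 1)) (k' := k) (by omega)
      rw [this, hp]
    have g0 := fe_two_odd q (x := (n - 1) - k - (b + 1)) (y := n - k - b) (by ring) (by omega) (by omega)
    have g1 : fe q ((n - 1) - k + (b + 1) + 1) = fe q (n - k + b + 1) := by congr 1; ring
    have g2 : fo q ((n - 1) + k + (b + 1) + 2) = fo q (n + k + b + 2) := by congr 1; ring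
    have g3 := fo_two_even q (x := (n - 1) + k - (b + 1) + 1) (y := n + k - b + 1) (by ring) (by omega) (by omega)
    simp only [low, hp, hp', gW, if_true, if_false, Bool.false_eq_true, g0, g1, g2, g3]
    ring_nf
  · have hm := par_mod_true hp
    have hp' : par (n - 1) (b + 1) k = true := by
      have := par_same (n := n) (b := b) (k := k) (n' := (n - 1)) (b' := (b + 1)) (k' := k) (by omega)
      rw [this, hp]
    have g0 := fe_two_even q (x := (n - 1) - k - (b + 1)) (y := n - k - b) (by ring) (by omega) (by omega)
    have g1 : fe q ((n - 1) - k + (b + 1) + 1) = fe q (n - k + b + 1) := by congr 1; ring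
    have g2 : fo q ((n - 1) + k + (b + 1) + 2) = fo q (n + k + b + 2) := by congr 1; ring
    have g3 := fo_two_odd q (x := (n - 1) + k - (b + 1) + 1) (y := n + k - b + 1) (by ring) (by omega) (by omega)
    simp only [low, hp, hp', gW, if_true, if_false, Bool.false_eq_true, g0, g1, g2, g3]
    ring_nf

end

/-! ### Admissible points: positivity, and vanishing of coefficients at the boundary. -/

/-- The lattice points which label the basis vectors. -/
def Adm (a n b k : ℤ) : Prop := 0 ≤ k ∧ k ≤ n ∧ -k - 1 ≤ a ∧ a ≤ k ∧ -(n - k) - 1 ≤ b ∧ b ≤ n - k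

/-- The adjoint of a generator. -/
def star : SGen → SGen
  | .x₀ => .x₀ | .x₁ => .x₁s | .x₂ => .x₂s | .x₁s => .x₁ | .x₂s => .x₂
/-- The change of `m₁`. -/
def da : SGen → ℤ
  | .x₁s => 1 | .x₁ => -1 | _ => 0
/-- The change of `m₂`. -/
def dB : SGen → ℤ
  | .x₂s => 1 | .x₂ => -1 | _ => 0
/-- The directions which correspond to the changes of `j`. -/
def dir : Fin 3 → Dir := ![.p, .z, .m]
/-- The reduced operators which occur in a generator. -/
def dr : SGen → Fin 3 → Dir
  | .x₂s, _ => .d | .x₂, _ => .e | _, σ => dir σ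

section
variable (q : Param)

/-- The coefficients which depend on `j`, `m₁`. -/
noncomputable def kk : SGen → Fin 3 → ℤ → ℤ → ℝ
  | .x₀, σ, a, k => kA (dir σ) (rp q) (qz q k) (qz q a)
  | .x₁s, σ, a, k => kB (dir σ) (rp q) (qz q k) (qz q a)
  | .x₁, σ, a, k => kC (dir σ) (rp q) (qz q k) (qz q a)
  | _, σ, _, _ => if σ = 1 then 1 else 0

/-- The factors of `kk` which depend on the basis. -/
noncomputable def kl (g : SGen) (σ : Fin 3) (a k : ℤ) : ℝ :=
  match g, σ with
  | .x₀, 2 => bz q (k + a + 1) * bz q (k - a)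
  | .x₁s, 1 => bz q (k - a)
  | .x₁s, 2 => bz q (k - a) * bz q (k - a - 1)
  | .x₁, 1 => bz q (k + a + 1)
  | .x₁, 2 => bz q (k + a) * bz q (k + a + 1)
  | .x₂s, 0 => 0
  | .x₂s, 2 => 0
  | .x₂, 0 => 0
  | .x₂, 2 => 0
  | _, _ => 1

/-- The factors of `kk` which do not depend on the basis. -/
noncomputable def kr (g : SGen) (σ : Fin 3) (a k : ℤ) : ℝ :=
  match g, σ with
  | .x₀, 0 => qz q a / rp q / bz q (2 * k + 3)
  | .x₀, 1 => kA .z (rp q) (qz q k) (qz q a)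
  | .x₀, 2 => qz q a / rp q / bz q (2 * k + 1)
  | .x₁s, 0 => qz q a / (rp q * qz q k) / bz q (2 * k + 3)
  | .x₁s, 1 => (1 + rp q ^ 4) * qz q a * bz q 1 / (bz q (2 * k + 1) * bz q (2 * k + 3))
  | .x₁s, 2 => -(rp q ^ 3 * qz q k * qz q a) / bz q (2 * k + 1)
  | .x₁, 0 => -(rp q ^ 3 * qz q k * qz q a) / bz q (2 * k + 3)
  | .x₁, 1 => (1 + rp q ^ 4) * (qz q a / rp q ^ 2) * bz q 1 / (bz q (2 * k + 1) * bz q (2 * k + 3))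
  | .x₁, 2 => qz q a / (rp q * qz q k) / bz q (2 * k + 1)
  | .x₂s, 1 => 1
  | .x₂, 1 => 1
  | _, _ => 0

theorem kk_eq (g : SGen) (σ : Fin 3) (a k : ℤ) : kk q g σ a k = kr q g σ a k * kl q g σ a k := by
  have e2 : rp q ^ 2 = qz q 1 := rp_pow q 1
  have e4 : rp q ^ 4 = qz q 2 := rp_pow q 2
  have e6 : rp q ^ 6 = qz q 3 := rp_pow q 3
  have a1 : br (qz q k / qz q a) = bz q (k - a) := by rw [bz, qz_sub]
  have a2 : br (rp q ^ 2 * qz q k * qz q a) = bz q (k + a + 1) := by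
    rw [bz, e2, ← qz_add, ← qz_add]; congr 2; ring
  have a3 : br (qz q k * qz q a) = bz q (k + a) := by rw [bz, qz_add]
  have a4 : br (qz q k / (rp q ^ 2 * qz q a)) = bz q (k - a - 1) := by
    rw [bz, e2, ← qz_add, ← qz_sub]; congr 2; ring
  have a9 : br (rp q ^ 6 * qz q k ^ 2) = bz q (2 * k + 3) := by
    rw [bz, e6, qz_pow, ← qz_add]; congr 2; push_cast; ring
  have a10 : br (rp q ^ 2 * qz q k ^ 2) = bz q (2 * k + 1) := by
    rw [bz, e2, qz_pow, ← qz_add]; congr 2; push_cast; ring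
  have a11 : br (rp q ^ 2) = bz q 1 := by rw [bz, e2]
  cases g <;> fin_cases σ <;>
    simp [kk, kl, kr, dir, kA, kB, kC, a1, a2, a3, a4, a9, a10, a11] <;> ring

theorem kr_rev (g : SGen) (σ : Fin 3) (a k : ℤ) :
    kr q (star g) σ.rev (a + da g) (k + tv σ) = kr q g σ a k := by
  have hp := (rp_pos q).ne'
  have hX := (qz_pos q a).ne'
  have hK := (qz_pos q k).ne'
  have r0 : Fin.rev (0 : Fin 3) = 2 := rfl
  have r1 : Fin.rev (1 : Fin 3) = 1 := rfl
  have r2 : Fin.rev (2 : Fin 3) = 0 := rfl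
  have m1 : 2 * (k + 1) + 1 = 2 * k + 3 := by ring
  have m2 : 2 * (k - 1) + 3 = 2 * k + 1 := by ring
  have v0 : tv 0 = 1 := rfl
  have v1 : tv 1 = 0 := rfl
  have v2 : tv 2 = -1 := rfl
  cases g <;> fin_cases σ <;> simp only [Fin.zero_eta, Fin.mk_one, Fin.reduceFinMk, r0, r1, r2, v0, v1, v2, star, da, kr, add_zero, ← sub_eq_add_neg, qz_succ, qz_pred, m1, m2] <;>
    first | done | (field_simp; done)

/-- The analogue of `low_rev` for m₁ and j. There is no parity here, so ordinary products of
brackets serve as weights. -/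
theorem kl_rev (g : SGen) (σ : Fin 3) {a k : ℤ} (h1 : -k - 1 ≤ a) (h2 : a ≤ k)
    (h1' : -(k + tv σ) - 1 ≤ a + da g) (h2' : a + da g ≤ k + tv σ) :
    kl q g σ a k * gV q (a + da g) (k + tv σ) = kl q (star g) σ.rev (a + da g) (k + tv σ) * gV q a k := by
  have r0 : Fin.rev (0 : Fin 3) = 2 := rfl
  have r1 : Fin.rev (1 : Fin 3) = 1 := rfl
  have r2 : Fin.rev (2 : Fin 3) = 0 := rfl
  have v0 : tv 0 = 1 := rfl
  have v1 : tv 1 = 0 := rfl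
  have v2 : tv 2 = -1 := rfl
  have two : ∀ {x y : ℤ}, y = x + 2 → 0 ≤ x → ff q y = bz q y * (bz q (y - 1) * ff q x) := by
    intro x y h h0
    rw [ff_succ q (x := y - 1) (by omega) (by omega), ff_succ q (x := x) (y := y - 1) (by omega) h0]
  cases g <;> fin_cases σ <;> simp only [Fin.zero_eta, Fin.mk_one, Fin.reduceFinMk, r0, r1, r2, v0, v1, v2, star, da, kl, gV] at h1' h2' ⊢
  · rw [ff_succ q (x := k + a + 1) (y := k + 1 + (a + 0) + 1) (by ring) (by omega), ff_succ q (x := k - a) (y := k + 1 - (a + 0)) (by ring) (by omega)]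
    ring_nf
  · ring_nf
  · rw [ff_succ q (x := k + -1 + (a + 0) + 1) (y := k + a + 1) (by ring) (by omega), ff_succ q (x := k + -1 - (a + 0)) (y := k - a) (by ring) (by omega)]
    ring_nf
  · rw [two (x := k - a) (y := k + 1 - (a + -1)) (by ring) (by omega)]
    ring_nf
  · rw [ff_succ q (x := k + 0 + (a + -1) + 1) (y := k + a + 1) (by ring) (by omega), ff_succ q (x := k - a) (y := k + 0 - (a + -1)) (by ring) (by omega)]
    ring_nf
  · rw [two (x := k + -1 + (a + -1) + 1) (y := k + a + 1) (by ring) (by omega)]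
    ring_nf
  · simp
  · ring_nf
  · simp
  · rw [two (x := k + a + 1) (y := k + 1 + (a + 1) + 1) (by ring) (by omega)]
    ring_nf
  · rw [ff_succ q (x := k + a + 1) (y := k + 0 + (a + 1) + 1) (by ring) (by omega), ff_succ q (x := k + 0 - (a + 1)) (y := k - a) (by ring) (by omega)]
    ring_nf
  · rw [two (x := k + -1 - (a + 1)) (y := k - a) (by ring) (by omega)]
    ring_nf
  · simp
  · ring_nf
  · simp

theorem low_rev (f : Dir) (δ : Fin 3) {n b k : ℤ} (hk : 0 ≤ k) (hn : k ≤ n) (h1 : -(n - k) - 1 ≤ b) (h2 : b ≤ n - k)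
    (hk' : 0 ≤ k + dk f) (hn' : k + dk f ≤ n + tv δ) (h1' : -(n + tv δ - (k + dk f)) - 1 ≤ b + db f)
    (h2' : b + db f ≤ n + tv δ - (k + dk f)) :
    low q f δ n b k * gW q (n + tv δ) (b + db f) (k + dk f) =
      low q (rev f) δ.rev (n + tv δ) (b + db f) (k + dk f) * gW q n b k := by
  have r0 : Fin.rev (0 : Fin 3) = 2 := rfl
  have r1 : Fin.rev (1 : Fin 3) = 1 := rfl
  have r2 : Fin.rev (2 : Fin 3) = 0 := rfl
  have v0 : tv 0 = 1 := rfl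
  have v1 : tv 1 = 0 := rfl
  have v2 : tv 2 = -1 := rfl
  cases f <;> fin_cases δ <;>
    simp only [Fin.zero_eta, Fin.mk_one, Fin.reduceFinMk, r0, r1, r2, v0, v1, v2, rev, db, dk, add_zero, ← sub_eq_add_neg] at hk' hn' h1' h2' ⊢
  · exact low_p_0 q hk hn h1 h2 hn' h1' h2'
  · exact low_p_1 q hk hn h1 h2 hn' h1' h2'
  · exact low_p_2 q hk hn h1 h2 hn' h1' h2'
  · exact low_z_0 q hk hn h1 h2 hn' h1' h2'
  · exact low_z_2 q hk hn h1 h2 hn' h1' h2'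
  · simpa using (low_p_2 q (n := n + 1) (b := b) (k := k - 1) hk' hn' h1' h2' (by omega) (by omega) (by omega)).symm
  · simpa using (low_p_1 q (n := n) (b := b) (k := k - 1) hk' hn' h1' h2' (by omega) (by omega) (by omega)).symm
  · simpa using (low_p_0 q (n := n - 1) (b := b) (k := k - 1) hk' hn' h1' h2' (by omega) (by omega) (by omega)).symm
  · exact low_d_0 q hk hn h1 h2 hn' h1' h2'
  · exact low_d_1 q hk hn h1 h2 hn' h1' h2'
  · exact low_d_2 q hk hn h1 h2 hn' h1' h2'
  · simpa using (low_d_2 q (n := n + 1) (b := b - 1) (k := k) hk' hn' h1' h2' (by omega) (by omega) (by omega)).symm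
  · simpa using (low_d_1 q (n := n) (b := b - 1) (k := k) hk' hn' h1' h2' (by omega) (by omega) (by omega)).symm
  · simpa using (low_d_0 q (n := n - 1) (b := b - 1) (k := k) hk' hn' h1' h2' (by omega) (by omega) (by omega)).symm

/-- The parity keeps the arguments of the brackets non-negative: n - k - b - 1 ≥ 0 when n - k - b is
odd, and n - k + b ≥ 0 when it is even. -/
theorem low_nonneg (f : Dir) (δ : Fin 3) {n b k : ℤ} (hk : 0 ≤ k) (hn : k ≤ n) (h1 : -(n - k) - 1 ≤ b) (h2 : b ≤ n - k) :
    0 ≤ low q f δ n b k := by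
  rcases hp : par n b k
  · have := par_mod_false hp
    cases f <;> fin_cases δ <;> simp only [Fin.zero_eta, Fin.mk_one, Fin.reduceFinMk, low, hp, if_false, Bool.false_eq_true] <;>
      first | exact zero_le_one | (apply bz_nonneg; omega) | (apply mul_nonneg <;> apply bz_nonneg <;> omega)
  · have := par_mod_true hp
    by_cases hb : n - k - b = 0
    · have e : n - k + b = 2 * b := by omega
      cases f <;> fin_cases δ <;> simp only [Fin.zero_eta, Fin.mk_one, Fin.reduceFinMk, low, hp, if_true, hb, bz_zero, mul_zero, zero_mul, le_refl] <;>
        first | exact zero_le_one | (apply bz_nonneg; omega) | (apply mul_nonneg <;> apply bz_nonneg <;> omega)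
    by_cases hb' : b = -(n - k) - 1
    · exfalso; omega
    cases f <;> fin_cases δ <;> simp only [Fin.zero_eta, Fin.mk_one, Fin.reduceFinMk, low, hp, if_true] <;>
      first | exact zero_le_one | (apply bz_nonneg; omega) | (apply mul_nonneg <;> apply bz_nonneg <;> omega)

/-- A step across the edge of the region carries a bracket with argument 0. The condition on j alone
is assumed here; it comes from `kl_exit`. -/
theorem low_exit (f : Dir) (δ : Fin 3) {n b k : ℤ} (hk : 0 ≤ k) (hn : k ≤ n) (h1 : -(n - k) - 1 ≤ b) (h2 : b ≤ n - k)
    (hk' : 0 ≤ k + dk f) (h : low q f δ n b k ≠ 0) : k + dk f ≤ n + tv δ ∧ -(n + tv δ - (k + dk f)) - 1 ≤ b + db f ∧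
    b + db f ≤ n + tv δ - (k + dk f) := by
  have z : ∀ {x : ℤ}, bz q x ≠ 0 → x ≠ 0 := by
    rintro x hx rfl
    exact hx (bz_zero q)
  have v0 : tv 0 = 1 := rfl
  have v1 : tv 1 = 0 := rfl
  have v2 : tv 2 = -1 := rfl
  rcases hp : par n b k
  · have := par_mod_false hp
    cases f <;> fin_cases δ <;> simp only [Fin.zero_eta, Fin.mk_one, Fin.reduceFinMk, low, hp, if_false, Bool.false_eq_true, v0, v1, v2, dk, db, mul_ne_zero_iff] at h hk' ⊢ <;>
      first | omega | (have := z h; omega) | (have := z h.1; have := z h.2; omega)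
  · have := par_mod_true hp
    cases f <;> fin_cases δ <;> simp only [Fin.zero_eta, Fin.mk_one, Fin.reduceFinMk, low, hp, if_true, v0, v1, v2, dk, db, mul_ne_zero_iff] at h hk' ⊢ <;>
      first | omega | (have := z h; omega) | (have := z h.1; have := z h.2; omega)

theorem kl_nonneg (g : SGen) (σ : Fin 3) {a k : ℤ} (h1 : -k - 1 ≤ a) (h2 : a ≤ k) : 0 ≤ kl q g σ a k := by
  -- On the edge a = k the second bracket of a product can be negative, but the first one vanishes;
  -- the edge a = -k - 1 is similar.
  by_cases e1 : k - a = 0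
  · cases g <;> fin_cases σ <;> simp only [Fin.zero_eta, Fin.mk_one, Fin.reduceFinMk, kl, e1, bz_zero, mul_zero, zero_mul, le_refl, zero_le_one] <;>
      first | (apply bz_nonneg; omega) | (apply mul_nonneg <;> apply bz_nonneg <;> omega)
  by_cases e2 : k + a + 1 = 0
  · cases g <;> fin_cases σ <;> simp only [Fin.zero_eta, Fin.mk_one, Fin.reduceFinMk, kl, e2, bz_zero, mul_zero, zero_mul, le_refl, zero_le_one] <;>
      first | (apply bz_nonneg; omega) | (apply mul_nonneg <;> apply bz_nonneg <;> omega)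
  cases g <;> fin_cases σ <;> simp only [Fin.zero_eta, Fin.mk_one, Fin.reduceFinMk, kl, le_refl, zero_le_one] <;>
    first | (apply bz_nonneg; omega) | (apply mul_nonneg <;> apply bz_nonneg <;> omega)

theorem kl_exit (g : SGen) (σ : Fin 3) {a k : ℤ} (hk : 0 ≤ k) (h1 : -k - 1 ≤ a) (h2 : a ≤ k) (h : kl q g σ a k ≠ 0) :
    0 ≤ k + tv σ ∧ -(k + tv σ) - 1 ≤ a + da g ∧ a + da g ≤ k + tv σ := by
  have z : ∀ {x : ℤ}, bz q x ≠ 0 → x ≠ 0 := by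
    rintro x hx rfl
    exact hx (bz_zero q)
  have v0 : tv 0 = 1 := rfl
  have v1 : tv 1 = 0 := rfl
  have v2 : tv 2 = -1 := rfl
  cases g <;> fin_cases σ <;> simp only [Fin.zero_eta, Fin.mk_one, Fin.reduceFinMk, kl, v0, v1, v2, da, mul_ne_zero_iff, ne_eq, not_true_eq_false] at h ⊢ <;>
    first | omega | (have := z h; omega) | (have := z h.1; have := z h.2; omega)

end

/-! ### The Hilbert space in integral coordinates. -/

theorem admissible_iff (a n b k : ℤ) :
    Admissible ((n : ℝ) + 1 / 2) (a + 1 / 2) (b + 1 / 2) (k + 1 / 2) ↔ Adm a n b k := by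
  have key : ∀ (x y : ℤ) , (∃ m : ℕ, (x : ℝ) + 1 / 2 - |(y : ℝ) + 1 / 2| = m) ↔ -x - 1 ≤ y ∧ y ≤ x := by
    intro x y
    rcases le_or_gt 0 y with hy | hy
    · have : (0 : ℝ) ≤ (y : ℝ) + 1 / 2 := by
        have : (0 : ℝ) ≤ y := by exact_mod_cast hy
        linarith
      rw [abs_of_nonneg this]
      constructor
      · rintro ⟨m, hm⟩
        have : (x : ℝ) - y = m := by linarith
        have : x - y = m := by exact_mod_cast this
        omega
      · intro h
        refine ⟨(x - y).toNat, ?_⟩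
        have : (((x - y).toNat : ℤ) : ℝ) = ((x - y : ℤ) : ℝ) := by rw [Int.toNat_of_nonneg (by omega)]
        push_cast at this
        linarith
    · have : (y : ℝ) + 1 / 2 ≤ 0 := by
        have : (y : ℝ) ≤ -1 := by exact_mod_cast (by omega : y ≤ -1)
        linarith
      rw [abs_of_nonpos this]
      constructor
      · rintro ⟨m, hm⟩
        have : (x : ℝ) + y + 1 = m := by linarith
        have : x + y + 1 = m := by exact_mod_cast this
        omega
      · intro h
        refine ⟨(x + y + 1).toNat, ?_⟩
        have : (((x + y + 1).toNat : ℤ) : ℝ) = ((x + y + 1 : ℤ) : ℝ) := by rw [Int.toNat_of_nonneg (by omega)]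
        push_cast at this
        linarith
  have nat : ∀ x : ℤ, (∃ m : ℕ, (x : ℝ) + 1 / 2 = m + 1 / 2) ↔ 0 ≤ x := by
    intro x
    constructor
    · rintro ⟨m, hm⟩
      have : (x : ℝ) = m := by linarith
      have : x = m := by exact_mod_cast this
      omega
    · intro h
      refine ⟨x.toNat, ?_⟩
      have : ((x.toNat : ℤ) : ℝ) = x := by rw [Int.toNat_of_nonneg h]
      push_cast at this
      rw [this]
  have e : (n : ℝ) + 1 / 2 + 1 / 2 - (k + 1 / 2) - |(b : ℝ) + 1 / 2| = ((n - k : ℤ) : ℝ) + 1 / 2 - |(b : ℝ) + 1 / 2| := by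
    push_cast; ring
  have le : (k : ℝ) + 1 / 2 ≤ n + 1 / 2 ↔ k ≤ n := by
    rw [add_le_add_iff_right]; exact_mod_cast Iff.rfl
  simp only [Admissible, e, key, nat, le, Adm]
  omega

theorem Admissible.exists_int {l m₁ m₂ j : ℝ} (h : Admissible l m₁ m₂ j) :
    ∃ a n b k : ℤ, l = n + 1 / 2 ∧ m₁ = a + 1 / 2 ∧ m₂ = b + 1 / 2 ∧ j = k + 1 / 2 ∧ Adm a n b k := by
  have h' := h
  obtain ⟨⟨n, rfl⟩, ⟨k, rfl⟩, -, ⟨x, hx⟩, ⟨y, hy⟩⟩ := h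
  have h1 : ∃ a : ℤ, m₁ = a + 1 / 2 := by
    rcases abs_cases m₁ with ⟨e, -⟩ | ⟨e, -⟩
    · exact ⟨k - x, by push_cast; linarith⟩
    · exact ⟨x - k - 1, by push_cast; linarith⟩
  have h2 : ∃ b : ℤ, m₂ = b + 1 / 2 := by
    rcases abs_cases m₂ with ⟨e, -⟩ | ⟨e, -⟩
    · exact ⟨n - k - y, by push_cast; linarith⟩
    · exact ⟨y - (n - k) - 1, by push_cast; linarith⟩
  obtain ⟨a, rfl⟩ := h1
  obtain ⟨b, rfl⟩ := h2
  refine ⟨a, n, b, k, by push_cast; rfl, rfl, rfl, by push_cast; rfl, ?_⟩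
  rw [← admissible_iff]
  exact_mod_cast h'

/-- The index with given integral coordinates. -/
noncomputable def ind {a n b k : ℤ} (h : Adm a n b k) : SpinorIndex :=
  ⟨n + 1 / 2, a + 1 / 2, b + 1 / 2, k + 1 / 2, (admissible_iff a n b k).2 h⟩

theorem exists_ind (v : SpinorIndex) : ∃ a n b k, ∃ h : Adm a n b k, v = ind h := by
  obtain ⟨l, m₁, m₂, j, hv⟩ := v
  obtain ⟨a, n, b, k, rfl, rfl, rfl, rfl, h⟩ := hv.exists_int
  exact ⟨a, n, b, k, h, rfl⟩

theorem ind_inj {a n b k a' n' b' k' : ℤ} (h : Adm a n b k) (h' : Adm a' n' b' k') :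
    ind h = ind h' ↔ a = a' ∧ n = n' ∧ b = b' ∧ k = k' := by
  simp only [ind, SpinorIndex.mk.injEq, add_left_inj, Int.cast_inj]
  tauto

open scoped Classical in
/-- The extension by zero of a function of the index to the lattice. -/
noncomputable def ext (f : SpinorIndex → ℂ) (a n b k : ℤ) : ℂ := if h : Adm a n b k then f (ind h) else 0

theorem ext_adm (f : SpinorIndex → ℂ) {a n b k : ℤ} (h : Adm a n b k) : ext f a n b k = f (ind h) := dif_pos h
theorem ext_not (f : SpinorIndex → ℂ) {a n b k : ℤ} (h : ¬Adm a n b k) : ext f a n b k = 0 := dif_neg h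

theorem ext_inj {f g : SpinorSpace} (h : ∀ a n b k, Adm a n b k → ext f a n b k = ext g a n b k) : f = g := by
  apply lp.ext
  funext v
  obtain ⟨a, n, b, k, hv, rfl⟩ := exists_ind v
  rw [← ext_adm f hv, ← ext_adm g hv, h a n b k hv]

theorem ext_add (f g : SpinorSpace) (a n b k : ℤ) : ext (f + g : SpinorSpace) a n b k = ext f a n b k + ext g a n b k := by
  by_cases h : Adm a n b k
  · rw [ext_adm _ h, ext_adm _ h, ext_adm _ h]; rfl
  · rw [ext_not _ h, ext_not _ h, ext_not _ h, add_zero]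
theorem ext_sub (f g : SpinorSpace) (a n b k : ℤ) : ext (f - g : SpinorSpace) a n b k = ext f a n b k - ext g a n b k := by
  by_cases h : Adm a n b k
  · rw [ext_adm _ h, ext_adm _ h, ext_adm _ h]; rfl
  · rw [ext_not _ h, ext_not _ h, ext_not _ h, sub_zero]
theorem ext_smul (c : ℂ) (f : SpinorSpace) (a n b k : ℤ) : ext (c • f : SpinorSpace) a n b k = c * ext f a n b k := by
  by_cases h : Adm a n b k
  · rw [ext_adm _ h, ext_adm _ h]; rfl
  · rw [ext_not _ h, ext_not _ h, mul_zero]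
theorem ext_zero (a n b k : ℤ) : ext (0 : SpinorSpace) a n b k = 0 := by
  by_cases h : Adm a n b k
  · rw [ext_adm _ h]; rfl
  · rw [ext_not _ h]
theorem ext_sum {ι : Type*} (s : Finset ι) (f : ι → SpinorSpace) (a n b k : ℤ) :
    ext (∑ i ∈ s, f i : SpinorSpace) a n b k = ∑ i ∈ s, ext (f i) a n b k := by
  classical
  induction s using Finset.induction_on with
  | empty => rw [Finset.sum_empty, Finset.sum_empty, ext_zero]
  | insert i s hi ih => rw [Finset.sum_insert hi, ext_add, ih, Finset.sum_insert hi]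

/-- A translation of the labels is injective where it stays admissible, so a weighted shift is
bounded on ℓ² by the supremum of its weights. Translates outside the region contribute nothing,
since `ext` vanishes there. -/
theorem exists_shift (c : ℤ → ℤ → ℤ → ℤ → ℂ) (da dn db dk : ℤ) (M : ℝ)
    (hc : ∀ a n b k, Adm a n b k → Adm (a + da) (n + dn) (b + db) (k + dk) → ‖c a n b k‖ ≤ M) :
    ∃ T : SpinorSpace →L[ℂ] SpinorSpace, ∀ f a n b k, Adm a n b k →
      ext (T f) a n b k = c a n b k * ext f (a + da) (n + dn) (b + db) (k + dk) := by
  classical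
  have hM : 0 ≤ max M 0 := le_max_right _ _
  choose A N B K hA hv using exists_ind
  let g : SpinorSpace → SpinorIndex → ℂ := fun f v => c (A v) (N v) (B v) (K v) * ext f (A v + da) (N v + dn) (B v + db) (K v + dk)
  have e2 : (2 : ENNReal).toReal = 2 := by norm_num
  have hp : 0 < (2 : ENNReal).toReal := by norm_num
  let P : SpinorIndex → Prop := fun v => Adm (A v + da) (N v + dn) (B v + db) (K v + dk)
  -- The value of φ outside P is irrelevant: the sums are restricted to P.
  let φ : SpinorIndex → SpinorIndex := fun v => if h : P v then ind h else v
  have hφ : ∀ v w, P v → P w → φ v = φ w → v = w := by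
    intro v w h h' e
    simp only [φ, dif_pos h, dif_pos h', ind_inj] at e
    rw [hv v, hv w, ind_inj]
    omega
  have bound : ∀ (f : SpinorSpace) (s : Finset SpinorIndex),
      ∑ i ∈ s, ‖g f i‖ ^ (2 : ENNReal).toReal ≤ (max M 0 * ‖f‖) ^ (2 : ENNReal).toReal := by
    intro f s
    have h1 : ∑ i ∈ s, ‖g f i‖ ^ (2 : ENNReal).toReal ≤
        ∑ i ∈ s.filter P, (max M 0) ^ (2 : ENNReal).toReal * ‖f (φ i)‖ ^ (2 : ENNReal).toReal := by
      rw [Finset.sum_filter]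
      refine Finset.sum_le_sum fun i _ => ?_
      by_cases h : P i
      · rw [if_pos h, ← Real.mul_rpow hM (norm_nonneg _)]
        refine Real.rpow_le_rpow (norm_nonneg _) ?_ hp.le
        simp only [g, norm_mul, φ, dif_pos h, ext_adm _ h]
        exact mul_le_mul_of_nonneg_right ((hc _ _ _ _ (hA i) h).trans (le_max_left _ _)) (norm_nonneg _)
      · rw [if_neg h]
        simp [g, ext_not _ h]
    have h2 : ∑ i ∈ s.filter P, ‖f (φ i)‖ ^ (2 : ENNReal).toReal ≤ ‖f‖ ^ (2 : ENNReal).toReal := by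
      rw [← Finset.sum_image (s := s.filter P) (g := φ) (f := fun i => ‖f i‖ ^ (2 : ENNReal).toReal)]
      · exact lp.sum_rpow_le_norm_rpow hp f _
      · intro v hv w hw e
        exact hφ v w (Finset.mem_filter.1 hv).2 (Finset.mem_filter.1 hw).2 e
    rw [← Finset.mul_sum] at h1
    rw [Real.mul_rpow hM (norm_nonneg _)]
    exact h1.trans (mul_le_mul_of_nonneg_left h2 (Real.rpow_nonneg hM _))
  let L : SpinorSpace →ₗ[ℂ] SpinorSpace :=
    { toFun := fun f => ⟨g f, memℓp_gen' (bound f)⟩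
      map_add' := by
        intro x y
        apply lp.ext
        funext v
        change _ * ext (x + y : SpinorSpace) _ _ _ _ = _ * ext x _ _ _ _ + _ * ext y _ _ _ _
        rw [ext_add, mul_add]
      map_smul' := by
        intro r x
        apply lp.ext
        funext v
        change _ * ext (r • x : SpinorSpace) _ _ _ _ = r * (_ * ext x _ _ _ _)
        rw [ext_smul, mul_left_comm] }
  refine ⟨L.mkContinuous (max M 0) fun f => lp.norm_le_of_forall_sum_le hp (by positivity) (bound f), ?_⟩
  intro f a n b k h
  rw [ext_adm _ h]
  change g f (ind h) = _
  have := hv (ind h)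
  rw [ind_inj] at this
  obtain ⟨e1, e2, e3, e4⟩ := this
  simp only [g, ← e1, ← e2, ← e3, ← e4]

theorem exists_op (c : Fin 3 → Fin 3 → ℤ → ℤ → ℤ → ℤ → ℂ) (da db : ℤ) (M : ℝ)
    (hc : ∀ σ δ a n b k, Adm a n b k → Adm (a + da) (n + tv δ) (b + db) (k + tv σ) → ‖c σ δ a n b k‖ ≤ M) :
    ∃ T : SpinorSpace →L[ℂ] SpinorSpace, ∀ f a n b k, Adm a n b k →
      ext (T f) a n b k = ∑ σ, ∑ δ, c σ δ a n b k * ext f (a + da) (n + tv δ) (b + db) (k + tv σ) := by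
  choose T hT using fun σ δ => exists_shift (c σ δ) da (tv δ) db (tv σ) M (hc σ δ)
  refine ⟨∑ σ, ∑ δ, T σ δ, fun f a n b k h => ?_⟩
  simp only [sum_apply, ext_sum, hT _ _ f a n b k h]

/-- The vector of the basis at a lattice point, which is zero if the point is not admissible. -/
noncomputable def vec (a n b k : ℤ) : SpinorSpace := ket (n + 1 / 2) (a + 1 / 2) (b + 1 / 2) (k + 1 / 2)

theorem vec_adm {a n b k : ℤ} (h : Adm a n b k) : vec a n b k = lp.single 2 (ind h) (1 : ℂ) :=
  dif_pos ((admissible_iff a n b k).2 h)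
theorem vec_not {a n b k : ℤ} (h : ¬Adm a n b k) : vec a n b k = 0 :=
  dif_neg (fun h' => h ((admissible_iff a n b k).1 h'))

theorem ext_vec {a n b k : ℤ} (a' n' b' k' : ℤ) (h : Adm a n b k) :
    ext (vec a' n' b' k') a n b k = if a = a' ∧ n = n' ∧ b = b' ∧ k = k' then 1 else 0 := by
  rw [ext_adm _ h]
  by_cases h' : Adm a' n' b' k'
  · rw [vec_adm h', lp.single_apply, Pi.single_apply]
    simp only [ind_inj]
  · rw [vec_not h', if_neg]
    · rfl
    · rintro ⟨rfl, rfl, rfl, rfl⟩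
      exact h' h

theorem inner_vec (a n b k : ℤ) (f : SpinorSpace) : inner ℂ (vec a n b k) f = ext f a n b k := by
  by_cases h : Adm a n b k
  · rw [vec_adm h, ext_adm _ h, lp.inner_single_left]
    simp
  · rw [vec_not h, ext_not _ h, inner_zero_left]

theorem star_star (g : SGen) : star (star g) = g := by cases g <;> rfl
theorem da_star (g : SGen) : da (star g) = -da g := by cases g <;> rfl
theorem dB_star (g : SGen) : dB (star g) = -dB g := by cases g <;> rfl
theorem dr_star (g : SGen) (σ : Fin 3) : dr (star g) σ.rev = rev (dr g σ) := by
  cases g <;> fin_cases σ <;> rfl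
theorem db_dr (g : SGen) (σ : Fin 3) : db (dr g σ) = dB g := by
  cases g <;> fin_cases σ <;> rfl

section
variable (q : Param)

/-- The coefficients of the generators in the rational gauge. -/
noncomputable def mv (g : SGen) (σ δ : Fin 3) (a n b k : ℤ) : ℝ := kk q g σ a k * lc q (dr g σ) δ n b k

/-- The coefficients of the generators in the orthonormal basis. -/
noncomputable def hc (g : SGen) (σ δ : Fin 3) (a n b k : ℤ) : ℝ :=
  kr q g σ a k * rr q (dr g σ) δ n b k *
    √(kl q g σ a k * kl q (star g) σ.rev (a + da g) (k + tv σ)) *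
    √(low q (dr g σ) δ n b k * low q (rev (dr g σ)) δ.rev (n + tv δ) (b + dB g) (k + tv σ))

/-- The gauge factor. -/
noncomputable def gg (a n b k : ℤ) : ℝ := √(gW q n b k * gV q a k)

/-- The sign of the part of a generator which preserves `l`. -/
def sg (s : ℝ) (δ : Fin 3) : ℝ := if δ = 1 then s else 1

theorem gg_pos (a n b k : ℤ) : 0 < gg q a n b k := Real.sqrt_pos.2 (mul_pos (gW_pos q _ _ _) (gV_pos q _ _))

theorem kr_ne {g : SGen} {σ : Fin 3} {a k : ℤ} (h : kr q g σ a k ≠ 0) : dk (dr g σ) = tv σ := by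
  cases g <;> fin_cases σ <;> first | rfl | (exfalso; exact h rfl)

/-- The factors `kr` and `rr` do not see the direction of a step, and each square root contains both
directions. The case distinction is there because for x₂ and x₂* the values σ ≠ 1 do not correspond
to a change of j; then `kr` is zero. -/
theorem hc_rev (g : SGen) (σ δ : Fin 3) (a n b k : ℤ) :
    hc q (star g) σ.rev δ.rev (a + da g) (n + tv δ) (b + dB g) (k + tv σ) = hc q g σ δ a n b k := by
  have e1 : a + da g + -da g = a := by ring
  have e2 : k + tv σ + -tv σ = k := by ring
  have e3 : n + tv δ + -tv δ = n := by ring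
  have e4 : b + dB g + -dB g = b := by ring
  by_cases h : kr q g σ a k = 0
  · rw [hc, hc, kr_rev, h]; simp
  · have h' := kr_ne q h
    have r := rr_rev q (dr g σ) δ n b k
    rw [h', db_dr] at r
    rw [hc, hc, kr_rev, dr_star, r, rev_rev, star_star, da_star, dB_star, tv_rev, tv_rev, Fin.rev_rev, Fin.rev_rev, e1, e2, e3, e4,
      mul_comm (kl q (star g) _ _ _), mul_comm (low q (rev _) _ _ _ _)]

/-- Seen from an admissible point, only admissible points matter. This allows the relations on the
whole lattice to be used on the Hilbert space. -/
theorem mv_exit (g : SGen) (σ δ : Fin 3) {a n b k : ℤ} (hv : Adm a n b k) (h : mv q g σ δ a n b k ≠ 0) :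
    Adm (a + da g) (n + tv δ) (b + dB g) (k + tv σ) := by
  obtain ⟨hk, hn, h1, h2, h3, h4⟩ := hv
  rw [mv, kk_eq, lc_eq, mul_ne_zero_iff, mul_ne_zero_iff, mul_ne_zero_iff] at h
  obtain ⟨⟨i1, i2⟩, -, i3⟩ := h
  have h' := kr_ne q i1
  obtain ⟨j1, j2, j3⟩ := kl_exit q g σ hk h1 h2 i2
  obtain ⟨j4, j5, j6⟩ := low_exit q (dr g σ) δ hk hn h3 h4 (by omega) i3
  rw [h', db_dr] at *
  exact ⟨j1, j4, j2, j3, j5, j6⟩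

theorem sqrt_gauge {x y V V' : ℝ} (hx : 0 ≤ x) (hV : 0 < V) (h : x * V' = y * V) : √(x * y) * √V = x * √V' := by
  rw [← Real.sqrt_mul' _ hV.le, mul_assoc, ← h, ← mul_assoc, Real.sqrt_mul (mul_nonneg hx hx), Real.sqrt_mul_self hx]

/-- Conjugation by the gauge factor turns the rational coefficients into the symmetric ones: take
square roots in `kl_rev` and `low_rev`. -/
theorem hc_gg (g : SGen) (σ δ : Fin 3) {a n b k : ℤ} (hv : Adm a n b k)
    (hv' : Adm (a + da g) (n + tv δ) (b + dB g) (k + tv σ)) :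
    hc q g σ δ a n b k * gg q a n b k = mv q g σ δ a n b k * gg q (a + da g) (n + tv δ) (b + dB g) (k + tv σ) := by
  obtain ⟨hk, hn, h1, h2, h3, h4⟩ := hv
  obtain ⟨hk', hn', h1', h2', h3', h4'⟩ := hv'
  rw [mv, kk_eq, lc_eq, hc]
  by_cases h : kr q g σ a k = 0
  · rw [h]; simp
  · have h' := kr_ne q h
    have k1 := kl_rev q g σ h1 h2 h1' h2'
    have k2 := low_rev q (dr g σ) δ hk hn h3 h4 (by omega) (by omega) (by rw [h', db_dr]; exact h3') (by rw [h', db_dr]; exact h4')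
    rw [h', db_dr] at k2
    have k3 := sqrt_gauge (kl_nonneg q g σ h1 h2) (gV_pos q a k) k1
    have k4 := sqrt_gauge (low_nonneg q (dr g σ) δ hk hn h3 h4) (gW_pos q n b k) k2
    rw [gg, gg, Real.sqrt_mul (gW_pos q _ _ _).le, Real.sqrt_mul (gW_pos q _ _ _).le]
    linear_combination kr q g σ a k * rr q (dr g σ) δ n b k * (√(low q (dr g σ) δ n b k * low q (rev (dr g σ)) δ.rev (n + tv δ) (b + dB g) (k + tv σ)) * √(gW q n b k)) * k3 +
      kr q g σ a k * rr q (dr g σ) δ n b k * kl q g σ a k * √(gV q (a + da g) (k + tv σ)) * k4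

/-- Along a step followed by its reverse the gauge factors cancel. -/
theorem hc_mul (g : SGen) (σ δ : Fin 3) {a n b k : ℤ} (hv : Adm a n b k)
    (hv' : Adm (a + da g) (n + tv δ) (b + dB g) (k + tv σ)) :
    mv q g σ δ a n b k * mv q (star g) σ.rev δ.rev (a + da g) (n + tv δ) (b + dB g) (k + tv σ) = hc q g σ δ a n b k ^ 2 := by
  have e1 : a + da g + -da g = a := by ring
  have e2 : k + tv σ + -tv σ = k := by ring
  have e3 : n + tv δ + -tv δ = n := by ring
  have e4 : b + dB g + -dB g = b := by ring
  have h1 := hc_gg q g σ δ hv hv'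
  have h2 := hc_gg q (star g) σ.rev δ.rev hv' (by rw [da_star, dB_star, tv_rev, tv_rev, e1, e2, e3, e4]; exact hv)
  rw [hc_rev, da_star, dB_star, tv_rev, tv_rev, e1, e2, e3, e4] at h2
  have p1 := (gg_pos q a n b k).ne'
  have p2 := (gg_pos q (a + da g) (n + tv δ) (b + dB g) (k + tv σ)).ne'
  have h3 : mv q g σ δ a n b k * mv q (star g) σ.rev δ.rev (a + da g) (n + tv δ) (b + dB g) (k + tv σ) *
      (gg q (a + da g) (n + tv δ) (b + dB g) (k + tv σ) * gg q a n b k) = hc q g σ δ a n b k ^ 2 *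
      (gg q (a + da g) (n + tv δ) (b + dB g) (k + tv σ) * gg q a n b k) := by
    linear_combination -(hc q g σ δ a n b k * gg q (a + da g) (n + tv δ) (b + dB g) (k + tv σ)) * h1 -
      mv q g σ δ a n b k * gg q (a + da g) (n + tv δ) (b + dB g) (k + tv σ) * h2
  exact mul_right_cancel₀ (mul_ne_zero p2 p1) h3

theorem lat_eq (s : ℝ) (g : SGen) (u : ℤ → ℤ → ℤ → ℤ → ℂ) (a n b k : ℤ) :
    lat q s g u a n b k = ∑ σ, ∑ δ, ((sg s δ * mv q g σ δ a n b k : ℝ) : ℂ) * u (a + da g) (n + tv δ) (b + dB g) (k + tv σ) := by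
  have v0 : tv 0 = 1 := rfl
  have v1 : tv 1 = 0 := rfl
  have v2 : tv 2 = -1 := rfl
  cases g <;> simp only [lat, spin, rop, Fin.sum_univ_three, mv, kk, sg, lc, dir, dr, da, dB, v0, v1, v2, db, dk] <;>
    simp [Matrix.cons_val_zero, sub_eq_add_neg] <;> ring

end

/-! ### A Casimir identity for the parts which preserve l. -/

section
variable {F : Type*} [Field F] {p K A X B : F}

/-- The contribution of a reduced operator to the Casimir element. -/
def casimirWeight (f : Dir) (p K A : F) : F :=
  (1 + p ^ 4) * (kA f p K A * kA (rev f) p (kS f p K) A) + kC f p K A * kB (rev f) p (kS f p K) (A / p ^ 2) +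
    (p ^ 4)⁻¹ * (kB f p K A * kC (rev f) p (kS f p K) (p ^ 2 * A))

/-- The weights 1 + q², 1, q⁻² of x₀x₀, x₁x₁*, x₁*x₁ are such that the dependence on m₁ drops out.
-/
theorem casimirWeight_p (hp : p ≠ 0) (hK : K ≠ 0) (hA : A ≠ 0) (k2 : 1 - p ^ 8 * K ^ 4 ≠ 0) (k3 : 1 - p ^ 12 * K ^ 4 ≠ 0) :
    casimirWeight .p p K A = br (p ^ 8 * K ^ 2) / (p ^ 2 * br (p ^ 6 * K ^ 2)) := by
  have e : p ^ 2 * (p ^ 2 * K) ^ 2 = p ^ 6 * K ^ 2 := by ring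
  simp only [casimirWeight, rev, kS, kA, kB, kC, e]
  simp only [br]
  field_simp
  ring

theorem casimirWeight_m (hp : p ≠ 0) (hK : K ≠ 0) (hA : A ≠ 0) (k1 : 1 - p ^ 4 * K ^ 4 ≠ 0) :
    casimirWeight .m p K A = br (K ^ 2) / (p ^ 2 * br (p ^ 2 * K ^ 2)) := by
  have e : p ^ 6 * (K / p ^ 2) ^ 2 = p ^ 2 * K ^ 2 := by field_simp
  simp only [casimirWeight, rev, kS, kA, kB, kC, e]
  simp only [br]
  field_simp
  ring

theorem casimirWeight_z (hp : p ≠ 0) (hK : K ≠ 0) (hA : A ≠ 0) (k1 : 1 - p ^ 4 * K ^ 4 ≠ 0) (k2 : 1 - p ^ 8 * K ^ 4 ≠ 0)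
    (k3 : 1 - p ^ 12 * K ^ 4 ≠ 0) :
    casimirWeight .z p K A = br (p ^ 2) ^ 2 / (p ^ 2 * br (p ^ 4 * K ^ 2)) * (1 / br (p ^ 6 * K ^ 2) + 1 / br (p ^ 2 * K ^ 2)) := by
  simp only [casimirWeight, rev, kS, kA, kB, kC]
  simp only [br]
  field_simp
  ring

/-- Adding x₂x₂* and x₂*x₂ with weights 1 and q⁻⁶ removes j, m₂ and the parity as well. The result
depends on l alone and decays as q^{4l}. -/
theorem casimir_preserving (hp : p ≠ 0) (hK : K ≠ 0) (hX : X ≠ 0) (hB : B ≠ 0) (k1 : 1 - p ^ 4 * K ^ 4 ≠ 0) (k2 : 1 - p ^ 8 * K ^ 4 ≠ 0)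
    (k3 : 1 - p ^ 12 * K ^ 4 ≠ 0) (h3 : 1 - p ^ 12 * X ^ 4 ≠ 0) (h5 : 1 - p ^ 20 * X ^ 4 ≠ 0) (e : Bool) :
    br (p ^ 8 * K ^ 2) / (p ^ 2 * br (p ^ 6 * K ^ 2)) * (cZ .p e p X K B * cZ .m (!e) p X (p ^ 2 * K) B) +
    br (p ^ 2) ^ 2 / (p ^ 2 * br (p ^ 4 * K ^ 2)) * (1 / br (p ^ 6 * K ^ 2) + 1 / br (p ^ 2 * K ^ 2)) * (cZ .z e p X K B * cZ .z e p X K B) +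
    br (K ^ 2) / (p ^ 2 * br (p ^ 2 * K ^ 2)) * (cZ .m e p X K B * cZ .p (!e) p X (K / p ^ 2) B) +
    cZ .e e p X K B * cZ .d (!e) p X K (B / p ^ 2) + (p ^ 12)⁻¹ * (cZ .d e p X K B * cZ .e (!e) p X K (p ^ 2 * B)) =
    br (p ^ 6) * br (p ^ 4) / (p ^ 6 * (br (p ^ 6 * X ^ 2) * br (p ^ 10 * X ^ 2))) := by
  cases e <;> simp only [Bool.not_true, Bool.not_false, cZ, pZ, mZ, zZ, dZ, eZ, nn, n3, n5] <;> simp only [br] <;> field_simp <;> ring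
end

/-! ### Bounds for the coefficients from sums of squares. -/

section
variable (q : Param)

theorem lat_congr (s : ℝ) (g : SGen) {u u' : ℤ → ℤ → ℤ → ℤ → ℂ} (h : ∀ a n b k, Adm a n b k → u a n b k = u' a n b k)
    {a n b k : ℤ} (hv : Adm a n b k) : lat q s g u a n b k = lat q s g u' a n b k := by
  rw [lat_eq, lat_eq]
  refine Finset.sum_congr rfl fun σ _ => Finset.sum_congr rfl fun δ _ => ?_
  by_cases h0 : mv q g σ δ a n b k = 0
  · simp [h0]
  · rw [h _ _ _ _ (mv_exit q g σ δ hv h0)]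

/-- The function which is `1` at a point of the lattice and vanishes elsewhere. -/
def point (a n b k : ℤ) (a' n' b' k' : ℤ) : ℂ := if a' = a ∧ n' = n ∧ b' = b ∧ k' = k then 1 else 0

/-- After the step (σ, δ) the only second step which returns to the starting point is the reverse
one. -/
theorem sum_rev (g : SGen) (c : Fin 3 → Fin 3 → ℂ) (a n b k : ℤ) (σ δ : Fin 3) :
    ∑ σ', ∑ δ', c σ' δ' * point a n b k (a + da g + da (star g)) (n + tv δ + tv δ') (b + dB g + dB (star g)) (k + tv σ + tv σ') =
      c σ.rev δ.rev := by
  have inj : ∀ x y : Fin 3, tv x + tv y = 0 → y = x.rev := by decide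
  rw [Finset.sum_eq_single σ.rev, Finset.sum_eq_single δ.rev]
  · rw [point, if_pos, mul_one]
    rw [da_star, dB_star, tv_rev, tv_rev]
    omega
  · intro δ' _ h
    rw [point, if_neg, mul_zero]
    rintro ⟨-, h', -, -⟩
    exact h (inj _ _ (by omega))
  · simp
  · intro σ' _ h
    refine Finset.sum_eq_zero fun δ' _ => ?_
    rw [point, if_neg, mul_zero]
    rintro ⟨-, -, -, h'⟩
    exact h (inj _ _ (by omega))
  · simp

/-- The diagonal entry of x_g x_g* at a point. The sign s occurs twice along each closed path and
disappears. -/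
theorem lat_star_point {s : ℝ} (hs : s ^ 2 = 1) (g : SGen) {a n b k : ℤ} (hv : Adm a n b k) :
    lat q s g (lat q s (star g) (point a n b k)) a n b k =
      ((∑ σ, ∑ δ, mv q g σ δ a n b k * mv q (star g) σ.rev δ.rev (a + da g) (n + tv δ) (b + dB g) (k + tv σ) : ℝ) : ℂ) := by
  rw [lat_eq]
  push_cast
  refine Finset.sum_congr rfl fun σ _ => Finset.sum_congr rfl fun δ _ => ?_
  rw [lat_eq, sum_rev]
  have e : sg s δ * sg s δ.rev = 1 := by
    fin_cases δ <;> simp [sg, ← pow_two, hs]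
  have e' : (sg s δ : ℂ) * sg s δ.rev = 1 := by exact_mod_cast e
  push_cast
  linear_combination ((mv q g σ δ a n b k : ℂ) * mv q (star g) σ.rev δ.rev (a + da g) (n + tv δ) (b + dB g) (k + tv σ)) * e'

theorem mv_mul_nonneg (g : SGen) (σ δ : Fin 3) {a n b k : ℤ} (hv : Adm a n b k) :
    0 ≤ mv q g σ δ a n b k * mv q (star g) σ.rev δ.rev (a + da g) (n + tv δ) (b + dB g) (k + tv σ) := by
  by_cases h : mv q g σ δ a n b k = 0
  · rw [h, zero_mul]
  · rw [hc_mul q g σ δ hv (mv_exit q g σ δ hv h)]; positivity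

/-- A sum of non-negative terms dominates each of them. This serves for the sphere relation with M =
1 and for the Casimir sum. -/
theorem hc_sq_le_of {ι : Type*} [Fintype ι] (gs : ι → SGen) (w : ι → Fin 3 → Fin 3 → ℝ) (M : ℝ) {a n b k : ℤ} (hv : Adm a n b k)
    (hw : ∀ i σ δ, 0 ≤ w i σ δ)
    (h : ∑ i, ∑ σ, ∑ δ, w i σ δ * (mv q (gs i) σ δ a n b k *
      mv q (star (gs i)) σ.rev δ.rev (a + da (gs i)) (n + tv δ) (b + dB (gs i)) (k + tv σ)) = M)
    (i : ι) (σ δ : Fin 3) (hv' : Adm (a + da (gs i)) (n + tv δ) (b + dB (gs i)) (k + tv σ)) :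
    w i σ δ * hc q (gs i) σ δ a n b k ^ 2 ≤ M := by
  rw [← hc_mul q (gs i) σ δ hv hv', ← h]
  have nn : ∀ i σ δ, 0 ≤ w i σ δ * (mv q (gs i) σ δ a n b k *
      mv q (star (gs i)) σ.rev δ.rev (a + da (gs i)) (n + tv δ) (b + dB (gs i)) (k + tv σ)) :=
    fun i σ δ => mul_nonneg (hw i σ δ) (mv_mul_nonneg q (gs i) σ δ hv)
  refine (Finset.single_le_sum (f := fun δ => w i σ δ * (mv q (gs i) σ δ a n b k *
      mv q (star (gs i)) σ.rev δ.rev (a + da (gs i)) (n + tv δ) (b + dB (gs i)) (k + tv σ))) (fun δ _ => nn i σ δ) (Finset.mem_univ δ)).trans ?_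
  refine (Finset.single_le_sum (f := fun σ => ∑ δ, w i σ δ * (mv q (gs i) σ δ a n b k *
      mv q (star (gs i)) σ.rev δ.rev (a + da (gs i)) (n + tv δ) (b + dB (gs i)) (k + tv σ)))
      (fun σ _ => Finset.sum_nonneg fun δ _ => nn i σ δ) (Finset.mem_univ σ)).trans ?_
  exact Finset.single_le_sum (f := fun i => ∑ σ, ∑ δ, w i σ δ * (mv q (gs i) σ δ a n b k *
      mv q (star (gs i)) σ.rev δ.rev (a + da (gs i)) (n + tv δ) (b + dB (gs i)) (k + tv σ)))
      (fun i _ => Finset.sum_nonneg fun σ _ => Finset.sum_nonneg fun δ _ => nn i σ δ) (Finset.mem_univ i)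

/-- Evaluate x₀² + x₁x₁* + x₂x₂* = 1 on the indicator function of a point, at that point. -/
theorem hc_sq_le_one_aux (i : Fin 3) (σ δ : Fin 3) {a n b k : ℤ} (hv : Adm a n b k)
    (hv' : Adm (a + da (![SGen.x₀, .x₁, .x₂] i)) (n + tv δ) (b + dB (![SGen.x₀, .x₁, .x₂] i)) (k + tv σ)) :
    hc q (![SGen.x₀, .x₁, .x₂] i) σ δ a n b k ^ 2 ≤ 1 := by
  have h := lat_rad q (s := ((1 : ℝ) : ℂ)) (by simp) (point a n b k) a n b k hv.1
  rw [show lat q _ .x₀ (lat q _ .x₀ (point a n b k)) a n b k = _ from lat_star_point q (by simp) .x₀ hv,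
    show lat q _ .x₁ (lat q _ .x₁s (point a n b k)) a n b k = _ from lat_star_point q (by simp) .x₁ hv,
    show lat q _ .x₂ (lat q _ .x₂s (point a n b k)) a n b k = _ from lat_star_point q (by simp) .x₂ hv,
    point, if_pos (by simp)] at h
  have := hc_sq_le_of q ![SGen.x₀, .x₁, .x₂] (fun _ _ _ => 1) 1 hv (fun _ _ _ => zero_le_one) (by
    simp only [one_mul]
    rw [Fin.sum_univ_three]
    exact_mod_cast h) i σ δ hv'
  simpa using this

/-- By symmetry a bound for the coefficients of a generator holds for those of its adjoint, read
from the other end of the step. -/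
theorem hc_rev_of (g : SGen) (σ δ : Fin 3) (a n b k : ℤ) (P : ℤ → ℝ → Prop)
    (h : ∀ a n b k, Adm a n b k → Adm (a + da g) (n + tv δ) (b + dB g) (k + tv σ) → P (n + tv δ) (hc q g σ δ a n b k))
    (hv : Adm a n b k) (hv' : Adm (a + da (star g)) (n + tv δ.rev) (b + dB (star g)) (k + tv σ.rev)) :
    P n (hc q (star g) σ.rev δ.rev a n b k) := by
  have e1 : a + da (star g) + da g = a := by rw [da_star]; ring
  have e2 : k + tv σ.rev + tv σ = k := by rw [tv_rev]; ring
  have e3 : n + tv δ.rev + tv δ = n := by rw [tv_rev]; ring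
  have e4 : b + dB (star g) + dB g = b := by rw [dB_star]; ring
  have := h _ _ _ _ hv' (by rw [e1, e2, e3, e4]; exact hv)
  rw [← hc_rev, e1, e2, e3, e4] at this
  exact this

theorem hc_le_one (g : SGen) (σ δ : Fin 3) {a n b k : ℤ} (hv : Adm a n b k)
    (hv' : Adm (a + da g) (n + tv δ) (b + dB g) (k + tv σ)) : |hc q g σ δ a n b k| ≤ 1 := by
  have key : ∀ i : Fin 3, ∀ σ δ : Fin 3, ∀ a n b k, Adm a n b k → Adm (a + da (![SGen.x₀, .x₁, .x₂] i)) (n + tv δ) (b + dB (![SGen.x₀, .x₁, .x₂] i)) (k + tv σ) →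
      |hc q (![SGen.x₀, .x₁, .x₂] i) σ δ a n b k| ≤ 1 := fun i σ δ a n b k h h' =>
    (sq_le_one_iff_abs_le_one _).1 (hc_sq_le_one_aux q i σ δ h h')
  cases g
  · exact key 0 σ δ a n b k hv hv'
  · exact key 1 σ δ a n b k hv hv'
  · exact key 2 σ δ a n b k hv hv'
  · have := hc_rev_of q .x₁ σ.rev δ.rev a n b k (fun _ x => |x| ≤ 1) (key 1 _ _) hv (by rw [Fin.rev_rev, Fin.rev_rev]; exact hv')
    rwa [Fin.rev_rev, Fin.rev_rev] at this
  · have := hc_rev_of q .x₂ σ.rev δ.rev a n b k (fun _ x => |x| ≤ 1) (key 2 _ _) hv (by rw [Fin.rev_rev, Fin.rev_rev]; exact hv')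
    rwa [Fin.rev_rev, Fin.rev_rev] at this

/-- The Casimir weights of the generators. -/
noncomputable def genWeight (p : ℝ) : SGen → ℝ
  | .x₀ => 1 + p ^ 4 | .x₁ => 1 | .x₁s => (p ^ 4)⁻¹ | .x₂ => 1 | .x₂s => (p ^ 12)⁻¹

theorem casimir_sum (a n b k : ℤ) (hk : 0 ≤ k) :
    ∑ i, ∑ σ, genWeight (rp q) (![SGen.x₀, .x₁, .x₁s, .x₂, .x₂s] i) * (mv q (![SGen.x₀, .x₁, .x₁s, .x₂, .x₂s] i) σ 1 a n b k *
      mv q (star (![SGen.x₀, .x₁, .x₁s, .x₂, .x₂s] i)) σ.rev 1 (a + da (![SGen.x₀, .x₁, .x₁s, .x₂, .x₂s] i)) n (b + dB (![SGen.x₀, .x₁, .x₁s, .x₂, .x₂s] i)) (k + tv σ)) =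
    bz q 3 * bz q 2 / (qz q 3 * (bz q (2 * n + 3) * bz q (2 * n + 5))) := by
  have hs := spinGeneric q hk a
  have hg := generic q n b k
  have e6 : rp q ^ 6 = qz q 3 := rp_pow q 3
  have e4 : rp q ^ 4 = qz q 2 := rp_pow q 2
  have e10 : rp q ^ 10 = qz q 5 := rp_pow q 5
  have k1 : 1 - rp q ^ 4 * qz q k ^ 4 ≠ 0 := one_sub_ne q (by norm_num; omega)
  have k2 : 1 - rp q ^ 8 * qz q k ^ 4 ≠ 0 := one_sub_ne q (by norm_num; omega)
  have k3 : 1 - rp q ^ 12 * qz q k ^ 4 ≠ 0 := one_sub_ne q (by norm_num; omega)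
  have main := casimir_preserving hg.hp hg.hK hg.hX hg.hB k1 k2 k3 (one_sub_ne q (by norm_num; omega)) (one_sub_ne q (by norm_num; omega)) (par n b k)
  rw [← casimirWeight_p hg.hp hg.hK hs.hA k2 k3, ← casimirWeight_m hg.hp hg.hK hs.hA k1, ← casimirWeight_z hg.hp hg.hK hs.hA k1 k2 k3] at main
  have a9 : br (rp q ^ 6 * qz q n ^ 2) = bz q (2 * n + 3) := by
    rw [bz, e6, qz_pow, ← qz_add]; congr 2; push_cast; ring
  have a10 : br (rp q ^ 10 * qz q n ^ 2) = bz q (2 * n + 5) := by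
    rw [bz, e10, qz_pow, ← qz_add]; congr 2; push_cast; ring
  rw [a9, a10, e6, e4] at main
  rw [show br (qz q 3) = bz q 3 from rfl, show br (qz q 2) = bz q 2 from rfl] at main
  rw [← main]
  have r0 : Fin.rev (0 : Fin 3) = 2 := rfl
  have r1 : Fin.rev (1 : Fin 3) = 1 := rfl
  have r2 : Fin.rev (2 : Fin 3) = 0 := rfl
  have v0 : tv 0 = 1 := rfl
  have v1 : tv 1 = 0 := rfl
  have v2 : tv 2 = -1 := rfl
  have p1 : par n b (k + 1) = !par n b k := par_flip (by omega)
  have p2 : par n b (k - 1) = !par n b k := par_flip (by omega)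
  have p3 : par n (b + 1) k = !par n b k := par_flip (by omega)
  have p4 : par n (b - 1) k = !par n b k := par_flip (by omega)
  simp only [Fin.sum_univ_five, Fin.sum_univ_three, r0, r1, r2, v0, v1, v2, casimirWeight, rev, kS]
  simp only [Matrix.cons_val_zero, Matrix.cons_val_one, Matrix.cons_val]
  simp only [star, da, dB, mv, kk, dr, dir, lc, lZ, genWeight, add_zero, ← sub_eq_add_neg,
    Matrix.cons_val_zero, Matrix.cons_val_one, Matrix.cons_val, p1, p2, p3, p4, qz_succ, qz_pred]
  norm_num
  ring

end

/-! ### Decay of the coefficients which preserve l, and the bounded operators. -/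

section
variable (q : Param)

/-- Write q^{-z} - q^z = q^{-z}(1 - q^{2z}) and use q^{2z} ≤ q. Applied to both denominators of the
Casimir sum, it gives the order q^{4n}. -/
theorem bz_lower {z : ℤ} (hz : 1 ≤ z) : (1 - (q : ℝ)) * qz q (-z) ≤ bz q z := by
  have h : qz q (2 * z) ≤ (q : ℝ) := by
    have := zpow_le_zpow_right_of_le_one₀ q.2.1 q.2.2.le (show (1 : ℤ) ≤ 2 * z by omega)
    simpa [qz] using this
  have e : qz q z = qz q (2 * z) * qz q (-z) := by rw [← qz_add]; congr 1; ring
  have e' : (qz q z)⁻¹ = qz q (-z) := by rw [qz, qz, zpow_neg]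
  rw [bz, br, e', e]
  nlinarith [qz_pos q (-z)]

/-- A bound for the parts of the generators which preserve `l`. -/
noncomputable def decayConst : ℝ := √(bz q 3 * bz q 2 * qz q 5 / (1 - (q : ℝ)) ^ 2)

theorem casimir_const_le {n : ℤ} (hn : 0 ≤ n) : bz q 3 * bz q 2 / (qz q 3 * (bz q (2 * n + 3) * bz q (2 * n + 5))) ≤
    (decayConst q * qz q (2 * n)) ^ 2 := by
  have hq : 0 < 1 - (q : ℝ) := sub_pos.2 q.2.2
  have h1 := bz_lower q (z := 2 * n + 3) (by omega)
  have h2 := bz_lower q (z := 2 * n + 5) (by omega)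
  have b2 := bz_pos q (z := 2) (by norm_num)
  have b3 := bz_pos q (z := 3) (by norm_num)
  have p1 := mul_pos hq (qz_pos q (-(2 * n + 3)))
  have p2 := mul_pos hq (qz_pos q (-(2 * n + 5)))
  rw [decayConst, mul_pow, Real.sq_sqrt (by have := qz_pos q 5; positivity)]
  have h3 : (1 - (q : ℝ)) * qz q (-(2 * n + 3)) * ((1 - (q : ℝ)) * qz q (-(2 * n + 5))) ≤ bz q (2 * n + 3) * bz q (2 * n + 5) :=
    mul_le_mul h1 h2 p2.le (p1.le.trans h1)
  have h4 : bz q 3 * bz q 2 / (qz q 3 * (bz q (2 * n + 3) * bz q (2 * n + 5))) ≤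
      bz q 3 * bz q 2 / (qz q 3 * ((1 - (q : ℝ)) * qz q (-(2 * n + 3)) * ((1 - (q : ℝ)) * qz q (-(2 * n + 5))))) := by
    have := qz_pos q 3
    have := mul_pos p1 p2
    gcongr
  refine h4.trans (le_of_eq ?_)
  have e : qz q 3 * (qz q (-(2 * n + 3)) * qz q (-(2 * n + 5))) * (qz q 5 * qz q (2 * n) ^ 2) = 1 := by
    rw [qz_pow, ← qz_add, ← qz_add, ← qz_add, ← qz_add, ← qz_zero q]; congr 1; push_cast; ring
  have z3 := (qz_pos q 3).ne'
  have z1 := (qz_pos q (-(2 * n + 3))).ne'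
  have z2 := (qz_pos q (-(2 * n + 5))).ne'
  have := hq.ne'
  rw [div_mul_eq_mul_div, div_eq_div_iff (by positivity) (by positivity)]
  linear_combination (-bz q 3 * bz q 2 * (1 - (q : ℝ)) ^ 2) * e

theorem one_le_genWeight (g : SGen) : 1 ≤ genWeight (rp q) g := by
  have h0 := rp_pos q
  have h1 := (rp_lt_one q).le
  cases g <;> simp only [genWeight]
  · have := pow_pos h0 4
    linarith
  · exact le_rfl
  · exact le_rfl
  · exact (one_le_inv₀ (pow_pos h0 4)).2 (pow_le_one₀ h0.le h1)
  · exact (one_le_inv₀ (pow_pos h0 12)).2 (pow_le_one₀ h0.le h1)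

/-- One square with weight at least 1 is bounded by the whole Casimir sum, hence the coefficient by
its square root, of order q^{2n}. -/
theorem hc_preserving_le (g : SGen) (σ : Fin 3) {a n b k : ℤ} (hv : Adm a n b k)
    (hv' : Adm (a + da g) n (b + dB g) (k + tv σ)) : |hc q g σ 1 a n b k| ≤ decayConst q * qz q (2 * n) := by
  have v1 : tv 1 = 0 := rfl
  obtain ⟨i, rfl⟩ : ∃ i : Fin 5, g = ![SGen.x₀, .x₁, .x₁s, .x₂, .x₂s] i := by
    cases g
    exacts [⟨0, rfl⟩, ⟨1, rfl⟩, ⟨3, rfl⟩, ⟨2, rfl⟩, ⟨4, rfl⟩]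
  have h := hc_sq_le_of q ![SGen.x₀, .x₁, .x₁s, .x₂, .x₂s]
    -- Steps which change l get weight 0, so that the total is the sum computed in `casimir_sum`.
    (fun i _ δ => if δ = 1 then genWeight (rp q) (![SGen.x₀, .x₁, .x₁s, .x₂, .x₂s] i) else 0) _ hv (by
      intro i σ δ
      split_ifs
      · exact zero_le_one.trans (one_le_genWeight q _)
      · exact le_rfl) rfl i σ 1 (by rw [v1, add_zero]; exact hv')
  have e : ∀ (i : Fin 5) (σ : Fin 3), (∑ δ : Fin 3, (if δ = 1 then genWeight (rp q) (![SGen.x₀, .x₁, .x₁s, .x₂, .x₂s] i) else 0) *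
      (mv q (![SGen.x₀, .x₁, .x₁s, .x₂, .x₂s] i) σ δ a n b k *
      mv q (star (![SGen.x₀, .x₁, .x₁s, .x₂, .x₂s] i)) σ.rev δ.rev (a + da (![SGen.x₀, .x₁, .x₁s, .x₂, .x₂s] i)) (n + tv δ)
        (b + dB (![SGen.x₀, .x₁, .x₁s, .x₂, .x₂s] i)) (k + tv σ))) =
      genWeight (rp q) (![SGen.x₀, .x₁, .x₁s, .x₂, .x₂s] i) * (mv q (![SGen.x₀, .x₁, .x₁s, .x₂, .x₂s] i) σ 1 a n b k *
      mv q (star (![SGen.x₀, .x₁, .x₁s, .x₂, .x₂s] i)) σ.rev 1 (a + da (![SGen.x₀, .x₁, .x₁s, .x₂, .x₂s] i)) n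
        (b + dB (![SGen.x₀, .x₁, .x₁s, .x₂, .x₂s] i)) (k + tv σ)) := by
    intro i σ
    rw [Finset.sum_eq_single 1]
    · rw [if_pos rfl, v1, add_zero, show Fin.rev (1 : Fin 3) = 1 from rfl]
    · intro δ _ h
      rw [if_neg h, zero_mul]
    · simp
  simp only [e, casimir_sum q a n b k hv.1, if_true] at h
  have h2 := (h.trans (casimir_const_le q (hv.1.trans hv.2.1)))
  have h3 : hc q (![SGen.x₀, .x₁, .x₁s, .x₂, .x₂s] i) σ 1 a n b k ^ 2 ≤ (decayConst q * qz q (2 * n)) ^ 2 := by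
    refine le_trans ?_ h2
    have := one_le_genWeight q (![SGen.x₀, .x₁, .x₁s, .x₂, .x₂s] i)
    nlinarith [sq_nonneg (hc q (![SGen.x₀, .x₁, .x₁s, .x₂, .x₂s] i) σ 1 a n b k)]
  exact abs_le_of_sq_le_sq h3 (mul_nonneg (Real.sqrt_nonneg _) (qz_pos q _).le)

/-! The operators. -/

variable {s : ℝ} (hs : s ^ 2 = 1)

theorem sg_abs (hs : s ^ 2 = 1) (δ : Fin 3) : |sg s δ| = 1 := by
  rw [sg]
  split_ifs
  · exact (pow_eq_one_iff_of_nonneg (abs_nonneg s) two_ne_zero).1 (by rw [sq_abs, hs])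
  · exact abs_one

include hs in
theorem exists_gen (g : SGen) : ∃ T : SpinorSpace →L[ℂ] SpinorSpace, ∀ f a n b k, Adm a n b k →
    ext (T f) a n b k = ∑ σ, ∑ δ, ((sg s δ * hc q g σ δ a n b k : ℝ) : ℂ) * ext f (a + da g) (n + tv δ) (b + dB g) (k + tv σ) := by
  refine exists_op _ (da g) (dB g) 1 fun σ δ a n b k h h' => ?_
  rw [Complex.norm_real, Real.norm_eq_abs, abs_mul, sg_abs hs, one_mul]
  exact hc_le_one q g σ δ h h'

/-- The operators of the generators. -/
noncomputable def genOp (g : SGen) : SpinorSpace →L[ℂ] SpinorSpace := (exists_gen q hs g).choose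

theorem ext_genOp (g : SGen) (f : SpinorSpace) {a n b k : ℤ} (h : Adm a n b k) :
    ext (genOp q hs g f) a n b k =
      ∑ σ, ∑ δ, ((sg s δ * hc q g σ δ a n b k : ℝ) : ℂ) * ext f (a + da g) (n + tv δ) (b + dB g) (k + tv σ) :=
  (exists_gen q hs g).choose_spec f a n b k h

/-- The coordinates of a vector in the rational gauge. -/
noncomputable def gext (f : SpinorSpace) (a n b k : ℤ) : ℂ := (gg q a n b k : ℂ) * ext f a n b k

theorem gext_genOp (g : SGen) (f : SpinorSpace) {a n b k : ℤ} (h : Adm a n b k) :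
    gext q (genOp q hs g f) a n b k = lat q s g (gext q f) a n b k := by
  rw [gext, ext_genOp q hs g f h, lat_eq, Finset.mul_sum]
  refine Finset.sum_congr rfl fun σ _ => ?_
  rw [Finset.mul_sum]
  refine Finset.sum_congr rfl fun δ _ => ?_
  rw [gext]
  by_cases h' : Adm (a + da g) (n + tv δ) (b + dB g) (k + tv σ)
  · have e : ((hc q g σ δ a n b k : ℝ) : ℂ) * gg q a n b k = mv q g σ δ a n b k * gg q (a + da g) (n + tv δ) (b + dB g) (k + tv σ) := by
      exact_mod_cast hc_gg q g σ δ h h'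
    push_cast
    linear_combination ((sg s δ : ℂ) * ext f (a + da g) (n + tv δ) (b + dB g) (k + tv σ)) * e
  · rw [ext_not _ h']; simp

/-- The formula for the inner operator is known only at admissible points, which is enough by
`lat_congr`. -/
theorem gext_genOp_genOp (g g' : SGen) (f : SpinorSpace) {a n b k : ℤ} (h : Adm a n b k) :
    gext q ((genOp q hs g * genOp q hs g') f) a n b k = lat q s g (lat q s g' (gext q f)) a n b k := by
  rw [mul_apply_eq_comp, gext_genOp q hs g _ h]
  exact lat_congr q s g (fun a n b k h' => gext_genOp q hs g' f h') h

theorem gext_inj {f f' : SpinorSpace} (h : ∀ a n b k, Adm a n b k → gext q f a n b k = gext q f' a n b k) : f = f' :=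
  ext_inj fun a n b k hv => mul_left_cancel₀ (by exact_mod_cast (gg_pos q a n b k).ne') (h a n b k hv)

theorem gext_add (f f' : SpinorSpace) (a n b k : ℤ) : gext q (f + f') a n b k = gext q f a n b k + gext q f' a n b k := by
  rw [gext, ext_add, mul_add]; rfl
theorem gext_sub (f f' : SpinorSpace) (a n b k : ℤ) : gext q (f - f') a n b k = gext q f a n b k - gext q f' a n b k := by
  rw [gext, ext_sub, mul_sub]; rfl
theorem gext_smul (c : ℂ) (f : SpinorSpace) (a n b k : ℤ) : gext q (c • f) a n b k = c * gext q f a n b k := by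
  rw [gext, ext_smul, mul_left_comm]; rfl

theorem genOp_vec (g : SGen) (a n b k : ℤ) (h : Adm a n b k) : genOp q hs g (vec a n b k) =
    ∑ σ, ∑ δ, ((sg s δ * hc q (star g) σ δ a n b k : ℝ) : ℂ) • vec (a + da (star g)) (n + tv δ) (b + dB (star g)) (k + tv σ) := by
  refine ext_inj fun a' n' b' k' h' => ?_
  -- The coordinate at the end of a step is read along the reverse step, hence the reversal of the
  -- indices.
  rw [ext_genOp q hs g _ h', ext_sum, ← Equiv.sum_comp Fin.revPerm]
  refine Finset.sum_congr rfl fun σ _ => ?_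
  rw [ext_sum, ← Equiv.sum_comp Fin.revPerm]
  refine Finset.sum_congr rfl fun δ _ => ?_
  rw [ext_smul, ext_vec _ _ _ _ h', Fin.revPerm_apply, Fin.revPerm_apply]
  have t1 := tv_rev σ
  have t2 := tv_rev δ
  have t3 := da_star g
  have t4 := dB_star g
  by_cases e : a' + da g = a ∧ n' + tv δ.rev = n ∧ b' + dB g = b ∧ k' + tv σ.rev = k
  · obtain ⟨rfl, rfl, rfl, rfl⟩ := e
    rw [if_pos ⟨by omega, by omega, by omega, by omega⟩, ext_vec _ _ _ _ h, if_pos ⟨rfl, rfl, rfl, rfl⟩]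
    have := hc_rev q g σ.rev δ.rev a' n' b' k'
    rw [Fin.rev_rev, Fin.rev_rev] at this
    rw [this]
    congr 3
    fin_cases δ <;> rfl
  · rw [if_neg (by omega)]
    by_cases h2 : Adm (a' + da g) (n' + tv δ.rev) (b' + dB g) (k' + tv σ.rev)
    · rw [ext_vec _ _ _ _ h2, if_neg e]; simp
    · rw [ext_not _ h2]; simp

/-- The coefficients are real, and symmetric by `hc_rev`, which enters through `genOp_vec`. -/
theorem adjoint_genOp (g : SGen) : ContinuousLinearMap.adjoint (genOp q hs g) = genOp q hs (star g) := by
  ext1 f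
  refine ext_inj fun a n b k h => ?_
  rw [← inner_vec, ContinuousLinearMap.adjoint_inner_right, genOp_vec q hs g a n b k h, ext_genOp q hs _ f h, sum_inner]
  refine Finset.sum_congr rfl fun σ _ => ?_
  rw [sum_inner]
  refine Finset.sum_congr rfl fun δ _ => ?_
  rw [inner_smul_left, inner_vec, Complex.conj_ofReal]

end

/-! ### The chiral representations. -/

section
variable (q : Param)

theorem qc_pow_two : qc q ^ 2 = (rp q : ℂ) ^ 4 := by rw [qc, ← rp_sq]; push_cast; ring
theorem qc_pow_four : qc q ^ 4 = (rp q : ℂ) ^ 8 := by rw [qc, ← rp_sq]; push_cast; ring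

variable {s : ℝ} (hs : s ^ 2 = 1)

theorem genOp_swap (g g' : SGen) (h : ∀ u : ℤ → ℤ → ℤ → ℤ → ℂ, ∀ a n b k, 0 ≤ k →
    lat q s g (lat q s g' u) a n b k = (rp q : ℂ) ^ 4 * lat q s g' (lat q s g u) a n b k) :
    genOp q hs g * genOp q hs g' = qc q ^ 2 • (genOp q hs g' * genOp q hs g) := by
  ext1 f
  refine gext_inj q fun a n b k hv => ?_
  rw [smul_apply, gext_smul, gext_genOp_genOp q hs _ _ _ hv, gext_genOp_genOp q hs _ _ _ hv, h _ _ _ _ _ hv.1,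
    qc_pow_two]

/-- Take adjoints; the scalar q² is real. -/
theorem genOp_swap_star (g g' : SGen) (h : genOp q hs g * genOp q hs g' = qc q ^ 2 • (genOp q hs g' * genOp q hs g)) :
    genOp q hs (star g') * genOp q hs (star g) = qc q ^ 2 • (genOp q hs (star g) * genOp q hs (star g')) := by
  have h' := congrArg Star.star h
  rw [star_mul, star_smul, star_mul] at h'
  simp only [ContinuousLinearMap.star_eq_adjoint, adjoint_genOp] at h'
  rw [h']
  congr 1
  rw [star_pow, qc]
  congr 1
  exact Complex.conj_ofReal _

set_option maxHeartbeats 800000 in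
theorem genOp_relations : SRelations q (genOp q hs) := by
  have hs' : (s : ℂ) ^ 2 = 1 := by exact_mod_cast hs
  have h1 := genOp_swap q hs .x₁s .x₀ fun u a n b k hk => lat_r1s0 q hs' u a n b k hk
  have h2 := genOp_swap q hs .x₂s .x₀ fun u a n b k hk => lat_r2s0 q hs' u a n b k
  have h3 := genOp_swap q hs .x₂s .x₁s fun u a n b k hk => lat_r2s1s q hs' u a n b k
  have h4 := genOp_swap q hs .x₂s .x₁ fun u a n b k hk => lat_r2s1 q hs' u a n b k
  have i1 := genOp_swap_star q hs .x₁s .x₀ h1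
  have i2 := genOp_swap_star q hs .x₂s .x₀ h2
  have i3 := genOp_swap_star q hs .x₂s .x₁s h3
  have i4 := genOp_swap_star q hs .x₂s .x₁ h4
  simp only [star] at i1 i2 i3 i4
  intro a b h
  cases h
  · exact i1
  · exact i2
  · exact i3
  · exact h1
  · exact h2
  · exact h3
  · exact i4
  · exact h4
  · ext1 f
    refine gext_inj q fun a n b k hv => ?_
    rw [sub_apply, smul_apply, gext_sub, gext_smul, pow_two, gext_genOp_genOp q hs _ _ _ hv,
      gext_genOp_genOp q hs _ _ _ hv, gext_genOp_genOp q hs _ _ _ hv, lat_r11 q hs' _ _ _ _ _ hv.1, qc_pow_four]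
  · ext1 f
    refine gext_inj q fun a n b k hv => ?_
    rw [sub_apply, sub_apply, smul_apply, gext_sub, gext_sub, gext_smul, gext_genOp_genOp q hs _ _ _ hv,
      gext_genOp_genOp q hs _ _ _ hv, gext_genOp_genOp q hs _ _ _ hv, gext_genOp_genOp q hs _ _ _ hv, lat_r22 q hs' _ _ _ _ _ hv.1, qc_pow_four]
  · ext1 f
    refine gext_inj q fun a n b k hv => ?_
    rw [add_apply, add_apply, gext_add, gext_add, pow_two, gext_genOp_genOp q hs _ _ _ hv,
      gext_genOp_genOp q hs _ _ _ hv, gext_genOp_genOp q hs _ _ _ hv, lat_rad q hs' _ _ _ _ _ hv.1, one_apply_eq_self]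

/-- The chiral representations. -/
noncomputable def rep : SphereAlg q →ₐ[ℂ] (SpinorSpace →L[ℂ] SpinorSpace) := SphereAlg.lift q (genOp q hs) (genOp_relations q hs)

theorem rep_gen (g : SGen) : rep q hs (sgen q g) = genOp q hs g := SphereAlg.lift_gen q _ _ g

/-! The coefficients in the orthonormal basis. -/

/-- The coefficients of the reduced operators in the orthonormal basis. -/
noncomputable def hl (f : Dir) (δ : Fin 3) (n b k : ℤ) : ℝ :=
  rr q f δ n b k * √(low q f δ n b k * low q (rev f) δ.rev (n + tv δ) (b + db f) (k + dk f))
/-- The coefficients which depend on `j` and `m₁` in the orthonormal basis. -/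
noncomputable def hk (g : SGen) (σ : Fin 3) (a k : ℤ) : ℝ :=
  kr q g σ a k * √(kl q g σ a k * kl q (star g) σ.rev (a + da g) (k + tv σ))

/-- The factor `hl` uses the change of j by the reduced operator and not σ. They agree unless `kr`
vanishes. -/
theorem hc_eq (g : SGen) (σ δ : Fin 3) (a n b k : ℤ) : hc q g σ δ a n b k = hk q g σ a k * hl q (dr g σ) δ n b k := by
  by_cases h : kr q g σ a k = 0
  · rw [hc, hk, h]; simp
  · rw [hc, hk, hl, kr_ne q h, db_dr]; ring

theorem hl_rev (f : Dir) (δ : Fin 3) (n b k : ℤ) :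
    hl q (rev f) δ.rev (n + tv δ) (b + db f) (k + dk f) = hl q f δ n b k := by
  rw [hl, hl, rr_rev, rev_rev, Fin.rev_rev, tv_rev, db_rev, dk_rev, add_neg_cancel_right, add_neg_cancel_right, add_neg_cancel_right,
    mul_comm (low q (rev f) _ _ _ _)]

theorem hk_rev (g : SGen) (σ : Fin 3) (a k : ℤ) : hk q (star g) σ.rev (a + da g) (k + tv σ) = hk q g σ a k := by
  rw [hk, hk, kr_rev, star_star, Fin.rev_rev, tv_rev, da_star, add_neg_cancel_right, add_neg_cancel_right,
    mul_comm (kl q (star g) _ _ _)]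

theorem qNum_one_ne : (q : ℝ) - (q : ℝ)⁻¹ ≠ 0 := by
  have := (one_lt_inv₀ q.2.1).2 q.2.2
  have := q.2.2
  exact (by linarith : (q : ℝ) - (q : ℝ)⁻¹ < 0).ne
theorem qNum_of {x : ℝ} {z : ℤ} (h : x = z) : qNum q x = bz q z / bz q 1 := by
  have h1 := qNum_one_ne q
  rw [qNum, h, bz, br, bz, br, qz, qz, ← Int.cast_neg, Real.rpow_intCast, Real.rpow_intCast, zpow_neg, zpow_one,
    ← neg_sub, ← neg_sub (q : ℝ) (q : ℝ)⁻¹, neg_div, div_neg]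
theorem sqrt_qNum {x y : ℝ} {z w : ℤ} (hx : x = z) (hy : y = w) : √(qNum q x * qNum q y) = √(bz q z * bz q w) / bz q 1 := by
  have h1 := bz_pos q one_pos
  rw [qNum_of q hx, qNum_of q hy, div_mul_div_comm, Real.sqrt_div' _ (by positivity), Real.sqrt_mul_self h1.le]
theorem qpow_of {x : ℝ} {m : ℤ} (h : x = m / 2) : (q : ℝ) ^ x = rp q ^ m := by
  rw [h, rp, ← Real.rpow_intCast, Real.sqrt_eq_rpow, ← Real.rpow_mul q.2.1.le]
  congr 1; ring
theorem eps_of (n b k : ℤ) : eps (n + 1 / 2) (k + 1 / 2) (b + 1 / 2) = if par n b k then 1 / 2 else -1 / 2 := by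
  rw [eps]
  congr 1
  rw [par, decide_eq_true_eq, even_iff_two_dvd, dvd_def]
  refine propext (exists_congr fun m => ?_)
  rw [show (n : ℝ) + 1 / 2 + 1 / 2 - (k + 1 / 2) - (b + 1 / 2) = ((n - k - b : ℤ) : ℝ) by push_cast; ring]
  exact_mod_cast Iff.rfl

theorem coefA_eq (a k : ℤ) : coefA q (k + 1 / 2) (a + 1 / 2) = hk q .x₀ 0 a k := by
  have h1 := (bz_pos q one_pos).ne'
  have hp := (rp_pos q).ne'
  rw [coefA, qpow_of q (m := 2 * a - 1), sqrt_qNum q (z := k + a + 2) (w := k - a + 1), qNum_of q (z := 2 * k + 3), zpow_sub₀ hp, ← qz_eq]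
  · simp only [hk, kr, kl, star, tv, da, Fin.rev]
    have e1 : k + 1 + a + 1 = k + a + 2 := by ring
    have e2 : k + 1 - a = k - a + 1 := by ring
    simp [e1, e2]
    field_simp
  all_goals push_cast; ring

end

/-! ### Comparison with the prescribed coefficients. -/

section
variable (q : Param)

theorem qpow_add {x : ℝ} {m c : ℤ} (h : x = m + c / 2) : (q : ℝ) ^ x = qz q m * rp q ^ c := by
  rw [qpow_of q (m := 2 * m + c) (by rw [h]; push_cast; ring), zpow_add₀ (rp_pos q).ne', ← qz_eq]

theorem bz_two : bz q 1 * (rp q ^ 2 + (rp q ^ 2)⁻¹) = bz q 2 := by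
  have hp := (rp_pos q).ne'
  have e1 : qz q 1 = rp q ^ 2 := (rp_pow q 1).symm
  have e2 : qz q 2 = rp q ^ 4 := (rp_pow q 2).symm
  rw [bz, bz, br, br, e1, e2]
  field_simp
  ring

/-- In this and the following comparisons ε = ±1/2 is resolved by the parity, half-integral powers
of q become q^m p^c, and q-numbers become quotients of brackets. The two factors under the root are
the values of `low` for the step and its reverse. -/
theorem coefC_eq (n b k : ℤ) : coefC q (n + 1 / 2) (k + 1 / 2) (b + 1 / 2) = hl q .p 0 n b k := by
  have h1 := (bz_pos q one_pos).ne'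
  have hp := (rp_pos q).ne'
  have e2 := bz_two q
  have pd : par (n + 1) (b + 1) k = par n b k := par_same (by omega)
  rw [coefC, eps_of]
  rcases h : par n b k
  · rw [if_neg Bool.false_ne_true, qpow_add q (m := b) (c := 0), sqrt_qNum q (z := n + k + b + 4) (w := n + k - b + 4),
      qNum_of q (x := 2 * (n + 1 / 2) + 4) (z := 2 * n + 5)]
    · simp only [hl, rr, low, rev, tv, db, dk, Fin.rev, h, Bool.false_eq_true, if_false, if_true]
      simp [par_same (n := n) (b := b) (k := k), par_flip (n := n) (b := b) (k := k), h, pd, qz_add, qz_sub, zpow_neg, bz_neg]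
      try rw [← e2]
      try field_simp
      try ring_nf
    all_goals push_cast; ring
  · rw [if_pos rfl, qpow_add q (m := b) (c := -2), sqrt_qNum q (z := n + k + b + 5) (w := n + k - b + 3),
      qNum_of q (x := 2 * (n + 1 / 2) + 4) (z := 2 * n + 5)]
    · simp only [hl, rr, low, rev, tv, db, dk, Fin.rev, h, Bool.false_eq_true, if_false, if_true]
      simp [par_same (n := n) (b := b) (k := k), par_flip (n := n) (b := b) (k := k), h, pd, qz_add, qz_sub, zpow_neg, bz_neg]
      try rw [← e2]
      try field_simp
      try ring_nf
    all_goals push_cast; ring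

/-- The minus sign corresponds to the sign ∓ with which C⁰ enters x₀ and x₁. -/
theorem coefC₀_eq (n b k : ℤ) : coefC₀ q (n + 1 / 2) (k + 1 / 2) (b + 1 / 2) = -hl q .p 1 n b k := by
  have h1 := (bz_pos q one_pos).ne'
  have hp := (rp_pos q).ne'
  have e2 := bz_two q
  have pd : par (n + 1) (b + 1) k = par n b k := par_same (by omega)
  rw [coefC₀, eps_of]
  rcases h : par n b k
  · rw [if_neg Bool.false_ne_true, qpow_add q (m := b - n) (c := -5), sqrt_qNum q (z := n + k + b + 4) (w := n - k + b + 1),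
      qNum_of q (x := 4 * (-1 / 2)) (z := -2),
      qNum_of q (x := 2 * (n + 1 / 2) + 2) (z := 2 * n + 3),
      qNum_of q (x := 2 * (n + 1 / 2) + 4) (z := 2 * n + 5)]
    · simp only [hl, rr, low, rev, tv, db, dk, Fin.rev, h, Bool.false_eq_true, if_false, if_true]
      simp [par_same (n := n) (b := b) (k := k), par_flip (n := n) (b := b) (k := k), h, pd, qz_add, qz_sub, zpow_neg, bz_neg]
      try rw [← e2]
      try field_simp
      try ring_nf
    all_goals push_cast; ring
  · rw [if_pos rfl, qpow_add q (m := n + b) (c := 3), sqrt_qNum q (z := n + k - b + 3) (w := n - k - b),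
      qNum_of q (x := 4 * (1 / 2)) (z := 2),
      qNum_of q (x := 2 * (n + 1 / 2) + 2) (z := 2 * n + 3),
      qNum_of q (x := 2 * (n + 1 / 2) + 4) (z := 2 * n + 5)]
    · simp only [hl, rr, low, rev, tv, db, dk, Fin.rev, h, Bool.false_eq_true, if_false, if_true]
      simp [par_same (n := n) (b := b) (k := k), par_flip (n := n) (b := b) (k := k), h, pd, qz_add, qz_sub, zpow_neg, bz_neg]
      try rw [← e2]
      try field_simp
      try ring_nf
    all_goals push_cast; ring

theorem coefCm_eq (n b k : ℤ) : coefCm q (n + 1 / 2) (k + 1 / 2) (b + 1 / 2) = hl q .p 2 n b k := by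
  have h1 := (bz_pos q one_pos).ne'
  have hp := (rp_pos q).ne'
  have e2 := bz_two q
  have pd : par (n + 1) (b + 1) k = par n b k := par_same (by omega)
  rw [coefCm, eps_of]
  rcases h : par n b k
  · rw [if_neg Bool.false_ne_true, qpow_add q (m := b) (c := -2), sqrt_qNum q (z := n - k + b + 1) (w := n - k - b - 1),
      qNum_of q (x := 2 * (n + 1 / 2) + 2) (z := 2 * n + 3)]
    · simp only [hl, rr, low, rev, tv, db, dk, Fin.rev, h, Bool.false_eq_true, if_false, if_true]
      simp [par_same (n := n) (b := b) (k := k), par_flip (n := n) (b := b) (k := k), h, pd, qz_add, qz_sub, zpow_neg, bz_neg]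
      try rw [← e2]
      try field_simp
      try ring_nf
    all_goals push_cast; ring
  · rw [if_pos rfl, qpow_add q (m := b) (c := 0), sqrt_qNum q (z := n - k + b) (w := n - k - b),
      qNum_of q (x := 2 * (n + 1 / 2) + 2) (z := 2 * n + 3)]
    · simp only [hl, rr, low, rev, tv, db, dk, Fin.rev, h, Bool.false_eq_true, if_false, if_true]
      simp [par_same (n := n) (b := b) (k := k), par_flip (n := n) (b := b) (k := k), h, pd, qz_add, qz_sub, zpow_neg, bz_neg]
      try rw [← e2]
      try field_simp
      try ring_nf
    all_goals push_cast; ring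

theorem coefH_eq (n b k : ℤ) : coefH q (n + 1 / 2) (k + 1 / 2) (b + 1 / 2) = hl q .z 0 n b k := by
  have h1 := (bz_pos q one_pos).ne'
  have hp := (rp_pos q).ne'
  have e2 := bz_two q
  have pd : par (n + 1) (b + 1) k = par n b k := par_same (by omega)
  rw [coefH, eps_of]
  rcases h : par n b k
  · rw [if_neg Bool.false_ne_true, qpow_add q (m := b - k) (c := -3), sqrt_qNum q (z := n - k - b + 1) (w := n + k + b + 4),
      qNum_of q (x := 2 * (n + 1 / 2) + 4) (z := 2 * n + 5)]
    · simp only [hl, rr, low, rev, tv, db, dk, Fin.rev, h, Bool.false_eq_true, if_false, if_true]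
      simp [par_same (n := n) (b := b) (k := k), par_flip (n := n) (b := b) (k := k), h, pd, qz_add, qz_sub, zpow_neg, bz_neg]
      try rw [← e2]
      try field_simp
      try ring_nf
    all_goals push_cast; ring
  · rw [if_pos rfl, qpow_add q (m := b + k) (c := 1), sqrt_qNum q (z := n + k - b + 3) (w := n - k + b + 2),
      qNum_of q (x := 2 * (n + 1 / 2) + 4) (z := 2 * n + 5)]
    · simp only [hl, rr, low, rev, tv, db, dk, Fin.rev, h, Bool.false_eq_true, if_false, if_true]
      simp [par_same (n := n) (b := b) (k := k), par_flip (n := n) (b := b) (k := k), h, pd, qz_add, qz_sub, zpow_neg, bz_neg]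
      try rw [← e2]
      try field_simp
      try ring_nf
    all_goals push_cast; ring

theorem coefD_eq (n b k : ℤ) : coefD q (n + 1 / 2) (k + 1 / 2) (b + 1 / 2) = hl q .d 0 n b k := by
  have h1 := (bz_pos q one_pos).ne'
  have hp := (rp_pos q).ne'
  have e2 := bz_two q
  have pd : par (n + 1) (b + 1) k = par n b k := par_same (by omega)
  rw [coefD, eps_of]
  rcases h : par n b k
  · rw [if_neg Bool.false_ne_true, qpow_add q (m := b - n) (c := -3), sqrt_qNum q (z := n + k + b + 4) (w := n - k + b + 3),
      qNum_of q (x := 2 * (n + 1 / 2) + 4) (z := 2 * n + 5)]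
    · simp only [hl, rr, low, rev, tv, db, dk, Fin.rev, h, Bool.false_eq_true, if_false, if_true]
      simp [par_same (n := n) (b := b) (k := k), par_flip (n := n) (b := b) (k := k), h, pd, qz_add, qz_sub, zpow_neg, bz_neg]
      try rw [← e2]
      try field_simp
      try ring_nf
    all_goals push_cast; ring
  · rw [if_pos rfl, qpow_add q (m := b - n) (c := -3), sqrt_qNum q (z := n + k + b + 5) (w := n - k + b + 2),
      qNum_of q (x := 2 * (n + 1 / 2) + 4) (z := 2 * n + 5)]
    · simp only [hl, rr, low, rev, tv, db, dk, Fin.rev, h, Bool.false_eq_true, if_false, if_true]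
      simp [par_same (n := n) (b := b) (k := k), par_flip (n := n) (b := b) (k := k), h, pd, qz_add, qz_sub, zpow_neg, bz_neg]
      try rw [← e2]
      try field_simp
      try ring_nf
    all_goals push_cast; ring

theorem coefD₀_eq (n b k : ℤ) : coefD₀ q (n + 1 / 2) (k + 1 / 2) (b + 1 / 2) = hl q .d 1 n b k := by
  have h1 := (bz_pos q one_pos).ne'
  have hp := (rp_pos q).ne'
  have e2 := bz_two q
  have pd : par (n + 1) (b + 1) k = par n b k := par_same (by omega)
  rw [coefD₀, eps_of]
  rcases h : par n b k
  · rw [if_neg Bool.false_ne_true, qpow_add q (m := b) (c := 2), sqrt_qNum q (z := n + k - b + 2) (w := n + k + b + 4),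
      qNum_of q (x := 2) (z := 2),
      qNum_of q (x := 2 * (n + 1 / 2) + 2) (z := 2 * n + 3),
      qNum_of q (x := 2 * (n + 1 / 2) + 4) (z := 2 * n + 5)]
    · simp only [hl, rr, low, rev, tv, db, dk, Fin.rev, h, Bool.false_eq_true, if_false, if_true]
      simp [par_same (n := n) (b := b) (k := k), par_flip (n := n) (b := b) (k := k), h, pd, qz_add, qz_sub, zpow_neg, bz_neg]
      try rw [← e2]
      try field_simp
      try ring_nf
    all_goals push_cast; ring
  · rw [if_pos rfl, qpow_add q (m := b) (c := 2), sqrt_qNum q (z := n - k - b) (w := n - k + b + 2),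
      qNum_of q (x := 2) (z := 2),
      qNum_of q (x := 2 * (n + 1 / 2) + 2) (z := 2 * n + 3),
      qNum_of q (x := 2 * (n + 1 / 2) + 4) (z := 2 * n + 5)]
    · simp only [hl, rr, low, rev, tv, db, dk, Fin.rev, h, Bool.false_eq_true, if_false, if_true]
      simp [par_same (n := n) (b := b) (k := k), par_flip (n := n) (b := b) (k := k), h, pd, qz_add, qz_sub, zpow_neg, bz_neg]
      try rw [← e2]
      try field_simp
      try ring_nf
    all_goals push_cast; ring

theorem coefDm_eq (n b k : ℤ) : coefDm q (n + 1 / 2) (k + 1 / 2) (b + 1 / 2) = hl q .d 2 n b k := by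
  have h1 := (bz_pos q one_pos).ne'
  have hp := (rp_pos q).ne'
  have e2 := bz_two q
  have pd : par (n + 1) (b + 1) k = par n b k := par_same (by omega)
  rw [coefDm, eps_of]
  rcases h : par n b k
  · rw [if_neg Bool.false_ne_true, qpow_add q (m := n + b) (c := 5), sqrt_qNum q (z := n - k - b - 1) (w := n + k - b + 2),
      qNum_of q (x := 2 * (n + 1 / 2) + 2) (z := 2 * n + 3)]
    · simp only [hl, rr, low, rev, tv, db, dk, Fin.rev, h, Bool.false_eq_true, if_false, if_true]
      simp [par_same (n := n) (b := b) (k := k), par_flip (n := n) (b := b) (k := k), h, pd, qz_add, qz_sub, zpow_neg, bz_neg]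
      try rw [← e2]
      try field_simp
      try ring_nf
    all_goals push_cast; ring
  · rw [if_pos rfl, qpow_add q (m := n + b) (c := 5), sqrt_qNum q (z := n - k - b) (w := n + k - b + 1),
      qNum_of q (x := 2 * (n + 1 / 2) + 2) (z := 2 * n + 3)]
    · simp only [hl, rr, low, rev, tv, db, dk, Fin.rev, h, Bool.false_eq_true, if_false, if_true]
      simp [par_same (n := n) (b := b) (k := k), par_flip (n := n) (b := b) (k := k), h, pd, qz_add, qz_sub, zpow_neg, bz_neg]
      try rw [← e2]
      try field_simp
      try ring_nf
    all_goals push_cast; ring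


theorem coefH₀_eq (n b k : ℤ) : coefH₀ q (n + 1 / 2) (k + 1 / 2) (b + 1 / 2) = hl q .z 1 n b k := by
  have h1 := (bz_pos q one_pos).ne'
  have hp := (rp_pos q).ne'
  have e2 : rp q ^ 2 = qz q 1 := rp_pow q 1
  have e4 : rp q ^ 4 = qz q 2 := rp_pow q 2
  have e6 : rp q ^ 6 = qz q 3 := rp_pow q 3
  have e8 : rp q ^ 8 = qz q 4 := rp_pow q 4
  have e10 : rp q ^ 10 = qz q 5 := rp_pow q 5
  have a9 : br (rp q ^ 6 * qz q n ^ 2) = bz q (2 * n + 3) := by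
    rw [bz, e6, qz_pow, ← qz_add]; congr 2; push_cast; ring
  have a10 : br (rp q ^ 10 * qz q n ^ 2) = bz q (2 * n + 5) := by
    rw [bz, e10, qz_pow, ← qz_add]; congr 2; push_cast; ring
  have b1 : br (qz q n / (qz q k * qz q b)) = bz q (n - k - b) := by
    rw [bz]; congr 1; rw [qz_sub, qz_sub, div_div]
  have b2 : br (rp q ^ 4 * qz q n * qz q b / qz q k) = bz q (n - k + b + 2) := by
    rw [bz, e4, ← qz_add, ← qz_add, ← qz_sub]; congr 2; ring
  have b3 : br (rp q ^ 6 * qz q n * qz q k / qz q b) = bz q (n + k - b + 3) := by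
    rw [bz, e6, ← qz_add, ← qz_add, ← qz_sub]; congr 2; ring
  have b4 : br (rp q ^ 6 * qz q n * qz q k * qz q b) = bz q (n + k + b + 3) := by
    rw [bz, e6, ← qz_add, ← qz_add, ← qz_add]; congr 2; ring
  have b5 : br (rp q ^ 4 * qz q n * qz q k / qz q b) = bz q (n + k - b + 2) := by
    rw [bz, e4, ← qz_add, ← qz_add, ← qz_sub]; congr 2; ring
  have b6 : br (rp q ^ 8 * qz q n * qz q k * qz q b) = bz q (n + k + b + 4) := by
    rw [bz, e8, ← qz_add, ← qz_add, ← qz_add]; congr 2; ring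
  have b7 : br (rp q ^ 2 * qz q n / (qz q k * qz q b)) = bz q (n - k - b + 1) := by
    rw [bz, e2, ← qz_add, ← qz_add, ← qz_sub]; congr 2; ring
  have b8 : br (rp q ^ 2 * qz q n * qz q b / qz q k) = bz q (n - k + b + 1) := by
    rw [bz, e2, ← qz_add, ← qz_add, ← qz_sub]; congr 2; ring
  have par0 : rp q ^ (-4 : ℤ) = (rp q ^ 4)⁻¹ := by rw [zpow_neg]; rfl
  rw [coefH₀, eps_of, qpow_of q (m := -4) (by norm_num), par0, qNum_of q (x := 2 * (n + 1 / 2) + 2) (z := 2 * n + 3) (by push_cast; ring),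
    qNum_of q (x := 2 * (n + 1 / 2) + 4) (z := 2 * n + 5) (by push_cast; ring)]
  rcases h : par n b k
  · rw [if_neg Bool.false_ne_true, qNum_of q (z := n + k - b + 2) (x := n + 1 / 2 - -1 / 2 * (2 * (k + 1 / 2) + 1) - (b + 1 / 2) + 1) (by push_cast; ring),
      qNum_of q (z := n + k + b + 4) (x := n + 1 / 2 - -1 / 2 * (2 * (k + 1 / 2) + 1) + (b + 1 / 2) + 2) (by push_cast; ring),
      qNum_of q (z := n - k - b + 1) (x := n + 1 / 2 + -1 / 2 * (2 * (k + 1 / 2) + 1) - (b + 1 / 2) + 2) (by push_cast; ring),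
      qNum_of q (z := n - k + b + 1) (x := n + 1 / 2 + -1 / 2 * (2 * (k + 1 / 2) + 1) + (b + 1 / 2) + 1) (by push_cast; ring)]
    simp only [hl, rr, low, rev, lZ, cZ, zZ, n3, n5, h, a9, a10, b5, b6, b7, b8, Fin.rev]
    simp
    field_simp
  · rw [if_pos rfl, qNum_of q (z := n - k - b) (x := n + 1 / 2 - 1 / 2 * (2 * (k + 1 / 2) + 1) - (b + 1 / 2) + 1) (by push_cast; ring),
      qNum_of q (z := n - k + b + 2) (x := n + 1 / 2 - 1 / 2 * (2 * (k + 1 / 2) + 1) + (b + 1 / 2) + 2) (by push_cast; ring),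
      qNum_of q (z := n + k - b + 3) (x := n + 1 / 2 + 1 / 2 * (2 * (k + 1 / 2) + 1) - (b + 1 / 2) + 2) (by push_cast; ring),
      qNum_of q (z := n + k + b + 3) (x := n + 1 / 2 + 1 / 2 * (2 * (k + 1 / 2) + 1) + (b + 1 / 2) + 1) (by push_cast; ring)]
    simp only [hl, rr, low, rev, lZ, cZ, zZ, n3, n5, h, a9, a10, b1, b2, b3, b4, Fin.rev]
    simp
    field_simp

theorem coefA₀_eq (a k : ℤ) : coefA₀ q (k + 1 / 2) (a + 1 / 2) = hk q .x₀ 1 a k := by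
  have h1 := (bz_pos q one_pos).ne'
  have hp := (rp_pos q).ne'
  have e2 : rp q ^ 2 = qz q 1 := rp_pow q 1
  have e6 : rp q ^ 6 = qz q 3 := rp_pow q 3
  have a1 : br (qz q k / qz q a) = bz q (k - a) := by rw [bz, qz_sub]
  have a9 : br (rp q ^ 6 * qz q k ^ 2) = bz q (2 * k + 3) := by
    rw [bz, e6, qz_pow, ← qz_add]; congr 2; push_cast; ring
  have a10 : br (rp q ^ 2 * qz q k ^ 2) = bz q (2 * k + 1) := by
    rw [bz, e2, qz_pow, ← qz_add]; congr 2; push_cast; ring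
  have a11 : br (rp q ^ 2) = bz q 1 := by rw [bz, e2]
  have par0 : rp q ^ (-4 : ℤ) = (rp q ^ 4)⁻¹ := by rw [zpow_neg]; rfl
  rw [coefA₀, qpow_of q (m := -4) (by norm_num), par0, qpow_add q (m := k + a) (c := 4) (by push_cast; ring), qNum_of q (x := 2) (z := 2) (by norm_num),
    qNum_of q (x := k + 1 / 2 - (a + 1 / 2)) (z := k - a) (by push_cast; ring),
    qNum_of q (x := 2 * (k + 1 / 2)) (z := 2 * k + 1) (by push_cast; ring),
    qNum_of q (x := 2 * (k + 1 / 2) + 2) (z := 2 * k + 3) (by push_cast; ring), ← bz_two]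
  simp only [hk, kr, kl, kA, star, a1, a9, a10, a11, Fin.rev, qz_add]
  simp
  field_simp
  try ring

/-- The index is x₁* because the action of x₁ on kets is read off from the coefficients of x₁* on
coordinates (`genOp_ket`). -/
theorem coefB_eq (a k : ℤ) : coefB q (k + 1 / 2) (a + 1 / 2) = hk q .x₁s 0 a k := by
  have h1 := (bz_pos q one_pos).ne'
  have hp := (rp_pos q).ne'
  rw [coefB, qpow_add q (m := a - k) (c := -1), sqrt_qNum q (z := k + a + 2) (w := k + a + 3), qNum_of q (z := 2 * k + 3)]
  · simp only [hk, kr, kl, star, tv, da, Fin.rev]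
    simp [qz_sub, zpow_neg]
    field_simp
    try ring_nf
  all_goals push_cast; ring

theorem coefB₀_eq (a k : ℤ) : coefB₀ q (k + 1 / 2) (a + 1 / 2) = hk q .x₁s 1 a k := by
  have h1 := (bz_pos q one_pos).ne'
  have hp := (rp_pos q).ne'
  rw [coefB₀, qpow_add q (m := a) (c := 0), sqrt_qNum q (z := k - a) (w := k + a + 2), qNum_of q (x := 2 * (k + 1 / 2)) (z := 2 * k + 1) (by push_cast; ring),
    qNum_of q (x := 2 * (k + 1 / 2) + 2) (z := 2 * k + 3) (by push_cast; ring), ← rp_sq]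
  · simp only [hk, kr, kl, star, tv, da, Fin.rev]
    simp
    field_simp
    try ring_nf
  all_goals push_cast; ring

theorem coefBm_eq (a k : ℤ) : coefBm q (k + 1 / 2) (a + 1 / 2) = hk q .x₁s 2 a k := by
  have h1 := (bz_pos q one_pos).ne'
  have hp := (rp_pos q).ne'
  rw [coefBm, qpow_add q (m := k + a) (c := 3), sqrt_qNum q (z := k - a) (w := k - a - 1), qNum_of q (z := 2 * k + 1)]
  · simp only [hk, kr, kl, star, tv, da, Fin.rev]
    simp [qz_add]
    field_simp
    try ring_nf
  all_goals push_cast; ring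

end

section
variable (q : Param)

/-- The prescribed formulas express the steps with j - 1, and the step of z with l - 1, by the
coefficients of the reverse steps with shifted subscripts. -/
theorem hl_m (n b k : ℤ) : hl q .m 0 n b k = hl q .p 2 (n + 1) b (k - 1) ∧ hl q .m 1 n b k = hl q .p 1 n b (k - 1) ∧
    hl q .m 2 n b k = hl q .p 0 (n - 1) b (k - 1) ∧ hl q .z 2 n b k = hl q .z 0 (n - 1) b k := by
  have h1 := hl_rev q .m 0 n b k
  have h2 := hl_rev q .m 1 n b k
  have h3 := hl_rev q .m 2 n b k
  have h4 := hl_rev q .z 2 n b k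
  have r0 : Fin.rev (0 : Fin 3) = 2 := rfl
  have r1 : Fin.rev (1 : Fin 3) = 1 := rfl
  have r2 : Fin.rev (2 : Fin 3) = 0 := rfl
  have v0 : tv 0 = 1 := rfl
  have v1 : tv 1 = 0 := rfl
  have v2 : tv 2 = -1 := rfl
  simp only [rev, db, dk, r0, r1, r2, v0, v1, v2, add_zero, ← sub_eq_add_neg] at h1 h2 h3 h4
  exact ⟨h1.symm, h2.symm, h3.symm, h4.symm⟩

theorem hk_m (a k : ℤ) : hk q .x₀ 2 a k = hk q .x₀ 0 a (k - 1) := by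
  have h1 := hk_rev q .x₀ 2 a k
  have r2 : Fin.rev (2 : Fin 3) = 0 := rfl
  have v2 : tv 2 = -1 := rfl
  simp only [star, da, r2, v2, add_zero, ← sub_eq_add_neg] at h1
  exact h1.symm

variable {s : ℝ} (hs : s ^ 2 = 1)

theorem genOp_ket (g : SGen) {a n b k : ℤ} (h : Adm a n b k) : genOp q hs g (vec a n b k) =
    ∑ σ, ∑ δ, (sg s δ * (hk q (star g) σ a k * hl q (dr (star g) σ) δ n b k)) • vec (a + da (star g)) (n + tv δ) (b + dB (star g)) (k + tv σ) := by
  rw [genOp_vec q hs g a n b k h]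
  refine Finset.sum_congr rfl fun σ _ => Finset.sum_congr rfl fun δ _ => ?_
  rw [hc_eq, Complex.coe_smul]
  rfl

theorem rep_isChiral : IsChiralRep q s (rep q hs) := by
  have v0 : tv 0 = 1 := rfl
  have v1 : tv 1 = 0 := rfl
  have v2 : tv 2 = -1 := rfl
  have c1 : ∀ x : ℤ, (x : ℝ) + 1 / 2 + 1 = ((x + 1 : ℤ) : ℝ) + 1 / 2 := fun x => by push_cast; ring
  have c2 : ∀ x : ℤ, (x : ℝ) + 1 / 2 - 1 = ((x - 1 : ℤ) : ℝ) + 1 / 2 := fun x => by push_cast; ring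
  have d0 : dir 0 = .p := rfl
  have d1 : dir 1 = .z := rfl
  have d2 : dir 2 = .m := rfl
  have g0 : sg s 0 = 1 := rfl
  have g1 : sg s 1 = s := rfl
  have g2 : sg s 2 = 1 := rfl
  refine ⟨?_, ?_, ?_, ?_, ?_, ?_⟩
  · intro l m₁ m₂ j hj
    obtain ⟨a, n, b, k, rfl, rfl, rfl, rfl, h⟩ := hj.exists_int
    obtain ⟨m0, m1, m2, z2⟩ := hl_m q n b k
    simp only [rep_gen, c1, c2, coefC_eq, coefC₀_eq, coefCm_eq, coefH_eq, coefH₀_eq, coefA_eq, coefA₀_eq]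
    have := genOp_ket q hs .x₀ h
    simp only [vec] at this
    rw [this]
    simp only [Fin.sum_univ_three, star, da, dB, dr, v0, v1, v2, d0, d1, d2, g0, g1, g2, add_zero, ← sub_eq_add_neg, m0, m1, m2, z2, hk_m]
    module
  · intro l m₁ m₂ j hj
    obtain ⟨a, n, b, k, rfl, rfl, rfl, rfl, h⟩ := hj.exists_int
    obtain ⟨m0, m1, m2, z2⟩ := hl_m q n b k
    simp only [rep_gen, c1, c2, coefC_eq, coefC₀_eq, coefCm_eq, coefH_eq, coefH₀_eq, coefB_eq, coefB₀_eq, coefBm_eq]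
    have := genOp_ket q hs .x₁ h
    simp only [vec] at this
    rw [this]
    simp only [Fin.sum_univ_three, star, da, dB, dr, v0, v1, v2, d0, d1, d2, g0, g1, g2, add_zero, ← sub_eq_add_neg, m0, m1, m2, z2]
    module
  · intro l m₁ m₂ j hj
    obtain ⟨a, n, b, k, rfl, rfl, rfl, rfl, h⟩ := hj.exists_int
    simp only [rep_gen, c1, c2, coefD_eq, coefD₀_eq, coefDm_eq]
    have k0 : hk q .x₂s 0 a k = 0 := by simp [hk, kr]
    have k1 : hk q .x₂s 1 a k = 1 := by simp [hk, kr, kl, star, Fin.rev]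
    have k2 : hk q .x₂s 2 a k = 0 := by simp [hk, kr]
    have := genOp_ket q hs .x₂ h
    simp only [vec] at this
    rw [this]
    simp only [Fin.sum_univ_three, star, da, dB, dr, v0, v1, v2, k0, k1, k2, g0, g1, g2, add_zero, ← sub_eq_add_neg]
    module
  · rw [rep_gen, adjoint_genOp]; rfl
  · rw [rep_gen, rep_gen, adjoint_genOp]; rfl
  · rw [rep_gen, rep_gen, adjoint_genOp]; rfl

end

/-! ### Nuclear operators and their traces. -/

section Nuclear
variable {E : Type} [NormedAddCommGroup E] [InnerProductSpace ℂ E]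

theorem sum_inner_mul_le {κ : Type*} (b : HilbertBasis κ ℂ E) (x y : E) (s : Finset κ) :
    ∑ k ∈ s, ‖inner ℂ x (b k) * inner ℂ (b k) y‖ ≤ ‖x‖ * ‖y‖ := by
  have h : ∀ z : E, √(∑ k ∈ s, ‖inner ℂ (b k) z‖ ^ 2) ≤ ‖z‖ := fun z =>
    Real.sqrt_le_iff.2 ⟨norm_nonneg _, Orthonormal.sum_inner_products_le z b.orthonormal⟩
  calc ∑ k ∈ s, ‖inner ℂ x (b k) * inner ℂ (b k) y‖ = ∑ k ∈ s, ‖inner ℂ (b k) x‖ * ‖inner ℂ (b k) y‖ := by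
        refine Finset.sum_congr rfl fun k _ => ?_
        rw [norm_mul, norm_inner_symm]
    _ ≤ √(∑ k ∈ s, ‖inner ℂ (b k) x‖ ^ 2) * √(∑ k ∈ s, ‖inner ℂ (b k) y‖ ^ 2) := Real.sum_mul_le_sqrt_mul_sqrt _ _ _
    _ ≤ ‖x‖ * ‖y‖ := mul_le_mul (h x) (h y) (Real.sqrt_nonneg _) (norm_nonneg _)

/-- By Bessel and Cauchy–Schwarz the double family ⟨x_i, b_k⟩⟨b_k, y_i⟩ is absolutely summable.
Summation over k first is Parseval and gives the value; summation over i first gives the diagonal of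
T. -/
theorem hasSum_trace {ι κ : Type*} {x y : ι → E} {T : E →L[ℂ] E} (hs : Summable fun i => ‖x i‖ * ‖y i‖)
    (hT : ∀ u, HasSum (fun i => inner ℂ (x i) u • y i) (T u)) (b : HilbertBasis κ ℂ E) :
    HasSum (fun k => inner ℂ (b k) (T (b k))) (∑' i, inner ℂ (x i) (y i)) := by
  let F : ι × κ → ℂ := fun p => inner ℂ (x p.1) (b p.2) * inner ℂ (b p.2) (y p.1)
  have hrow : ∀ i, Summable fun k => ‖F (i, k)‖ := fun i =>
    summable_of_sum_le (fun k => norm_nonneg _) (sum_inner_mul_le b (x i) (y i))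
  have hF : Summable fun p => ‖F p‖ := by
    refine (summable_prod_of_nonneg fun p => norm_nonneg _).2 ⟨hrow, ?_⟩
    refine Summable.of_nonneg_of_le (fun i => tsum_nonneg fun k => norm_nonneg _) (fun i => ?_) hs
    exact (hrow i).tsum_le_of_sum_le (sum_inner_mul_le b (x i) (y i))
  have hF' : Summable F := hF.of_norm
  have e1 : HasSum F (∑' i, inner ℂ (x i) (y i)) := by
    have : ∑' i, inner ℂ (x i) (y i) = ∑' p, F p := by
      rw [hF'.tsum_prod' fun i => (hrow i).of_norm]
      refine tsum_congr fun i => ?_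
      exact (b.tsum_inner_mul_inner (x i) (y i)).symm
    rw [this]
    exact hF'.hasSum
  have e2 := (Equiv.prodComm κ ι).hasSum_iff.2 e1
  refine e2.prod_fiberwise fun k => ?_
  have := (hT (b k)).mapL (innerSL ℂ (b k))
  simp only [innerSL_apply_apply, inner_smul_right] at this
  exact this

/-- The definition asks for sequences, so the families are extended by zero along an injection into
ℕ. -/
theorem isTraceClass_of {ι : Type*} [Countable ι] {x y : ι → E} {T : E →L[ℂ] E} (hs : Summable fun i => ‖x i‖ * ‖y i‖)
    (hT : ∀ u, HasSum (fun i => inner ℂ (x i) u • y i) (T u)) : IsTraceClass T := by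
  obtain ⟨e, he⟩ := exists_injective_nat ι
  refine ⟨Function.extend e x 0, Function.extend e y 0, ?_, fun u => ?_⟩
  · have : (fun n => ‖Function.extend e x 0 n‖ * ‖Function.extend e y 0 n‖) = Function.extend e (fun i => ‖x i‖ * ‖y i‖) 0 := by
      funext n
      by_cases h : ∃ i, e i = n
      · obtain ⟨i, rfl⟩ := h
        simp only [he.extend_apply]
      · simp [Function.extend_apply' _ _ _ h]
    rw [this]
    exact (summable_extend_zero he).2 hs
  · have : (fun n => inner ℂ (Function.extend e x 0 n) u • Function.extend e y 0 n) = Function.extend e (fun i => inner ℂ (x i) u • y i) 0 := by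
      funext n
      by_cases h : ∃ i, e i = n
      · obtain ⟨i, rfl⟩ := h
        simp only [he.extend_apply]
      · simp [Function.extend_apply' _ _ _ h]
    rw [this]
    exact (hasSum_extend_zero he).2 (hT u)

theorem hasTrace_of {ι : Type*} [Countable ι] {x y : ι → E} {T : E →L[ℂ] E} (hs : Summable fun i => ‖x i‖ * ‖y i‖)
    (hT : ∀ u, HasSum (fun i => inner ℂ (x i) u • y i) (T u)) : HasTrace T (∑' i, inner ℂ (x i) (y i)) :=
  ⟨isTraceClass_of hs hT, fun _ b => hasSum_trace hs hT b⟩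
end Nuclear

/-! ### Summability of the modular weight against powers of q^l. -/

section Weights
variable (q : Param)

/-- The value of `l - 1/2`. -/
noncomputable def lev (v : SpinorIndex) : ℕ := v.adm.1.choose
theorem lev_spec (v : SpinorIndex) : v.l = lev v + 1 / 2 := v.adm.1.choose_spec
theorem lev_ind {a n b k : ℤ} (h : Adm a n b k) : (lev (ind h) : ℤ) = n := by
  have := lev_spec (ind h)
  simp only [ind, add_left_inj] at this
  exact_mod_cast this.symm

theorem modularWeight_ind {a n b k : ℤ} (h : Adm a n b k) :
    modularWeight q (ind h) = ((qz q (-(2 * a + 6 * b + 4)) : ℝ) : ℂ) := by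
  rw [modularWeight, qz, ← Real.rpow_intCast]
  congr 2
  simp only [ind]
  push_cast
  ring

/-- On admissible labels 2a + 6b ≤ 6n, so q^{8n} beats the modular weight. In the four non-negative
integers n, k, a + k + 1, b + n - k + 1, which determine the label, a product of geometric series
with ratio p is a majorant. -/
theorem summable_weight : Summable fun v : SpinorIndex => ‖modularWeight q v‖ * (q : ℝ) ^ (8 * lev v) := by
  choose A N B K hA hv using exists_ind
  have hg : Summable fun m : ℕ => rp q ^ m := summable_geometric_of_lt_one (rp_pos q).le (rp_lt_one q)
  have hg2 := hg.mul_of_nonneg hg (fun _ => pow_nonneg (rp_pos q).le _) (fun _ => pow_nonneg (rp_pos q).le _)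
  have hg4 := hg2.mul_of_nonneg hg2 (fun _ => mul_nonneg (pow_nonneg (rp_pos q).le _) (pow_nonneg (rp_pos q).le _))
    (fun _ => mul_nonneg (pow_nonneg (rp_pos q).le _) (pow_nonneg (rp_pos q).le _))
  let φ : SpinorIndex → (ℕ × ℕ) × (ℕ × ℕ) := fun v => (((N v).toNat, (K v).toNat), ((A v + K v + 1).toNat, (B v + N v - K v + 1).toNat))
  have hφ : Function.Injective φ := by
    intro v w h
    obtain ⟨h1, h2, h3, h4, h5, h6⟩ := hA v
    obtain ⟨i1, i2, i3, i4, i5, i6⟩ := hA w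
    simp only [φ, Prod.mk.injEq] at h
    rw [hv v, hv w, ind_inj]
    omega
  refine Summable.of_nonneg_of_le (fun v => by have := q.2.1; positivity) (fun v => ?_)
    -- The exponent -10 accounts for -8 from the modular weight and for the two shifts by 1 in the
    -- coordinates of φ.
    ((hg4.comp_injective hφ).mul_left (rp q ^ (-10 : ℤ)))
  obtain ⟨h1, h2, h3, h4, h5, h6⟩ := hA v
  have hl : lev v = (N v).toNat := by
    have := lev_ind (hA v)
    rw [← hv v] at this
    omega
  have e1 : (q : ℝ) ^ (8 * lev v) = rp q ^ (16 * N v) := by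
    rw [← rp_sq, ← pow_mul, ← zpow_natCast]
    congr 1
    rw [hl]
    push_cast
    rw [Int.toNat_of_nonneg (by omega)]
    ring
  have e2 : ‖modularWeight q v‖ = rp q ^ (-(4 * A v + 12 * B v + 8)) := by
    conv_lhs => rw [hv v]
    rw [modularWeight_ind, Complex.norm_real, Real.norm_of_nonneg (qz_pos q _).le, qz_eq]
    congr 1
    ring
  rw [e1, e2]
  simp only [φ, Function.comp]
  rw [← zpow_natCast, ← zpow_natCast, ← zpow_natCast, ← zpow_natCast, Int.toNat_of_nonneg (by omega), Int.toNat_of_nonneg (by omega),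
    Int.toNat_of_nonneg (by omega), Int.toNat_of_nonneg (by omega), ← zpow_add₀ (rp_pos q).ne', ← zpow_add₀ (rp_pos q).ne',
    ← zpow_add₀ (rp_pos q).ne', ← zpow_add₀ (rp_pos q).ne', ← zpow_add₀ (rp_pos q).ne']
  exact zpow_le_zpow_right_of_le_one₀ (rp_pos q) (rp_lt_one q).le (by omega)
end Weights

/-! ### Operators which decay in l. -/

section
variable (q : Param)

theorem exists_diag (c : ℤ → ℤ → ℤ → ℤ → ℂ) (M : ℝ) (hc : ∀ a n b k, Adm a n b k → ‖c a n b k‖ ≤ M) :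
    ∃ T : SpinorSpace →L[ℂ] SpinorSpace, ∀ f a n b k, ext (T f) a n b k = c a n b k * ext f a n b k := by
  obtain ⟨T, hT⟩ := exists_shift c 0 0 0 0 M fun a n b k h _ => hc a n b k h
  refine ⟨T, fun f a n b k => ?_⟩
  by_cases h : Adm a n b k
  · simpa using hT f a n b k h
  · rw [ext_not _ h, ext_not _ h, mul_zero]

theorem qz_nonneg_le_one {z : ℤ} (hz : 0 ≤ z) : qz q z ≤ 1 := zpow_le_one₀ q.2.1 q.2.2.le hz
theorem qz_anti {y z : ℤ} (h : y ≤ z) : qz q z ≤ qz q y := zpow_le_zpow_right_of_le_one₀ q.2.1 q.2.2.le h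

theorem exists_level (t : ℕ) : ∃ T : SpinorSpace →L[ℂ] SpinorSpace, ∀ f a n b k, ext (T f) a n b k = (qz q (t * n) : ℂ) * ext f a n b k :=
  exists_diag _ 1 fun a n b k h => by
    rw [Complex.norm_real, Real.norm_of_nonneg (qz_pos q _).le]
    exact qz_nonneg_le_one q (mul_nonneg (Int.natCast_nonneg t) (h.1.trans h.2.1))

/-- The operator `q^{t (l - 1/2)}`. -/
noncomputable def levelOp (t : ℕ) : SpinorSpace →L[ℂ] SpinorSpace := (exists_level q t).choose
theorem ext_levelOp (t : ℕ) (f : SpinorSpace) (a n b k : ℤ) : ext (levelOp q t f) a n b k = (qz q (t * n) : ℂ) * ext f a n b k :=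
  (exists_level q t).choose_spec f a n b k

theorem levelOp_zero : levelOp q 0 = 1 := by
  ext1 f
  refine ext_inj fun a n b k h => ?_
  rw [ext_levelOp, one_apply_eq_self]
  simp [qz_zero]

/-- Operators which decay as `q^{t l}` with respect to `l`. -/
def Decay (t : ℕ) (T : SpinorSpace →L[ℂ] SpinorSpace) : Prop := ∀ s : ℕ, ∃ b, T * levelOp q s = levelOp q (t + s) * b

variable {q}

theorem Decay.add {t : ℕ} {S T : SpinorSpace →L[ℂ] SpinorSpace} (hS : Decay q t S) (hT : Decay q t T) : Decay q t (S + T) := by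
  intro s
  obtain ⟨b, hb⟩ := hS s
  obtain ⟨c, hc⟩ := hT s
  exact ⟨b + c, by rw [add_mul, hb, hc, mul_add]⟩
theorem Decay.smul {t : ℕ} {T : SpinorSpace →L[ℂ] SpinorSpace} (r : ℂ) (hT : Decay q t T) : Decay q t (r • T) := by
  intro s
  obtain ⟨c, hc⟩ := hT s
  exact ⟨r • c, by rw [smul_mul_assoc, hc, mul_smul_comm]⟩
theorem Decay.zero (t : ℕ) : Decay q t 0 := fun s => ⟨0, by simp⟩
theorem Decay.sum {ι : Type*} {t : ℕ} {T : ι → SpinorSpace →L[ℂ] SpinorSpace} (s : Finset ι) (h : ∀ i, Decay q t (T i)) :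
    Decay q t (∑ i ∈ s, T i) := by
  classical
  induction s using Finset.induction_on with
  | empty => rw [Finset.sum_empty]; exact Decay.zero t
  | insert i s hi ih => rw [Finset.sum_insert hi]; exact (h i).add ih
-- The orders add up because `Decay` is required against every power of q^l on the right and not
-- only for s = 0.
theorem Decay.mul {t t' : ℕ} {S T : SpinorSpace →L[ℂ] SpinorSpace} (hS : Decay q t S) (hT : Decay q t' T) : Decay q (t + t') (S * T) := by
  intro s
  obtain ⟨b, hb⟩ := hT s
  obtain ⟨c, hc⟩ := hS (t' + s)
  exact ⟨c * b, by rw [mul_assoc, hb, ← mul_assoc, hc, mul_assoc, add_assoc]⟩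
theorem Decay.one : Decay q 0 1 := fun s => ⟨1, by rw [one_mul, mul_one, zero_add]⟩
theorem Decay.mono {t t' : ℕ} (h : t' ≤ t) {T : SpinorSpace →L[ℂ] SpinorSpace} (hT : Decay q t T) : Decay q t' T := by
  intro s
  obtain ⟨b, hb⟩ := hT s
  refine ⟨levelOp q (t - t') * b, ?_⟩
  rw [hb, ← mul_assoc]
  congr 1
  ext1 f
  refine ext_inj fun a n b k _ => ?_
  rw [mul_apply_eq_comp, ext_levelOp, ext_levelOp, ext_levelOp, ← mul_assoc, ← Complex.ofReal_mul, ← qz_add]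
  congr 3
  have e : ((t + s : ℕ) : ℤ) = ((t' + s : ℕ) : ℤ) + ((t - t' : ℕ) : ℤ) := by omega
  rw [e]
  ring

variable (q)

/-- A step changes l by at most one, so moving q^{tl} across a generator multiplies its coefficients
by at most q^{-t}. -/
theorem decay_genOp {s : ℝ} (hs : s ^ 2 = 1) (g : SGen) : Decay q 0 (genOp q hs g) := by
  intro t
  obtain ⟨T, hT⟩ := exists_op (fun σ δ a n b k => ((sg s δ * hc q g σ δ a n b k * qz q (t * tv δ) : ℝ) : ℂ)) (da g) (dB g) (qz q (-t))
    fun σ δ a n b k h h' => by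
      rw [Complex.norm_real, Real.norm_eq_abs, abs_mul, abs_mul, sg_abs hs, one_mul, abs_of_pos (qz_pos q _)]
      have h1 : qz q (t * tv δ) ≤ qz q (-t) := by
        refine qz_anti q ?_
        fin_cases δ <;> simp [tv]
      exact (mul_le_mul (hc_le_one q g σ δ h h') h1 (qz_pos q _).le zero_le_one).trans_eq (one_mul _)
  refine ⟨T, ?_⟩
  ext1 f
  refine ext_inj fun a n b k h => ?_
  rw [mul_apply_eq_comp, mul_apply_eq_comp, ext_genOp q hs g _ h, ext_levelOp, hT f a n b k h, Finset.mul_sum]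
  refine Finset.sum_congr rfl fun σ _ => ?_
  rw [Finset.mul_sum]
  refine Finset.sum_congr rfl fun δ _ => ?_
  rw [ext_levelOp, mul_add, qz_add, zero_add]
  push_cast
  ring

theorem genOp_sub {s s' : ℝ} (hs : s ^ 2 = 1) (hs' : s' ^ 2 = 1) (g : SGen) (f : SpinorSpace) {a n b k : ℤ} (h : Adm a n b k) :
    ext ((genOp q hs g - genOp q hs' g) f) a n b k =
      ∑ σ, ((s - s' : ℝ) : ℂ) * (hc q g σ 1 a n b k : ℂ) * ext f (a + da g) n (b + dB g) (k + tv σ) := by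
  have g0 : ∀ s, sg s 0 = 1 := fun _ => rfl
  have g1 : ∀ s, sg s 1 = s := fun _ => rfl
  have g2 : ∀ s, sg s 2 = 1 := fun _ => rfl
  have v1 : tv 1 = 0 := rfl
  rw [sub_apply, ext_sub, ext_genOp q hs g f h, ext_genOp q hs' g f h, ← Finset.sum_sub_distrib]
  refine Finset.sum_congr rfl fun σ _ => ?_
  simp only [Fin.sum_univ_three, g0, g1, g2, v1, add_zero]
  push_cast
  ring

/-- Only the part which preserves l depends on the sign. By `hc_preserving_le` its coefficients stay
bounded after division by q^{2n}. -/
theorem decay_genOp_sub {s s' : ℝ} (hs : s ^ 2 = 1) (hs' : s' ^ 2 = 1) (g : SGen) : Decay q 2 (genOp q hs g - genOp q hs' g) := by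
  intro t
  obtain ⟨T, hT⟩ := exists_op (fun σ δ a n b k => if δ = 1 then (((s - s') * hc q g σ 1 a n b k * qz q (-(2 * n)) : ℝ) : ℂ) else 0) (da g) (dB g)
    (|s - s'| * decayConst q) fun σ δ a n b k h h' => by
      have hd : 0 ≤ decayConst q := Real.sqrt_nonneg _
      split_ifs with hδ
      · subst hδ
        rw [Complex.norm_real, Real.norm_eq_abs, abs_mul, abs_mul, abs_of_pos (qz_pos q _), mul_assoc]
        refine mul_le_mul_of_nonneg_left ?_ (abs_nonneg _)
        have := hc_preserving_le q g σ h (by simpa [tv] using h')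
        refine (mul_le_mul_of_nonneg_right this (qz_pos q _).le).trans_eq ?_
        rw [mul_assoc, ← qz_add, add_neg_cancel, qz_zero, mul_one]
      · rw [norm_zero]; positivity
  refine ⟨T, ?_⟩
  ext1 f
  refine ext_inj fun a n b k h => ?_
  have v1 : tv 1 = 0 := rfl
  rw [mul_apply_eq_comp, mul_apply_eq_comp, genOp_sub q hs hs' g _ h, ext_levelOp, hT f a n b k h, Finset.mul_sum]
  refine Finset.sum_congr rfl fun σ _ => ?_
  rw [Finset.sum_eq_single 1 (fun δ _ hδ => by rw [if_neg hδ, zero_mul]) (by simp), if_pos rfl, ext_levelOp, v1, add_zero]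
  have e : qz q ((2 + t : ℕ) * n) * qz q (-(2 * n)) = qz q (t * n) := by
    rw [← qz_add]; congr 1; push_cast; ring
  have e' : (qz q ((2 + t : ℕ) * n) : ℂ) * (qz q (-(2 * n)) : ℂ) = (qz q (t * n) : ℂ) := by exact_mod_cast e
  rw [← e']
  push_cast
  ring

theorem decay_rep {s : ℝ} (hs : s ^ 2 = 1) (a : SphereAlg q) : Decay q 0 (rep q hs a) := by
  induction a using SphereAlg.induction with
  | hg g => rw [rep_gen]; exact decay_genOp q hs g
  | hc r => rw [AlgHom.commutes, Algebra.algebraMap_eq_smul_one]; exact Decay.one.smul r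
  | ha x y hx hy => rw [map_add]; exact hx.add hy
  | hm x y hx hy =>
    have h := hx.mul hy
    rw [add_zero] at h
    rw [map_mul]
    exact h

/-- The chiral representation with sign `1`. -/
noncomputable def repP : SphereAlg q →ₐ[ℂ] (SpinorSpace →L[ℂ] SpinorSpace) := rep q (one_pow 2)
/-- The chiral representation with sign `-1`. -/
noncomputable def repM : SphereAlg q →ₐ[ℂ] (SpinorSpace →L[ℂ] SpinorSpace) := rep q (s := -1) (by norm_num)
/-- The difference of the chiral representations. -/
noncomputable def repD : SphereAlg q →ₗ[ℂ] (SpinorSpace →L[ℂ] SpinorSpace) := (repP q).toLinearMap - (repM q).toLinearMap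

theorem repD_apply (a : SphereAlg q) : repD q a = repP q a - repM q a := rfl
-- A Leibniz rule with two different actions. It propagates the decay from the generators to the
-- whole algebra and makes the Chern character a cocycle.
theorem repD_mul (a b : SphereAlg q) : repD q (a * b) = repD q a * repP q b + repM q a * repD q b := by
  simp only [repD_apply, map_mul, sub_mul, mul_sub]
  abel

theorem decay_repP (a : SphereAlg q) : Decay q 0 (repP q a) := decay_rep q _ a
theorem decay_repM (a : SphereAlg q) : Decay q 0 (repM q a) := decay_rep q _ a

theorem decay_repD (a : SphereAlg q) : Decay q 2 (repD q a) := by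
  induction a using SphereAlg.induction with
  | hg g => rw [repD_apply, repP, repM, rep_gen, rep_gen]; exact decay_genOp_sub q _ _ g
  | hc r => rw [repD_apply, AlgHom.commutes, AlgHom.commutes, sub_self]; exact Decay.zero 2
  | ha x y hx hy => rw [map_add]; exact hx.add hy
  | hm x y hx hy =>
    have h := (decay_repM q x).mul hy
    rw [zero_add] at h
    rw [repD_mul]
    exact (hx.mul (decay_repP q y)).add h

end

/-! ### The weighted trace and its twisted cyclicity. -/

/-- The vectors of the standard basis. -/
noncomputable def bvec (v : SpinorIndex) : SpinorSpace := lp.single 2 v (1 : ℂ)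

theorem inner_bvec (v : SpinorIndex) (f : SpinorSpace) : inner ℂ (bvec v) f = f v := by
  rw [bvec, lp.inner_single_left]; simp
theorem norm_bvec (v : SpinorIndex) : ‖bvec v‖ = 1 := by
  rw [bvec, lp.norm_single (by norm_num), norm_one]
theorem bvec_ind {a n b k : ℤ} (h : Adm a n b k) : bvec (ind h) = vec a n b k := (vec_adm h).symm
theorem ext_ind (f : SpinorSpace) {a n b k : ℤ} (h : Adm a n b k) : f (ind h) = ext f a n b k := (ext_adm f h).symm

/-- The standard basis. -/
noncomputable def stdBasis : HilbertBasis SpinorIndex ℂ SpinorSpace := HilbertBasis.ofRepr (LinearIsometryEquiv.refl ℂ _)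
theorem stdBasis_apply (v : SpinorIndex) : stdBasis v = bvec v := rfl

theorem hasSum_bvec (f : SpinorSpace) : HasSum (fun v => f v • bvec v) f := stdBasis.hasSum_repr f

instance : Countable SpinorIndex := by
  choose A N B K hA hv using exists_ind
  refine Function.Injective.countable (f := fun v => (A v, N v, B v, K v)) fun v w h => ?_
  simp only [Prod.mk.injEq] at h
  rw [hv v, hv w, ind_inj]
  exact h

section
variable (q : Param)

/-- The weighted trace `Tr (K₁⁻⁸ K₂⁻⁶ X)`. -/
noncomputable def tau (X : SpinorSpace →L[ℂ] SpinorSpace) : ℂ := ∑' v, modularWeight q v * X (bvec v) v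

/-- The relation `u' = K₁⁻⁸ K₂⁻⁶ u`. -/
def ModRel (u u' : SpinorSpace) : Prop := ∀ v, u' v = modularWeight q v * u v

theorem qz_lev (t : ℕ) {a n b k : ℤ} (h : Adm a n b k) : (qz q (t * n) : ℂ) = (q : ℂ) ^ (t * lev (ind h)) := by
  have e : (t : ℤ) * n = ((t * lev (ind h) : ℕ) : ℤ) := by rw [Nat.cast_mul, lev_ind h]
  rw [e, qz, zpow_natCast, Complex.ofReal_pow]

theorem exists_weight : ∃ T : SpinorSpace →L[ℂ] SpinorSpace, ∀ f v, T f v = modularWeight q v * (q : ℂ) ^ (8 * lev v) * f v := by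
  obtain ⟨T, hT⟩ := exists_diag (fun a n b k => ((qz q (-(2 * a + 6 * b + 4) + 8 * n) : ℝ) : ℂ)) (qz q (-4)) fun a n b k h => by
    rw [Complex.norm_real, Real.norm_of_nonneg (qz_pos q _).le]
    obtain ⟨h1, h2, h3, h4, h5, h6⟩ := h
    exact qz_anti q (by omega)
  refine ⟨T, fun f v => ?_⟩
  obtain ⟨a, n, b, k, h, rfl⟩ := exists_ind v
  rw [ext_ind _ h, hT, ext_ind _ h, modularWeight_ind, qz_add, Complex.ofReal_mul]
  congr 2
  exact qz_lev q 8 h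

theorem levelOp_apply (t : ℕ) (f : SpinorSpace) (v : SpinorIndex) : levelOp q t f v = (q : ℂ) ^ (t * lev v) * f v := by
  obtain ⟨a, n, b, k, h, rfl⟩ := exists_ind v
  rw [ext_ind _ h, ext_levelOp, ext_ind _ h, qz_lev q t h]

variable {q}

theorem Decay.eq {X : SpinorSpace →L[ℂ] SpinorSpace} (h : Decay q 8 X) : ∃ b, X = levelOp q 8 * b := by
  obtain ⟨b, hb⟩ := h 0
  rw [levelOp_zero, mul_one] at hb
  exact ⟨b, hb⟩

theorem Decay.summable {X : SpinorSpace →L[ℂ] SpinorSpace} (h : Decay q 8 X) :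
    Summable fun v => modularWeight q v * X (bvec v) v := by
  obtain ⟨b, rfl⟩ := h.eq
  refine Summable.of_norm_bounded ((summable_weight q).mul_right ‖b‖) fun v => ?_
  rw [mul_apply_eq_comp, levelOp_apply, ← mul_assoc, norm_mul, norm_mul, norm_pow, Complex.norm_real, Real.norm_of_nonneg q.2.1.le]
  refine mul_le_mul_of_nonneg_left ?_ (by have := q.2.1; positivity)
  refine (lp.norm_apply_le_norm (by norm_num) _ v).trans ((b.le_opNorm _).trans_eq ?_)
  rw [norm_bvec, mul_one]

/-- Write X = Q b with Q = q^{8(l - 1/2)}. The unbounded K₁⁻⁸K₂⁻⁶ times Q is a diagonal operator W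
with summable entries w_v, and T = W b is the sum of the rank one operators ⟨b* e_v, ·⟩ w_v e_v. The
extra factor A on the left is there for the cyclicity: the same decomposition identifies Tr(A T)
with τ(X A). -/
theorem Decay.nuclear {X : SpinorSpace →L[ℂ] SpinorSpace} (h : Decay q 8 X) : ∃ T : SpinorSpace →L[ℂ] SpinorSpace,
    (∀ u, ModRel q (X u) (T u)) ∧ ∃ x y : SpinorIndex → SpinorSpace, ∀ A : SpinorSpace →L[ℂ] SpinorSpace,
      Summable (fun v => ‖x v‖ * ‖A (y v)‖) ∧ (∀ u, HasSum (fun v => inner ℂ (x v) u • A (y v)) ((A * T) u)) ∧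
      ∑' v, inner ℂ (x v) (A (y v)) = tau q (X * A) := by
  obtain ⟨b, rfl⟩ := h.eq
  obtain ⟨W, hW⟩ := exists_weight q
  have hx : ∀ v u, inner ℂ (ContinuousLinearMap.adjoint b (bvec v)) u = b u v := fun v u => by
    rw [ContinuousLinearMap.adjoint_inner_left, inner_bvec]
  refine ⟨W * b, fun u v => ?_, fun v => ContinuousLinearMap.adjoint b (bvec v),
    fun v => (modularWeight q v * (q : ℂ) ^ (8 * lev v)) • bvec v, fun A => ⟨?_, fun u => ?_, ?_⟩⟩
  · rw [mul_apply_eq_comp, hW, mul_apply_eq_comp, levelOp_apply, mul_assoc]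
  · refine Summable.of_nonneg_of_le (fun v => by positivity) (fun v => ?_) ((summable_weight q).mul_left (‖ContinuousLinearMap.adjoint b‖ * ‖A‖))
    rw [map_smul, norm_smul, norm_mul, norm_pow, Complex.norm_real, Real.norm_of_nonneg q.2.1.le]
    have h1 := (ContinuousLinearMap.adjoint b).le_opNorm (bvec v)
    have h2 := A.le_opNorm (bvec v)
    rw [norm_bvec, mul_one] at h1 h2
    have := q.2.1
    calc _ ≤ ‖ContinuousLinearMap.adjoint b‖ * (‖modularWeight q v‖ * (q : ℝ) ^ (8 * lev v) * ‖A‖) := by gcongr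
      _ = _ := by ring
  · have := (hasSum_bvec (W (b u))).mapL A
    rw [mul_apply_eq_comp, mul_apply_eq_comp]
    convert this using 1
    funext v
    rw [hx, hW, map_smul, map_smul, smul_smul, mul_comm]
  · rw [tau]
    refine tsum_congr fun v => ?_
    rw [hx, map_smul, map_smul, mul_apply_eq_comp, mul_apply_eq_comp, levelOp_apply, ← mul_assoc]
    rfl

theorem tau_add {X Y : SpinorSpace →L[ℂ] SpinorSpace} (hX : Decay q 8 X) (hY : Decay q 8 Y) : tau q (X + Y) = tau q X + tau q Y := by
  rw [tau, tau, tau, ← hX.summable.tsum_add hY.summable]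
  refine tsum_congr fun v => ?_
  rw [← mul_add]; rfl
theorem tau_smul (r : ℂ) (X : SpinorSpace →L[ℂ] SpinorSpace) : tau q (r • X) = r * tau q X := by
  rw [tau, tau, ← tsum_mul_left]
  refine tsum_congr fun v => ?_
  rw [mul_left_comm]; rfl

/-- The labels m₁, m₂ of all steps of x_g change by the same amounts, and the resulting factor of
the modular weight is the eigenvalue of κ on x_g. -/
theorem modRel_genOp {s : ℝ} (hs : s ^ 2 = 1) (g : SGen) {u u' : SpinorSpace} (h : ModRel q u u') :
    ModRel q (rep q hs (kappa q (sgen q g)) u) (rep q hs (sgen q g) u') := by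
  have h' : ∀ a n b k, ext u' a n b k = (qz q (-(2 * a + 6 * b + 4)) : ℂ) * ext u a n b k := by
    intro a n b k
    by_cases hv : Adm a n b k
    · rw [ext_adm _ hv, ext_adm _ hv, h, modularWeight_ind]
    · rw [ext_not _ hv, ext_not _ hv, mul_zero]
  have hg : ∀ a b, (qz q (-(2 * (a + da g) + 6 * (b + dB g) + 4)) : ℂ) = (qz q (-(2 * a + 6 * b + 4)) : ℂ) * (kw q 0 g ^ 8 * kw q 1 g ^ 6) := by
    intro a b
    have e : (qz q (-(2 * (a + da g) + 6 * (b + dB g) + 4)) : ℂ) = (qz q (-(2 * a + 6 * b + 4)) : ℂ) * (qz q (-(2 * da g + 6 * dB g)) : ℂ) := by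
      rw [← Complex.ofReal_mul, ← qz_add]; congr 2; ring
    rw [e]
    congr 1
    have hq := qc_ne q
    have e2 : (qz q (-(2 * da g + 6 * dB g)) : ℂ) = qc q ^ (-(2 * da g + 6 * dB g)) := by
      rw [qz, qc]; push_cast; rfl
    rw [e2]
    cases g <;> simp [da, dB, kw, wt] <;> field_simp <;> norm_cast
  intro v
  obtain ⟨a, n, b, k, hv, rfl⟩ := exists_ind v
  rw [kappa_gen, map_smul, rep_gen, ext_ind _ hv, ext_ind _ hv, smul_apply, ext_smul, ext_genOp q hs g _ hv, ext_genOp q hs g _ hv,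
    modularWeight_ind, ← mul_assoc, Finset.mul_sum]
  refine Finset.sum_congr rfl fun σ _ => ?_
  rw [Finset.mul_sum]
  refine Finset.sum_congr rfl fun δ _ => ?_
  rw [h', hg]
  ring

/-- This is K⁻¹ π(κ(a)) = π(a) K⁻¹ for K = K₁⁸K₂⁶, as a relation between vectors because K⁻¹ is
unbounded. -/
theorem modRel_rep {s : ℝ} (hs : s ^ 2 = 1) (a : SphereAlg q) : ∀ {u u' : SpinorSpace}, ModRel q u u' →
    ModRel q (rep q hs (kappa q a) u) (rep q hs a u') := by
  induction a using SphereAlg.induction with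
  | hg g => exact fun h => modRel_genOp hs g h
  | hc r =>
    intro u u' h v
    have e : kappa q (algebraMap ℂ _ r) = algebraMap ℂ _ r := AlgEquiv.commutes _ r
    rw [e, AlgHom.commutes, Algebra.algebraMap_eq_smul_one, smul_apply, smul_apply, one_apply_eq_self, one_apply_eq_self]
    change r * u' v = _ * (r * u v)
    rw [h v, mul_left_comm]
  | ha x y hx hy =>
    intro u u' h v
    rw [map_add, map_add, map_add, add_apply, add_apply]
    change rep q hs x u' v + rep q hs y u' v = _ * (rep q hs (kappa q x) u v + rep q hs (kappa q y) u v)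
    rw [hx h v, hy h v, mul_add]
  | hm x y hx hy =>
    intro u u' h
    rw [map_mul, map_mul, map_mul, mul_apply_eq_comp, mul_apply_eq_comp]
    exact hx (hy h)

/-- Both sides are the trace of π(a) T with T = K⁻¹X: the left one in the standard basis by
`modRel_rep`, the right one by the nuclear decomposition. -/
theorem tau_rep {s : ℝ} (hs : s ^ 2 = 1) (a : SphereAlg q) {X : SpinorSpace →L[ℂ] SpinorSpace} (h : Decay q 8 X) :
    tau q (rep q hs (kappa q a) * X) = tau q (X * rep q hs a) := by
  obtain ⟨T, hT, x, y, hA⟩ := h.nuclear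
  obtain ⟨h1, h2, h3⟩ := hA (rep q hs a)
  rw [← h3, ← (hasSum_trace h1 h2 stdBasis).tsum_eq, tau]
  refine tsum_congr fun v => ?_
  rw [stdBasis_apply, inner_bvec, mul_apply_eq_comp, mul_apply_eq_comp, modRel_rep hs a (hT _) v]

end

/-! ### The twisted Chern character. -/

section
variable (q : Param)

/-- The operators which decay as `q^{8 l}`. -/
def decaySub : Submodule ℂ (SpinorSpace →L[ℂ] SpinorSpace) where
  carrier := {T | Decay q 8 T}
  add_mem' := fun h h' => Decay.add h h'
  zero_mem' := Decay.zero 8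
  smul_mem' := fun r _ h => Decay.smul r h

/-- The weighted trace as a linear form. -/
noncomputable def tauLin : decaySub q →ₗ[ℂ] ℂ where
  toFun := fun X => tau q X.1
  map_add' := fun X Y => tau_add X.2 Y.2
  map_smul' := fun r X => tau_smul r X.1

/-- The multilinear map `(a₀, …, a₄) ↦ d a₀ ⋯ d a₄`. -/
noncomputable def dprod : MultilinearMap ℂ (fun _ : Fin 5 => SphereAlg q) (SpinorSpace →L[ℂ] SpinorSpace) :=
  (MultilinearMap.mkPiAlgebraFin ℂ 5 (SpinorSpace →L[ℂ] SpinorSpace)).compLinearMap fun _ => repD q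

theorem dprod_apply (a : Fin 5 → SphereAlg q) : dprod q a = repD q (a 0) * repD q (a 1) * repD q (a 2) * repD q (a 3) * repD q (a 4) := by
  rw [dprod, MultilinearMap.compLinearMap_apply, MultilinearMap.mkPiAlgebraFin_apply]
  simp [List.ofFn_succ, mul_assoc]

theorem decay_five (a : Fin 5 → SphereAlg q) : Decay q 8 (dprod q a) := by
  rw [dprod_apply]
  exact (((((decay_repD q _).mul (decay_repD q _)).mul (decay_repD q _)).mul (decay_repD q _)).mul (decay_repD q _)).mono (by norm_num)

/-- The twisted Chern character. -/
noncomputable def chernForm : (⨂[ℂ]^5 (SphereAlg q)) →ₗ[ℂ] ℂ :=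
  (2 : ℂ) • PiTensorProduct.lift ((tauLin q).compMultilinearMap ((dprod q).codRestrict (decaySub q) (decay_five q)))

theorem chernForm_tprod (a : Fin 5 → SphereAlg q) : chernForm q (PiTensorProduct.tprod ℂ a) = 2 * tau q (dprod q a) := by
  rw [chernForm, LinearMap.smul_apply, PiTensorProduct.lift.tprod]
  rfl

/-- The commutator [F, a] is the off-diagonal operator (u, v) ↦ (-da v, da u). Together with F there
are six off-diagonal factors, so the product is diagonal; γ and the signs make both diagonal entries
da₀ ⋯ da₄. -/
theorem chernOp_eq (a : Fin 5 → SphereAlg q) : chernOp (repP q) (repM q) a = dsum (dprod q a) (dprod q a) := by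
  have h : ∀ x, opF * dsum (repP q x) (repM q x) - dsum (repP q x) (repM q x) * opF =
      onSpinors ((-(repD q x ∘L ContinuousLinearMap.snd ℂ _ _)).prod (repD q x ∘L ContinuousLinearMap.fst ℂ _ _)) := by
    intro x
    ext1 u
    apply (WithLp.prodContinuousLinearEquiv 2 ℂ SpinorSpace SpinorSpace).injective
    refine Prod.ext ?_ ?_
    · change repM q x u.snd - repP q x u.snd = -(repP q x u.snd - repM q x u.snd)
      abel
    · rfl
  rw [chernOp]
  simp only [h]
  ext1 u
  apply (WithLp.prodContinuousLinearEquiv 2 ℂ SpinorSpace SpinorSpace).injective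
  simp only [List.ofFn_succ, List.ofFn_zero, List.prod_cons, List.prod_nil, mul_one, dprod_apply]
  refine Prod.ext ?_ ?_
  · change repD q _ (-(repD q _ (repD q _ (-(repD q _ (repD q _ u.fst)))))) = repD q _ (repD q _ (repD q _ (repD q _ (repD q _ u.fst))))
    simp only [map_neg, neg_neg]
    rfl
  · change -(-(repD q _ (repD q _ (-(repD q _ (repD q _ (-(repD q _ u.snd)))))))) = repD q _ (repD q _ (repD q _ (repD q _ (repD q _ u.snd))))
    simp only [map_neg, neg_neg]
    rfl

/-- Two copies of the nuclear decomposition, one in each summand of H, whence the factor 2. -/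
theorem hasTrace_dsum {X : SpinorSpace →L[ℂ] SpinorSpace} (h : Decay q 8 X) :
    ∃ T : Spinors →L[ℂ] Spinors, IsModularMul q (dsum X X) T ∧ HasTrace T (2 * tau q X) := by
  obtain ⟨T, hT, x, y, hA⟩ := h.nuclear
  obtain ⟨h1, h2, h3⟩ := hA 1
  simp only [one_apply_eq_self, one_mul, mul_one] at h1 h2 h3
  refine ⟨dsum T T, fun u v => ⟨hT _ v, hT _ v⟩, ?_⟩
  let i1 : SpinorSpace →L[ℂ] Spinors := (WithLp.prodContinuousLinearEquiv 2 ℂ SpinorSpace SpinorSpace).symm.toContinuousLinearMap ∘L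
    ContinuousLinearMap.inl ℂ _ _
  let i2 : SpinorSpace →L[ℂ] Spinors := (WithLp.prodContinuousLinearEquiv 2 ℂ SpinorSpace SpinorSpace).symm.toContinuousLinearMap ∘L
    ContinuousLinearMap.inr ℂ _ _
  have e1 : ∀ z u, inner ℂ (i1 z) u = inner ℂ z u.fst := fun z u => by
    rw [WithLp.prod_inner_apply]
    change inner ℂ z u.fst + inner ℂ (0 : SpinorSpace) u.snd = _
    rw [inner_zero_left, add_zero]
  have e2 : ∀ z u, inner ℂ (i2 z) u = inner ℂ z u.snd := fun z u => by
    rw [WithLp.prod_inner_apply]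
    change inner ℂ (0 : SpinorSpace) u.fst + inner ℂ z u.snd = _
    rw [inner_zero_left, zero_add]
  have n1 : ∀ z, ‖i1 z‖ = ‖z‖ := fun z => by
    rw [WithLp.prod_norm_eq_of_L2]
    change √(‖z‖ ^ 2 + ‖(0 : SpinorSpace)‖ ^ 2) = _
    rw [norm_zero, zero_pow two_ne_zero, add_zero, Real.sqrt_sq (norm_nonneg z)]
  have n2 : ∀ z, ‖i2 z‖ = ‖z‖ := fun z => by
    rw [WithLp.prod_norm_eq_of_L2]
    change √(‖(0 : SpinorSpace)‖ ^ 2 + ‖z‖ ^ 2) = _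
    rw [norm_zero, zero_pow two_ne_zero, zero_add, Real.sqrt_sq (norm_nonneg z)]
  have hs : Summable fun k => ‖(Sum.elim (fun v => i1 (x v)) (fun v => i2 (x v)) : SpinorIndex ⊕ SpinorIndex → Spinors) k‖ *
      ‖(Sum.elim (fun v => i1 (y v)) (fun v => i2 (y v)) : SpinorIndex ⊕ SpinorIndex → Spinors) k‖ := by
    refine Summable.sum _ ?_ ?_
    · simpa only [Function.comp_def, Sum.elim_inl, n1] using h1
    · simpa only [Function.comp_def, Sum.elim_inr, n2] using h1
  have ht : ∀ u, HasSum (fun k => inner ℂ ((Sum.elim (fun v => i1 (x v)) (fun v => i2 (x v)) : SpinorIndex ⊕ SpinorIndex → Spinors) k) u •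
      (Sum.elim (fun v => i1 (y v)) (fun v => i2 (y v)) : SpinorIndex ⊕ SpinorIndex → Spinors) k) (dsum T T u) := by
    intro u
    have e : dsum T T u = i1 (T u.fst) + i2 (T u.snd) := by
      apply (WithLp.prodContinuousLinearEquiv 2 ℂ SpinorSpace SpinorSpace).injective
      refine Prod.ext ?_ ?_
      · change T u.fst = T u.fst + 0
        rw [add_zero]
      · change T u.snd = 0 + T u.snd
        rw [zero_add]
    rw [e]
    refine HasSum.sum ?_ ?_
    · have := (h2 u.fst).mapL i1
      simpa only [Function.comp_def, Sum.elim_inl, e1, map_smul] using this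
    · have := (h2 u.snd).mapL i2
      simpa only [Function.comp_def, Sum.elim_inr, e2, map_smul] using this
  have := hasTrace_of hs ht
  have hsum : Summable fun v => inner ℂ (x v) (y v) :=
    Summable.of_norm_bounded h1 fun v => norm_inner_le_norm _ _
  have hval : ∑' k, inner ℂ ((Sum.elim (fun v => i1 (x v)) (fun v => i2 (x v)) : SpinorIndex ⊕ SpinorIndex → Spinors) k)
      ((Sum.elim (fun v => i1 (y v)) (fun v => i2 (y v)) : SpinorIndex ⊕ SpinorIndex → Spinors) k) = 2 * tau q X := by
    have s1 : HasSum ((fun k => inner ℂ ((Sum.elim (fun v => i1 (x v)) (fun v => i2 (x v)) : SpinorIndex ⊕ SpinorIndex → Spinors) k)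
      ((Sum.elim (fun v => i1 (y v)) (fun v => i2 (y v)) : SpinorIndex ⊕ SpinorIndex → Spinors) k)) ∘ Sum.inl) (tau q X) := by
      simp only [Function.comp_def, Sum.elim_inl, e1]
      rw [← h3]
      exact hsum.hasSum
    have s2 : HasSum ((fun k => inner ℂ ((Sum.elim (fun v => i1 (x v)) (fun v => i2 (x v)) : SpinorIndex ⊕ SpinorIndex → Spinors) k)
      ((Sum.elim (fun v => i1 (y v)) (fun v => i2 (y v)) : SpinorIndex ⊕ SpinorIndex → Spinors) k)) ∘ Sum.inr) (tau q X) := by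
      simp only [Function.comp_def, Sum.elim_inr, e2]
      rw [← h3]
      exact hsum.hasSum
    rw [(s1.sum s2).tsum_eq, two_mul]
  rwa [hval] at this

theorem isTwistedChern : IsTwistedChern (repP q) (repM q) 4 (chernForm q) := by
  intro a
  rw [chernForm_tprod, chernOp_eq]
  exact hasTrace_dsum q (decay_five q a)

variable {q}

theorem modRel_repD (a : SphereAlg q) {u u' : SpinorSpace} (h : ModRel q u u') :
    ModRel q (repD q (kappa q a) u) (repD q a u') := by
  intro v
  have h1 := modRel_rep (one_pow 2) a h v
  have h2 := modRel_rep (s := -1) (by norm_num) a h v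
  change rep q _ a u' v - rep q _ a u' v = _ * (rep q _ (kappa q a) u v - rep q _ (kappa q a) u v)
  rw [h1, h2, mul_sub]

/-- Each diagonal entry is invariant: a basis vector is an eigenvector of K⁻¹, and K⁻¹ is carried
through the five differences by `modRel_repD`. -/
theorem tau_dprod_kappa (a : Fin 5 → SphereAlg q) : tau q (dprod q fun i => kappa q (a i)) = tau q (dprod q a) := by
  rw [tau, tau]
  refine tsum_congr fun v => ?_
  have h0 : ModRel q (bvec v) (modularWeight q v • bvec v) := by
    intro w
    change modularWeight q v * bvec v w = _
    by_cases h : w = v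
    · rw [h]
    · have : bvec v w = 0 := by rw [bvec, lp.single_apply, Pi.single_apply, if_neg h]
      rw [this, mul_zero, mul_zero]
  have h1 := modRel_repD (a 0) (modRel_repD (a 1) (modRel_repD (a 2) (modRel_repD (a 3) (modRel_repD (a 4) h0)))) v
  rw [dprod_apply, dprod_apply]
  refine Eq.trans h1.symm ?_
  simp only [map_smul]
  rfl

theorem chernForm_kappa : chernForm q ∘ₗ twistMap (kappa q) 4 = chernForm q := by
  refine PiTensorProduct.ext (MultilinearMap.ext fun a => ?_)
  change chernForm q (twistMap (kappa q) 4 (PiTensorProduct.tprod ℂ a)) = chernForm q (PiTensorProduct.tprod ℂ a)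
  rw [twistMap, PiTensorProduct.map_tprod, chernForm_tprod, chernForm_tprod]
  exact congrArg _ (tau_dprod_kappa a)

theorem repP_eq (a : SphereAlg q) : repP q a = repM q a + repD q a := by rw [repD_apply]; abel

end

/-! ### The Chern character vanishes on twisted boundaries. -/

theorem twistedBoundary_tprod_six {A : Type*} [Ring A] [Algebra ℂ A] (σ : A ≃ₐ[ℂ] A) (x : Fin 6 → A) :
    twistedBoundary σ 4 (PiTensorProduct.tprod ℂ x) =
      PiTensorProduct.tprod ℂ ![x 0 * x 1, x 2, x 3, x 4, x 5] - PiTensorProduct.tprod ℂ ![x 0, x 1 * x 2, x 3, x 4, x 5] +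
      PiTensorProduct.tprod ℂ ![x 0, x 1, x 2 * x 3, x 4, x 5] - PiTensorProduct.tprod ℂ ![x 0, x 1, x 2, x 3 * x 4, x 5] +
      PiTensorProduct.tprod ℂ ![x 0, x 1, x 2, x 3, x 4 * x 5] - PiTensorProduct.tprod ℂ ![σ (x 5) * x 0, x 1, x 2, x 3, x 4] := by
  have h0 : innerTuple 4 0 x = ![x 0 * x 1, x 2, x 3, x 4, x 5] := by funext x; fin_cases x <;> rfl
  have h1 : innerTuple 4 1 x = ![x 0, x 1 * x 2, x 3, x 4, x 5] := by funext x; fin_cases x <;> rfl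
  have h2 : innerTuple 4 2 x = ![x 0, x 1, x 2 * x 3, x 4, x 5] := by funext x; fin_cases x <;> rfl
  have h3 : innerTuple 4 3 x = ![x 0, x 1, x 2, x 3 * x 4, x 5] := by funext x; fin_cases x <;> rfl
  have h4 : innerTuple 4 4 x = ![x 0, x 1, x 2, x 3, x 4 * x 5] := by funext x; fin_cases x <;> rfl
  have h5 : lastTuple σ 4 x = ![σ (x 5) * x 0, x 1, x 2, x 3, x 4] := by funext x; fin_cases x <;> rfl
  have hs : ∀ f : Fin (4 + 1) → ((⨂[ℂ]^(4 + 2) A) →ₗ[ℂ] ⨂[ℂ]^(4 + 1) A), ∑ j, f j = f 0 + f 1 + f 2 + f 3 + f 4 :=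
    fun f => Fin.sum_univ_five f
  have e4 : ((4 : Fin (4 + 1)) : ℕ) = 4 := rfl
  have e3 : ((3 : Fin (4 + 1)) : ℕ) = 3 := rfl
  have e2 : ((2 : Fin (4 + 1)) : ℕ) = 2 := rfl
  have e1 : ((1 : Fin (4 + 1)) : ℕ) = 1 := rfl
  have e0 : ((0 : Fin (4 + 1)) : ℕ) = 0 := rfl
  rw [twistedBoundary, hs]
  simp only [e0, e1, e2, e3, e4, LinearMap.add_apply, LinearMap.smul_apply, tensorMap_tprod, h0, h1, h2, h3, h4, h5]
  norm_num
  module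

variable {q : Param}

theorem tau_sub {X Y : SpinorSpace →L[ℂ] SpinorSpace} (hX : Decay q 8 X) (hY : Decay q 8 Y) : tau q (X - Y) = tau q X - tau q Y := by
  rw [sub_eq_add_neg, ← neg_one_smul ℂ Y, tau_add hX (hY.smul _), tau_smul]; ring

theorem tau_repM (a : SphereAlg q) {X : SpinorSpace →L[ℂ] SpinorSpace} (h : Decay q 8 X) :
    tau q (repM q (kappa q a) * X) = tau q (X * repM q a) := tau_rep _ a h

theorem tau_repP (a : SphereAlg q) {X : SpinorSpace →L[ℂ] SpinorSpace} (h : Decay q 8 X) :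
    tau q (repP q (kappa q a) * X) = tau q (X * repP q a) := tau_rep _ a h

theorem tau_repD (a : SphereAlg q) {X : SpinorSpace →L[ℂ] SpinorSpace} (h : Decay q 8 X) :
    tau q (repD q (kappa q a) * X) = tau q (X * repD q a) := by
  have l := fun T (hT : Decay q 0 T) => (hT.mul h).mono (show 8 ≤ 0 + 8 by norm_num)
  have r := fun T (hT : Decay q 0 T) => (h.mul hT).mono (show 8 ≤ 8 + 0 by norm_num)
  rw [repD_apply, repD_apply, sub_mul, mul_sub, tau_sub (l _ (decay_repP q _)) (l _ (decay_repM q _)),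
    tau_sub (r _ (decay_repP q _)) (r _ (decay_repM q _)), tau_repP a h, tau_repM a h]

/-- Here m stands for π₋ and m + d for π₊. The term with π₊(x_j) from one product cancels against
π₋(x_j) and d x_j from the next; only the two ends remain. -/
theorem telescope {R : Type*} [Ring R] (d0 d1 d2 d3 d4 d5 m0 m1 m2 m3 m4 m5 : R) :
    (d0 * (m1 + d1) + m0 * d1) * d2 * d3 * d4 * d5 - d0 * (d1 * (m2 + d2) + m1 * d2) * d3 * d4 * d5 +
      d0 * d1 * (d2 * (m3 + d3) + m2 * d3) * d4 * d5 - d0 * d1 * d2 * (d3 * (m4 + d4) + m3 * d4) * d5 +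
      d0 * d1 * d2 * d3 * (d4 * (m5 + d5) + m4 * d5) =
    (m0 + d0) * d1 * d2 * d3 * d4 * d5 + d0 * d1 * d2 * d3 * d4 * m5 := by
  noncomm_ring


theorem decay_five' (x0 x1 x2 x3 x4 : SphereAlg q) : Decay q 8 (repD q x0 * repD q x1 * repD q x2 * repD q x3 * repD q x4) := by
  exact (((((decay_repD q _).mul (decay_repD q _)).mul (decay_repD q _)).mul (decay_repD q _)).mul (decay_repD q _)).mono (by norm_num)

theorem chernForm_vec (x0 x1 x2 x3 x4 : SphereAlg q) : chernForm q (PiTensorProduct.tprod ℂ ![x0, x1, x2, x3, x4]) =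
    2 * tau q (repD q x0 * repD q x1 * repD q x2 * repD q x3 * repD q x4) := by
  rw [chernForm_tprod, dprod_apply]
  rfl

/-- Apply the Leibniz rule to κ(x₅) x₀ and move the factor with κ(x₅) to the end by twisted
cyclicity. In one of the terms only four differences stay behind, so cyclicity is needed at decay of
order 8 and not 10. -/
theorem tau_cyclic (x0 x1 x2 x3 x4 x5 : SphereAlg q) :
    tau q (repD q (kappa q x5 * x0) * repD q x1 * repD q x2 * repD q x3 * repD q x4) =
      tau q (repP q x0 * repD q x1 * repD q x2 * repD q x3 * repD q x4 * repD q x5 +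
        repD q x0 * repD q x1 * repD q x2 * repD q x3 * repD q x4 * repM q x5) := by
  have d1 := decay_five' x0 x1 x2 x3 x4
  have d2 : Decay q 8 (repP q x0 * repD q x1 * repD q x2 * repD q x3 * repD q x4) :=
    (((((decay_repP q _).mul (decay_repD q _)).mul (decay_repD q _)).mul (decay_repD q _)).mul (decay_repD q _)).mono (by norm_num)
  have d3 : Decay q 8 (repD q (kappa q x5) * (repP q x0 * repD q x1 * repD q x2 * repD q x3 * repD q x4)) :=
    ((decay_repD q _).mul d2).mono (by norm_num)
  have d4 : Decay q 8 (repM q (kappa q x5) * (repD q x0 * repD q x1 * repD q x2 * repD q x3 * repD q x4)) :=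
    ((decay_repM q _).mul d1).mono (by norm_num)
  have d5 : Decay q 8 (repP q x0 * repD q x1 * repD q x2 * repD q x3 * repD q x4 * repD q x5) :=
    (d2.mul (decay_repD q _)).mono (by norm_num)
  have d6 : Decay q 8 (repD q x0 * repD q x1 * repD q x2 * repD q x3 * repD q x4 * repM q x5) :=
    (d1.mul (decay_repM q _)).mono (by norm_num)
  rw [tau_add d5 d6, ← tau_repD _ d2, ← tau_repM _ d1]
  rw [← tau_add d3 d4, repD_mul]
  simp only [add_mul, mul_assoc]

theorem tau_telescope (x0 x1 x2 x3 x4 x5 : SphereAlg q) :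
    tau q (repD q (x0 * x1) * repD q x2 * repD q x3 * repD q x4 * repD q x5) -
    tau q (repD q x0 * repD q (x1 * x2) * repD q x3 * repD q x4 * repD q x5) +
    tau q (repD q x0 * repD q x1 * repD q (x2 * x3) * repD q x4 * repD q x5) -
    tau q (repD q x0 * repD q x1 * repD q x2 * repD q (x3 * x4) * repD q x5) +
    tau q (repD q x0 * repD q x1 * repD q x2 * repD q x3 * repD q (x4 * x5)) =
      tau q (repP q x0 * repD q x1 * repD q x2 * repD q x3 * repD q x4 * repD q x5 +
        repD q x0 * repD q x1 * repD q x2 * repD q x3 * repD q x4 * repM q x5) := by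
  have ds : ∀ X Y : SpinorSpace →L[ℂ] SpinorSpace, Decay q 8 X → Decay q 8 Y → Decay q 8 (X - Y) := fun X Y hX hY => by
    rw [sub_eq_add_neg, ← neg_one_smul ℂ Y]; exact hX.add (hY.smul _)
  have e1 := decay_five' (x0 * x1) x2 x3 x4 x5
  have e2 := decay_five' x0 (x1 * x2) x3 x4 x5
  have e3 := decay_five' x0 x1 (x2 * x3) x4 x5
  have e4 := decay_five' x0 x1 x2 (x3 * x4) x5
  have e5 := decay_five' x0 x1 x2 x3 (x4 * x5)
  rw [← tau_sub e1 e2, ← tau_add (ds _ _ e1 e2) e3, ← tau_sub ((ds _ _ e1 e2).add e3) e4, ← tau_add (ds _ _ ((ds _ _ e1 e2).add e3) e4) e5]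
  simp only [repD_mul, repP_eq, telescope]

theorem chernForm_boundary : chernForm q ∘ₗ twistedBoundary (kappa q) 4 = 0 := by
  refine PiTensorProduct.ext (MultilinearMap.ext fun x => ?_)
  change chernForm q (twistedBoundary (kappa q) 4 (PiTensorProduct.tprod ℂ x)) = 0
  rw [twistedBoundary_tprod_six, map_sub, map_add, map_sub, map_add, map_sub]
  simp only [chernForm_vec]
  rw [tau_cyclic, ← tau_telescope]
  ring

/-! ### The blocks of the Dirac operator and their eigenvalues. -/

section
variable {F : Type*} [Field F]

/-- The blocks of the Dirac operator at a fixed level. -/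
def blk (π : Bool) (p X K B : F) : Matrix (Fin 4) (Fin 4) F :=
  !![br (p ^ 2) / br (p ^ 6 * K ^ 2) * zZ π p X K B, br (p ^ 4 * K ^ 2) / (p ^ 3 * br (p ^ 6 * K ^ 2)) * pZ π p X K B, p ^ 6 * eZ π p X K B, 0;
    p ^ 3 * br (p ^ 8 * K ^ 2) / br (p ^ 6 * K ^ 2) * mZ (!π) p X (p ^ 2 * K) B, -(br (p ^ 2) / br (p ^ 6 * K ^ 2) * zZ (!π) p X (p ^ 2 * K) B), 0,
      p ^ 6 * eZ (!π) p X (p ^ 2 * K) B;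
    dZ (!π) p X K (B / p ^ 2) / p ^ 6, 0, -(p ^ 4 * (br (p ^ 2) / br (p ^ 6 * K ^ 2) * zZ (!π) p X K (B / p ^ 2))),
      -(p ^ 4 * (br (p ^ 4 * K ^ 2) / (p ^ 3 * br (p ^ 6 * K ^ 2)) * pZ (!π) p X K (B / p ^ 2)));
    0, dZ π p X (p ^ 2 * K) (B / p ^ 2) / p ^ 6, -(p ^ 4 * (p ^ 3 * br (p ^ 8 * K ^ 2) / br (p ^ 6 * K ^ 2) * mZ π p X (p ^ 2 * K) (B / p ^ 2))),
      p ^ 4 * (br (p ^ 2) / br (p ^ 6 * K ^ 2) * zZ π p X (p ^ 2 * K) (B / p ^ 2))]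

/-- Left eigenvectors of the blocks. -/
def lefta : Bool → F → F → F → F → Fin 4 → F
  | true, p, X, K, B => ![br (p ^ 6 * X * K / B), K * br (X / (K * B)), -(p ^ 8 * K / X * br (p ^ 6 * X * K * B)), -(p ^ 2 / X * br (X * B / K))]
  | false, p, X, K, B => ![1, K, X * K * p ^ 16, X * p ^ 10]
def leftb : Bool → F → F → F → F → Fin 4 → F
  | true, p, X, K, B => ![br (p ^ 8 * K ^ 2) * br (p ^ 6 * X * K / B), -(K * br (p ^ 4 * K ^ 2) * br (X / (K * B))),
      p ^ 4 * K / X * br (p ^ 8 * K ^ 2) * br (p ^ 6 * X * K * B), -(br (p ^ 4 * K ^ 2) * br (X * B / K) / (p ^ 2 * X))]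
  | false, p, X, K, B => ![br (p ^ 8 * K ^ 2), -(br (p ^ 4 * K ^ 2) * K), -(br (p ^ 8 * K ^ 2) * X * K * p ^ 12), br (p ^ 4 * K ^ 2) * X * p ^ 6]
/-- The normalisation of the right eigenvectors. -/
def nrm (p X K : F) : F := br (p ^ 6 * X ^ 2) * br (p ^ 10 * X ^ 2) * br (p ^ 6 * K ^ 2)
/-- Right eigenvectors of the blocks. -/
def righta : Bool → F → F → F → F → Fin 4 → F
  | true, p, X, K, B => (-(br (p ^ 2) * X * B / (K * p ^ 2)) / nrm p X K) • ![br (p ^ 4 * K ^ 2), br (p ^ 8 * K ^ 2) * p ^ 6 * K,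
      -(br (p ^ 4 * K ^ 2) * K / (X * p ^ 4)), -(br (p ^ 8 * K ^ 2) / (X * p ^ 4))]
  | false, p, X, K, B => (br (p ^ 2) * B / (X * K * p ^ 10) / nrm p X K) • ![br (p ^ 4 * K ^ 2) * br (p ^ 2 * X * B / K),
      br (p ^ 8 * K ^ 2) * br (p ^ 8 * X * K * B) * p ^ 6 * K, br (p ^ 4 * K ^ 2) * br (p ^ 2 * X / (K * B)) * X * K * p ^ 4,
      br (p ^ 8 * K ^ 2) * br (p ^ 8 * X * K / B) * X * p ^ 4]
def rightb : Bool → F → F → F → F → Fin 4 → F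
  | true, p, X, K, B => (br (p ^ 2) * X * B * p ^ 2 / K / nrm p X K) • ![1, -(p ^ 6 * K), K / (X * p ^ 8), -(1 / (X * p ^ 8))]
  | false, p, X, K, B => (-(br (p ^ 2) * B / (X * K * p ^ 6)) / nrm p X K) • ![br (p ^ 2 * X * B / K), -(br (p ^ 8 * X * K * B) * p ^ 6 * K),
      -(br (p ^ 2 * X / (K * B)) * X * K), br (p ^ 8 * X * K / B) * X]
/-- The eigenvalues of the blocks. -/
def eiga : Bool → F → F → F
  | true, p, X => -(br (p ^ 6) / br (p ^ 10 * X ^ 2))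
  | false, p, X => br (p ^ 6) / br (p ^ 6 * X ^ 2)
def eigb : Bool → F → F → F
  | true, p, X => br (p ^ 2) / br (p ^ 10 * X ^ 2)
  | false, p, X => -(br (p ^ 2) / br (p ^ 6 * X ^ 2))
def eigc : Bool → F → F → F
  | true, p, X => -(br (p ^ 2) / br (p ^ 6 * X ^ 2))
  | false, p, X => br (p ^ 2) / br (p ^ 10 * X ^ 2)

/-- The hypotheses under which the block coefficients are defined. -/
structure BlockGeneric (p X K B : F) : Prop where
  hp : p ≠ 0
  hX : X ≠ 0
  hK : K ≠ 0
  hB : B ≠ 0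
  h3 : 1 - p ^ 12 * X ^ 4 ≠ 0
  h5 : 1 - p ^ 20 * X ^ 4 ≠ 0
  hk : 1 - p ^ 12 * K ^ 4 ≠ 0

variable {p X K B : F}

-- A block is a scalar plus a matrix of rank two. Only the two pairings with the left vectors need
-- to be followed under its powers.
set_option maxHeartbeats 4000000 in
theorem blk_true (h : BlockGeneric p X K B) (i j : Fin 4) : blk true p X K B i j =
    (if i = j then eigc true p X else 0) + righta true p X K B i * lefta true p X K B j + rightb true p X K B i * leftb true p X K B j := by
  obtain ⟨hp, hX, hK, hB, h3, h5, hk⟩ := h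
  fin_cases i <;> fin_cases j <;>
    simp [blk, lefta, leftb, righta, rightb, eigc, zZ, pZ, mZ, dZ, eZ, nn, n3, n5, nrm, br] <;>
    field_simp <;> ring

set_option maxHeartbeats 4000000 in
theorem blk_false (h : BlockGeneric p X K B) (i j : Fin 4) : blk false p X K B i j =
    (if i = j then eigc false p X else 0) + righta false p X K B i * lefta false p X K B j + rightb false p X K B i * leftb false p X K B j := by
  obtain ⟨hp, hX, hK, hB, h3, h5, hk⟩ := h
  fin_cases i <;> fin_cases j <;>
    simp [blk, lefta, leftb, righta, rightb, eigc, zZ, pZ, mZ, dZ, eZ, nn, n3, n5, nrm, br] <;>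
    field_simp <;> ring

-- Combined with the rank two form, these pairings say that the left vectors are eigenvectors with
-- eigenvalues `eiga` and `eigb`.
set_option maxHeartbeats 1000000 in
theorem dual_true (h : BlockGeneric p X K B) :
    ∑ i, lefta true p X K B i * righta true p X K B i = eiga true p X - eigc true p X ∧
    ∑ i, lefta true p X K B i * rightb true p X K B i = 0 ∧ ∑ i, leftb true p X K B i * righta true p X K B i = 0 ∧
    ∑ i, leftb true p X K B i * rightb true p X K B i = eigb true p X - eigc true p X := by
  obtain ⟨hp, hX, hK, hB, h3, h5, hk⟩ := h
  refine ⟨?_, ?_, ?_, ?_⟩ <;>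
    simp [Fin.sum_univ_four, lefta, leftb, righta, rightb, eiga, eigb, eigc, nrm, br] <;>
    field_simp <;> first | (ring; done) | (ring_nf; field_simp; ring)

set_option maxHeartbeats 1000000 in
theorem dual_false (h : BlockGeneric p X K B) :
    ∑ i, lefta false p X K B i * righta false p X K B i = eiga false p X - eigc false p X ∧
    ∑ i, lefta false p X K B i * rightb false p X K B i = 0 ∧ ∑ i, leftb false p X K B i * righta false p X K B i = 0 ∧
    ∑ i, leftb false p X K B i * rightb false p X K B i = eigb false p X - eigc false p X := by
  obtain ⟨hp, hX, hK, hB, h3, h5, hk⟩ := h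
  refine ⟨?_, ?_, ?_, ?_⟩ <;>
    simp [Fin.sum_univ_four, lefta, leftb, righta, rightb, eiga, eigb, eigc, nrm, br] <;>
    field_simp <;> first | (ring; done) | (ring_nf; field_simp; ring)

end

/-! ### Coupling with the spin one half of ℂ⁴. -/

section
variable {F : Type*} [Field F] {p K A : F}

-- The first equation collects the coefficients of u, the second those of v. There is no
-- contribution of m, and that of p is a multiple of a `minus` combination at j + 1: the total spin
-- is preserved.
set_option maxHeartbeats 1000000 in
theorem plus_coef (h : SpinGeneric p K A) (f : Dir) (hf : f = .p ∨ f = .z ∨ f = .m) :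
    K * br (p ^ 2 * K / A) * kA f p K A + br (p ^ 2 * K * A) * (kB f p K (A / p ^ 2) / p ^ 2) =
      (match f with | .p => br (p ^ 4 * K ^ 2) / (p ^ 3 * br (p ^ 6 * K ^ 2))
                    | .z => br (p ^ 2) / br (p ^ 6 * K ^ 2) * (K * br (p ^ 2 * K / A)) | _ => 0) ∧
    -(K * br (p ^ 2 * K / A) * (p ^ 2 * kC f p K A)) + br (p ^ 2 * K * A) * (p ^ 4 * kA f p K (A / p ^ 2)) =
      (match f with | .p => br (p ^ 4 * K ^ 2) / (p ^ 3 * br (p ^ 6 * K ^ 2)) * (p ^ 6 * K)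
                    | .z => br (p ^ 2) / br (p ^ 6 * K ^ 2) * (-br (p ^ 2 * K * A)) | _ => 0) := by
  obtain ⟨hp, hK, hA, h4, h8, k1, k2, k3, km, k5⟩ := h
  have k1' : 1 - K ^ 4 * p ^ 4 ≠ 0 := by rwa [mul_comm]
  have k3' : 1 - K ^ 4 * p ^ 12 ≠ 0 := by rwa [mul_comm]
  rcases hf with rfl | rfl | rfl <;> refine ⟨?_, ?_⟩ <;> simp only [kA, kB, kC, br] <;> field_simp <;> ring

set_option maxHeartbeats 1000000 in
theorem minus_coef (h : SpinGeneric p K A) (f : Dir) (hf : f = .p ∨ f = .z ∨ f = .m) :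
    kA f p K A - p ^ 4 * K * (kB f p K (A / p ^ 2) / p ^ 2) =
      (match f with | .z => -(br (p ^ 2) / br (p ^ 2 * K ^ 2))
                    | .m => p ^ 3 * br (p ^ 4 * K ^ 2) / br (p ^ 2 * K ^ 2) * (K / p ^ 2 * br (K / A)) | _ => 0) ∧
    -(p ^ 2 * kC f p K A) - p ^ 4 * K * (p ^ 4 * kA f p K (A / p ^ 2)) =
      (match f with | .z => -(br (p ^ 2) / br (p ^ 2 * K ^ 2)) * (p ^ 4 * K)
                    | .m => p ^ 3 * br (p ^ 4 * K ^ 2) / br (p ^ 2 * K ^ 2) * (-br (K * A)) | _ => 0) := by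
  obtain ⟨hp, hK, hA, h4, h8, k1, k2, k3, km, k5⟩ := h
  rcases hf with rfl | rfl | rfl <;> refine ⟨?_, ?_⟩ <;> simp only [kA, kB, kC, br] <;> field_simp <;> ring

end

section
variable (q : Param)

/-- The part of `spin` which preserves `l`. -/
noncomputable def spinZ (f : Dir → ℝ → ℝ → ℝ → ℝ) (a : ℤ) (w : ℤ → ℤ → ℤ → ℂ) (n b k : ℤ) : ℂ :=
  (f .p (rp q) (qz q k) (qz q a) : ℂ) * ((lZ q .p n b k : ℂ) * w n b (k + 1)) +
    (f .z (rp q) (qz q k) (qz q a) : ℂ) * ((lZ q .z n b k : ℂ) * w n b k) +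
    (f .m (rp q) (qz q k) (qz q a) : ℂ) * ((lZ q .m n b k : ℂ) * w n b (k - 1))

/-- The part of `lat` which preserves `l`. -/
noncomputable def latZ : SGen → (ℤ → ℤ → ℤ → ℤ → ℂ) → ℤ → ℤ → ℤ → ℤ → ℂ
  | .x₀, u, a => spinZ q kA a (u a)
  | .x₁s, u, a => spinZ q kB a (u (a + 1))
  | .x₁, u, a => spinZ q kC a (u (a - 1))
  | .x₂s, u, a => fun n b k => (lZ q .d n b k : ℂ) * u a n (b + 1) k
  | .x₂, u, a => fun n b k => (lZ q .e n b k : ℂ) * u a n (b - 1) k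

/-- Only the part which preserves l carries the sign of the chirality, so half the difference is
that part with its rational coefficients. -/
theorem lat_sub (g : SGen) (u : ℤ → ℤ → ℤ → ℤ → ℂ) (a n b k : ℤ) :
    lat q 1 g u a n b k - lat q (-1) g u a n b k = 2 * latZ q g u a n b k := by
  cases g <;> simp only [lat, latZ, spin, spinZ, rop, db, dk, add_zero, ← sub_eq_add_neg] <;> ring

theorem gext_half_repD (g : SGen) (f : SpinorSpace) {a n b k : ℤ} (h : Adm a n b k) :
    gext q (((1 / 2 : ℂ) • repD q (sgen q g)) f) a n b k = latZ q g (gext q f) a n b k := by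
  rw [smul_apply, gext_smul, repD_apply, repP, repM, rep_gen, rep_gen, sub_apply, gext_sub, gext_genOp q _ g f h, gext_genOp q _ g f h]
  have := lat_sub q g (gext q f) a n b k
  push_cast
  rw [this]
  ring

/-- The combinations of the coordinates of a pair of functions which the spin part of the Dirac operator preserves. -/
noncomputable def plus (u v : ℤ → ℤ → ℤ → ℤ → ℂ) (a n b k : ℤ) : ℂ :=
  (qz q k * bz q (k - a + 1) : ℝ) * u a n b k - (bz q (k + a + 1) : ℝ) * v (a - 1) n b k
-- Unnormalised Clebsch–Gordan combinations: `plus` has total spin j + 1/2 and `minus` has j - 1/2.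
-- The function v is taken at a - 1 so that both terms have the same total weight.
noncomputable def minus (u v : ℤ → ℤ → ℤ → ℤ → ℂ) (a n b k : ℤ) : ℂ :=
  u a n b k + (qz q (k + 2) : ℝ) * v (a - 1) n b k

variable (u v : ℤ → ℤ → ℤ → ℤ → ℂ) (a n b k : ℤ)

theorem bz_plus : bz q (k - a + 1) = br (rp q ^ 2 * qz q k / qz q a) ∧ bz q (k + a + 1) = br (rp q ^ 2 * qz q k * qz q a) := by
  have e2 : rp q ^ 2 = qz q 1 := rp_pow q 1
  rw [e2, ← qz_add, ← qz_sub, ← qz_add]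
  constructor <;> rw [bz] <;> congr 2 <;> ring

theorem plus_spinZ (hk : 0 ≤ k) :
    ((qz q k * bz q (k - a + 1) : ℝ) : ℂ) * (spinZ q kA a (u a) n b k - (rp q : ℂ) ^ 2 * spinZ q kC a (v (a - 1)) n b k) -
      ((bz q (k + a + 1) : ℝ) : ℂ) * (-(spinZ q kB (a - 1) (u a) n b k / (rp q : ℂ) ^ 2) - (rp q : ℂ) ^ 4 * spinZ q kA (a - 1) (v (a - 1)) n b k) =
    ((br (rp q ^ 2) / br (rp q ^ 6 * qz q k ^ 2) * lZ q .z n b k : ℝ) : ℂ) * plus q u v a n b k +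
      ((br (rp q ^ 4 * qz q k ^ 2) / (rp q ^ 3 * br (rp q ^ 6 * qz q k ^ 2)) * lZ q .p n b k : ℝ) : ℂ) * minus q u v a n b (k + 1) := by
  have h := spinGeneric q hk a
  obtain ⟨p1, p2⟩ := plus_coef h .p (by simp)
  obtain ⟨z1, z2⟩ := plus_coef h .z (by simp)
  obtain ⟨m1, m2⟩ := plus_coef h .m (by simp)
  have e6 : qz q (k + 1 + 2) = rp q ^ 6 * qz q k := by
    rw [show rp q ^ 6 = qz q 3 from rp_pow q 3, ← qz_add]; congr 1; ring
  rw [plus, minus, e6, (bz_plus q a k).1, (bz_plus q a k).2]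
  simp only [spinZ, qz_pred]
  have c : ∀ x y : ℝ, x = y → (x : ℂ) = y := fun x y h => congrArg _ h
  replace p1 := c _ _ p1
  replace p2 := c _ _ p2
  replace z1 := c _ _ z1
  replace z2 := c _ _ z2
  replace m1 := c _ _ m1
  replace m2 := c _ _ m2
  push_cast at *
  linear_combination (lZ q .p n b k : ℂ) * (u a n b (k + 1) * p1 + v (a - 1) n b (k + 1) * p2) +
    (lZ q .z n b k : ℂ) * (u a n b k * z1 + v (a - 1) n b k * z2) + (lZ q .m n b k : ℂ) * (u a n b (k - 1) * m1 + v (a - 1) n b (k - 1) * m2)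

/-- Coupled spin k leads only to `minus` at the same j and to `plus` at j - 1. With `plus_spinZ`
this gives blocks consisting of `plus` at k and `minus` at k + 1. -/
theorem minus_spinZ (hk : 0 ≤ k) :
    (spinZ q kA a (u a) n b k - (rp q : ℂ) ^ 2 * spinZ q kC a (v (a - 1)) n b k) +
      (qz q (k + 2) : ℝ) * (-(spinZ q kB (a - 1) (u a) n b k / (rp q : ℂ) ^ 2) - (rp q : ℂ) ^ 4 * spinZ q kA (a - 1) (v (a - 1)) n b k) =
    ((rp q ^ 3 * br (rp q ^ 4 * qz q k ^ 2) / br (rp q ^ 2 * qz q k ^ 2) * lZ q .m n b k : ℝ) : ℂ) * plus q u v a n b (k - 1) -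
      ((br (rp q ^ 2) / br (rp q ^ 2 * qz q k ^ 2) * lZ q .z n b k : ℝ) : ℂ) * minus q u v a n b k := by
  have h := spinGeneric q hk a
  obtain ⟨p1, p2⟩ := minus_coef h .p (by simp)
  obtain ⟨z1, z2⟩ := minus_coef h .z (by simp)
  obtain ⟨m1, m2⟩ := minus_coef h .m (by simp)
  have e4 : qz q (k + 2) = rp q ^ 4 * qz q k := by
    rw [show rp q ^ 4 = qz q 2 from rp_pow q 2, ← qz_add]; congr 1; ring
  have hp := (rp_pos q).ne'
  have e1 : bz q (k - 1 - a + 1) = br (qz q k / qz q a) := by rw [← qz_sub, bz]; congr 2; ring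
  have e3 : bz q (k - 1 + a + 1) = br (qz q k * qz q a) := by rw [← qz_add, bz]; congr 2; ring
  rw [plus, minus, e4, e1, e3]
  simp only [spinZ, qz_pred]
  have c : ∀ x y : ℝ, x = y → (x : ℂ) = y := fun x y h => congrArg _ h
  replace p1 := c _ _ p1
  replace p2 := c _ _ p2
  replace z1 := c _ _ z1
  replace z2 := c _ _ z2
  replace m1 := c _ _ m1
  replace m2 := c _ _ m2
  push_cast at *
  linear_combination (lZ q .p n b k : ℂ) * (u a n b (k + 1) * p1 + v (a - 1) n b (k + 1) * p2) +
    (lZ q .z n b k : ℂ) * (u a n b k * z1 + v (a - 1) n b k * z2) + (lZ q .m n b k : ℂ) * (u a n b (k - 1) * m1 + v (a - 1) n b (k - 1) * m2)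

end

/-! ### The Dirac operator in the coupled coordinates. -/

section
variable (q : Param)

/-- Half the difference of the operators which represent a generator. -/
noncomputable def genD (g : SGen) : SpinorSpace →L[ℂ] SpinorSpace := (1 / 2 : ℂ) • repD q (sgen q g)
/-- The Dirac matrix of the operators `genD`. -/
noncomputable def diracD : Matrix (Fin 4) (Fin 4) (SpinorSpace →L[ℂ] SpinorSpace) := diracMat q (genD q)

/-- The action of a matrix of operators. -/
noncomputable def opAct (Z : Matrix (Fin 4) (Fin 4) (SpinorSpace →L[ℂ] SpinorSpace)) (y : Fin 4 → SpinorSpace) : Fin 4 → SpinorSpace :=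
  fun i => ∑ j, Z i j (y j)

theorem opAct_mul (Z Z' : Matrix (Fin 4) (Fin 4) (SpinorSpace →L[ℂ] SpinorSpace)) (y : Fin 4 → SpinorSpace) :
    opAct (Z * Z') y = opAct Z (opAct Z' y) := by
  funext i
  simp only [opAct, Matrix.mul_apply, sum_apply, map_sum, mul_apply_eq_comp]
  exact Finset.sum_comm

theorem opAct_diracD (y : Fin 4 → SpinorSpace) : opAct (diracD q) y =
    ![genD q .x₀ (y 0) + qc q ^ 3 • genD q .x₂ (y 1) - qc q • genD q .x₁ (y 2),
      (qc q ^ 3)⁻¹ • genD q .x₂s (y 0) - qc q ^ 2 • genD q .x₀ (y 1) + qc q ^ 3 • genD q .x₁ (y 3),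
      -((qc q)⁻¹ • genD q .x₁s (y 0)) - qc q ^ 2 • genD q .x₀ (y 2) + qc q ^ 3 • genD q .x₂ (y 3),
      qc q • genD q .x₁s (y 1) + (qc q ^ 3)⁻¹ • genD q .x₂s (y 2) + qc q ^ 4 • genD q .x₀ (y 3)] := by
  funext i
  fin_cases i <;> simp [opAct, Fin.sum_univ_four, diracD, diracMat, gammaMat, add_apply, smul_apply] <;> module

theorem gext_genD (g : SGen) (f : SpinorSpace) {a n b k : ℤ} (h : Adm a n b k) :
    gext q (genD q g f) a n b k = latZ q g (gext q f) a n b k := gext_half_repD q g f h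

/-- The coordinates of a vector on which a block of the Dirac operator acts. -/
noncomputable def grp (y : Fin 4 → SpinorSpace) (a n b k : ℤ) : Fin 4 → ℂ :=
  ![plus q (gext q (y 0)) (gext q (y 2)) a n b k, minus q (gext q (y 0)) (gext q (y 2)) a n b (k + 1),
    plus q (gext q (y 1)) (gext q (y 3)) a n (b - 1) k, minus q (gext q (y 1)) (gext q (y 3)) a n (b - 1) (k + 1)]

/-- The range of the labels `l`, `m₂`, `j`. -/
def Row (n b k : ℤ) : Prop := 0 ≤ k ∧ k ≤ n ∧ -(n - k) - 1 ≤ b ∧ b ≤ n - k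
/-- The rows of a block which belong to admissible labels. -/
def BlockRow (n b k : ℤ) : Fin 4 → Prop := ![Row n b k, Row n b (k + 1), Row n (b - 1) k, Row n (b - 1) (k + 1)]

variable {q}

/-- At the extreme values of a one of the two coordinates is not admissible, but its coefficient is
the bracket of 0. -/
theorem plus_congr {u v U V : ℤ → ℤ → ℤ → ℤ → ℂ} {a n b k : ℤ} (h : Row n b k) (h1 : -k - 1 ≤ a) (h2 : a ≤ k + 1)
    (hu : ∀ a, Adm a n b k → u a n b k = U a n b k) (hv : ∀ a, Adm a n b k → v a n b k = V a n b k) :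
    plus q u v a n b k = plus q U V a n b k := by
  obtain ⟨e1, e2, e3, e4⟩ := h
  rw [plus, plus]
  congr 1
  · by_cases h : a = k + 1
    · rw [show k - a + 1 = 0 by omega, bz_zero]; simp
    · rw [hu a ⟨e1, e2, by omega, by omega, e3, e4⟩]
  · by_cases h : a = -k - 1
    · rw [show k + a + 1 = 0 by omega, bz_zero]; simp
    · rw [hv (a - 1) ⟨e1, e2, by omega, by omega, e3, e4⟩]

theorem minus_congr {u v U V : ℤ → ℤ → ℤ → ℤ → ℂ} {a n b k : ℤ} (h : Row n b k) (h1 : -k ≤ a) (h2 : a ≤ k)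
    (hu : ∀ a, Adm a n b k → u a n b k = U a n b k) (hv : ∀ a, Adm a n b k → v a n b k = V a n b k) :
    minus q u v a n b k = minus q U V a n b k := by
  obtain ⟨e1, e2, e3, e4⟩ := h
  rw [minus, minus, hu a ⟨e1, e2, by omega, by omega, e3, e4⟩, hv (a - 1) ⟨e1, e2, by omega, by omega, e3, e4⟩]

variable (q)

theorem plus_def (u v : ℤ → ℤ → ℤ → ℤ → ℂ) (a n b k : ℤ) : plus q u v a n b k =
  (qz q k * bz q (k - a + 1) : ℝ) * u a n b k - (bz q (k + a + 1) : ℝ) * v (a - 1) n b k := rfl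
theorem minus_def (u v : ℤ → ℤ → ℤ → ℤ → ℂ) (a n b k : ℤ) : minus q u v a n b k =
  u a n b k + (qz q (k + 2) : ℝ) * v (a - 1) n b k := rfl

theorem blk_par (n b k : ℤ) : par n b (k + 1) = (!par n b k) ∧ par n (b - 1) k = (!par n b k) ∧ par n (b - 1) (k + 1) = par n b k :=
  ⟨par_flip (by omega), par_flip (by omega), par_same (by omega)⟩

theorem qc_rp : qc q = (rp q : ℂ) ^ 2 := by
  rw [qc, ← rp_sq, Complex.ofReal_pow]

/-- The formulas for the rows of the Dirac operator. -/
noncomputable def rowD (y : Fin 4 → SpinorSpace) : Fin 4 → ℤ → ℤ → ℤ → ℤ → ℂ :=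
  ![fun a n b k => latZ q .x₀ (gext q (y 0)) a n b k + (rp q : ℂ) ^ 6 * latZ q .x₂ (gext q (y 1)) a n b k -
      (rp q : ℂ) ^ 2 * latZ q .x₁ (gext q (y 2)) a n b k,
    fun a n b k => latZ q .x₂s (gext q (y 0)) a n b k / (rp q : ℂ) ^ 6 - (rp q : ℂ) ^ 4 * latZ q .x₀ (gext q (y 1)) a n b k +
      (rp q : ℂ) ^ 6 * latZ q .x₁ (gext q (y 3)) a n b k,
    fun a n b k => -(latZ q .x₁s (gext q (y 0)) a n b k / (rp q : ℂ) ^ 2) - (rp q : ℂ) ^ 4 * latZ q .x₀ (gext q (y 2)) a n b k +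
      (rp q : ℂ) ^ 6 * latZ q .x₂ (gext q (y 3)) a n b k,
    fun a n b k => (rp q : ℂ) ^ 2 * latZ q .x₁s (gext q (y 1)) a n b k + latZ q .x₂s (gext q (y 2)) a n b k / (rp q : ℂ) ^ 6 +
      (rp q : ℂ) ^ 8 * latZ q .x₀ (gext q (y 3)) a n b k]

theorem gext_opAct (y : Fin 4 → SpinorSpace) (i : Fin 4) {a n b k : ℤ} (h : Adm a n b k) :
    gext q (opAct (diracD q) y i) a n b k = rowD q y i a n b k := by
  rw [opAct_diracD]
  have neg : ∀ f, gext q (-f) a n b k = -gext q f a n b k := fun f => by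
    rw [← neg_one_smul ℂ f, gext_smul]; ring
  fin_cases i <;>
    simp only [rowD, Fin.zero_eta, Fin.mk_one, Fin.reduceFinMk, Matrix.cons_val, gext_add, gext_sub, neg, gext_smul, gext_genD q _ _ h, qc_rp] <;> ring

-- The generators x₀, x₁, x₁* couple the first two and the last two coordinates by `plus_spinZ` and
-- `minus_spinZ`, while x₂ and x₂* couple b with b - 1. The row must be admissible: elsewhere the
-- coordinates are zero by definition and need not obey the formula.
set_option maxHeartbeats 1000000 in
theorem grp_act (y : Fin 4 → SpinorSpace) {a n b k : ℤ} (hk : -1 ≤ k) (h1 : -k - 1 ≤ a) (h2 : a ≤ k + 1) (i : Fin 4) (hi : BlockRow n b k i) :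
    grp q (opAct (diracD q) y) a n b k i = ∑ j, ((blk (par n b k) (rp q) (qz q n) (qz q k) (qz q b) i j : ℝ) : ℂ) * grp q y a n b k j := by
  obtain ⟨r1, r2, r3⟩ := blk_par n b k
  have hp : (rp q : ℂ) ≠ 0 := by exact_mod_cast (rp_pos q).ne'
  have hi4 : (rp q : ℂ) ^ 4 * ((rp q : ℂ)⁻¹) ^ 2 = (rp q : ℂ) ^ 2 := by field_simp
  have e1 : rp q ^ 2 * (rp q ^ 2 * qz q k) ^ 2 = rp q ^ 6 * qz q k ^ 2 := by ring
  have e2 : rp q ^ 4 * (rp q ^ 2 * qz q k) ^ 2 = rp q ^ 8 * qz q k ^ 2 := by ring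
  fin_cases i
  · have e := plus_congr (q := q) hi h1 h2 (U := rowD q y 0) (V := rowD q y 2) (fun a h => gext_opAct q y 0 h) (fun a h => gext_opAct q y 2 h)
    have s := plus_spinZ q (gext q (y 0)) (gext q (y 2)) a n b k hi.1
    simp only [grp, blk, Fin.sum_univ_four, Matrix.cons_val, Matrix.of_apply, Fin.zero_eta] at e ⊢
    rw [e, plus]
    simp only [rowD, Matrix.cons_val]
    simp only [latZ, sub_add_cancel, lZ, cZ] at s ⊢
    rw [plus_def q _ _ a n (b - 1)]
    push_cast at s ⊢
    linear_combination s
  · have e := minus_congr (q := q) hi (by omega) h2 (U := rowD q y 0) (V := rowD q y 2) (fun a h => gext_opAct q y 0 h) (fun a h => gext_opAct q y 2 h)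
    have s := minus_spinZ q (gext q (y 0)) (gext q (y 2)) a n b (k + 1) hi.1
    simp only [grp, blk, Fin.sum_univ_four, Matrix.cons_val, Matrix.of_apply, Fin.mk_one] at e ⊢
    rw [e, minus]
    simp only [rowD, Matrix.cons_val]
    simp only [latZ, sub_add_cancel, add_sub_cancel_right, lZ, cZ, r1, qz_succ, e1, e2] at s ⊢
    rw [minus_def q _ _ a n (b - 1)]
    push_cast at s ⊢
    linear_combination s
  -- On the components 1 and 3 the spin part is -q² times that on the components 0 and 2.
  · have e := plus_congr (q := q) hi h1 h2 (U := rowD q y 1) (V := rowD q y 3) (fun a h => gext_opAct q y 1 h) (fun a h => gext_opAct q y 3 h)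
    have s := plus_spinZ q (gext q (y 1)) (gext q (y 3)) a n (b - 1) k hi.1
    simp only [grp, blk, Fin.sum_univ_four, Matrix.cons_val, Matrix.of_apply, Fin.reduceFinMk] at e ⊢
    rw [e, plus]
    simp only [rowD, Matrix.cons_val]
    simp only [latZ, sub_add_cancel, lZ, cZ, r2, qz_pred] at s ⊢
    rw [plus_def q _ _ a n b]
    push_cast at s ⊢
    linear_combination (-(rp q : ℂ) ^ 4) * s + ((bz q (k + a + 1) : ℝ) : ℂ) * spinZ q kB (a - 1) (gext q (y 1) a) n (b - 1) k * hi4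
  · have e := minus_congr (q := q) hi (by omega) h2 (U := rowD q y 1) (V := rowD q y 3) (fun a h => gext_opAct q y 1 h) (fun a h => gext_opAct q y 3 h)
    have s := minus_spinZ q (gext q (y 1)) (gext q (y 3)) a n (b - 1) (k + 1) hi.1
    simp only [grp, blk, Fin.sum_univ_four, Matrix.cons_val, Matrix.of_apply, Fin.reduceFinMk] at e ⊢
    rw [e, minus]
    simp only [rowD, Matrix.cons_val]
    simp only [latZ, sub_add_cancel, add_sub_cancel_right, lZ, cZ, r3, qz_succ, qz_pred, e1, e2] at s ⊢
    rw [minus_def q _ _ a n b]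
    push_cast at s ⊢
    linear_combination (-(rp q : ℂ) ^ 4) * s - ((qz q (k + 1 + 2) : ℝ) : ℂ) * spinZ q kB (a - 1) (gext q (y 1) a) n (b - 1) (k + 1) * hi4

end

/-! ### The powers of the Dirac operator on a block. -/

open Filter Topology

/-- Choose r < 1 above all three moduli. The solution is bounded by a constant times (1 + m) rᵐ,
where the factor m allows for coinciding rates. -/
theorem tendsto_recurrence {x : ℕ → ℂ} {c A s B t : ℂ} (hc : ‖c‖ < 1) (hs : ‖s‖ < 1) (ht : ‖t‖ < 1)
    (h : ∀ m, x (m + 1) = c * x m + A * s ^ m + B * t ^ m) : Tendsto x atTop (𝓝 0) := by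
  obtain ⟨r, hr, hr1⟩ := exists_between (max_lt (max_lt (max_lt hc hs) ht) one_pos)
  simp only [max_lt_iff] at hr
  obtain ⟨⟨⟨r1, r2⟩, r3⟩, r0⟩ := hr
  have b : ∀ m, ‖x m‖ ≤ ‖x 0‖ * r ^ m + (‖A‖ + ‖B‖) / r * (m * r ^ m) := by
    intro m
    induction m with
    | zero => simp
    | succ m ih =>
      rw [h]
      have e1 : ‖s‖ ^ m ≤ r ^ m := pow_le_pow_left₀ (norm_nonneg _) r2.le m
      have e2 : ‖t‖ ^ m ≤ r ^ m := pow_le_pow_left₀ (norm_nonneg _) r3.le m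
      calc _ ≤ ‖c‖ * ‖x m‖ + ‖A‖ * ‖s‖ ^ m + ‖B‖ * ‖t‖ ^ m := by
            refine (norm_add₃_le).trans_eq ?_
            rw [norm_mul, norm_mul, norm_mul, norm_pow, norm_pow]
        _ ≤ r * (‖x 0‖ * r ^ m + (‖A‖ + ‖B‖) / r * (m * r ^ m)) + ‖A‖ * r ^ m + ‖B‖ * r ^ m := by gcongr
        _ = _ := by push_cast; field_simp; ring
  refine squeeze_zero_norm b ?_
  have l1 := (tendsto_pow_atTop_nhds_zero_of_lt_one r0.le hr1).const_mul ‖x 0‖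
  have l2 := (tendsto_self_mul_const_pow_of_lt_one r0.le hr1).const_mul ((‖A‖ + ‖B‖) / r)
  simpa using l1.add l2

section
variable {F : Type*} [Field F] {p X K B : F}

theorem blk_eq (π : Bool) (h : BlockGeneric p X K B) (i j : Fin 4) : blk π p X K B i j =
    (if i = j then eigc π p X else 0) + righta π p X K B i * lefta π p X K B j + rightb π p X K B i * leftb π p X K B j := by
  cases π
  exacts [blk_false h i j, blk_true h i j]

theorem dual_eq (π : Bool) (h : BlockGeneric p X K B) :
    ∑ i, lefta π p X K B i * righta π p X K B i = eiga π p X - eigc π p X ∧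
    ∑ i, lefta π p X K B i * rightb π p X K B i = 0 ∧ ∑ i, leftb π p X K B i * righta π p X K B i = 0 ∧
    ∑ i, leftb π p X K B i * rightb π p X K B i = eigb π p X - eigc π p X := by
  cases π
  exacts [dual_false h, dual_true h]

end

section
variable (q : Param)

theorem blockGeneric (n b k : ℤ) : BlockGeneric (rp q) (qz q n) (qz q k) (qz q b) where
  hp := (rp_pos q).ne'
  hX := (qz_pos q n).ne'
  hK := (qz_pos q k).ne'
  hB := (qz_pos q b).ne'
  h3 := one_sub_ne q (by norm_num; omega)
  h5 := one_sub_ne q (by norm_num; omega)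
  hk := one_sub_ne q (by norm_num; omega)

/-- The value of the first left eigenvector on a block. -/
noncomputable def psia (y : Fin 4 → SpinorSpace) (a n b k : ℤ) : ℂ :=
  ∑ j, ((lefta (par n b k) (rp q) (qz q n) (qz q k) (qz q b) j : ℝ) : ℂ) * grp q y a n b k j
/-- The value of the second left eigenvector on a block. -/
noncomputable def psib (y : Fin 4 → SpinorSpace) (a n b k : ℤ) : ℂ :=
  ∑ j, ((leftb (par n b k) (rp q) (qz q n) (qz q k) (qz q b) j : ℝ) : ℂ) * grp q y a n b k j

theorem grp_zero (y : Fin 4 → SpinorSpace) {a n b k : ℤ} {i : Fin 4} (hi : ¬BlockRow n b k i) : grp q y a n b k i = 0 := by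
  have z : ∀ (f : SpinorSpace) (a n b k : ℤ), ¬Row n b k → gext q f a n b k = 0 := fun f a n b k h => by
    rw [gext, ext_not _ fun h' => h ⟨h'.1, h'.2.1, h'.2.2.2.2.1, h'.2.2.2.2.2⟩, mul_zero]
  fin_cases i <;> simp only [BlockRow, grp, plus, minus, Matrix.cons_val, Fin.zero_eta, Fin.mk_one, Fin.reduceFinMk] at hi ⊢ <;>
    rw [z _ _ _ _ _ hi, z _ _ _ _ _ hi] <;> simp

/-- The rows for which the formula for the Dirac operator holds. -/
def Valid (n b k : ℤ) (i : Fin 4) : Prop := BlockRow n b k i ∨ k = -1 ∧ (i = 0 ∨ i = 2)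

/-- For k = -1, that is total spin 0, the two `plus` coordinates are absent. The formula remains
true as 0 = 0, because their couplings to the `minus` coordinates contain the bracket of 2k + 2. -/
theorem grp_valid (y : Fin 4 → SpinorSpace) {a n b k : ℤ} (hk : -1 ≤ k) (h1 : -k - 1 ≤ a) (h2 : a ≤ k + 1) {i : Fin 4} (hi : Valid n b k i) :
    grp q (opAct (diracD q) y) a n b k i = ∑ j, ((blk (par n b k) (rp q) (qz q n) (qz q k) (qz q b) i j : ℝ) : ℂ) * grp q y a n b k j := by
  rcases hi with hi | ⟨rfl, hi⟩
  · exact grp_act q y hk h1 h2 i hi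
  · have r0 : ¬BlockRow n b (-1) 0 := fun h => by have : (0 : ℤ) ≤ -1 := h.1; omega
    have r2 : ¬BlockRow n b (-1) 2 := fun h => by have : (0 : ℤ) ≤ -1 := h.1; omega
    have e : br (rp q ^ 4 * qz q (-1) ^ 2) = 0 := by
      rw [show rp q ^ 4 = qz q 2 from rp_pow q 2, qz_pow, ← qz_add]
      exact bz_zero q
    rw [Fin.sum_univ_four, grp_zero q y r0, grp_zero q y r2]
    rcases hi with rfl | rfl
    · rw [grp_zero q _ r0]; simp [blk, e]
    · rw [grp_zero q _ r2]; simp [blk, e]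

theorem grp_rec (y : Fin 4 → SpinorSpace) {a n b k : ℤ} (hk : -1 ≤ k) (h1 : -k - 1 ≤ a) (h2 : a ≤ k + 1) {i : Fin 4} (hi : Valid n b k i) :
    grp q (opAct (diracD q) y) a n b k i = (eigc (par n b k) (rp q) (qz q n) : ℝ) * grp q y a n b k i +
      (righta (par n b k) (rp q) (qz q n) (qz q k) (qz q b) i : ℝ) * psia q y a n b k +
      (rightb (par n b k) (rp q) (qz q n) (qz q k) (qz q b) i : ℝ) * psib q y a n b k := by
  rw [grp_valid q y hk h1 h2 hi, psia, psib, Finset.mul_sum, Finset.mul_sum]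
  simp only [blk_eq _ (blockGeneric q n b k), Complex.ofReal_add, Complex.ofReal_mul, add_mul, Finset.sum_add_distrib, mul_assoc]
  congr 2
  rw [Finset.sum_eq_single i (fun j _ h => by rw [if_neg h.symm]; simp) (by simp), if_pos rfl]

/-- Pair the row formula with a left eigenvector. Rows where the formula fails do no harm if both
left eigenvectors vanish there. -/
theorem psi_rec (y : Fin 4 → SpinorSpace) {a n b k : ℤ} (hk : -1 ≤ k) (h1 : -k - 1 ≤ a) (h2 : a ≤ k + 1)
    (H : ∀ i, Valid n b k i ∨ lefta (par n b k) (rp q) (qz q n) (qz q k) (qz q b) i = 0 ∧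
      leftb (par n b k) (rp q) (qz q n) (qz q k) (qz q b) i = 0) :
    psia q (opAct (diracD q) y) a n b k = (eiga (par n b k) (rp q) (qz q n) : ℝ) * psia q y a n b k ∧
    psib q (opAct (diracD q) y) a n b k = (eigb (par n b k) (rp q) (qz q n) : ℝ) * psib q y a n b k := by
  obtain ⟨d1, d2, d3, d4⟩ := dual_eq (par n b k) (blockGeneric q n b k)
  have key : ∀ l : Fin 4 → ℝ, (∀ i, Valid n b k i ∨ l i = 0) → ∑ j, (l j : ℂ) * grp q (opAct (diracD q) y) a n b k j =
      (eigc (par n b k) (rp q) (qz q n) : ℝ) * ∑ j, (l j : ℂ) * grp q y a n b k j +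
        ((∑ j, l j * righta (par n b k) (rp q) (qz q n) (qz q k) (qz q b) j : ℝ) : ℂ) * psia q y a n b k +
        ((∑ j, l j * rightb (par n b k) (rp q) (qz q n) (qz q k) (qz q b) j : ℝ) : ℂ) * psib q y a n b k := by
    intro l hl
    push_cast
    rw [Finset.mul_sum, Finset.sum_mul, Finset.sum_mul, ← Finset.sum_add_distrib, ← Finset.sum_add_distrib]
    refine Finset.sum_congr rfl fun j _ => ?_
    rcases hl j with h | h
    · rw [grp_rec q y hk h1 h2 h]; ring
    · rw [h]; simp
  constructor
  · rw [psia, key _ fun i => (H i).imp id And.left, d1, d2, ← psia]; push_cast; ring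
  · rw [psib, key _ fun i => (H i).imp id And.right, d3, d4, ← psib]; push_cast; ring

theorem opAct_pow_succ (y : Fin 4 → SpinorSpace) (m : ℕ) : opAct (diracD q ^ (m + 1)) y = opAct (diracD q) (opAct (diracD q ^ m) y) := by
  rw [pow_succ', opAct_mul]

theorem psi_pow (y : Fin 4 → SpinorSpace) {a n b k : ℤ} (hk : -1 ≤ k) (h1 : -k - 1 ≤ a) (h2 : a ≤ k + 1)
    (H : ∀ i, Valid n b k i ∨ lefta (par n b k) (rp q) (qz q n) (qz q k) (qz q b) i = 0 ∧
      leftb (par n b k) (rp q) (qz q n) (qz q k) (qz q b) i = 0) (m : ℕ) :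
    psia q (opAct (diracD q ^ m) y) a n b k = psia q (opAct (diracD q ^ 0) y) a n b k * ((eiga (par n b k) (rp q) (qz q n) : ℝ) : ℂ) ^ m ∧
    psib q (opAct (diracD q ^ m) y) a n b k = psib q (opAct (diracD q ^ 0) y) a n b k * ((eigb (par n b k) (rp q) (qz q n) : ℝ) : ℂ) ^ m := by
  induction m with
  | zero => simp
  | succ m ih =>
    obtain ⟨r1, r2⟩ := psi_rec q (opAct (diracD q ^ m) y) hk h1 h2 H
    rw [opAct_pow_succ, r1, r2, ih.1, ih.2]
    constructor <;> ring

theorem bz_lt {x y : ℤ} (h : x < y) : bz q x < bz q y := by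
  have h1 := qz_pos q x
  have h2 := qz_pos q y
  have h3 : qz q y < qz q x := zpow_lt_zpow_right_of_lt_one₀ q.2.1 q.2.2 h
  have h4 := (inv_lt_inv₀ h1 h2).2 h3
  rw [bz, bz, br, br]
  linarith

theorem eig_bz (n : ℤ) : br (rp q ^ 2) = bz q 1 ∧ br (rp q ^ 6) = bz q 3 ∧ br (rp q ^ 6 * qz q n ^ 2) = bz q (2 * n + 3) ∧
    br (rp q ^ 10 * qz q n ^ 2) = bz q (2 * n + 5) := by
  rw [show rp q ^ 2 = qz q 1 from rp_pow q 1, show rp q ^ 6 = qz q 3 from rp_pow q 3, show rp q ^ 10 = qz q 5 from rp_pow q 5, qz_pow, ← qz_add, ← qz_add]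
  refine ⟨rfl, rfl, ?_, ?_⟩ <;> rw [bz] <;> congr 2 <;> push_cast <;> ring

/-- Up to sign the eigenvalues are quotients of the bracket of 1 or 3 by that of 2n + 3 or 2n + 5,
and brackets increase. Equality occurs only for 3 over 2n + 3 at n = 0, with odd parity. -/
theorem eig_lt {n : ℤ} (hn : 0 ≤ n) (π : Bool) : ‖((eigc π (rp q) (qz q n) : ℝ) : ℂ)‖ < 1 ∧ ‖((eigb π (rp q) (qz q n) : ℝ) : ℂ)‖ < 1 ∧
    (1 ≤ n ∨ π = true → ‖((eiga π (rp q) (qz q n) : ℝ) : ℂ)‖ < 1) := by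
  obtain ⟨e1, e2, e3, e4⟩ := eig_bz q n
  have key : ∀ {x y : ℤ}, 0 ≤ x → x < y → ‖((bz q x / bz q y : ℝ) : ℂ)‖ < 1 := fun {x y} hx h => by
    rw [Complex.norm_real, Real.norm_of_nonneg (div_nonneg (bz_nonneg q hx) (bz_nonneg q (hx.trans h.le))), div_lt_one (bz_pos q (hx.trans_lt h))]
    exact bz_lt q h
  cases π
  · simp only [eiga, eigb, eigc, e1, e2, e3, e4, Complex.ofReal_neg, norm_neg]
    refine ⟨key (by omega) (by omega), key (by omega) (by omega), fun h => key (by omega) ?_⟩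
    rcases h with h | h
    · omega
    · cases h
  · simp only [eiga, eigb, eigc, e1, e2, e3, e4, Complex.ofReal_neg, norm_neg]
    exact ⟨key (by omega) (by omega), key (by omega) (by omega), fun _ => key (by omega) (by omega)⟩

theorem left_zero (n b k : ℤ) :
    (n - k - b = 0 → lefta true (rp q) (qz q n) (qz q k) (qz q b) 1 = 0 ∧ leftb true (rp q) (qz q n) (qz q k) (qz q b) 1 = 0) ∧
    (n - k + b = 0 → lefta true (rp q) (qz q n) (qz q k) (qz q b) 3 = 0 ∧ leftb true (rp q) (qz q n) (qz q k) (qz q b) 3 = 0) ∧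
    (n - k + b + 1 = 0 → righta false (rp q) (qz q n) (qz q k) (qz q b) 0 = 0 ∧ rightb false (rp q) (qz q n) (qz q k) (qz q b) 0 = 0) ∧
    (n - k - b + 1 = 0 → righta false (rp q) (qz q n) (qz q k) (qz q b) 2 = 0 ∧ rightb false (rp q) (qz q n) (qz q k) (qz q b) 2 = 0) := by
  have hb : ∀ z : ℤ, z = 0 → br (qz q z) = 0 := fun z h => by rw [h]; exact bz_zero q
  have e2 : rp q ^ 2 = qz q 1 := rp_pow q 1
  refine ⟨fun h => ?_, fun h => ?_, fun h => ?_, fun h => ?_⟩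
  · have : br (qz q n / (qz q k * qz q b)) = 0 := by
      rw [← qz_add, ← qz_sub]; exact hb _ (by omega)
    simp [lefta, leftb, this]
  · have : br (qz q n * qz q b / qz q k) = 0 := by
      rw [← qz_add, ← qz_sub]; exact hb _ (by omega)
    simp [lefta, leftb, this]
  · have : br (rp q ^ 2 * qz q n * qz q b / qz q k) = 0 := by
      rw [e2, ← qz_add, ← qz_add, ← qz_sub]; exact hb _ (by omega)
    simp [righta, rightb, this]
  · have : br (rp q ^ 2 * qz q n / (qz q k * qz q b)) = 0 := by
      rw [e2, ← qz_add, ← qz_add, ← qz_sub]; exact hb _ (by omega)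
    simp [righta, rightb, this]

/-- At the edges of the range of m₂ only some of the four rows are admissible. For even parity the
left eigenvectors vanish on the missing rows, so their recursion persists. For odd parity at an edge
the right vectors vanish on the given row, which then evolves by `eigc` alone. -/
theorem block_cases {n b k : ℤ} (hk : -1 ≤ k) {i : Fin 4} (hi : BlockRow n b k i) : 0 ≤ n ∧
    ((1 ≤ n ∨ par n b k = true ∨ n = 0 ∧ k = -1 ∧ b = 0) ∧ (∀ i, Valid n b k i ∨ lefta (par n b k) (rp q) (qz q n) (qz q k) (qz q b) i = 0 ∧
      leftb (par n b k) (rp q) (qz q n) (qz q k) (qz q b) i = 0) ∨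
    righta (par n b k) (rp q) (qz q n) (qz q k) (qz q b) i = 0 ∧ rightb (par n b k) (rp q) (qz q n) (qz q k) (qz q b) i = 0) := by
  obtain ⟨z1, z2, z3, z4⟩ := left_zero q n b k
  rcases hp : par n b k
  · have hm := par_mod_false hp
    by_cases hb : -(n - k) + 1 ≤ b ∧ b ≤ n - k - 1
    · have h0 : 0 ≤ n := by
        fin_cases i <;> simp only [BlockRow, Row, Matrix.cons_val, Fin.zero_eta, Fin.mk_one, Fin.reduceFinMk] at hi <;> omega
      refine ⟨h0, Or.inl ⟨by omega, fun j => Or.inl ?_⟩⟩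
      fin_cases j <;> simp only [Valid, BlockRow, Row, Matrix.cons_val, Fin.zero_eta, Fin.mk_one, Fin.reduceFinMk] <;> simp <;> omega
    · fin_cases i <;> simp only [BlockRow, Row, Matrix.cons_val, Fin.zero_eta, Fin.mk_one, Fin.reduceFinMk] at hi ⊢
      · exact ⟨by omega, Or.inr (z3 (by omega))⟩
      · omega
      · exact ⟨by omega, Or.inr (z4 (by omega))⟩
      · omega
  · have hm := par_mod_true hp
    have hb : -(n - k) ≤ b ∧ b ≤ n - k ∧ 0 ≤ n := by
      fin_cases i <;> simp only [BlockRow, Row, Matrix.cons_val, Fin.zero_eta, Fin.mk_one, Fin.reduceFinMk] at hi <;> omega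
    refine ⟨hb.2.2, Or.inl ⟨Or.inr (Or.inl rfl), fun j => ?_⟩⟩
    fin_cases j <;> simp only [Valid, BlockRow, Row, Matrix.cons_val, Fin.zero_eta, Fin.mk_one, Fin.reduceFinMk]
    · exact Or.inl (by simp; omega)
    · by_cases h : n - k - b = 0
      · exact Or.inr (z1 h)
      · exact Or.inl (by simp; omega)
    · exact Or.inl (by simp; omega)
    · by_cases h : n - k + b = 0
      · exact Or.inr (z2 h)
      · exact Or.inl (by simp; omega)

theorem tendsto_grp (y : Fin 4 → SpinorSpace) {a n b k : ℤ} (hk : -1 ≤ k) (h1 : -k - 1 ≤ a) (h2 : a ≤ k + 1)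
    (hn : ¬(n = 0 ∧ k = -1 ∧ b = 0)) (i : Fin 4) :
    Tendsto (fun m => grp q (opAct (diracD q ^ m) y) a n b k i) atTop (𝓝 0) := by
  by_cases hi : BlockRow n b k i
  · obtain ⟨h0, ⟨hn', H⟩ | H⟩ := block_cases q hk hi
    · obtain ⟨l1, l2, l3⟩ := eig_lt q h0 (par n b k)
      have l4 := l3 (by tauto)
      refine tendsto_recurrence (A := (righta (par n b k) (rp q) (qz q n) (qz q k) (qz q b) i : ℝ) * psia q (opAct (diracD q ^ 0) y) a n b k)
        (B := (rightb (par n b k) (rp q) (qz q n) (qz q k) (qz q b) i : ℝ) * psib q (opAct (diracD q ^ 0) y) a n b k) l1 l4 l2 fun m => ?_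
      obtain ⟨p1, p2⟩ := psi_pow q y hk h1 h2 H m
      rw [opAct_pow_succ, grp_rec q _ hk h1 h2 (Or.inl hi), p1, p2]
      ring
    · obtain ⟨l1, l2, l3⟩ := eig_lt q h0 (par n b k)
      refine tendsto_recurrence (A := 0) (B := 0) l1 l2 l2 fun m => ?_
      rw [opAct_pow_succ, grp_rec q _ hk h1 h2 (Or.inl hi), H.1, H.2]
      simp
  · simp only [grp_zero q _ hi]
    exact tendsto_const_nhds

/-- The weight of the harmonic spinors. -/
noncomputable def rho : ℝ := br (rp q ^ 4) / (rp q ^ 4 * bz q 5 * (1 - bz q 1 / bz q 5))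

theorem righta_exceptional {p : ℝ} (hp : p ≠ 0) (h4 : 1 - p ^ 4 ≠ 0) (h12 : 1 - p ^ 12 ≠ 0) (h20 : 1 - p ^ 20 ≠ 0) (i : Fin 4) (hi : i = 1 ∨ i = 3) :
    righta false p 1 (p ^ 2)⁻¹ 1 i = br (p ^ 4) / (p ^ 4 * br (p ^ 10)) := by
  rcases hi with rfl | rfl <;> simp [righta, nrm, br] <;> field_simp <;> ring

/-- In this block the first pairing ψ is constant under the powers. The identity for `righta` says
that the fixed point of the row recursion is `rho` times ψ, for both remaining rows. -/
theorem exceptional : eiga false (rp q) (qz q 0) = 1 ∧ (∀ i, i = 1 ∨ i = 3 → righta false (rp q) (qz q 0) (qz q (-1)) (qz q 0) i =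
    rho q * (1 - eigc false (rp q) (qz q 0))) ∧ 1 - eigc false (rp q) (qz q 0) ≠ 0 := by
  obtain ⟨e1, e2, e3, e4⟩ := eig_bz q 0
  have h0 : qz q 0 = 1 := qz_zero q
  have hk : qz q (-1) = (rp q ^ 2)⁻¹ := by rw [show rp q ^ 2 = qz q 1 from rp_pow q 1]; simp [qz]
  have hp := (rp_pos q).ne'
  have g := fun i (h : i ≠ 0) => one_sub_ne q (i := i) (j := 0) (n := 0) (by omega)
  simp only [pow_zero, mul_one] at g
  have l5 := bz_pos q (z := 5) (by norm_num)
  have l1 := bz_lt q (x := 1) (y := 5) (by norm_num)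
  have hne : 1 - bz q 1 / bz q 5 ≠ 0 := by
    rw [sub_ne_zero, ne_comm, Ne, div_eq_one_iff_eq l5.ne']; exact l1.ne
  have hc : eigc false (rp q) (qz q 0) = bz q 1 / bz q 5 := by rw [eigc, e1, e4]; norm_num
  refine ⟨?_, fun i hi => ?_, by rwa [hc]⟩
  · rw [eiga, e2, e3]; exact div_self (bz_pos q (by norm_num)).ne'
  · rw [hc, h0, hk, righta_exceptional hp (g 4 (by norm_num)) (g 12 (by norm_num)) (g 20 (by norm_num)) i hi, rho,
      show rp q ^ 10 = qz q 5 from rp_pow q 5]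
    change _ / (_ * bz q 5) = _
    rw [div_mul_eq_mul_div, mul_div_mul_right _ _ hne]

theorem tendsto_grp_exceptional (y : Fin 4 → SpinorSpace) (i : Fin 4) (hi : i = 1 ∨ i = 3) :
    Tendsto (fun m => grp q (opAct (diracD q ^ m) y) 0 0 0 (-1) i) atTop
      (𝓝 ((rho q : ℂ) * ((qz q (-1) : ℂ) * grp q y 0 0 0 (-1) 1 + (qz q 5 : ℂ) * grp q y 0 0 0 (-1) 3))) := by
  obtain ⟨x1, x2, x3⟩ := exceptional q
  have hp : par 0 0 (-1) = false := by decide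
  have H : ∀ j, Valid 0 0 (-1) j := fun j => by
    fin_cases j <;> simp [Valid, BlockRow, Row]
  have hpsi : psia q y 0 0 0 (-1) = (qz q (-1) : ℂ) * grp q y 0 0 0 (-1) 1 + (qz q 5 : ℂ) * grp q y 0 0 0 (-1) 3 := by
    have r0 : ¬BlockRow 0 0 (-1) 0 := fun h => by have : (0 : ℤ) ≤ -1 := h.1; omega
    have r2 : ¬BlockRow 0 0 (-1) 2 := fun h => by have : (0 : ℤ) ≤ -1 := h.1; omega
    rw [psia, hp, Fin.sum_univ_four, grp_zero q y r0, grp_zero q y r2]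
    simp [lefta, qz_zero, show rp q ^ 10 = qz q 5 from rp_pow q 5]
  rw [← hpsi]
  have ha1 : -(-1 : ℤ) - 1 ≤ 0 := by norm_num
  have ha2 : (0 : ℤ) ≤ -1 + 1 := by norm_num
  have y0 : opAct (diracD q ^ 0) y = y := by
    funext i
    rw [opAct, pow_zero, Finset.sum_eq_single i (fun j _ h => by rw [Matrix.one_apply_ne h.symm, zero_apply]) (by simp), Matrix.one_apply_eq, one_apply_eq_self]
  obtain ⟨l1, l2, l3⟩ := eig_lt q le_rfl (par 0 0 (-1))
  -- Subtracting the fixed point leaves a recursion with the rates `eigc` and `eigb` only.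
  have := tendsto_recurrence (x := fun m => grp q (opAct (diracD q ^ m) y) 0 0 0 (-1) i - rho q * psia q y 0 0 0 (-1)) (A := 0)
    (B := (rightb (par 0 0 (-1)) (rp q) (qz q 0) (qz q (-1)) (qz q 0) i : ℝ) * psib q (opAct (diracD q ^ 0) y) 0 0 0 (-1)) (s := 0) l1 (by simp) l2 fun m => by
      obtain ⟨p1, p2⟩ := psi_pow q y le_rfl ha1 ha2 (fun i => Or.inl (H i)) m
      rw [opAct_pow_succ, grp_rec q _ le_rfl ha1 ha2 (H i), p1, p2, hp, x1, x2 i hi, y0]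
      push_cast
      ring
  simpa using this.add_const (rho q * psia q y 0 0 0 (-1))

end

/-! ### From the blocks back to the coordinates, and the harmonic spinors. -/

open Filter Topology

section
variable (q : Param)

/-- The determinant of the transformation to the coordinates `plus` and `minus`. -/
noncomputable def pairDet (a k : ℤ) : ℝ := qz q (2 * k + 2) * bz q (k - a + 1) + bz q (k + a + 1)

theorem pairDet_pos {a k : ℤ} (h1 : -k - 1 ≤ a) (h2 : a ≤ k + 1) (hk : 0 ≤ k) : 0 < pairDet q a k := by
  have p := qz_pos q (2 * k + 2)
  have e1 := bz_nonneg q (z := k - a + 1) (by omega)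
  have e2 := bz_nonneg q (z := k + a + 1) (by omega)
  rcases (show 0 < k - a + 1 ∨ 0 < k + a + 1 by omega) with h | h
  · have := mul_pos p (bz_pos q h)
    rw [pairDet]; linarith
  · have := bz_pos q h
    have := mul_nonneg p.le e1
    rw [pairDet]; linarith

theorem pair_inv (u v : ℤ → ℤ → ℤ → ℤ → ℂ) {a n b k : ℤ} (h1 : -k - 1 ≤ a) (h2 : a ≤ k + 1) (hk : 0 ≤ k) :
    u a n b k = ((qz q (k + 2) : ℂ) * plus q u v a n b k + (bz q (k + a + 1) : ℂ) * minus q u v a n b k) / (pairDet q a k : ℂ) ∧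
    v (a - 1) n b k = ((qz q k : ℂ) * ((bz q (k - a + 1) : ℂ) * minus q u v a n b k) - plus q u v a n b k) / (pairDet q a k : ℂ) := by
  have hd : (pairDet q a k : ℂ) ≠ 0 := by exact_mod_cast (pairDet_pos q h1 h2 hk).ne'
  have e : qz q (2 * k + 2) = qz q (k + 2) * qz q k := by rw [← qz_add]; congr 1; ring
  rw [eq_div_iff hd, eq_div_iff hd, plus, minus, pairDet, e]
  push_cast
  constructor <;> ring

/-- The labels of the harmonic spinors. -/
def sa : Fin 4 → ℤ := ![0, 0, -1, -1]
def sb : Fin 4 → ℤ := ![0, -1, 0, -1]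

/-- The limit of the coordinates which belong to the eigenvalue `1`. -/
noncomputable def harm (y : Fin 4 → SpinorSpace) : ℂ :=
  (rho q : ℂ) * ((qz q (-1) : ℂ) * grp q y 0 0 0 (-1) 1 + (qz q 5 : ℂ) * grp q y 0 0 0 (-1) 3)

theorem pairDet_zero : (pairDet q 0 0 : ℂ) = bz q 1 * (1 + qz q 2) := by
  rw [pairDet]; push_cast; norm_num; ring

/-- Invert the coupling by `pair_inv`. At the extreme a no limit of `minus` is available, but there
its coefficient is the bracket of 0. -/
theorem tendsto_pair {u v : ℕ → ℤ → ℤ → ℤ → ℤ → ℂ} {n b k : ℤ} (hk : 0 ≤ k) {s : Prop} [Decidable s] {L : ℂ}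
    (hp : ∀ a, -k - 1 ≤ a → a ≤ k + 1 → Tendsto (fun m => plus q (u m) (v m) a n b k) atTop (𝓝 0))
    (hm : ∀ a, -k ≤ a → a ≤ k → Tendsto (fun m => minus q (u m) (v m) a n b k) atTop (𝓝 (if s ∧ a = 0 then L else 0))) (hs : s → k = 0) (a : ℤ) :
    (-k - 1 ≤ a → a ≤ k → Tendsto (fun m => u m a n b k) atTop (𝓝 (if s ∧ a = 0 then L / (1 + qz q 2) else 0))) ∧
    (-k - 1 ≤ a → a ≤ k → Tendsto (fun m => v m a n b k) atTop (𝓝 (if s ∧ a + 1 = 0 then L / (1 + qz q 2) else 0))) := by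
  have hb : (bz q 1 : ℂ) ≠ 0 := by exact_mod_cast (bz_pos q one_pos).ne'
  refine ⟨fun h1 h2 => ?_, fun h1 h2 => ?_⟩
  · have c1 : Tendsto (fun m => (bz q (k + a + 1) : ℂ) * minus q (u m) (v m) a n b k) atTop (𝓝 ((bz q (k + a + 1) : ℂ) * if s ∧ a = 0 then L else 0)) := by
      by_cases h : a = -k - 1
      · rw [show k + a + 1 = 0 by omega, bz_zero]; simp
      · exact (hm a (by omega) h2).const_mul _
    have c2 := (((hp a h1 (by omega)).const_mul (qz q (k + 2) : ℂ)).add c1).div_const (pairDet q a k : ℂ)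
    simp only [← (pair_inv q _ _ h1 (show a ≤ k + 1 by omega) hk).1] at c2
    convert c2 using 2
    split_ifs with h
    · obtain ⟨h, rfl⟩ := h
      obtain rfl := hs h
      rw [pairDet_zero]
      norm_num
      rw [mul_div_mul_left _ _ hb]
    · simp
  · have c1 : Tendsto (fun m => (bz q (k - (a + 1) + 1) : ℂ) * minus q (u m) (v m) (a + 1) n b k) atTop
        (𝓝 ((bz q (k - (a + 1) + 1) : ℂ) * if s ∧ a + 1 = 0 then L else 0)) := by
      by_cases h : a = k
      · rw [show k - (a + 1) + 1 = 0 by omega, bz_zero]; simp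
      · exact (hm (a + 1) (by omega) (by omega)).const_mul _
    have c2 := ((c1.const_mul (qz q k : ℂ)).sub (hp (a + 1) (by omega) (by omega))).div_const (pairDet q (a + 1) k : ℂ)
    have e := fun m => (pair_inv q (u m) (v m) (n := n) (b := b) (show -k - 1 ≤ a + 1 by omega) (show a + 1 ≤ k + 1 by omega) hk).2
    simp only [← e, add_sub_cancel_right] at c2
    convert c2 using 2
    split_ifs with h
    · obtain ⟨h, h'⟩ := h
      obtain rfl := hs h
      rw [h', pairDet_zero]
      norm_num
      rw [qz_zero, Complex.ofReal_one, one_mul, mul_div_mul_left _ _ hb]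
    · simp

/-- The `minus` coordinates at k belong to the block k - 1, and the components 1, 3 at b to the
block b + 1. The exceptional block with k = -1 therefore shows up at j = 1/2 with m₂ = ±1/2. -/
theorem tendsto_gext (y : Fin 4 → SpinorSpace) (i : Fin 4) {a n b k : ℤ} (h : Adm a n b k) :
    Tendsto (fun m => gext q (opAct (diracD q ^ m) y i) a n b k) atTop
      (𝓝 (if n = 0 ∧ a = sa i ∧ b = sb i then harm q y / (1 + qz q 2) else 0)) := by
  obtain ⟨hk, hn, h1, h2, h3, h4⟩ := h
  have p1 := tendsto_pair q (u := fun m => gext q (opAct (diracD q ^ m) y 0)) (v := fun m => gext q (opAct (diracD q ^ m) y 2)) (n := n) (b := b)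
    hk (s := n = 0 ∧ b = 0) (L := harm q y)
    (fun a h1 h2 => tendsto_grp q y (n := n) (b := b) (k := k) (a := a) (by omega) h1 h2 (by omega) 0)
    (fun a h1 h2 => by
      have e : k - 1 + 1 = k := by ring
      by_cases hs : n = 0 ∧ k - 1 = -1 ∧ b = 0
      · obtain ⟨rfl, h', rfl⟩ := hs
        obtain rfl : k = 0 := by omega
        obtain rfl : a = 0 := by omega
        rw [if_pos ⟨⟨rfl, rfl⟩, rfl⟩]
        exact tendsto_grp_exceptional q y 1 (Or.inl rfl)
      · have := tendsto_grp q y (n := n) (b := b) (k := k - 1) (a := a) (by omega) (by omega) (by omega) hs 1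
        simp only [grp, Matrix.cons_val, e] at this
        rw [if_neg (by omega)]
        exact this)
    (by omega) a
  have p2 := tendsto_pair q (u := fun m => gext q (opAct (diracD q ^ m) y 1)) (v := fun m => gext q (opAct (diracD q ^ m) y 3)) (n := n) (b := b)
    hk (s := n = 0 ∧ b = -1) (L := harm q y)
    (fun a h1 h2 => by
      have := tendsto_grp q y (n := n) (b := b + 1) (k := k) (a := a) (by omega) h1 h2 (by omega) 2
      simpa only [grp, Matrix.cons_val, add_sub_cancel_right] using this)
    (fun a h1 h2 => by
      have e : k - 1 + 1 = k := by ring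
      by_cases hs : n = 0 ∧ k - 1 = -1 ∧ b + 1 = 0
      · obtain ⟨rfl, h', h''⟩ := hs
        obtain rfl : k = 0 := by omega
        obtain rfl : a = 0 := by omega
        obtain rfl : b = -1 := by omega
        rw [if_pos ⟨⟨rfl, rfl⟩, rfl⟩]
        exact tendsto_grp_exceptional q y 3 (Or.inr rfl)
      · have := tendsto_grp q y (n := n) (b := b + 1) (k := k - 1) (a := a) (by omega) (by omega) (by omega) hs 3
        simp only [grp, Matrix.cons_val, e, add_sub_cancel_right] at this
        rw [if_neg (by omega)]
        exact this)
    (by omega) a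
  fin_cases i
  · convert p1.1 h1 h2 using 3
    simp [sa, sb]; tauto
  · convert p2.1 h1 h2 using 3
    simp [sa, sb]; tauto
  · convert p1.2 h1 h2 using 3
    · rfl
    change (n = 0 ∧ a = -1 ∧ b = 0) ↔ _
    omega
  · convert p2.2 h1 h2 using 3
    · rfl
    change (n = 0 ∧ a = -1 ∧ b = -1) ↔ _
    omega

/-- The coefficients of the harmonic spinors. -/
noncomputable def harmW : Fin 4 → ℝ := ![qz q (-1), qz q 5, qz q 1, qz q 7]

theorem adm_harm (i : Fin 4) : Adm (sa i) 0 (sb i) 0 := by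
  fin_cases i <;> simp [sa, sb, Adm]

theorem opAct_single (Z : Matrix (Fin 4) (Fin 4) (SpinorSpace →L[ℂ] SpinorSpace)) (i j : Fin 4) (f : SpinorSpace) :
    opAct Z (Pi.single i f) j = Z j i f := by
  rw [opAct, Finset.sum_eq_single i (fun l _ h => by rw [Pi.single_eq_of_ne h, map_zero]) (by simp), Pi.single_eq_same]

theorem harm_single (i : Fin 4) : harm q (Pi.single i (bvec (ind (adm_harm i)))) = (rho q : ℂ) * harmW q i * gg q (sa i) 0 (sb i) 0 := by
  have z : ∀ a n b k, gext q (0 : SpinorSpace) a n b k = 0 := fun a n b k => by rw [gext, ext_zero, mul_zero]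
  have e : gext q (bvec (ind (adm_harm i))) (sa i) 0 (sb i) 0 = gg q (sa i) 0 (sb i) 0 := by
    rw [gext, bvec_ind, ext_vec _ _ _ _ (adm_harm i), if_pos ⟨rfl, rfl, rfl, rfl⟩, mul_one]
  have m1 : (qz q 1 : ℂ) = qz q (-1) * qz q 2 := by rw [← Complex.ofReal_mul, ← qz_add]; norm_num
  have m7 : (qz q 7 : ℂ) = qz q 5 * qz q 2 := by rw [← Complex.ofReal_mul, ← qz_add]; norm_num
  fin_cases i <;> simp [sa, sb] at e <;> simp [harm, grp, minus, sa, sb, harmW, z, e, m1, m7] <;> ring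

/-- The limit of the powers is a rank one projection; this identity says that its trace is 1. -/
theorem sum_harmW : rho q * ∑ i, harmW q i = 1 + qz q 2 := by
  have hp := (rp_pos q).ne'
  have l := (bz_lt q (x := 1) (y := 5) (by norm_num)).ne'
  have l5 := (bz_pos q (z := 5) (by norm_num)).ne'
  have em : qz q (-1) = (rp q ^ 2)⁻¹ := by rw [show rp q ^ 2 = qz q 1 from rp_pow q 1]; simp [qz]
  have key : bz q 2 * (qz q (-1) + qz q 5 + qz q 1 + qz q 7) = qz q 2 * (bz q 5 - bz q 1) * (1 + qz q 2) := by
    rw [bz, bz, bz, em, ← show rp q ^ 2 = qz q 1 from rp_pow q 1, ← show rp q ^ 4 = qz q 2 from rp_pow q 2,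
      ← show rp q ^ 10 = qz q 5 from rp_pow q 5, ← show rp q ^ 14 = qz q 7 from rp_pow q 7]
    simp only [br]
    field_simp
    ring
  have e4 : rp q ^ 4 = qz q 2 := rp_pow q 2
  have p2 := (qz_pos q 2).ne'
  have hr : rho q = bz q 2 / (qz q 2 * (bz q 5 - bz q 1)) := by
    have e2 : br (qz q 2) = bz q 2 := rfl
    rw [rho, e4, e2]
    congr 1
    rw [mul_assoc, mul_sub, mul_one, mul_div_cancel₀ _ l5]
  rw [hr, Fin.sum_univ_four]
  simp only [harmW, Matrix.cons_val]
  rw [div_mul_eq_mul_div, key, mul_div_cancel_left₀ _ (mul_ne_zero p2 (sub_ne_zero.2 l))]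

/-- Apply the limit to a basis vector in the i-th component. In a diagonal entry the gauge factor
cancels, so the rational gauge may be used. -/
theorem tendsto_diag (i : Fin 4) (v : SpinorIndex) :
    Tendsto (fun m => (diracD q ^ m) i i (bvec v) v) atTop
      (𝓝 (if v = ind (adm_harm i) then ((rho q * harmW q i / (1 + qz q 2) : ℝ) : ℂ) else 0)) := by
  obtain ⟨a, n, b, k, h, rfl⟩ := exists_ind v
  have hg : (gg q a n b k : ℂ) ≠ 0 := by exact_mod_cast (gg_pos q a n b k).ne'
  have t := (tendsto_gext q (Pi.single i (bvec (ind h))) i h).div_const (gg q a n b k : ℂ)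
  simp only [opAct_single, gext, mul_div_cancel_left₀ _ hg] at t
  simp only [ext_ind]
  convert t using 2
  have hiff : ind h = ind (adm_harm i) ↔ n = 0 ∧ a = sa i ∧ b = sb i := by
    rw [ind_inj]
    have := h.1
    have := h.2.1
    constructor
    · rintro ⟨h1, h2, h3, h4⟩; exact ⟨h2, h1, h3⟩
    · rintro ⟨h1, h2, h3⟩; exact ⟨h2, h1, h3, by omega⟩
  by_cases hh : ind h = ind (adm_harm i)
  · rw [if_pos hh, if_pos (hiff.1 hh), hh, harm_single]
    obtain ⟨r1, r2, r3, r4⟩ := (ind_inj _ _).1 hh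
    subst r1 r2 r3 r4
    push_cast
    field_simp
  · rw [if_neg hh, if_neg fun h' => hh (hiff.2 h'), zero_div]

end

/-! ### Passage to the limit under the weighted trace. -/

open Filter Topology

section
variable (q : Param)

theorem levelOp_injective (t : ℕ) {X Y : SpinorSpace →L[ℂ] SpinorSpace} (h : levelOp q t * X = levelOp q t * Y) : X = Y := by
  ext1 f
  apply lp.ext
  funext v
  have := congrArg (fun T : SpinorSpace →L[ℂ] SpinorSpace => T f v) h
  simp only [mul_apply_eq_comp, levelOp_apply] at this
  have hq : (q : ℂ) ≠ 0 := by exact_mod_cast q.2.1.ne'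
  exact mul_left_cancel₀ (pow_ne_zero _ hq) this

theorem commute_genD (g : SGen) : Commute (levelOp q 2) (genD q g) := by
  ext1 f
  refine ext_inj fun a n b k h => ?_
  rw [mul_apply_eq_comp, mul_apply_eq_comp, ext_levelOp, genD, repD_apply, repP, repM, rep_gen, rep_gen, smul_apply, smul_apply, ext_smul, ext_smul,
    genOp_sub q _ _ g _ h, genOp_sub q _ _ g _ h, mul_left_comm, Finset.mul_sum]
  congr 1
  refine Finset.sum_congr rfl fun σ _ => ?_
  rw [ext_levelOp]
  ring

theorem commute_diracD (i j : Fin 4) : Commute (levelOp q 2) (diracD q i j) := by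
  simp only [diracD, diracMat, Matrix.of_apply]
  have h := fun g (c : ℂ) => (commute_genD q g).smul_right c
  exact ((((h _ _).add_right (h _ _)).add_right (h _ _)).add_right (h _ _)).add_right (h _ _)

theorem diracD_apply (i j : Fin 4) : diracD q i j = repD q (idemHalf q i j) := by
  rw [idemHalf_eq]
  simp only [diracD, diracMat, Matrix.of_apply, Matrix.smul_apply, map_smul, map_add, genD]
  module

/-- The Dirac operator preserves l, so it commutes with Q = q^{2(l - 1/2)}. Writing it as Q b, also
b commutes with Q because Q is injective, and the N-th power is Q^N b^N. -/
theorem exists_factor : ∃ b : Matrix (Fin 4) (Fin 4) (SpinorSpace →L[ℂ] SpinorSpace),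
    ∀ N i j, (diracD q ^ N) i j = levelOp q 2 ^ N * (b ^ N) i j := by
  have h : ∀ i j, ∃ b, diracD q i j = levelOp q 2 * b ∧ Commute (levelOp q 2) b := by
    intro i j
    obtain ⟨b, hb⟩ := (diracD_apply q i j ▸ decay_repD q _ : Decay q 2 (diracD q i j)) 0
    rw [levelOp_zero, mul_one] at hb
    refine ⟨b, hb, levelOp_injective q 2 ?_⟩
    change levelOp q 2 * (levelOp q 2 * b) = levelOp q 2 * (b * levelOp q 2)
    have := (commute_diracD q i j).eq
    rw [hb] at this
    rw [this, mul_assoc]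
  choose b hb hc using h
  refine ⟨Matrix.of b, fun N => ?_⟩
  induction N with
  | zero => simp
  | succ N ih =>
    intro i j
    have hcN : ∀ N i j, Commute (levelOp q 2) (((Matrix.of b) ^ N) i j) := by
      intro N
      induction N with
      | zero =>
        intro i j
        rw [pow_zero, Matrix.one_apply]
        split_ifs
        exacts [Commute.one_right _, Commute.zero_right _]
      | succ N ih =>
        intro i j
        rw [pow_succ, Matrix.mul_apply]
        exact Commute.sum_right _ _ _ fun l _ => (ih i l).mul_right (hc l j)
    rw [pow_succ, Matrix.mul_apply, pow_succ, pow_succ, Matrix.mul_apply, Finset.mul_sum]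
    refine Finset.sum_congr rfl fun l _ => ?_
    rw [ih, hb, mul_assoc, ← mul_assoc _ (levelOp q 2), ← (hcN N i l).eq]
    simp only [mul_assoc]
    rfl

theorem norm_pow_entry (b : Matrix (Fin 4) (Fin 4) (SpinorSpace →L[ℂ] SpinorSpace)) : ∃ C : ℝ, 1 ≤ C ∧ ∀ N i j, ‖(b ^ N) i j‖ ≤ C ^ N := by
  have hs : ∀ i j, ‖b i j‖ ≤ ∑ i, ∑ j, ‖b i j‖ := fun i j =>
    (Finset.single_le_sum (f := fun j => ‖b i j‖) (fun j _ => norm_nonneg _) (Finset.mem_univ j)).trans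
      (Finset.single_le_sum (f := fun i => ∑ j, ‖b i j‖) (fun i _ => Finset.sum_nonneg fun j _ => norm_nonneg _) (Finset.mem_univ i))
  set C0 := ∑ i, ∑ j, ‖b i j‖
  have h0 : 0 ≤ C0 := Finset.sum_nonneg fun i _ => Finset.sum_nonneg fun j _ => norm_nonneg _
  -- The factor 4 counts the terms of a matrix product; the summand 1 makes the constant at least 1.
  refine ⟨4 * C0 + 1, by linarith, fun N => ?_⟩
  induction N with
  | zero =>
    intro i j
    rw [pow_zero, pow_zero, Matrix.one_apply]
    split_ifs
    exacts [ContinuousLinearMap.norm_id_le, by rw [norm_zero]; exact zero_le_one]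
  | succ N ih =>
    intro i j
    rw [pow_succ, Matrix.mul_apply]
    refine (norm_sum_le _ _).trans ?_
    have hp : 0 ≤ (4 * C0 + 1) ^ N := by positivity
    calc ∑ l, ‖(b ^ N) i l * b l j‖ ≤ ∑ l : Fin 4, (4 * C0 + 1) ^ N * C0 := Finset.sum_le_sum fun l _ =>
          (norm_mul_le _ _).trans (mul_le_mul (ih i l) (hs l j) (norm_nonneg _) hp)
      _ = (4 * C0 + 1) ^ N * (4 * C0) := by rw [Fin.sum_const, nsmul_eq_mul]; push_cast; ring
      _ ≤ _ := by rw [pow_succ]; exact mul_le_mul_of_nonneg_left (by linarith) hp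

theorem levelOp_pow_apply (N : ℕ) (f : SpinorSpace) (v : SpinorIndex) : (levelOp q 2 ^ N) f v = ((q : ℂ) ^ (2 * lev v)) ^ N * f v := by
  induction N with
  | zero => simp
  | succ N ih => rw [pow_succ', mul_apply_eq_comp, levelOp_apply, ih, pow_succ']; ring

theorem exists_entry_bound : ∃ C : ℝ, 1 ≤ C ∧ ∀ N i j v, ‖(diracD q ^ N) i j (bvec v) v‖ ≤ (C * (q : ℝ) ^ (2 * lev v)) ^ N := by
  obtain ⟨b, hb⟩ := exists_factor q
  obtain ⟨C, h1, hC⟩ := norm_pow_entry b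
  refine ⟨C, h1, fun N i j v => ?_⟩
  rw [hb, mul_apply_eq_comp, levelOp_pow_apply, norm_mul, norm_pow, norm_pow, Complex.norm_real, Real.norm_of_nonneg q.2.1.le, mul_pow, mul_comm]
  refine mul_le_mul_of_nonneg_right ?_ (by have := q.2.1; positivity)
  refine (lp.norm_apply_le_norm (by norm_num) _ v).trans ((((b ^ N) i j).le_opNorm _).trans ?_)
  rw [norm_bvec, mul_one]
  exact hC N i j

theorem finite_lev (n₀ : ℕ) : {v : SpinorIndex | lev v < n₀}.Finite := by
  choose A N B K hA hv using exists_ind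
  have hinj : Function.Injective fun v => (A v, N v, B v, K v) := fun v w h => by
    simp only [Prod.mk.injEq] at h
    rw [hv v, hv w, ind_inj]
    exact h
  refine Set.Finite.of_injOn (f := fun v => (A v, N v, B v, K v))
    (t := Set.Icc (-(n₀ + 2 : ℤ)) (n₀ + 2) ×ˢ Set.Icc (-(n₀ + 2 : ℤ)) (n₀ + 2) ×ˢ Set.Icc (-(n₀ + 2 : ℤ)) (n₀ + 2) ×ˢ Set.Icc (-(n₀ + 2 : ℤ)) (n₀ + 2))
    (fun v h => ?_) hinj.injOn ((Set.finite_Icc _ _).prod ((Set.finite_Icc _ _).prod ((Set.finite_Icc _ _).prod (Set.finite_Icc _ _))))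
  have e := lev_ind (hA v)
  rw [← hv v] at e
  have h' : lev v < n₀ := h
  obtain ⟨h1, h2, h3, h4, h5, h6⟩ := hA v
  simp only [Set.mem_prod, Set.mem_Icc]
  omega

/-- Dominated convergence. The N-th diagonal entry is at most (C q^{2n})^N, where C q^{2n} ≤ 1 for
all but finitely many labels. For those N may be replaced by 5, which leaves a summable majorant;
each of the finitely many others is a convergent, hence bounded sequence. -/
theorem tendsto_tau (i : Fin 4) : Tendsto (fun m : ℕ => tau q ((diracD q ^ (5 + 2 * m)) i i)) atTop
    (𝓝 (modularWeight q (ind (adm_harm i)) * ((rho q * harmW q i / (1 + qz q 2) : ℝ) : ℂ))) := by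
  obtain ⟨C, h1, hC⟩ := exists_entry_bound q
  have hN : Tendsto (fun m : ℕ => 5 + 2 * m) atTop atTop := tendsto_atTop_mono (fun m => by simp only [id]; omega) tendsto_id
  have hq0 := q.2.1
  have hq1 := q.2.2
  obtain ⟨n₀, hn₀⟩ : ∃ n₀ : ℕ, C * (q : ℝ) ^ (2 * n₀) ≤ 1 := by
    have : Tendsto (fun n : ℕ => C * ((q : ℝ) ^ 2) ^ n) atTop (𝓝 (C * 0)) :=
      (tendsto_pow_atTop_nhds_zero_of_lt_one (by positivity) (pow_lt_one₀ hq0.le hq1 two_ne_zero)).const_mul C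
    rw [mul_zero] at this
    obtain ⟨n, hn⟩ := (this.eventually (gt_mem_nhds one_pos)).exists
    exact ⟨n, by rw [pow_mul]; exact hn.le⟩
  have hlim := fun v => ((tendsto_diag q i v).comp hN).const_mul (modularWeight q v)
  have hb : ∀ v, ∃ B : ℝ, 0 ≤ B ∧ ∀ m : ℕ, ‖modularWeight q v * (diracD q ^ (5 + 2 * m)) i i (bvec v) v‖ ≤ B := by
    intro v
    obtain ⟨B, hB⟩ := (hlim v).norm.bddAbove_range
    exact ⟨B, (norm_nonneg _).trans (hB ⟨0, rfl⟩), fun m => hB ⟨m, rfl⟩⟩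
  choose B hB0 hB using hb
  have hsum : ∑' v, modularWeight q v * (if v = ind (adm_harm i) then ((rho q * harmW q i / (1 + qz q 2) : ℝ) : ℂ) else 0) =
      modularWeight q (ind (adm_harm i)) * ((rho q * harmW q i / (1 + qz q 2) : ℝ) : ℂ) := by
    rw [tsum_eq_single (ind (adm_harm i)) fun v h => by rw [if_neg h, mul_zero], if_pos rfl]
  rw [← hsum]
  -- From q^{10n} only the factor q^{8n} is kept, to match `summable_weight`.
  refine tendsto_tsum_of_dominated_convergence (bound := fun v => (if lev v < n₀ then B v else 0) + ‖modularWeight q v‖ * (q : ℝ) ^ (8 * lev v) * C ^ 5) ?_ hlim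
    (Eventually.of_forall fun m v => ?_)
  · refine Summable.add ?_ ((summable_weight q).mul_right _)
    exact summable_of_hasFiniteSupport ((finite_lev n₀).subset fun v h => by
      by_contra h'
      exact h (if_neg h'))
  · by_cases h : lev v < n₀
    · rw [if_pos h]
      exact (hB v m).trans (le_add_of_nonneg_right (by positivity))
    · rw [if_neg h, zero_add, norm_mul, mul_assoc]
      refine mul_le_mul_of_nonneg_left ?_ (norm_nonneg _)
      refine (hC _ i i v).trans ?_
      have l1 : C * (q : ℝ) ^ (2 * lev v) ≤ 1 := by
        refine le_trans (mul_le_mul_of_nonneg_left ?_ (by linarith)) hn₀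
        exact pow_le_pow_of_le_one hq0.le hq1.le (by omega)
      refine (pow_le_pow_of_le_one (by positivity) l1 (show 5 ≤ 5 + 2 * m by omega)).trans ?_
      rw [mul_pow, mul_comm, ← pow_mul]
      refine mul_le_mul_of_nonneg_right ?_ (by positivity)
      exact pow_le_pow_of_le_one hq0.le hq1.le (by omega)

end

/-! ### The pairing with ω₄ as an index. -/

open Filter Topology

section
variable (q : Param)

theorem tau_sum {ι : Type*} (s : Finset ι) {T : ι → SpinorSpace →L[ℂ] SpinorSpace} (h : ∀ i, Decay q 8 (T i)) :
    tau q (∑ i ∈ s, T i) = ∑ i ∈ s, tau q (T i) := by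
  classical
  induction s using Finset.induction_on with
  | empty => simp [tau]
  | insert i s hi ih => rw [Finset.sum_insert hi, Finset.sum_insert hi, tau_add (h i) (Decay.sum s h), ih]

/-- The twisted trace of a matrix of operators. -/
noncomputable def tauMat (Z : Matrix (Fin 4) (Fin 4) (SpinorSpace →L[ℂ] SpinorSpace)) : ℂ :=
  ∑ a, etaDiag q a * tau q (Z a a)

variable {q}

theorem tauMat_add {Y Z : Matrix (Fin 4) (Fin 4) (SpinorSpace →L[ℂ] SpinorSpace)} (hY : ∀ i j, Decay q 8 (Y i j))
    (hZ : ∀ i j, Decay q 8 (Z i j)) : tauMat q (Y + Z) = tauMat q Y + tauMat q Z := by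
  simp only [tauMat, Matrix.add_apply, tau_add (hY _ _) (hZ _ _), mul_add, Finset.sum_add_distrib]

theorem tauMat_neg (Z : Matrix (Fin 4) (Fin 4) (SpinorSpace →L[ℂ] SpinorSpace)) : tauMat q (-Z) = -tauMat q Z := by
  have h : ∀ a, tau q ((-Z) a a) = -tau q (Z a a) := fun a => by
    rw [show (-Z) a a = (-1 : ℂ) • Z a a by rw [neg_one_smul]; rfl, tau_smul, neg_one_mul]
  simp only [tauMat, h, mul_neg, Finset.sum_neg_distrib]

/-- The twist in the cyclicity of τ multiplies the entries of e - 1/2 by weights which η compensates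
(`etaDiag_kapDiag`), so the combined trace is honestly cyclic for π(e - 1/2). -/
theorem tauMat_map_mul {π : SphereAlg q →ₐ[ℂ] (SpinorSpace →L[ℂ] SpinorSpace)} (hd : ∀ a, Decay q 0 (π a))
    (hπ : ∀ a {X : SpinorSpace →L[ℂ] SpinorSpace}, Decay q 8 X → tau q (π (kappa q a) * X) = tau q (X * π a))
    {Z : Matrix (Fin 4) (Fin 4) (SpinorSpace →L[ℂ] SpinorSpace)} (hZ : ∀ i j, Decay q 8 (Z i j)) :
    tauMat q ((idemHalf q).map π * Z) = tauMat q (Z * (idemHalf q).map π) := by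
  have l := fun i j k l => (((hd (idemHalf q i j)).mul (hZ k l)).mono (show 8 ≤ 0 + 8 by norm_num))
  have r := fun i j k l => (((hZ k l).mul (hd (idemHalf q i j))).mono (show 8 ≤ 8 + 0 by norm_num))
  simp only [tauMat, Matrix.mul_apply, Matrix.map_apply]
  have hl : ∀ a, etaDiag q a * tau q (∑ k, π (idemHalf q a k) * Z k a) = ∑ k, etaDiag q a * tau q (π (idemHalf q a k) * Z k a) :=
    fun a => by rw [tau_sum q _ fun k => l a k k a, Finset.mul_sum]
  have hr : ∀ a, etaDiag q a * tau q (∑ k, Z a k * π (idemHalf q k a)) = ∑ k, etaDiag q a * tau q (Z a k * π (idemHalf q k a)) :=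
    fun a => by rw [tau_sum q _ fun k => r k a a k, Finset.mul_sum]
  simp only [hl, hr]
  rw [Finset.sum_comm]
  refine Finset.sum_congr rfl fun k _ => Finset.sum_congr rfl fun a _ => ?_
  have e := hπ (idemHalf q a k) (hZ k a)
  rw [kappa_idemHalf, map_smul, smul_mul_assoc, tau_smul] at e
  rw [← e, ← mul_assoc]
  congr 1
  have h1 := etaDiag_kapDiag q k
  have h2 := etaDiag_kapDiag q a
  have h3 := kapDiag_ne q a
  have h : etaDiag q k * kapDiag q k = etaDiag q a * kapDiag q a := h1.trans h2.symm
  field_simp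
  linear_combination -h

variable (q)

theorem map_idemHalf_sq (π : SphereAlg q →ₐ[ℂ] (SpinorSpace →L[ℂ] SpinorSpace)) :
    (idemHalf q).map π * (idemHalf q).map π = (1 / 4 : ℂ) • (1 : Matrix (Fin 4) (Fin 4) (SpinorSpace →L[ℂ] SpinorSpace)) := by
  ext1 i j
  have h := congrArg π (idemHalf_mul q i j)
  rw [map_sum] at h
  simp only [map_mul] at h
  simp only [Matrix.mul_apply, Matrix.map_apply, h, Matrix.smul_apply, Matrix.one_apply]
  split_ifs <;> simp

theorem diracD_eq : diracD q = (idemHalf q).map (repP q) - (idemHalf q).map (repM q) := by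
  ext1 i j
  rw [diracD_apply, repD_apply, Matrix.sub_apply, Matrix.map_apply, Matrix.map_apply]

/-- The sum of the two chiral images of `e - 1/2`. -/
noncomputable def diracS : Matrix (Fin 4) (Fin 4) (SpinorSpace →L[ℂ] SpinorSpace) :=
  (idemHalf q).map (repP q) + (idemHalf q).map (repM q)

/-- The sum and the difference of two elements with the same square anticommute. -/
theorem diracS_mul_diracD : diracS q * diracD q = -(diracD q * diracS q) := by
  have hp := map_idemHalf_sq q (repP q)
  have hm := map_idemHalf_sq q (repM q)
  rw [diracS, diracD_eq, add_mul, sub_mul, mul_sub, mul_sub, mul_add, mul_add, hp, hm]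
  abel

theorem diracS_sq : diracS q * diracS q = 1 - diracD q * diracD q := by
  have hp := map_idemHalf_sq q (repP q)
  have hm := map_idemHalf_sq q (repM q)
  have h : (1 : Matrix (Fin 4) (Fin 4) (SpinorSpace →L[ℂ] SpinorSpace)) =
      (1 / 4 : ℂ) • 1 + (1 / 4 : ℂ) • 1 + ((1 / 4 : ℂ) • 1 + (1 / 4 : ℂ) • 1) := by module
  rw [h, diracS, diracD_eq, add_mul, sub_mul, mul_sub, mul_sub, mul_add, mul_add, hp, hm]
  abel

theorem decay_diracD_pow (n : ℕ) (i j : Fin 4) : Decay q (2 * n) ((diracD q ^ n) i j) := by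
  induction n generalizing i j with
  | zero =>
    rw [pow_zero, Matrix.one_apply]
    split_ifs
    exacts [Decay.one, Decay.zero _]
  | succ n ih =>
    rw [pow_succ, Matrix.mul_apply]
    refine Decay.sum _ fun k => ?_
    rw [diracD_apply q k j]
    exact (ih i k).mul (decay_repD q _)

theorem decay_diracS (i j : Fin 4) : Decay q 0 (diracS q i j) := (decay_repP q _).add (decay_repM q _)

variable {q}

theorem tauMat_diracS {Z : Matrix (Fin 4) (Fin 4) (SpinorSpace →L[ℂ] SpinorSpace)} (hZ : ∀ i j, Decay q 8 (Z i j)) :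
    tauMat q (diracS q * Z) = tauMat q (Z * diracS q) := by
  have l : ∀ {π : SphereAlg q →ₐ[ℂ] (SpinorSpace →L[ℂ] SpinorSpace)}, (∀ a, Decay q 0 (π a)) → ∀ i j,
      Decay q 8 (((idemHalf q).map π * Z) i j) := fun hd i j => by
    rw [Matrix.mul_apply]
    exact Decay.sum _ fun k => ((hd _).mul (hZ _ _)).mono (show 8 ≤ 0 + 8 by norm_num)
  have r : ∀ {π : SphereAlg q →ₐ[ℂ] (SpinorSpace →L[ℂ] SpinorSpace)}, (∀ a, Decay q 0 (π a)) → ∀ i j,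
      Decay q 8 ((Z * (idemHalf q).map π) i j) := fun hd i j => by
    rw [Matrix.mul_apply]
    exact Decay.sum _ fun k => ((hZ _ _).mul (hd _)).mono (show 8 ≤ 8 + 0 by norm_num)
  rw [diracS, add_mul, mul_add, tauMat_add (l (decay_repP q)) (l (decay_repM q)),
    tauMat_add (r (decay_repP q)) (r (decay_repM q)), tauMat_map_mul (decay_repP q) (fun a _ h => tau_repP a h) hZ,
    tauMat_map_mul (decay_repM q) (fun a _ h => tau_repM a h) hZ]

variable (q)

/-- The difference of the two sides is the trace of Dⁿ S². Moving one S around by cyclicity and back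
through Dⁿ by anticommutation changes its sign, since n is odd. -/
theorem tauMat_step (n : ℕ) (hn : 5 ≤ n) (ho : Odd n) : tauMat q (diracD q ^ n) = tauMat q (diracD q ^ (n + 2)) := by
  have hd : ∀ {n : ℕ}, 5 ≤ n → ∀ i j, Decay q 8 ((diracD q ^ n) i j) := fun h i j => (decay_diracD_pow q _ i j).mono (by omega)
  have hs : ∀ i j, Decay q 8 ((diracD q ^ n * diracS q) i j) := fun i j => by
    rw [Matrix.mul_apply]
    exact Decay.sum _ fun k => ((hd hn _ _).mul (decay_diracS q _ _)).mono (show 8 ≤ 8 + 0 by norm_num)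
  have hss : ∀ i j, Decay q 8 ((diracD q ^ n * diracS q * diracS q) i j) := fun i j => by
    rw [Matrix.mul_apply]
    exact Decay.sum _ fun k => ((hs _ _).mul (decay_diracS q _ _)).mono (show 8 ≤ 8 + 0 by norm_num)
  have anti : diracS q * diracD q ^ n = -(diracD q ^ n * diracS q) := by
    have h : SemiconjBy (diracS q) (diracD q) (-diracD q) := by
      rw [SemiconjBy, diracS_mul_diracD, neg_mul]
    have := (h.pow_right n).eq
    rwa [ho.neg_pow, neg_mul] at this
  have e : diracD q ^ n = diracD q ^ (n + 2) + diracD q ^ n * diracS q * diracS q := by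
    rw [mul_assoc, diracS_sq, mul_sub, mul_one, pow_add, sq, add_sub_cancel]
  have z : tauMat q (diracD q ^ n * diracS q * diracS q) = 0 := by
    have h := tauMat_diracS hs
    rw [← mul_assoc, anti, neg_mul, tauMat_neg] at h
    linear_combination (-1 / 2 : ℂ) * h
  conv_lhs => rw [e, tauMat_add (hd (by omega)) hss, z, add_zero]

theorem tauMat_five : tauMat q (diracD q ^ 5) = 1 := by
  have hc : ∀ m : ℕ, tauMat q (diracD q ^ (5 + 2 * m)) = tauMat q (diracD q ^ 5) := fun m => by
    induction m with
    | zero => rfl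
    | succ m ih => rw [← ih, show 5 + 2 * (m + 1) = 5 + 2 * m + 2 by ring, ← tauMat_step q _ (by omega) ⟨m + 2, by ring⟩]
  have h := tendsto_finsetSum Finset.univ fun i (_ : i ∈ Finset.univ) => (tendsto_tau q i).const_mul (etaDiag q i)
  refine tendsto_nhds_unique (l := atTop) (f := fun _ : ℕ => tauMat q (diracD q ^ 5)) tendsto_const_nhds ((?_ : Tendsto (fun m : ℕ => tauMat q (diracD q ^ (5 + 2 * m))) atTop (𝓝 1)).congr hc)
  -- On the labels of the harmonic spinors η cancels the modular weight, so the weighted trace of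
  -- the limit is its ordinary trace.
  have e : ∀ i, etaDiag q i * modularWeight q (ind (adm_harm i)) = 1 := fun i => by
    rw [modularWeight_ind]
    have hq := qc_ne q
    have hz : ∀ n : ℤ, ((qz q n : ℝ) : ℂ) = qc q ^ n := fun n => by simp [qz, qc]
    rw [hz]
    fin_cases i
    · simp [etaDiag, sa, sb]
      rw [← zpow_natCast, ← zpow_neg, ← zpow_add₀ hq]; norm_num
    · simp [etaDiag, sa, sb]
      rw [← zpow_natCast, inv_mul_cancel₀ (zpow_ne_zero _ hq)]
    · simp [etaDiag, sa, sb]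
      rw [← zpow_natCast, ← zpow_neg, ← zpow_add₀ hq]; norm_num
    · simp [etaDiag, sa, sb]
      rw [← zpow_natCast, inv_mul_cancel₀ (zpow_ne_zero _ hq)]
  have s : ∑ i, etaDiag q i * (modularWeight q (ind (adm_harm i)) * ((rho q * harmW q i / (1 + qz q 2) : ℝ) : ℂ)) = 1 := by
    simp only [← mul_assoc, e, one_mul]
    rw [← Complex.ofReal_sum, ← Finset.sum_div, ← Finset.mul_sum, sum_harmW, div_self, Complex.ofReal_one]
    have := qz_pos q 2
    positivity
  rw [s] at h
  exact h

theorem chernForm_omega : chernForm q (omega₄ q) = 2 := by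
  have hd : ∀ a b c d e, Decay q 8 (diracD q a b * (diracD q b c * (diracD q c d * (diracD q d e * diracD q e a)))) := fun a b c d e => by
    simp only [diracD_apply, ← mul_assoc]
    exact decay_five' _ _ _ _ _
  rw [omega_eq]
  simp only [map_sum, map_smul, chernForm_vec, ← diracD_apply, smul_eq_mul]
  refine Eq.trans ?_ ((congrArg (fun z : ℂ => 2 * z) (tauMat_five q)).trans (mul_one 2))
  simp only [tauMat]
  rw [Finset.mul_sum]
  refine Finset.sum_congr rfl fun a _ => ?_
  have e5 : diracD q ^ 5 = diracD q * (diracD q * (diracD q * (diracD q * diracD q))) := by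
    simp only [pow_succ, pow_zero, one_mul, mul_assoc]
  rw [e5]
  simp only [Matrix.mul_apply, Finset.mul_sum]
  rw [tau_sum q _ fun b => Decay.sum _ fun c => Decay.sum _ fun d => Decay.sum _ fun e => hd a b c d e]
  simp only [Finset.mul_sum]
  refine Finset.sum_congr rfl fun b _ => ?_
  rw [tau_sum q _ fun c => Decay.sum _ fun d => Decay.sum _ fun e => hd a b c d e]
  simp only [Finset.mul_sum]
  refine Finset.sum_congr rfl fun c _ => ?_
  rw [tau_sum q _ fun d => Decay.sum _ fun e => hd a b c d e]
  simp only [Finset.mul_sum]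
  refine Finset.sum_congr rfl fun d _ => ?_
  rw [tau_sum q _ fun e => hd a b c d e]
  simp only [Finset.mul_sum]
  refine Finset.sum_congr rfl fun e _ => ?_
  simp only [mul_assoc]
  ring

end

end QSphere

theorem mainTheorem10 (q : Set.Ioo (0 : ℝ) 1) :
    (∀ i j k : QSphere.SGen,
      (QSphere.eta q * QSphere.gammaMat q i * QSphere.gammaMat q j * QSphere.gammaMat q k).trace = 0) ∧
    (∀ h : QSphere.UqSo5 q, QSphere.tensorAct q 5 h (QSphere.omega₄ q) =
      Coalgebra.counit (R := ℂ) h • QSphere.omega₄ q) ∧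
    ∃ hω : QSphere.omega₄ q ∈ QSphere.twistedCycles (QSphere.kappa q) 4,
      (∃ πp πm : QSphere.SphereAlg q →ₐ[ℂ] (QSphere.SpinorSpace →L[ℂ] QSphere.SpinorSpace),
        QSphere.IsChiralRep q 1 πp ∧ QSphere.IsChiralRep q (-1) πm ∧
        ∃ ch : (⨂[ℂ]^5 (QSphere.SphereAlg q)) →ₗ[ℂ] ℂ,
          QSphere.IsTwistedChern πp πm 4 ch ∧
          ch ∘ₗ QSphere.twistMap (QSphere.kappa q) 4 = ch ∧
          ch ∘ₗ QSphere.twistedBoundary (QSphere.kappa q) 4 = 0 ∧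
          ch (QSphere.omega₄ q) = 2) ∧
      QSphere.TwistedHH.mk (QSphere.kappa q) 4 ⟨QSphere.omega₄ q, hω⟩ ≠ 0 := by
  refine ⟨QSphere.gammaMat_trace q, QSphere.omega_invariant q, QSphere.omega_mem_twistedCycles q,
    ⟨QSphere.repP q, QSphere.repM q, QSphere.rep_isChiral q _, QSphere.rep_isChiral q _, QSphere.chernForm q,
      QSphere.isTwistedChern q, QSphere.chernForm_kappa, QSphere.chernForm_boundary, QSphere.chernForm_omega q⟩, fun h => ?_⟩
  -- If the class were zero, ω₄ would be a boundary and its pairing with the cocycle would be 0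
  -- instead of 2.
  rw [QSphere.TwistedHH.mk, Submodule.mkQ_apply, Submodule.Quotient.mk_eq_zero] at h
  obtain ⟨x, -, hx⟩ := h
  have h0 := LinearMap.congr_fun (QSphere.chernForm_boundary (q := q)) x
  rw [LinearMap.comp_apply, hx] at h0
  exact two_ne_zero ((QSphere.chernForm_omega q).symm.trans h0)
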